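/- Let $G$ be a finite simple graph with maximum degree $\Delta$. An acyclic edge coloring of a graph is a proper edge coloring in which every cycle receives at least three colors, and the acyclic chromatic index $\chi'_a$ of a graph is the least number of colors in an acyclic edge coloring of it. For a natural number $\kappa$, call $G$ $\kappa$-deletion-minimal if $\Delta \leq \kappa$, $\chi'_a(G) > \kappa$, and $\chi'_a(H) \leq \kappa$ for every proper subgraph $H$ of $G$. Suppose that $G$ is $\kappa$-deletion-minimal with $\kappa \geq \Delta + 5$, let $u$ be a vertex of degree $5$ in $G$, and let $u, w, w_1$ be the vertices of a triangle of $G$. (a) If $\deg_G(w) \leq \kappa - \Delta$ and $\deg_G(w_1) \leq 6$, then $$\sum_{x \in N_G(u)} \deg_G(x) \geq 2\kappa + 7.$$ (b) If $\deg_G(w) \leq \kappa - \Delta - 1$ and $\deg_G(w_1) \leq 7$, then $$\sum_{x \in N_G(u)} \deg_G(x) \geq 2\kappa + 7.$$ -/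

import Mathlib

namespace SimpleGraph

/-- A proper edge coloring `C` of `G` (a vertex coloring of the line graph of `G`) is *acyclic* if
the edges of every cycle of `G` receive at least three different colors. -/
def IsAcyclicEdgeColoring {V : Type*} {G : SimpleGraph V} {α : Type*}
    (C : G.lineGraph.Coloring α) : Prop :=
  ∀ (v : V) (p : G.Walk v v), p.IsCycle →
    3 ≤ (C '' {e : G.edgeSet | (e : Sym2 V) ∈ p.edges}).encard

/-- `G` has an acyclic edge coloring with colors from a set of `n` colors. -/
def AcyclicallyEdgeColorable {V : Type*} (G : SimpleGraph V) (n : ℕ) : Prop :=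
  ∃ C : G.lineGraph.Coloring (Fin n), IsAcyclicEdgeColoring C

/-- The acyclic chromatic index: the least number of colors in an acyclic edge coloring of `G`
(and `⊤` if there is no acyclic edge coloring with finitely many colors, which cannot happen for
finite graphs). -/
noncomputable def acyclicChromaticIndex {V : Type*} (G : SimpleGraph V) : ℕ∞ :=
  ⨅ n ∈ {n : ℕ | G.AcyclicallyEdgeColorable n}, (n : ℕ∞)

/-- A finite graph `G` of maximum degree at most `κ` is *`κ`-deletion-minimal* if its acyclic
chromatic index is more than `κ`, while that of every proper subgraph (obtained by deleting
vertices or edges) is at most `κ`. -/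
def IsDeletionMinimal {V : Type*} [Fintype V] (G : SimpleGraph V) [DecidableRel G.Adj]
    (κ : ℕ) : Prop :=
  G.maxDegree ≤ κ ∧ (κ : ℕ∞) < G.acyclicChromaticIndex ∧
    ∀ H : G.Subgraph, H < ⊤ → H.coe.acyclicChromaticIndex ≤ (κ : ℕ∞)

end SimpleGraph

/-!
Let `x 0 = w`, `x 1 = w₁`, `x 2`, `x 3`, `x 4` be the neighbours of `u`, and let `f` be an acyclic
edge colouring of `G - uw` with `κ` colours. Deleting all edges at `u` (and possibly `w w₁`) leaves
a coloured graph `H`, and the whole argument uses only its `Palette`: the sets `X i` of colours at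
`x i`, and the *conflicts*, where `a` at `x i` conflicts with `b` at `x k` if giving these colours
to the edges `u x i` and `u x k` closes a cycle coloured with `a` and `b`. In a properly coloured
graph the components of two colours are paths and cycles, so that `a` at `x i` conflicts with a
given `b` at one index at most. Five colours for the edges at `u` that are missing at their ends,
distinct and free of conflicts extend the colouring of `H`
(`IsGoodColoring.exists_of_isAssignment`), and the four colours which `f` gives to the edges at `u`
are such a system for the nonzero indices (`IsGoodColoring.fits`).

The *weight* of a colour is the number of sets `X t` that contain it, less two. Up to a constant,
the sum of all weights is the sum of the degrees of the neighbours of `u`, less `2 * κ`.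

If `w` and `w₁` have no colour in common in `G - u - w w₁`, this graph is used as `H`, and the sum
of the weights must be shown to be nonnegative. Either its palette is stuck, that is, it admits no
assignment of five colours (`Palette.Stuck.sum_nonneg`), or every assignment leads to a colouring of
`G - w w₁` that cannot be extended to the edge `w w₁` (`IsGoodColoring.exists_of_final`,
`Palette.sum_nonneg_of_final`). If `w` and `w₁` do have a common colour `r`, then `H = G - u` keeps
the edge `w w₁`, coloured `g` say. Its palette is stuck because `G` has no colouring, and the sum of
the weights must be shown to be at least two (`Palette.Linked.sum_ge_two`). This uses the common
colours `g` and `r`, and that the paths which end in `w` with the colour `g` continue to `w₁`.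

For a stuck palette, call the colours in `X 0` *used* and the others *free*. Every free colour
outside a fitting quadruple conflicts at `0` with some colour of the quadruple
(`Palette.Stuck.blocked`), which has to be a used one. Choose the fitting quadruple with as few used
colours as possible. Then a free colour cannot replace a used colour of the quadruple, and so it
occurs at, or is blocked by a conflict at, each index that carries a used colour. A conflict of a
colour at one index means that it occurs at another index, and serves only once. In this way the
free colours outside the quadruple have nonnegative, often positive weight. Negative weight occurs
only for the free colours of the quadruple and for the *wild* colours, which lie in no set but `X 0`
and of which there are at most two (`Palette.card_wild_le`). The number of used colours in the
quadruple distinguishes the cases. The last one for linked palettes is that of two used colours when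
all weights vanish except that of `g`; there the bound on the degree of `w₁` is indispensable
(`Palette.Linked.cap_contra`).
-/

namespace SimpleGraph

set_option linter.unusedSectionVars false

/-! ### Palettes -/

section

/-- What is retained of a properly edge-coloured graph `H` for colouring five further edges that
join a new vertex to the vertices `x 0, …, x 4` of `H`. `X i` is the set of colours of the edges at
`x i`, and `conf a i b k` says that the colours `a` at `x i` and `b` at `x k` *conflict*: there is a
path in `H` from `x i` to `x k` with edges coloured `b` and `a` alternately, starting with `b` and
ending with `a`. The axioms express that such a path is determined by its end `x i`. -/
structure Palette (K : Type*) where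
  X : Fin 5 → Finset K
  conf : K → Fin 5 → K → Fin 5 → Prop
  conf_symm : ∀ {a i b k}, conf a i b k → conf b k a i
  conf_notMem : ∀ {a i b k}, conf a i b k → a ∉ X i
  conf_mem : ∀ {a i b k}, conf a i b k → a ∈ X k
  conf_unique : ∀ {a i b k l}, conf a i b k → conf a i b l → k = l

/-- `i, j, k, l` are the four nonzero indices, in some order. -/
structure Quad (i j k l : Fin 5) : Prop where
  i0 : i ≠ 0
  j0 : j ≠ 0
  k0 : k ≠ 0
  l0 : l ≠ 0
  ij : i ≠ j
  ik : i ≠ k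
  il : i ≠ l
  jk : j ≠ k
  jl : j ≠ l
  kl : k ≠ l

theorem Quad.univ_eq {i j k l : Fin 5} (q : Quad i j k l) :
    (Finset.univ : Finset (Fin 5)) = {0, i, j, k, l} := by
  obtain ⟨h1, h2, h3, h4, h5, h6, h7, h8, h9, h10⟩ := q
  symm
  apply Finset.eq_univ_of_card
  rw [Finset.card_insert_of_notMem, Finset.card_insert_of_notMem, Finset.card_insert_of_notMem,
    Finset.card_insert_of_notMem] <;> simp [*, Ne.symm h1, Ne.symm h2, Ne.symm h3, Ne.symm h4]

theorem Quad.eq_or {i j k l : Fin 5} (q : Quad i j k l) (t : Fin 5) :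
    t = 0 ∨ t = i ∨ t = j ∨ t = k ∨ t = l := by
  have := Finset.mem_univ t
  rw [q.univ_eq] at this
  simpa using this

namespace Palette

variable {K : Type*} (P : Palette K)

/-- The colours `c 0, …, c 4` can be given to the five edges at the new vertex: they are distinct,
`c i` is missing at `x i`, and no two of them conflict. -/
def IsAssignment (c : Fin 5 → K) : Prop :=
  Function.Injective c ∧ (∀ i, c i ∉ P.X i) ∧ ∀ i k, ¬ P.conf (c i) i (c k) k

/-- The five edges at the new vertex cannot be coloured. -/
def Stuck : Prop := ∀ c, ¬ P.IsAssignment c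

/-- The colours `a, b, c, d` can be given to the edges to `x i`, `x j`, `x k`, `x l`. -/
structure Fits (i j k l : Fin 5) (a b c d : K) : Prop where
  q : Quad i j k l
  ai : a ∉ P.X i
  bj : b ∉ P.X j
  ck : c ∉ P.X k
  dl : d ∉ P.X l
  ab : a ≠ b
  ac : a ≠ c
  ad : a ≠ d
  bc : b ≠ c
  bd : b ≠ d
  cd : c ≠ d
  hab : ¬ P.conf a i b j
  hac : ¬ P.conf a i c k
  had : ¬ P.conf a i d l
  hbc : ¬ P.conf b j c k
  hbd : ¬ P.conf b j d l
  hcd : ¬ P.conf c k d l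

variable {P} {i j k l : Fin 5} {a b c d : K}

theorem conf_notMem' (h : P.conf a i b j) : b ∉ P.X j := P.conf_notMem (P.conf_symm h)
theorem conf_mem' (h : P.conf a i b j) : b ∈ P.X i := P.conf_mem (P.conf_symm h)
theorem conf_unique' (h : P.conf a i b j) (h' : P.conf a k b j) : i = k :=
  P.conf_unique (P.conf_symm h) (P.conf_symm h')

theorem Fits.swap12 (h : P.Fits i j k l a b c d) : P.Fits j i k l b a c d := by
  obtain ⟨⟨_, _, _, _, _, _, _, _, _, _⟩, _, _, _, _, _, _, _, _, _, _, _, _, _, _, _, _⟩ := h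
  constructor <;> first | assumption | (intro h; have := P.conf_symm h; contradiction) |
    (apply Ne.symm; assumption) | (constructor <;> first | assumption | (apply Ne.symm; assumption))

theorem Fits.swap23 (h : P.Fits i j k l a b c d) : P.Fits i k j l a c b d := by
  obtain ⟨⟨_, _, _, _, _, _, _, _, _, _⟩, _, _, _, _, _, _, _, _, _, _, _, _, _, _, _, _⟩ := h
  constructor <;> first | assumption | (intro h; have := P.conf_symm h; contradiction) |
    (apply Ne.symm; assumption) | (constructor <;> first | assumption | (apply Ne.symm; assumption))

theorem Fits.swap34 (h : P.Fits i j k l a b c d) : P.Fits i j l k a b d c := by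
  obtain ⟨⟨_, _, _, _, _, _, _, _, _, _⟩, _, _, _, _, _, _, _, _, _, _, _, _, _, _, _, _⟩ := h
  constructor <;> first | assumption | (intro h; have := P.conf_symm h; contradiction) |
    (apply Ne.symm; assumption) | (constructor <;> first | assumption | (apply Ne.symm; assumption))

theorem Fits.exists_assignment (h : P.Fits i j k l a b c d) {x : K} (hx : x ∉ P.X 0) (xa : x ≠ a)
    (xb : x ≠ b) (xc : x ≠ c) (xd : x ≠ d) (ca : ¬ P.conf x 0 a i) (cb : ¬ P.conf x 0 b j)
    (cc : ¬ P.conf x 0 c k) (cd : ¬ P.conf x 0 d l) :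
    ∃ f, P.IsAssignment f ∧ f 0 = x ∧ f i = a ∧ f j = b ∧ f k = c ∧ f l = d := by
  have hq := h.q.eq_or
  have hs := @P.conf_symm
  have hm := @P.conf_mem
  have hnm := @P.conf_notMem
  obtain ⟨⟨h1, h2, h3, h4, h5, h6, h7, h8, h9, h10⟩, _, _, _, _, _, _, _, _, _, _, _, _, _, _, _,
      _⟩ := h
  let f : Fin 5 → K := fun t => if t = 0 then x else if t = i then a else if t = j then b
    else if t = k then c else d
  have f0 : f 0 = x := by simp [f]
  have fi : f i = a := by simp [f, *]
  have fj : f j = b := by simp [f, *, h5.symm]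
  have fk : f k = c := by simp [f, *, h6.symm, h8.symm]
  have fl : f l = d := by simp [f, *, h7.symm, h9.symm, h10.symm]
  clear_value f
  refine ⟨f, ⟨fun s t hst => ?_, fun t => ?_, fun s t => ?_⟩, f0, fi, fj, fk, fl⟩
  · rcases hq s with rfl | rfl | rfl | rfl | rfl <;> rcases hq t with rfl | rfl | rfl | rfl | rfl <;>
      first | rfl | (exfalso; grind)
  · rcases hq t with rfl | rfl | rfl | rfl | rfl <;> grind
  · intro hst
    have h1 := hs hst
    have h2 := hm hst
    have h3 := hnm hst
    rcases hq s with rfl | rfl | rfl | rfl | rfl <;> rcases hq t with rfl | rfl | rfl | rfl | rfl <;>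
      first | contradiction | grind

/-- In a stuck palette, every colour missing at `0` is in the quadruple or conflicts at `0` with one
of its colours. -/
theorem Stuck.blocked (hP : P.Stuck) (h : P.Fits i j k l a b c d) {x : K} (hx : x ∉ P.X 0) :
    x = a ∨ x = b ∨ x = c ∨ x = d ∨ P.conf x 0 a i ∨ P.conf x 0 b j ∨ P.conf x 0 c k ∨
      P.conf x 0 d l := by
  by_contra hn
  push Not at hn
  obtain ⟨xa, xb, xc, xd, ca, cb, cc, cd⟩ := hn
  obtain ⟨f, hf, -⟩ := h.exists_assignment hx xa xb xc xd ca cb cc cd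
  exact hP f hf

section Counting

variable [DecidableEq K]

/-- The indicator function of `s`, with integer values. -/
def ind (s : Finset K) (α : K) : ℤ := if α ∈ s then 1 else 0

theorem ind_of_mem {s : Finset K} {α : K} (h : α ∈ s) : ind s α = 1 := if_pos h
theorem ind_of_notMem {s : Finset K} {α : K} (h : α ∉ s) : ind s α = 0 := if_neg h
theorem ind_nonneg (s : Finset K) (α : K) : 0 ≤ ind s α := by unfold ind; split <;> simp
theorem ind_le_one (s : Finset K) (α : K) : ind s α ≤ 1 := by unfold ind; split <;> simp

variable (P) in
/-- The weight of a colour: the number of sets `X t` that contain it, less two. The lower bounds on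
the sum of the degrees are lower bounds on the sum of the weights. -/
def wt (α : K) : ℤ := ∑ t, ind (P.X t) α - 2

theorem wt_eq (q : Quad i j k l) (α : K) : P.wt α =
    ind (P.X 0) α + ind (P.X i) α + ind (P.X j) α + ind (P.X k) α + ind (P.X l) α - 2 := by
  unfold wt
  rw [q.univ_eq]
  obtain ⟨h1, h2, h3, h4, h5, h6, h7, h8, h9, h10⟩ := q
  rw [Finset.sum_insert, Finset.sum_insert, Finset.sum_insert, Finset.sum_insert,
    Finset.sum_singleton] <;> simp [*, h1.symm, h2.symm, h3.symm, h4.symm]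
  ring

variable [Fintype K]

theorem sum_ind (s : Finset K) : ∑ α, ind s α = s.card := by
  simp [ind]

theorem sum_wt : ∑ α, P.wt α = ∑ t, ((P.X t).card : ℤ) - 2 * Fintype.card K := by
  simp only [wt, Finset.sum_sub_distrib]
  rw [Finset.sum_comm]
  simp [sum_ind, mul_comm]

/-- If the weighted sum of the indicator functions of some sets is bounded by `f`, the weighted sum
of their cardinalities is bounded by the sum of `f`. -/
theorem sum_ge (f : K → ℤ) (L : List (ℤ × Finset K))
    (h : ∀ α, (L.map fun p => p.1 * ind p.2 α).sum ≤ f α) :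
    (L.map fun p => p.1 * (p.2.card : ℤ)).sum ≤ ∑ α, f α := by
  refine le_trans (le_of_eq ?_) (Finset.sum_le_sum fun α _ => h α)
  clear h
  induction L with
  | nil => simp
  | cons p L ih => simp [Finset.sum_add_distrib, ← Finset.mul_sum, sum_ind, ih]

end Counting
end Palette

end

/-! ### Blocked colours and their weights -/

section

variable {i j k l : Fin 5}
theorem Quad.swap12 (q : Quad i j k l) : Quad j i k l :=
  ⟨q.j0, q.i0, q.k0, q.l0, q.ij.symm, q.jk, q.jl, q.ik, q.il, q.kl⟩
theorem Quad.swap23 (q : Quad i j k l) : Quad i k j l :=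
  ⟨q.i0, q.k0, q.j0, q.l0, q.ik, q.ij, q.il, q.jk.symm, q.kl, q.jl⟩
theorem Quad.swap34 (q : Quad i j k l) : Quad i j l k :=
  ⟨q.i0, q.j0, q.l0, q.k0, q.ij, q.il, q.ik, q.jl, q.jk, q.kl.symm⟩

namespace Palette
variable {K : Type*} {P : Palette K} {i j k l : Fin 5} {a b c d : K}

/-- Either `x` can replace the first colour of a fitting quadruple, or it is blocked by its presence
in `X i` or by a conflict. -/
theorem Fits.replace_first (h : P.Fits i j k l a b c d) {x : K} (xb : x ≠ b) (xc : x ≠ c) (xd : x ≠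
    d) :
    x ∈ P.X i ∨ P.conf x i b j ∨ P.conf x i c k ∨ P.conf x i d l ∨ P.Fits i j k l x b c d := by
  by_cases h0 : x ∈ P.X i
  · exact Or.inl h0
  by_cases h1 : P.conf x i b j
  · exact Or.inr (Or.inl h1)
  by_cases h2 : P.conf x i c k
  · exact Or.inr (Or.inr (Or.inl h2))
  by_cases h3 : P.conf x i d l
  · exact Or.inr (Or.inr (Or.inr (Or.inl h3)))
  · exact Or.inr (Or.inr (Or.inr (Or.inr ⟨h.q, h0, h.bj, h.ck, h.dl, xb, xc, xd, h.bc, h.bd, h.cd,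
      h1, h2, h3, h.hbc, h.hbd, h.hcd⟩)))

theorem Fits.served (h : P.Fits i j k l a b c d) {x : K} (xb : x ≠ b) (xc : x ≠ c) (xd : x ≠ d)
    (hn : ¬ P.Fits i j k l x b c d) :
    x ∈ P.X i ∨ P.conf x i b j ∨ P.conf x i c k ∨ P.conf x i d l := by
  rcases h.replace_first xb xc xd with h | h | h | h | h
  exacts [Or.inl h, Or.inr (Or.inl h), Or.inr (Or.inr (Or.inl h)), Or.inr (Or.inr (Or.inr h)),
    (hn h).elim]

variable (P) in
/-- The properties of conflicts, collected in a form that can be instantiated by automated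
reasoning: symmetry, membership and uniqueness. -/
structure Rules : Prop where
  s : ∀ a i b k, P.conf a i b k → P.conf b k a i
  m : ∀ a i b k, P.conf a i b k → a ∉ P.X i ∧ a ∈ P.X k ∧ b ∈ P.X i ∧ b ∉ P.X k
  u : ∀ a i b k l, P.conf a i b k → P.conf a i b l → k = l

variable (P) in
theorem rules : P.Rules :=
  ⟨fun _ _ _ _ h => P.conf_symm h, fun _ _ _ _ h => ⟨P.conf_notMem h, P.conf_mem h, conf_mem' h,
    conf_notMem' h⟩, fun _ _ _ _ _ h h' => P.conf_unique h h'⟩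

/-- The reasons why four colours may fail to fit, spelled out. -/
theorem fails (q : Quad i j k l) (h : ¬ P.Fits i j k l a b c d) :
    a ∈ P.X i ∨ b ∈ P.X j ∨ c ∈ P.X k ∨ d ∈ P.X l ∨ a = b ∨ a = c ∨ a = d ∨ b = c ∨ b = d ∨ c = d ∨
    P.conf a i b j ∨ P.conf a i c k ∨ P.conf a i d l ∨ P.conf b j c k ∨ P.conf b j d l ∨
    P.conf c k d l := by
  by_contra hn
  push Not at hn
  obtain ⟨h1, h2, h3, h4, h5, h6, h7, h8, h9, h10, h11, h12, h13, h14, h15, h16⟩ := hn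
  exact h ⟨q, h1, h2, h3, h4, h5, h6, h7, h8, h9, h10, h11, h12, h13, h14, h15, h16⟩

variable [DecidableEq K]

variable (P) in
theorem neg_two_le_wt (x : K) : -2 ≤ P.wt x := by
  have : 0 ≤ ∑ t, ind (P.X t) x := Finset.sum_nonneg fun t _ => ind_nonneg _ _
  unfold wt
  omega

theorem wt_of_mem (q : Quad i j k l) {x : K} (hx : x ∈ P.X 0)
    (h : x ∈ P.X i ∨ x ∈ P.X j ∨ x ∈ P.X k ∨ x ∈ P.X l) : 0 ≤ P.wt x := by
  rw [wt_eq q]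
  simp only [ind]
  grind

/-- If all fitting quadruples consist of used colours, that is, colours in `X 0`, then every free
colour (a colour missing at `0`) has positive weight: it conflicts at `0` with a colour of the
quadruple, and it cannot replace any of them. -/
theorem wt_of_four (hP : P.Stuck) (h : P.Fits i j k l a b c d)
    (hmin : ∀ {i j k l a b c d}, P.Fits i j k l a b c d → a ∈ P.X 0)
    {x : K} (hx : x ∉ P.X 0) : 1 ≤ P.wt x := by
  have h0 := hmin h
  have h1 := hmin h.swap12
  have h2 := hmin h.swap23.swap12
  have h3 := hmin h.swap34.swap23.swap12
  have e0 := hP.blocked h hx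
  have e1 := h.replace_first (x := x) (by grind) (by grind) (by grind)
  have e2 := h.swap12.replace_first (x := x) (by grind) (by grind) (by grind)
  have e3 := h.swap23.swap12.replace_first (x := x) (by grind) (by grind) (by grind)
  have e4 := h.swap34.swap23.swap12.replace_first (x := x) (by grind) (by grind) (by grind)
  have g1 : ¬ P.Fits i j k l x b c d := fun hh => hx (hmin hh)
  have g2 : ¬ P.Fits j i k l x a c d := fun hh => hx (hmin hh)
  have g3 : ¬ P.Fits k i j l x a b d := fun hh => hx (hmin hh)
  have g4 : ¬ P.Fits l i j k x a b c := fun hh => hx (hmin hh)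
  obtain ⟨s, m, u⟩ := P.rules
  have q := h.q
  rw [wt_eq q]
  obtain ⟨q1, q2, q3, q4, q5, q6, q7, q8, q9, q10⟩ := q
  simp only [ind]
  grind

/-- The weight of a free colour when `d` is the only free colour of a fitting quadruple and every
fitting quadruple has at least three used colours. -/
theorem wt_of_three (hP : P.Stuck) (h : P.Fits i j k l a b c d)
    (hmin : ∀ {i j k l a b c d}, P.Fits i j k l a b c d → a ∈ P.X 0 ∨ b ∈ P.X 0)
    (hd : d ∉ P.X 0) {x : K} (hx : x ∉ P.X 0) (hxd : x ≠ d) :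
    0 ≤ P.wt x ∧ (x ∈ P.X l → 1 ≤ P.wt x) ∧
      (P.conf x l a i ∨ P.conf x l b j ∨ P.conf x l c k → 1 ≤ P.wt x) := by
  have h1 : a ∈ P.X 0 := by have := hmin h.swap34.swap23; grind
  have h2 : b ∈ P.X 0 := by have := hmin h.swap34.swap23.swap12.swap23; grind
  have h3 : c ∈ P.X 0 := by have := hmin h.swap23.swap12.swap34.swap23; grind
  have e0 := hP.blocked h hx
  have e1 := h.replace_first (x := x) (by grind) (by grind) (by grind)
  have e2 := h.swap12.replace_first (x := x) (by grind) (by grind) (by grind)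
  have e3 := h.swap23.swap12.replace_first (x := x) (by grind) (by grind) (by grind)
  have g1 : ¬ P.Fits i j k l x b c d := fun hh => by have := hmin hh.swap34.swap23; grind
  have g2 : ¬ P.Fits j i k l x a c d := fun hh => by have := hmin hh.swap34.swap23; grind
  have g3 : ¬ P.Fits k i j l x a b d := fun hh => by have := hmin hh.swap34.swap23; grind
  obtain ⟨s, m, u⟩ := P.rules
  have q := h.q
  rw [wt_eq q]
  obtain ⟨q1, q2, q3, q4, q5, q6, q7, q8, q9, q10⟩ := q
  simp only [ind]
  grind

/-- The weight of a free colour when `c` and `d` are the free colours of a fitting quadruple and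
every fitting quadruple has at least two used colours. -/
theorem wt_of_two (hP : P.Stuck) (h : P.Fits i j k l a b c d)
    (hmin : ∀ {i j k l a b c d}, P.Fits i j k l a b c d → a ∈ P.X 0 ∨ b ∈ P.X 0 ∨ c ∈ P.X 0)
    (hc : c ∉ P.X 0) (hd : d ∉ P.X 0) {x : K} (hx : x ∉ P.X 0) (hxc : x ≠ c) (hxd : x ≠ d) :
    0 ≤ P.wt x ∧
    ((x ∈ P.X l ∨ P.conf x l a i ∨ P.conf x l b j ∨ P.conf x l c k) →
      (x ∈ P.X k → 1 ≤ P.wt x) ∧ (x ∉ P.X i → d ∉ P.X i → 1 ≤ P.wt x) ∧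
      ((x ∈ P.X k ∨ P.conf x k a i ∨ P.conf x k b j ∨ P.conf x k d l) → 1 ≤ P.wt x)) := by
  have h1 : a ∈ P.X 0 := by have := hmin h.swap23.swap34; grind
  have h2 : b ∈ P.X 0 := by have := hmin h.swap12.swap23.swap34; grind
  have e0 := hP.blocked h hx
  have e1 := h.replace_first (x := x) (by grind) (by grind) (by grind)
  have e2 := h.swap12.replace_first (x := x) (by grind) (by grind) (by grind)
  have g1 : ¬ P.Fits i j k l x b c d := fun hh => by have := hmin hh.swap23.swap34; grind
  have g2 : ¬ P.Fits j i k l x a c d := fun hh => by have := hmin hh.swap23.swap34; grind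
  obtain ⟨s, m, u⟩ := P.rules
  have q := h.q
  rw [wt_eq q]
  obtain ⟨q1, q2, q3, q4, q5, q6, q7, q8, q9, q10⟩ := q
  simp only [ind]
  grind

variable (P) in
/-- A wild colour: it occurs in `X 0` only, and so conflicts with no colour at a nonzero index. -/
def Wild (θ : K) : Prop := θ ∈ P.X 0 ∧ ∀ t, t ≠ 0 → θ ∉ P.X t

variable (P) in
open Classical in
/-- The set of wild colours; these are the only used colours of negative weight. -/
noncomputable def wild [Fintype K] : Finset K := {θ | P.Wild θ}

theorem mem_wild [Fintype K] {θ : K} : θ ∈ P.wild ↔ P.Wild θ := by simp [wild]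

theorem quad1234 : Quad 1 2 3 4 := by constructor <;> decide

theorem wt_of_mem' [Fintype K] (x : K) (hx : x ∈ P.X 0) : - ind P.wild x ≤ P.wt x := by
  by_cases h : P.Wild x
  · rw [ind_of_mem (mem_wild.2 h), wt_eq quad1234, ind_of_mem hx]
    have := ind_nonneg (P.X 1) x
    have := ind_nonneg (P.X 2) x
    have := ind_nonneg (P.X 3) x
    have := ind_nonneg (P.X 4) x
    linarith
  · rw [ind_of_notMem (fun hh => h (mem_wild.1 hh)), neg_zero]
    apply wt_of_mem quad1234 hx
    by_contra hn
    push Not at hn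
    refine h ⟨hx, fun t ht => ?_⟩
    rcases quad1234.eq_or t with rfl | rfl | rfl | rfl | rfl <;> grind

/-- Three wild colours can be placed at three of the nonzero indices so as to avoid conflicts with a
free colour at `0`, which would give an assignment. -/
theorem not_three_wild (hP : P.Stuck) (hB : ∀ t, t ≠ 0 → ∀ x, ∃ y, y ∉ P.X 0 ∧ y ∉ P.X t ∧ y ≠ x)
    {x : K} (hx : x ∉ P.X 0) (h1 : P.Wild a) (h2 : P.Wild b) (h3 : P.Wild c) (hab : a ≠ b)
    (hac : a ≠ c) (hbc : b ≠ c) : False := by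
  obtain ⟨s, m, u⟩ := P.rules
  obtain ⟨a0, ha⟩ := h1
  obtain ⟨b0, hb⟩ := h2
  obtain ⟨c0, hc⟩ := h3
  have key : ∀ {i j k l}, Quad i j k l → P.conf x 0 a i ∨ P.conf x 0 b j ∨ P.conf x 0 c k := by
    intro i j k l q
    obtain ⟨y, y0, yl, yx⟩ := hB l q.l0 x
    have hf : P.Fits i j k l a b c y := by
      by_contra hf
      have := fails q hf
      obtain ⟨q1, q2, q3, q4, q5, q6, q7, q8, q9, q10⟩ := q
      grind
    have := hP.blocked hf hx
    grind
  have k1 := key quad1234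
  have k2 := key (i := 2) (j := 3) (k := 4) (l := 1) (by constructor <;> decide)
  have k3 := key (i := 3) (j := 4) (k := 1) (l := 2) (by constructor <;> decide)
  have k4 := key (i := 4) (j := 1) (k := 2) (l := 3) (by constructor <;> decide)
  have := u x 0 a
  have := u x 0 b
  have := u x 0 c
  grind

theorem card_wild_le [Fintype K] (hP : P.Stuck)
    (hB : ∀ t, t ≠ 0 → ∀ x, ∃ y, y ∉ P.X 0 ∧ y ∉ P.X t ∧ y ≠ x) : P.wild.card ≤ 2 := by
  by_contra hn
  push Not at hn
  rw [Finset.two_lt_card] at hn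
  obtain ⟨a, ha, b, hb, c, hc, hab, hac, hbc⟩ := hn
  have : Nonempty K := ⟨a⟩
  obtain ⟨x, hx, -⟩ := hB 1 (by decide) a
  exact not_three_wild hP hB hx (mem_wild.1 ha) (mem_wild.1 hb) (mem_wild.1 hc) hab hac hbc
end Palette

end

/-! ### Stuck palettes -/

section

namespace Palette
variable {K : Type*} {P : Palette K} {i j k l : Fin 5} {a b c d : K}
variable [DecidableEq K] [Fintype K]

/-- A fitting quadruple of free colours becomes an assignment with any further free colour at `0`.
-/
theorem not_fits_zero (hP : P.Stuck) (h : P.Fits i j k l a b c d) (hA : 5 ≤ (P.X 0)ᶜ.card)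
    (ha : a ∉ P.X 0) (hb : b ∉ P.X 0) (hc : c ∉ P.X 0) (hd : d ∉ P.X 0) : False := by
  obtain ⟨x, hx, hx'⟩ : ∃ x ∈ (P.X 0)ᶜ, x ∉ ({a, b, c, d} : Finset K) := by
    by_contra hn
    push Not at hn
    have := Finset.card_le_card (show (P.X 0)ᶜ ⊆ {a, b, c, d} from hn)
    have := Finset.card_le_four (a := a) (b := b) (c := c) (d := d)
    omega
  have := hP.blocked h (by simpa using hx)
  have := @conf_mem' _ P
  simp at hx'
  grind

section Stuck
variable {Δ e : ℕ} (hP : P.Stuck) (hA : (P.X 0)ᶜ.card = Δ + e + 2)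
  (hX : ∀ t, t ≠ 0 → (P.X t).card + 1 ≤ Δ)

include hA hX in
theorem exists_not_mem (t : Fin 5) (ht : t ≠ 0) (x y : K) :
    ∃ z, z ∉ P.X 0 ∧ z ∉ P.X t ∧ z ≠ x ∧ z ≠ y := by
  by_contra hn
  push Not at hn
  have h1 : (P.X 0)ᶜ ⊆ insert x (insert y (P.X t)) := by
    intro z hz
    have := hn z (by simpa using hz)
    simp; grind
  have := Finset.card_le_card h1
  have := Finset.card_insert_le x (insert y (P.X t))
  have := Finset.card_insert_le y (P.X t)
  have := hX t ht
  omega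

include hP hA hX in
/-- The bound when every fitting quadruple consists of used colours. -/
theorem sum_nonneg_of_four_used (h : P.Fits i j k l a b c d)
    (hmin : ∀ {i j k l a b c d}, P.Fits i j k l a b c d → a ∈ P.X 0)
    (h0 : (P.X 0).card + 2 ≤ Δ) : 0 ≤ ∑ x, P.wt x := by
  have := sum_ge P.wt [(1, (P.X 0)ᶜ), (-1, P.X 0)] (by
    intro x
    by_cases hx : x ∈ P.X 0
    · have := wt_of_mem' x hx
      have := ind_le_one P.wild x
      simp [ind, hx]; omega
    · have := wt_of_four hP h hmin hx
      simp [ind, hx]; omega)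
  simp only [List.map_cons, List.map_nil, List.sum_cons, List.sum_nil] at this
  omega

include hP hA hX in
/-- The bound when every fitting quadruple has at least three used colours, and some has exactly
three. -/
theorem sum_nonneg_of_three_used (h : P.Fits i j k l a b c d)
    (hmin : ∀ {i j k l a b c d}, P.Fits i j k l a b c d → a ∈ P.X 0 ∨ b ∈ P.X 0)
    (hd : d ∉ P.X 0) (h0 : (P.X 0).card + 2 ≤ Δ) : 0 ≤ ∑ x, P.wt x := by
  by_cases hl : ∃ x, x ∉ P.X 0 ∧ x ≠ d ∧ P.Fits i j k l a b c x
  -- The cases are whether the colour `d` can be exchanged for another free colour.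
  · obtain ⟨d', hd', hdd, h'⟩ := hl
    have hw : ∀ x, x ∉ P.X 0 → 0 ≤ P.wt x := by
      intro x hx
      by_cases hxd : x = d
      · exact (wt_of_three hP h' hmin hd' hx (by grind)).1
      · exact (wt_of_three hP h hmin hd hx hxd).1
    have key : ∀ {i j k l a b c d}, P.Fits i j k l a b c d → d ∉ P.X 0 → P.Wild a →
      0 ≤ ∑ x, P.wt x := by
      intro i j k l a b c d h hd ha
      have hs : ∀ x, x ∉ P.X 0 → x ∉ P.X i → x ≠ d → 1 ≤ P.wt x := by
        -- A free colour missing at `i` has positive weight: otherwise it could be placed at `i`,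
        -- with the wild colour `a` moved to `j` or to `k`, so that only two used colours would
        -- remain.
        intro x hx hxi hxd
        have h0 := hw x hx
        have h1 : a ∈ P.X 0 := by have := hmin h.swap34.swap23; grind
        have h2 : b ∈ P.X 0 := by have := hmin h.swap34.swap23.swap12.swap23; grind
        have h3 : c ∈ P.X 0 := by have := hmin h.swap23.swap12.swap34.swap23; grind
        have e0 := hP.blocked h hx
        have e1 := h.replace_first (x := x) (by grind) (by grind) (by grind)
        have e2 := h.swap12.replace_first (x := x) (by grind) (by grind) (by grind)
        have e3 := h.swap23.swap12.replace_first (x := x) (by grind) (by grind) (by grind)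
        have g1 : ¬ P.Fits i j k l x b c d := fun hh => by have := hmin hh.swap34.swap23; grind
        have g2 : ¬ P.Fits j i k l x a c d := fun hh => by have := hmin hh.swap34.swap23; grind
        have g3 : ¬ P.Fits k i j l x a b d := fun hh => by have := hmin hh.swap34.swap23; grind
        have f1 := fails (P := P) (i := i) (j := k) (k := j) (l := l) (a := x) (b := a) (c := b)
          (d := d) h.q.swap23 fun hh => by have := hmin hh.swap34.swap23; grind
        have f2 := fails (P := P) (i := i) (j := j) (k := k) (l := l) (a := x) (b := a) (c := c)
          (d := d) h.q fun hh => by have := hmin hh.swap34.swap23; grind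
        obtain ⟨s, m, u⟩ := P.rules
        obtain ⟨-, ha⟩ := ha
        have q := h.q
        obtain ⟨q0, w1, w2, w3, w4, w5, w6, w7, w8, w9, w10, w11, w12, w13, w14, w15, w16⟩ := h
        rw [wt_eq q]
        obtain ⟨q1, q2, q3, q4, q5, q6, q7, q8, q9, q10⟩ := q
        simp only [ind]
        grind
      have hc : 2 ≤ ((P.X 0)ᶜ \ insert d (P.X i)).card := by
        have h1 := Finset.le_card_sdiff (insert d (P.X i)) (P.X 0)ᶜ
        have := Finset.card_insert_le d (P.X i)
        have := hX i h.q.i0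
        omega
      have := sum_ge P.wt [(1, (P.X 0)ᶜ \ insert d (P.X i)), (-1, P.wild)] (by
        intro x
        by_cases hx : x ∈ P.X 0
        · have := wt_of_mem' x hx
          simp only [List.map_cons, List.map_nil, List.sum_cons, List.sum_nil]
          rw [ind_of_notMem (by simp [hx])]; omega
        · have hn : x ∉ P.wild := fun hh => hx (mem_wild.1 hh).1
          have h1 := hs x hx
          have h2 := hw x hx
          simp only [List.map_cons, List.map_nil, List.sum_cons, List.sum_nil, ind_of_notMem hn]
          simp only [ind, Finset.mem_sdiff, Finset.mem_insert, Finset.mem_compl]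
          grind)
      simp only [List.map_cons, List.map_nil, List.sum_cons, List.sum_nil] at this
      have h2 := card_wild_le hP (fun t ht x => by
        obtain ⟨z, h1, h2, h3, -⟩ := exists_not_mem hA hX t ht x x
        exact ⟨z, h1, h2, h3⟩)
      omega
    by_cases hw0 : ∃ θ, P.Wild θ
    · obtain ⟨θ, hθ⟩ := hw0
      have h1 : θ = a ∨ θ = b ∨ θ = c ∨ P.Fits i j k l θ b c d := by
        by_contra hn
        push Not at hn
        obtain ⟨n1, n2, n3, n4⟩ := hn
        have := h.replace_first n2 n3 (by rintro rfl; exact hd hθ.1)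
        have hm := @P.conf_mem
        have := hθ.2
        have := h.q.i0
        have := h.q.j0
        have := h.q.k0
        have := h.q.l0
        grind
      rcases h1 with rfl | rfl | rfl | h1
      · exact key h hd hθ
      · exact key h.swap12 hd hθ
      · exact key h.swap23.swap12 hd hθ
      · exact key h1 hd hθ
    · push Not at hw0
      refine Finset.sum_nonneg fun x _ => ?_
      by_cases hx : x ∈ P.X 0
      · have := wt_of_mem' x hx
        rw [ind_of_notMem (fun hh => hw0 x (mem_wild.1 hh))] at this
        simpa using this
      · exact hw x hx
  · push Not at hl
    have hw : ∀ x, x ∉ P.X 0 → x ≠ d → 1 ≤ P.wt x := by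
      intro x hx hxd
      have h1 : a ∈ P.X 0 := by have := hmin h.swap34.swap23; grind
      have h2 : b ∈ P.X 0 := by have := hmin h.swap34.swap23.swap12.swap23; grind
      have h3 : c ∈ P.X 0 := by have := hmin h.swap23.swap12.swap34.swap23; grind
      have e4 := h.swap34.swap23.swap12.replace_first (x := x) (by grind) (by grind) (by grind)
      obtain ⟨-, e1, e2⟩ := wt_of_three hP h hmin hd hx hxd
      have e3 := hl x hx hxd
      have e5 : ¬ P.Fits l i j k x a b c := fun hh => e3 (hh.swap12.swap23.swap34)
      tauto
    have := sum_ge P.wt [(1, (P.X 0)ᶜ), (-1, P.X 0), (-3, {d})] (by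
      intro x
      by_cases hx : x ∈ P.X 0
      · have := wt_of_mem' x hx
        have := ind_le_one P.wild x
        have : x ≠ d := by rintro rfl; exact hd hx
        simp [ind, hx, this]; omega
      · by_cases hxd : x = d
        · subst hxd
          have := P.neg_two_le_wt x
          simp [ind, hx]; omega
        · have := hw x hx hxd
          simp [ind, hx, hxd]; omega)
    simp only [List.map_cons, List.map_nil, List.sum_cons, List.sum_nil,
        Finset.card_singleton] at this
    omega

include hP hX in
/-- If only `a` is used and none of `b, c, d` conflicts with it at `0`, then the index `0` can take
over any of `b, c, d`. So no further colour can be placed at the vacated index, and all colours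
outside the quadruple have positive weight. -/
theorem sum_ge_two_of_one_used_of_not_conf (h : P.Fits i j k l a b c d) (h0 : a ∈ P.X 0)
    (hb : b ∉ P.X 0) (hc : c ∉ P.X 0) (hd : d ∉ P.X 0) (hK : Δ + 5 ≤ Fintype.card K)
    (hK' : 10 ≤ Fintype.card K) (hb' : ¬ P.conf b 0 a i) (hc' : ¬ P.conf c 0 a i)
    (hd' : ¬ P.conf d 0 a i) : 2 ≤ ∑ x, P.wt x := by
  obtain ⟨s, m, u⟩ := P.rules
  have hAi : ∀ x, x ∉ P.X 0 → x ≠ b → x ≠ c → x ≠ d → P.conf x 0 a i := by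
    intro x hx xb xc xd
    have := hP.blocked h hx
    grind
  have key : ∀ {j k l b c d}, P.Fits i j k l a b c d → b ∉ P.X 0 → c ∉ P.X 0 → d ∉ P.X 0 →
      ¬ P.conf b 0 a i → ¬ P.conf c 0 a i → ¬ P.conf d 0 a i →
      ∀ x, x ≠ a → x ≠ b → x ≠ c → x ≠ d →
        x ∈ P.X j ∨ P.conf x j c k ∨ P.conf x j d l ∨ P.conf x j a i := by
    intro j k l b' c' d' h hb hc hd hbi hci hdi x xa xb xc xd
    have f := h.swap12.replace_first (x := x) xa xc xd
    by_contra hn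
    have hf : P.Fits j i k l x a c' d' := by tauto
    have := hP.blocked hf hb
    have := h.q.i0
    have := h.bj
    have := h.bc
    have := h.bd
    have := h.ab
    grind
  have k1 := key h hb hc hd hb' hc' hd'
  have k2 := key h.swap23 hc hb hd hc' hb' hd'
  have k3 := key h.swap34.swap23 hd hb hc hd' hb' hc'
  have q := h.q
  have hw : ∀ x, x ≠ a → x ≠ b → x ≠ c → x ≠ d → 1 ≤ P.wt x := by
    intro x xa xb xc xd
    have := k1 x xa xb xc xd
    have := k2 x xa xc xb xd
    have := k3 x xa xd xb xc
    have := hAi x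
    rw [wt_eq q]
    obtain ⟨q1, q2, q3, q4, q5, q6, q7, q8, q9, q10⟩ := q
    simp only [ind]
    grind
  have hex : ∀ t, t ≠ 0 → ∃ x, x ∉ P.X t ∧ x ≠ a ∧ x ≠ b ∧ x ≠ c ∧ x ≠ d := by
    intro t ht
    by_contra hn
    push Not at hn
    have h1 : Finset.univ ⊆ {a, b, c, d} ∪ P.X t := by
      intro x _
      have := hn x
      simp; grind
    have h1 := Finset.card_le_card h1
    have := Finset.card_union_le {a, b, c, d} (P.X t)
    have := Finset.card_le_four (a := a) (b := b) (c := c) (d := d)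
    have := hX t ht
    rw [Finset.card_univ] at h1
    omega
  obtain ⟨x1, y1⟩ := hex j q.j0
  obtain ⟨x2, y2⟩ := hex k q.k0
  obtain ⟨x3, y3⟩ := hex l q.l0
  have k1 := k1 x1 y1.2.1 y1.2.2.1 y1.2.2.2.1 y1.2.2.2.2
  have k2 := k2 x2 y2.2.1 y2.2.2.2.1 y2.2.2.1 y2.2.2.2.2
  have k3 := k3 x3 y3.2.1 y3.2.2.2.2 y3.2.2.1 y3.2.2.2.1
  have hs : -4 ≤ P.wt a + P.wt b + P.wt c + P.wt d := by
    simp only [wt_eq q]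
    have := ind_nonneg (P.X i) a
    have := ind_nonneg (P.X i) b
    have := ind_nonneg (P.X i) c
    have := ind_nonneg (P.X i) d
    have := ind_nonneg (P.X j) b
    have := ind_nonneg (P.X k) c
    have := ind_nonneg (P.X l) d
    have e1 : 1 ≤ ind (P.X j) a + ind (P.X j) b + ind (P.X j) c + ind (P.X j) d := by
        simp only [ind]; grind
    have e2 : 1 ≤ ind (P.X k) a + ind (P.X k) b + ind (P.X k) c + ind (P.X k) d := by
        simp only [ind]; grind
    have e3 : 1 ≤ ind (P.X l) a + ind (P.X l) b + ind (P.X l) c + ind (P.X l) d := by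
        simp only [ind]; grind
    simp only [ind_of_mem h0, ind_of_notMem hb, ind_of_notMem hc, ind_of_notMem hd]
    omega
  have := sum_ge P.wt [(1, Finset.univ \ {a, b, c, d}), (P.wt a, {a}), (P.wt b, {b}),
      (P.wt c, {c}), (P.wt d, {d})] (by
    intro x
    have := h.ab
    have := h.ac
    have := h.ad
    have := h.bc
    have := h.bd
    have := h.cd
    have := hw x
    simp only [List.map_cons, List.map_nil, List.sum_cons, List.sum_nil, ind, Finset.mem_sdiff,
      Finset.mem_univ, Finset.mem_insert, Finset.mem_singleton]
    grind)
  simp only [List.map_cons, List.map_nil, List.sum_cons, List.sum_nil,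
      Finset.card_singleton] at this
  have := Finset.le_card_sdiff ({a, b, c, d} : Finset K) Finset.univ
  have := Finset.card_le_four (a := a) (b := b) (c := c) (d := d)
  have := Finset.card_univ (α := K)
  omega

include hP hA hX in
/-- The bound when some fitting quadruple has exactly one used colour. -/
theorem sum_ge_two_of_one_used (h : P.Fits i j k l a b c d) (h0 : a ∈ P.X 0)
    (hb : b ∉ P.X 0) (hc : c ∉ P.X 0) (hd : d ∉ P.X 0) (hK : Δ + 5 ≤ Fintype.card K)
    (hK' : 10 ≤ Fintype.card K) : 2 ≤ ∑ x, P.wt x := by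
  obtain ⟨s, m, u⟩ := P.rules
  have hAi : ∀ x, x ∉ P.X 0 → x ≠ b → x ≠ c → x ≠ d → P.conf x 0 a i := by
    intro x hx xb xc xd
    have := hP.blocked h hx
    grind
  have hcard : (({b, c, d} : Finset K)).card = 3 := by
    rw [Finset.card_insert_of_notMem, Finset.card_pair h.cd]
    simp [h.bc, h.bd]
  have hsub : (P.X 0)ᶜ \ {b, c, d} ⊆ P.X i := by
    intro x hx
    simp at hx
    exact P.conf_mem (hAi x hx.1 hx.2.1 hx.2.2.1 hx.2.2.2)
  have hXi : P.X i = (P.X 0)ᶜ \ {b, c, d} := by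
    symm
    apply Finset.eq_of_subset_of_card_le hsub
    have := Finset.le_card_sdiff ({b, c, d} : Finset K) (P.X 0)ᶜ
    have := hX i h.q.i0
    omega
  have hXi' : ∀ x, x ∈ P.X i ↔ x ∉ P.X 0 ∧ x ≠ b ∧ x ≠ c ∧ x ≠ d := by
    intro x; rw [hXi]; simp
  refine sum_ge_two_of_one_used_of_not_conf hP hX h h0 hb hc hd hK hK' ?_ ?_ ?_ <;> intro hh <;>
      have := m _ _ _ _ hh <;>
    have := hXi' b <;> have := hXi' c <;> have := hXi' d <;> tauto

end Stuck
end Palette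

end

section

namespace Palette
variable {K : Type*} {P : Palette K} {i j k l : Fin 5} {a b c d : K}
variable [DecidableEq K] [Fintype K]

section Stuck
variable {Δ e : ℕ} (hP : P.Stuck) (hA : (P.X 0)ᶜ.card = Δ + e + 2)
  (hX : ∀ t, t ≠ 0 → (P.X t).card + 1 ≤ Δ)

include hP hA hX in
/-- The bound when every fitting quadruple has at least two used colours, and some with exactly two
contains a wild colour. -/
theorem sum_nonneg_of_two_used_of_wild (h : P.Fits i j k l a b c d)
    (hmin : ∀ {i j k l a b c d}, P.Fits i j k l a b c d → a ∈ P.X 0 ∨ b ∈ P.X 0 ∨ c ∈ P.X 0)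
    (ha : P.Wild a) (hc : c ∉ P.X 0) (hd : d ∉ P.X 0) : 0 ≤ ∑ x, P.wt x := by
  have q := h.q
  have hb : b ∈ P.X 0 := by have := hmin h.swap12.swap23.swap34; grind
  obtain ⟨s, m, u⟩ := P.rules
  have ha0 := ha.1
  have ha' := ha.2
  have hO : ∀ y, y ∉ P.X 0 → y ≠ c → y ≠ d → P.conf y 0 a i ∨ P.conf y 0 b j := by
    intro y hy yc yd
    have := hP.blocked h hy
    grind
  -- Otherwise `x, b, a, d` fit at `i, j, k, l`, the wild colour `a` being moved to `k`; a free
  -- colour missing at `j` would then conflict at `0` with `a`, both for `a` at `i` and at `k`.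
  have step : ∀ {k l c d}, P.Fits i j k l a b c d → c ∉ P.X 0 → d ∉ P.X 0 →
      ∀ x, x ∉ P.X 0 → x ∉ P.X i → x ≠ c → x ≠ d → P.conf x i d l := by
    intro k l c d h hc hd x hx xi xc xd
    have hO : ∀ y, y ∉ P.X 0 → y ≠ c → y ≠ d → P.conf y 0 a i ∨ P.conf y 0 b j := by
      intro y hy yc yd
      have := hP.blocked h hy
      grind
    have q := h.q
    by_contra hcon
    have hf : P.conf x i b j ∨ P.Fits i j k l x b a d := by
      by_contra hn
      push Not at hn
      have := fails q hn.2
      obtain ⟨q1, q2, q3, q4, q5, q6, q7, q8, q9, q10⟩ := q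
      obtain ⟨q0, w1, w2, w3, w4, w5, w6, w7, w8, w9, w10, w11, w12, w13, w14, w15, w16⟩ := h
      grind
    rcases hf with hf | hf
    · have h1 := hO x hx
      obtain ⟨q1, q2, q3, q4, q5, q6, q7, q8, q9, q10⟩ := q
      grind
    · obtain ⟨y, y1, y2, y3, y4⟩ := exists_not_mem hA hX j h.q.j0 x d
      have h1 := hP.blocked hf y1
      have h2 := hO y y1
      have h3 := hP.blocked hf hc
      have h4 := h.ac
      obtain ⟨q1, q2, q3, q4, q5, q6, q7, q8, q9, q10⟩ := q
      obtain ⟨q0, w1, w2, w3, w4, w5, w6, w7, w8, w9, w10, w11, w12, w13, w14, w15, w16⟩ := h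
      grind
  -- By symmetry, a free colour missing at `i` conflicts there with both `c` and `d`.
  have hs : ∀ x, x ∉ P.X 0 → x ∉ P.X i → x ≠ c → x ≠ d →
      1 ≤ P.wt x ∧ c ∈ P.X i ∧ d ∈ P.X i := by
    intro x hx hxi hxc hxd
    have h1 := step h hc hd x hx hxi hxc hxd
    have h2 := step h.swap34 hd hc x hx hxi hxd hxc
    have h3 := hO x hx hxc hxd
    rw [wt_eq q]
    obtain ⟨q1, q2, q3, q4, q5, q6, q7, q8, q9, q10⟩ := q
    simp only [ind]
    grind
  -- A free colour missing at `j` cannot replace `b`, so it conflicts there with `c` or `d`.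
  have hj : ∀ x, x ∉ P.X 0 → x ∉ P.X j → x ≠ c → x ≠ d → P.conf x j c k ∨ P.conf x j d l := by
    intro x hx hxj hxc hxd
    have f : ¬ P.Fits i j k l a x c d := fun hh => by have := hmin hh.swap12.swap23.swap34; grind
    have := fails q f
    obtain ⟨q1, q2, q3, q4, q5, q6, q7, q8, q9, q10⟩ := q
    obtain ⟨q0, w1, w2, w3, w4, w5, w6, w7, w8, w9, w10, w11, w12, w13, w14, w15, w16⟩ := h
    grind
  obtain ⟨x0, x1, x2, x3, x4⟩ := exists_not_mem hA hX i q.i0 c d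
  obtain ⟨-, hci, hdi⟩ := hs x0 x1 x2 x3 x4
  have hs : ∀ x, x ∉ P.X 0 → x ∉ P.X i → 1 ≤ P.wt x := by
    intro x hx hxi
    exact (hs x hx hxi (by grind) (by grind)).1
  have hs2 : ∀ x, x ∉ P.X 0 → x ≠ c → x ≠ d → 0 ≤ P.wt x := by
    intro x hx hxc hxd
    have h1 := hs x hx
    have h2 := hj x hx
    rw [wt_eq q] at *
    simp only [ind] at *
    grind
  obtain ⟨y0, y1, y2, y3, y4⟩ := exists_not_mem hA hX j q.j0 c d
  have hcd : -1 ≤ P.wt c + P.wt d := by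
    have h1 := hj y0 y1 y2 y3 y4
    have h1 : 1 ≤ ind (P.X j) c + ind (P.X j) d := by
      simp only [ind]; grind
    simp only [wt_eq q, ind_of_mem hci, ind_of_mem hdi, ind_of_notMem hc, ind_of_notMem hd]
    have := ind_nonneg (P.X l) c
    have := ind_nonneg (P.X k) d
    have := ind_nonneg (P.X k) c
    have := ind_nonneg (P.X l) d
    omega
  have hB : 3 ≤ ((P.X 0)ᶜ \ P.X i).card := by
    have h1 := Finset.le_card_sdiff (P.X i) (P.X 0)ᶜ
    have := hX i h.q.i0
    omega
  have := sum_ge P.wt [(1, (P.X 0)ᶜ \ P.X i), (-1, P.wild), (P.wt c, {c}), (P.wt d, {d})] (by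
    intro x
    simp only [List.map_cons, List.map_nil, List.sum_cons, List.sum_nil]
    by_cases hx : x ∈ P.X 0
    · have := wt_of_mem' x hx
      have hxc : x ≠ c := by grind
      have hxd : x ≠ d := by grind
      rw [ind_of_notMem (s := (P.X 0)ᶜ \ P.X i) (by simp [hx]), ind_of_notMem (s := {c}) (by simpa),
        ind_of_notMem (s := {d}) (by simpa)]
      linarith
    · have hn : x ∉ P.wild := fun hh => hx (mem_wild.1 hh).1
      have h1 := hs x hx
      have h2 := hs2 x hx
      have := h.cd
      rw [ind_of_notMem hn]
      simp only [ind, Finset.mem_sdiff, Finset.mem_singleton, Finset.mem_compl]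
      grind)
  simp only [List.map_cons, List.map_nil, List.sum_cons, List.sum_nil,
      Finset.card_singleton] at this
  have h2 := card_wild_le hP (fun t ht x => by
    obtain ⟨z, h1, h2, h3, -⟩ := exists_not_mem hA hX t ht x x
    exact ⟨z, h1, h2, h3⟩)
  omega

theorem used_two (h : P.Fits i j k l a b c d)
    (hmin : ∀ {i j k l a b c d}, P.Fits i j k l a b c d → a ∈ P.X 0 ∨ b ∈ P.X 0 ∨ c ∈ P.X 0)
    (hc : c ∉ P.X 0) (hd : d ∉ P.X 0) : a ∈ P.X 0 ∧ b ∈ P.X 0 := by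
  have := hmin h.swap23.swap34
  have := hmin h.swap12.swap23.swap34
  tauto

include hP hA hX in
/-- The bound for two used colours without colours of negative weight in `X 0`, when the free colour
`c` can be exchanged for another one. -/
theorem sum_nonneg_of_two_used_of_exchange (h : P.Fits i j k l a b c d)
    (hmin : ∀ {i j k l a b c d}, P.Fits i j k l a b c d → a ∈ P.X 0 ∨ b ∈ P.X 0 ∨ c ∈ P.X 0)
    (hc : c ∉ P.X 0) (hd : d ∉ P.X 0) (hw0 : ∀ x, x ∈ P.X 0 → 0 ≤ P.wt x)
    (hk : ∃ c', c' ∉ P.X 0 ∧ c' ≠ c ∧ c' ≠ d ∧ P.Fits i j k l a b c' d) : 0 ≤ ∑ x, P.wt x := by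
  have q := h.q
  -- If both free colours of the quadruple can be exchanged, all weights are nonnegative.
  by_cases hl : ∃ c' d', c' ∉ P.X 0 ∧ d' ∉ P.X 0 ∧ c' ≠ d ∧ d' ≠ d ∧ P.Fits i j k l a b c' d'
  · obtain ⟨c', hc', hcc, hcd, h'⟩ := hk
    obtain ⟨c2, d2, hc2, hd2, hcd2, hdd2, h2⟩ := hl
    refine Finset.sum_nonneg fun x _ => ?_
    by_cases hx : x ∈ P.X 0
    · exact hw0 x hx
    by_cases hxd : x = d
    · subst hxd
      exact (wt_of_two hP h2 hmin hc2 hd2 hx hcd2.symm hdd2.symm).1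
    by_cases hxc : x = c
    · subst hxc
      exact (wt_of_two hP h' hmin hc' hd hx hcc.symm hxd).1
    exact (wt_of_two hP h hmin hc hd hx hxc hxd).1
  · push Not at hl
    have key : ∀ {i j k l a b c}, P.Fits i j k l a b c d → c ∉ P.X 0 →
        (∀ c' d', c' ∉ P.X 0 → d' ∉ P.X 0 → c' ≠ d → d' ≠ d → ¬ P.Fits i j k l a b c' d') →
        ∀ x, x ∉ P.X 0 → x ≠ c → x ≠ d → 0 ≤ P.wt x ∧
          (x ∉ P.X i → d ∉ P.X i → 1 ≤ P.wt x) := by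
      intro i j k l a b c h hc hl x hx hxc hxd
      have h1 := hl c x hc hx h.cd hxd
      have h1 : ¬ P.Fits l i j k x a b c := fun hh => h1 hh.swap12.swap23.swap34
      obtain ⟨h0, h0'⟩ := used_two h hmin hc hd
      have h2 := h.swap34.swap23.swap12.replace_first (x := x) (ne_of_mem_of_not_mem h0 hx).symm
        (ne_of_mem_of_not_mem h0' hx).symm hxc
      obtain ⟨h3, h4⟩ := wt_of_two hP h hmin hc hd hx hxc hxd
      refine ⟨h3, (h4 (by tauto)).2.1⟩
    obtain ⟨c', hc', hcc, hcd, h'⟩ := hk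
    have hi : ∀ x, x ∉ P.X 0 → x ≠ d → 0 ≤ P.wt x ∧ (x ∉ P.X i → d ∉ P.X i → 1 ≤ P.wt x) := by
      intro x hx hxd
      by_cases hxc : x = c
      · exact key h' hc' hl x hx (by grind) hxd
      · exact key h hc hl x hx hxc hxd
    have hl' : ∀ c' d', c' ∉ P.X 0 → d' ∉ P.X 0 → c' ≠ d → d' ≠ d →
        ¬ P.Fits j i k l b a c' d' := fun c' d' h1 h2 h3 h4 hh => hl c' d' h1 h2 h3 h4 hh.swap12
    have hj : ∀ x, x ∉ P.X 0 → x ≠ d → 0 ≤ P.wt x ∧ (x ∉ P.X j → d ∉ P.X j → 1 ≤ P.wt x) := by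
      intro x hx hxd
      by_cases hxc : x = c
      · exact key h'.swap12 hc' hl' x hx (by grind) hxd
      · exact key h.swap12 hc hl' x hx hxc hxd
    -- If `d` is missing at `t`, the positive weights of the free colours missing at `t` make up for
    -- the weight of `d`.
    have fin : ∀ t, t ≠ 0 → (∀ x, x ∉ P.X 0 → x ≠ d → 0 ≤ P.wt x ∧
        (x ∉ P.X t → d ∉ P.X t → 1 ≤ P.wt x)) → d ∉ P.X t → 0 ≤ ∑ x, P.wt x := by
      intro t ht hi' hdt
      have := sum_ge P.wt [(1, (P.X 0)ᶜ \ insert d (P.X t)), (-2, {d})] (by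
        intro x
        have := P.neg_two_le_wt x
        have h1 := hi' x
        have h2 := hw0 x
        clear hl hl' key hmin hw0 hX hi hj hi' h h'
        simp only [List.map_cons, List.map_nil, List.sum_cons, List.sum_nil, ind,
          Finset.mem_sdiff, Finset.mem_compl, Finset.mem_insert, Finset.mem_singleton]
        by_cases hx : x ∈ P.X 0 <;> by_cases hxd : x = d <;> grind)
      simp only [List.map_cons, List.map_nil, List.sum_cons, List.sum_nil,
        Finset.card_singleton] at this
      have h1 := Finset.le_card_sdiff (insert d (P.X t)) (P.X 0)ᶜ
      have := Finset.card_insert_le d (P.X t)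
      have := hX t ht
      omega
    by_cases hdi : d ∈ P.X i
    · by_cases hdj : d ∈ P.X j
      · refine Finset.sum_nonneg fun x _ => ?_
        by_cases hx : x ∈ P.X 0
        · exact hw0 x hx
        by_cases hxd : x = d
        · subst hxd
          rw [wt_eq q]
          have := ind_nonneg (P.X 0) x
          have := ind_nonneg (P.X k) x
          have := ind_nonneg (P.X l) x
          simp only [ind_of_mem hdi, ind_of_mem hdj]
          omega
        · exact (hi x hx hxd).1
      · exact fin j q.j0 hj hdj
    · exact fin i q.i0 hi hdi

include hP hA hX in
/-- The bound when every fitting quadruple has at least two used colours, and some has exactly two.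
-/
theorem sum_nonneg_of_two_used (h : P.Fits i j k l a b c d)
    (hmin : ∀ {i j k l a b c d}, P.Fits i j k l a b c d → a ∈ P.X 0 ∨ b ∈ P.X 0 ∨ c ∈ P.X 0)
    (hc : c ∉ P.X 0) (hd : d ∉ P.X 0) (hΔ : 4 ≤ Δ) : 0 ≤ ∑ x, P.wt x := by
  have q := h.q
  by_cases hw : ∃ θ, P.Wild θ
  · obtain ⟨θ, hθ⟩ := hw
    have h1 : θ = a ∨ θ = b ∨ P.Fits i j k l θ b c d := by
      by_contra hn
      push Not at hn
      obtain ⟨n1, n2, n4⟩ := hn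
      have := h.replace_first n2 (by rintro rfl; exact hc hθ.1) (by rintro rfl; exact hd hθ.1)
      have hm := @P.conf_mem
      have := hθ.2
      obtain ⟨q1, q2, q3, q4, q5, q6, q7, q8, q9, q10⟩ := q
      grind
    rcases h1 with rfl | rfl | h1
    · exact sum_nonneg_of_two_used_of_wild hP hA hX h hmin hθ hc hd
    · exact sum_nonneg_of_two_used_of_wild hP hA hX h.swap12 hmin hθ hc hd
    · exact sum_nonneg_of_two_used_of_wild hP hA hX h1 hmin hθ hc hd
  push Not at hw
  have hw0 : ∀ x, x ∈ P.X 0 → 0 ≤ P.wt x := by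
    intro x hx
    have := wt_of_mem' x hx
    rw [ind_of_notMem (fun hh => hw x (mem_wild.1 hh))] at this
    simpa using this
  by_cases hk : ∃ c', c' ∉ P.X 0 ∧ c' ≠ c ∧ c' ≠ d ∧ P.Fits i j k l a b c' d
  · exact sum_nonneg_of_two_used_of_exchange hP hA hX h hmin hc hd hw0 hk
  · push Not at hk
    by_cases hl : ∃ d', d' ∉ P.X 0 ∧ d' ≠ c ∧ d' ≠ d ∧ P.Fits i j k l a b c d'
    · obtain ⟨d', h1, h2, h3, h4⟩ := hl
      exact sum_nonneg_of_two_used_of_exchange hP hA hX h.swap34 hmin hd hc hw0 ⟨d', h1, h3, h2,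
          h4.swap34⟩
    push Not at hl
    have hw1 : ∀ x, x ∉ P.X 0 → x ≠ c → x ≠ d → 1 ≤ P.wt x := by
      intro x hx hxc hxd
      have h1 := hl x hx hxc hxd
      have h2 := hk x hx hxc hxd
      have h1 : ¬ P.Fits l i j k x a b c := fun hh => h1 hh.swap12.swap23.swap34
      have h2 : ¬ P.Fits k i j l x a b d := fun hh => h2 hh.swap12.swap23
      obtain ⟨h0, h0'⟩ := used_two h hmin hc hd
      have h3 := h.swap34.swap23.swap12.replace_first (x := x) (ne_of_mem_of_not_mem h0 hx).symm
        (ne_of_mem_of_not_mem h0' hx).symm hxc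
      have h4 := h.swap23.swap12.replace_first (x := x) (ne_of_mem_of_not_mem h0 hx).symm
        (ne_of_mem_of_not_mem h0' hx).symm hxd
      exact ((wt_of_two hP h hmin hc hd hx hxc hxd).2 (by tauto)).2.2 (by tauto)
    have := sum_ge P.wt [(1, (P.X 0)ᶜ), (-3, {c, d})] (by
      intro x
      have := P.neg_two_le_wt x
      have h1 := hw1 x
      have h2 := hw0 x
      clear hl hmin hw hw0 hX hk hw1
      simp only [List.map_cons, List.map_nil, List.sum_cons, List.sum_nil, ind,
        Finset.mem_compl, Finset.mem_insert, Finset.mem_singleton]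
      by_cases hx : x ∈ P.X 0 <;> by_cases hxd : x = d <;> by_cases hxd : x = c <;> grind)
    simp only [List.map_cons, List.map_nil, List.sum_cons, List.sum_nil,
      Finset.card_pair h.cd] at this
    omega
end Stuck
end Palette

end

/-! ### Palettes with an assignment, and all stuck palettes -/

section

namespace Palette
variable {K : Type*} {P : Palette K} {i j k l : Fin 5} {a b c d : K}
variable [DecidableEq K] [Fintype K]

theorem IsAssignment.fits {f : Fin 5 → K} (hf : P.IsAssignment f) (q : Quad i j k l) :
    P.Fits i j k l (f i) (f j) (f k) (f l) := by
  obtain ⟨h1, h2, h3⟩ := hf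
  exact ⟨q, h2 _, h2 _, h2 _, h2 _, h1.ne q.ij, h1.ne q.ik, h1.ne q.il, h1.ne q.jk, h1.ne q.jl,
    h1.ne q.kl, h3 _ _, h3 _ _, h3 _ _, h3 _ _, h3 _ _, h3 _ _⟩

section Stuck
variable {Δ e : ℕ} (hA : (P.X 0)ᶜ.card = Δ + e + 2)
  (hX : ∀ t, t ≠ 0 → (P.X t).card + 1 ≤ Δ)

include hA hX in
/-- The sum of the weights of a stuck palette is nonnegative. The proof considers a fitting
quadruple with as few used colours as possible. -/
theorem Stuck.sum_nonneg (hP : P.Stuck) (h : P.Fits i j k l a b c d) (h0 : (P.X 0).card + 2 ≤ Δ)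
    (hK : Δ + 5 ≤ Fintype.card K) (hΔ : 5 ≤ Δ) : 0 ≤ ∑ x, P.wt x := by
  by_cases h1 : ∃ i j k l a b c d, P.Fits i j k l a b c d ∧ b ∉ P.X 0 ∧ c ∉ P.X 0 ∧ d ∉ P.X 0
  · obtain ⟨i, j, k, l, a, b, c, d, h, hb, hc, hd⟩ := h1
    by_cases ha : a ∈ P.X 0
    · have := sum_ge_two_of_one_used hP hA hX h ha hb hc hd hK (by omega)
      omega
    · exact (not_fits_zero hP h (by omega) ha hb hc hd).elim
  by_cases h2 : ∃ i j k l a b c d, P.Fits i j k l a b c d ∧ c ∉ P.X 0 ∧ d ∉ P.X 0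
  · obtain ⟨i, j, k, l, a, b, c, d, h, hc, hd⟩ := h2
    refine sum_nonneg_of_two_used hP hA hX h (fun {i j k l a b c d} h => ?_) hc hd (by omega)
    by_contra hn
    push Not at hn
    exact h1 ⟨_, _, _, _, _, _, _, _, h.swap34.swap23.swap12, hn⟩
  by_cases h3 : ∃ i j k l a b c d, P.Fits i j k l a b c d ∧ d ∉ P.X 0
  · obtain ⟨i, j, k, l, a, b, c, d, h, hd⟩ := h3
    refine sum_nonneg_of_three_used hP hA hX h (fun {i j k l a b c d} h => ?_) hd (by omega)
    by_contra hn
    push Not at hn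
    exact h2 ⟨_, _, _, _, _, _, _, _, h.swap23.swap34.swap12.swap23, hn⟩
  refine sum_nonneg_of_four_used hP hA hX h (fun {i j k l a b c d} h => ?_) h0
  by_contra hn
  exact h3 ⟨_, _, _, _, _, _, _, _, h.swap12.swap23.swap34, hn⟩

/-- The bound when only four colours are missing at both `0` and `1`, so that most colours lie in
`X 0` or in `X 1`. -/
theorem sum_nonneg_of_cover (hdis : ∀ x, x ∈ P.X 0 → x ∉ P.X 1) (h0 : 3 ≤ (P.X 0).card)
    (h1 : 3 ≤ (P.X 1).card) (y : K) (hy : (P.X 0 ∪ P.X 1)ᶜ ⊆ {y, b, c, d})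
    (k0 : ∀ z, z ∈ P.X 0 → 1 ≤ P.wt z) (k1 : ∀ z, z ∈ P.X 1 → 1 ≤ P.wt z)
    (k2 : (∀ z, z ∈ P.X 0 → 2 ≤ P.wt z) ∨ (∀ z, z ∈ P.X 1 → 2 ≤ P.wt z)) :
    0 ≤ ∑ x, P.wt x := by
  have h3 := Finset.card_le_card hy
  have h4 := Finset.card_le_four (a := y) (b := b) (c := c) (d := d)
  have key : ∀ A B : ℤ, (∀ z, z ∈ P.X 0 → A ≤ P.wt z) → (∀ z, z ∈ P.X 1 → B ≤ P.wt z) →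
      A * (P.X 0).card + B * (P.X 1).card - 8 ≤ ∑ x, P.wt x := by
    intro A B hA hB
    have := sum_ge P.wt [(A, P.X 0), (B, P.X 1), (-2, (P.X 0 ∪ P.X 1)ᶜ)] (by
      intro x
      have := P.neg_two_le_wt x
      have h1 := hdis x
      have h2 := hA x
      have h3 := hB x
      clear hA hB k0 k1 k2
      simp only [List.map_cons, List.map_nil, List.sum_cons, List.sum_nil, ind, Finset.mem_compl,
        Finset.mem_union]
      by_cases x ∈ P.X 0 <;> by_cases x ∈ P.X 1 <;> simp_all)
    simp only [List.map_cons, List.map_nil, List.sum_cons, List.sum_nil] at this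
    omega
  rcases k2 with k2 | k2
  · have := key 2 1 k2 k1
    omega
  · have := key 1 2 k0 k2
    omega

/-- A colour of `X 0` or `X i` has positive weight if it can replace no colour at the other three
indices. -/
theorem wt_of_served (q : Quad i j k l) (t : Fin 5) (ht : t = 0 ∨ t = i) {z : K} (hz : z ∈ P.X t)
    (h1 : z ∈ P.X j ∨ P.conf z j c k ∨ P.conf z j d l)
    (h2 : z ∈ P.X k ∨ P.conf z k b j ∨ P.conf z k d l)
    (h3 : z ∈ P.X l ∨ P.conf z l b j ∨ P.conf z l c k) : 1 ≤ P.wt z := by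
  obtain ⟨s, m, u⟩ := P.rules
  have : 1 ≤ ind (P.X 0) z + ind (P.X i) z := by
    have h1 := ind_nonneg (P.X 0) z
    have h2 := ind_nonneg (P.X i) z
    rcases ht with rfl | rfl <;> rw [ind_of_mem hz] <;> omega
  have : 2 ≤ ind (P.X j) z + ind (P.X k) z + ind (P.X l) z := by
    obtain ⟨q1, q2, q3, q4, q5, q6, q7, q8, q9, q10⟩ := q
    simp only [ind]
    grind
  rw [wt_eq q]
  omega

set_option maxHeartbeats 1600000 in
/-- The bound for a palette with an assignment `f`, none of which can be completed by a colour `g`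
for an additional edge between `x 0` and `x 1`. By `hF`, a colour `g` missing at both ends fails
only if it is one of the other three colours `f k`, and the colour at `0` or at `1` occurs at the
other end of the additional edge and at `x k`. -/
theorem sum_nonneg_of_final (hdis : ∀ x, x ∈ P.X 0 → x ∉ P.X 1)
    (hF : ∀ f, P.IsAssignment f → ∀ g, g ∉ P.X 0 → g ∉ P.X 1 → g ≠ f 0 → g ≠ f 1 →
      ∃ k, k ≠ 0 ∧ k ≠ 1 ∧ g = f k ∧
        (f 0 ∈ P.X 1 ∧ f 0 ∈ P.X k ∨ f 1 ∈ P.X 0 ∧ f 1 ∈ P.X k))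
    {f : Fin 5 → K} (hf : P.IsAssignment f)
    (hO : 4 + e ≤ (P.X 0 ∪ P.X 1)ᶜ.card) (h0 : 3 ≤ (P.X 0).card + e)
    (h1 : (P.X 1).card + (P.X 0 ∪ P.X 1)ᶜ.card = Δ + 2 + e) (hΔ : 5 ≤ Δ) : 0 ≤ ∑ x, P.wt x := by
  have hF' : ∀ {i j k l x a b c d}, P.Fits i j k l a b c d → i = 1 → x ∉ P.X 0 → x ≠ a → x ≠ b →
      x ≠ c → x ≠ d → ¬ P.conf x 0 a i → ¬ P.conf x 0 b j → ¬ P.conf x 0 c k → ¬ P.conf x 0 d l →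
      ∀ g, g ∉ P.X 0 → g ∉ P.X 1 → g ≠ x → g ≠ a →
      (g = b ∧ (x ∈ P.X 1 ∧ x ∈ P.X j ∨ a ∈ P.X 0 ∧ a ∈ P.X j)) ∨
      (g = c ∧ (x ∈ P.X 1 ∧ x ∈ P.X k ∨ a ∈ P.X 0 ∧ a ∈ P.X k)) ∨
      (g = d ∧ (x ∈ P.X 1 ∧ x ∈ P.X l ∨ a ∈ P.X 0 ∧ a ∈ P.X l)) := by
    intro i j k l x a b c d h hi hx xa xb xc xd ca cb cc cd g g0 g1 gx ga
    subst hi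
    obtain ⟨f, hf, f0, fi, fj, fk, fl⟩ := h.exists_assignment hx xa xb xc xd ca cb cc cd
    obtain ⟨t, ht0, ht1, hg, ht⟩ := hF f hf g g0 g1 (f0 ▸ gx) (fi ▸ ga)
    rw [f0, fi] at ht
    rcases h.q.eq_or t with rfl | rfl | rfl | rfl | rfl
    · exact (ht0 rfl).elim
    · exact (ht1 rfl).elim
    · exact Or.inl ⟨fj ▸ hg, ht⟩
    · exact Or.inr (Or.inl ⟨fk ▸ hg, ht⟩)
    · exact Or.inr (Or.inr ⟨fl ▸ hg, ht⟩)
  clear hF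
  obtain ⟨s, m, u⟩ := P.rules
  have q := quad1234
  have h := hf.fits q
  -- Only the five colours and the conditions `hF'` are needed from the assignment.
  obtain ⟨x, hx⟩ : ∃ x, x = f 0 := ⟨_, rfl⟩
  obtain ⟨a, ha⟩ : ∃ x, x = f 1 := ⟨_, rfl⟩
  obtain ⟨b, hb⟩ : ∃ x, x = f 2 := ⟨_, rfl⟩
  obtain ⟨c, hc⟩ : ∃ x, x = f 3 := ⟨_, rfl⟩
  obtain ⟨d, hd⟩ : ∃ x, x = f 4 := ⟨_, rfl⟩
  have x0 : x ∉ P.X 0 := hx ▸ hf.2.1 0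
  have xa : x ≠ a := by rw [hx, ha]; exact hf.1.ne (by decide)
  have xb : x ≠ b := by rw [hx, hb]; exact hf.1.ne (by decide)
  have xc : x ≠ c := by rw [hx, hc]; exact hf.1.ne (by decide)
  have xd : x ≠ d := by rw [hx, hd]; exact hf.1.ne (by decide)
  have ca : ¬ P.conf x 0 a 1 := by rw [hx, ha]; exact hf.2.2 _ _
  have cb : ¬ P.conf x 0 b 2 := by rw [hx, hb]; exact hf.2.2 _ _
  have cc : ¬ P.conf x 0 c 3 := by rw [hx, hc]; exact hf.2.2 _ _
  have cd : ¬ P.conf x 0 d 4 := by rw [hx, hd]; exact hf.2.2 _ _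
  rw [← ha, ← hb, ← hc, ← hd] at h
  clear hx ha hb hc hd hf f
  have hg := hF' h rfl x0 xa xb xc xd ca cb cc cd
  have mO : ∀ y, y ∈ (P.X 0 ∪ P.X 1)ᶜ ↔ y ∉ P.X 0 ∧ y ∉ P.X 1 := by simp
  have card3 : ¬ (P.X 0 ∪ P.X 1)ᶜ ⊆ {b, c, d} := by
    intro hh
    have := Finset.card_le_card hh
    have := Finset.card_le_three (a := b) (b := c) (c := d)
    omega
  have card2 : ¬ (P.X 0 ∪ P.X 1)ᶜ ⊆ {x, a} := by
    intro hh
    have := Finset.card_le_card hh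
    have := Finset.card_le_two (a := x) (b := a)
    omega
  have card4 : ∀ y, (P.X 0 ∪ P.X 1)ᶜ ⊆ {y, b, c, d} → e = 0 ∧ (P.X 0 ∪ P.X 1)ᶜ = {y, b, c, d} := by
    intro y hh
    have := Finset.card_le_card hh
    have := Finset.card_le_four (a := y) (b := b) (c := c) (d := d)
    refine ⟨by omega, Finset.eq_of_subset_of_card_le hh (by omega)⟩
  have hbd : b ≠ c ∧ b ≠ d ∧ c ≠ d ∧ a ≠ b ∧ a ≠ c ∧ a ≠ d := ⟨h.bc, h.bd, h.cd, h.ab, h.ac, h.ad⟩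
  -- If `f 0 ∈ X 1` and `f 1 ∈ X 0`, then the colours outside `X 0 ∪ X 1` are among `b, c, d`, which
  -- is too few; so just one of the two holds, and there are exactly four such colours.
  by_cases hx1 : x ∈ P.X 1
  · by_cases ha0 : a ∈ P.X 0
    · refine (card3 fun y hy => ?_).elim
      have hy' := (mO y).1 hy
      have := hg y hy'.1 hy'.2 (by rintro rfl; exact hy'.2 hx1) (by rintro rfl; exact hy'.1 ha0)
      simp only [Finset.mem_insert, Finset.mem_singleton]; tauto
    have hsub : (P.X 0 ∪ P.X 1)ᶜ ⊆ {a, b, c, d} := by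
      intro y hy
      have hy' := (mO y).1 hy
      have := hg y hy'.1 hy'.2 (by rintro rfl; exact hy'.2 hx1)
      simp only [Finset.mem_insert, Finset.mem_singleton]; tauto
    obtain ⟨e0, hO'⟩ := card4 a hsub
    have mO' : ∀ y, y = a ∨ y = b ∨ y = c ∨ y = d → y ∉ P.X 0 ∧ y ∉ P.X 1 := by
      intro y; rw [← mO, hO']; simp
    have ma := mO' a (by simp)
    have mb := mO' b (by simp)
    have mc := mO' c (by simp)
    have md := mO' d (by simp)
    -- Each colour of `X 1` can replace `x` at `0`.
    have w1 : ∀ z, z ∈ P.X 1 → z ∈ P.X 2 ∧ z ∈ P.X 3 ∧ z ∈ P.X 4 := by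
      intro z hz
      have hz0 : z ∉ P.X 0 := fun hh => hdis z hh hz
      have nz : ∀ y, y ∉ P.X 1 → z ≠ y := fun y hy e => hy (e ▸ hz)
      have nc : ∀ y t, y ∉ P.X 0 → ¬ P.conf z 0 y t := fun y t hy hh => hy (conf_mem' hh)
      have := hF' (x := z) h rfl hz0 (nz _ ma.2) (nz _ mb.2) (nz _ mc.2) (nz _ md.2) (nc _ _ ma.1)
        (nc _ _ mb.1) (nc _ _ mc.1) (nc _ _ md.1)
      have h1 := this b mb.1 mb.2 (nz _ mb.2).symm h.ab.symm
      have h2 := this c mc.1 mc.2 (nz _ mc.2).symm h.ac.symm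
      have h3 := this d md.1 md.2 (nz _ md.2).symm h.ad.symm
      have e1 := h.bc
      have e2 := h.bd
      have e3 := h.cd
      clear hF' hg this nz nc mO' mO card2 card3 card4
      refine ⟨?_, ?_, ?_⟩
      · clear h2 h3; tauto
      · have e1 := e1.symm; clear h1 h3; tauto
      · have e2 := e2.symm; have e3 := e3.symm; clear h1 h2; tauto
    -- A colour of `X 0` that can replace `b` at `j` leaves `b` for the index `0`, and then `c` is
    -- available for the extra edge.
    have w0 : ∀ {j k l b c d}, P.Fits 1 j k l a b c d → b ∉ P.X 0 ∧ b ∉ P.X 1 →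
        c ∉ P.X 0 ∧ c ∉ P.X 1 → d ∉ P.X 0 ∧ d ∉ P.X 1 →
        ∀ z, z ∈ P.X 0 → z ∈ P.X j ∨ P.conf z j c k ∨ P.conf z j d l := by
      intro j k l b c d h hb hc hd z hz
      have nz : ∀ y, y ∉ P.X 0 → z ≠ y := fun y hy e => hy (e ▸ hz)
      have f := h.swap12.replace_first (nz _ ma.1) (nz _ hc.1) (nz _ hd.1)
      by_contra hn
      have f : P.Fits j 1 k l z a c d := by
        have : ¬ P.conf z j a 1 := fun hh => hdis z hz (P.conf_mem hh)
        tauto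
      have h2 := h.bj
      have h5 := h.cd
      have := hF' f.swap12 rfl hb.1 h.ab.symm (nz _ hb.1).symm h.bc h.bd
        (fun hh => ma.1 (conf_mem' hh)) (fun hh => h.bj (P.conf_mem hh))
        (fun hh => hc.1 (conf_mem' hh)) (fun hh => hd.1 (conf_mem' hh)) c hc.1 hc.2 h.bc.symm
        h.ac.symm
      have h6 := (nz _ hc.1).symm
      clear hF' hg nz mO' mO card2 card3 card4
      tauto
    have h2 := Finset.card_le_card hsub
    have h3 := Finset.card_le_four (a := a) (b := b) (c := c) (d := d)
    refine sum_nonneg_of_cover hdis (by omega) (by omega) a hsub (fun z hz => ?_) (fun z hz => ?_)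
      (Or.inr fun z hz => ?_)
    · exact wt_of_served q 0 (Or.inl rfl) hz (w0 h mb mc md z hz) (w0 h.swap23 mc mb md z hz)
        (w0 h.swap34.swap23 md mb mc z hz)
    all_goals
      have := w1 z hz
      rw [wt_eq q]
      have h0 := ind_nonneg (P.X 0) z
      rw [ind_of_mem this.1, ind_of_mem this.2.1, ind_of_mem this.2.2, ind_of_mem hz]
      omega
  · have ha0 : a ∈ P.X 0 := by
      by_contra ha0
      refine card2 fun y hy => ?_
      have hy' := (mO y).1 hy
      have := hg y hy'.1 hy'.2
      simp only [Finset.mem_insert, Finset.mem_singleton]; tauto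
    have hsub : (P.X 0 ∪ P.X 1)ᶜ ⊆ {x, b, c, d} := by
      intro y hy
      have hy' := (mO y).1 hy
      have h1 : y ≠ a := by rintro rfl; exact hy'.1 ha0
      have := fun hx => hg y hy'.1 hy'.2 hx h1
      simp only [Finset.mem_insert, Finset.mem_singleton]; tauto
    obtain ⟨e0, hO'⟩ := card4 x hsub
    have mO' : ∀ y, y = x ∨ y = b ∨ y = c ∨ y = d → y ∉ P.X 0 ∧ y ∉ P.X 1 := by
      intro y; rw [← mO, hO']; simp
    have mb := mO' b (by simp)
    have mc := mO' c (by simp)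
    have md := mO' d (by simp)
    -- Each colour of `X 0` can replace `a` at `1`.
    have w1 : ∀ z, z ∈ P.X 0 → z ∈ P.X 2 ∧ z ∈ P.X 3 ∧ z ∈ P.X 4 := by
      intro z hz
      have hz0 : z ∉ P.X 1 := hdis z hz
      have nz : ∀ y, y ∉ P.X 0 → z ≠ y := fun y hy e => hy (e ▸ hz)
      have nc : ∀ y t, y ∉ P.X 1 → ¬ P.conf z 1 y t := fun y t hy hh => hy (conf_mem' hh)
      have f : P.Fits 1 2 3 4 z b c d := ⟨q, hz0, h.bj, h.ck, h.dl, nz _ mb.1, nz _ mc.1,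
        nz _ md.1, h.bc, h.bd, h.cd, nc _ _ mb.2, nc _ _ mc.2, nc _ _ md.2, h.hbc, h.hbd, h.hcd⟩
      have := hF' f rfl x0 (nz _ x0).symm xb xc xd (fun hh => hx1 (P.conf_mem hh)) cb cc cd
      have h1 := this b mb.1 mb.2 xb.symm (nz _ mb.1).symm
      have h2 := this c mc.1 mc.2 xc.symm (nz _ mc.1).symm
      have h3 := this d md.1 md.2 xd.symm (nz _ md.1).symm
      have e1 := h.bc
      have e2 := h.bd
      have e3 := h.cd
      clear hF' hg this nz nc mO' mO card2 card3 card4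
      refine ⟨?_, ?_, ?_⟩
      · clear h2 h3; tauto
      · have e1 := e1.symm; clear h1 h3; tauto
      · have e2 := e2.symm; have e3 := e3.symm; clear h1 h2; tauto
    have w0 : ∀ {j k l b c d}, P.Fits 1 j k l a b c d → b ∉ P.X 0 ∧ b ∉ P.X 1 →
        c ∉ P.X 0 ∧ c ∉ P.X 1 → d ∉ P.X 0 ∧ d ∉ P.X 1 → x ≠ b → x ≠ c → x ≠ d →
        ∀ z, z ∈ P.X 1 → z ∈ P.X j ∨ P.conf z j c k ∨ P.conf z j d l := by
      intro j k l b c d h hb hc hd xb xc xd z hz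
      have hz0 : z ∉ P.X 0 := fun hh => hdis z hh hz
      have nz : ∀ y, y ∉ P.X 1 → z ≠ y := fun y hy e => hy (e ▸ hz)
      by_contra hn
      push Not at hn
      have f : P.Fits 1 j k l b z c d := ⟨h.q, hb.2, hn.1, h.ck, h.dl, (nz _ hb.2).symm, h.bc, h.bd,
        nz _ hc.2, nz _ hd.2, h.cd, fun hh => h.bj (P.conf_mem hh), fun hh => hc.2 (conf_mem' hh),
        fun hh => hd.2 (conf_mem' hh), hn.2.1, hn.2.2, h.hcd⟩
      have := hF' f rfl x0 xb (nz _ hx1).symm xc xd (fun hh => hb.1 (conf_mem' hh))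
        (fun hh => hz0 (conf_mem' hh)) (fun hh => hc.1 (conf_mem' hh))
        (fun hh => hd.1 (conf_mem' hh)) c hc.1 hc.2 xc.symm h.bc.symm
      have h6 := (nz _ hc.2).symm
      have h5 := h.cd
      clear hF' hg nz mO' mO card2 card3 card4
      tauto
    have h2 := Finset.card_le_card hsub
    have h3 := Finset.card_le_four (a := x) (b := b) (c := c) (d := d)
    refine sum_nonneg_of_cover hdis (by omega) (by omega) x hsub (fun z hz => ?_) (fun z hz => ?_)
      (Or.inl fun z hz => ?_)
    · have := w1 z hz
      rw [wt_eq q]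
      have h0 := ind_nonneg (P.X 1) z
      rw [ind_of_mem this.1, ind_of_mem this.2.1, ind_of_mem this.2.2, ind_of_mem hz]
      omega
    · exact wt_of_served q 1 (Or.inr rfl) hz (w0 h mb mc md xb xc xd z hz)
        (w0 h.swap23 mc mb md xc xb xd z hz) (w0 h.swap34.swap23 md mb mc xd xb xc z hz)
    · have := w1 z hz
      rw [wt_eq q]
      have h0 := ind_nonneg (P.X 1) z
      rw [ind_of_mem this.1, ind_of_mem this.2.1, ind_of_mem this.2.2, ind_of_mem hz]
      omega
end Stuck
end Palette

end

/-! ### Linked palettes -/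

section

namespace Palette
variable {K : Type*} {P : Palette K} {i j k l : Fin 5} {a b c d : K}
variable [DecidableEq K] [Fintype K]

/-- A lower bound for the sum of the weights: `T` consists of free colours of positive weight, `E`
of the exceptional free colours, and `G` of used colours whose weights are to be counted. -/
theorem sum_bound (T E G : Finset K) (hT : ∀ x ∈ T, x ∉ P.X 0 ∧ x ∉ E ∧ 1 ≤ P.wt x)
    (hE : ∀ x ∈ E, x ∉ P.X 0) (h : ∀ x, x ∉ P.X 0 → x ∉ E → 0 ≤ P.wt x)
    (hG : ∀ x ∈ G, x ∈ P.X 0 ∧ ¬ P.Wild x) :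
    (T.card : ℤ) - P.wild.card + ∑ x ∈ G, P.wt x + ∑ x ∈ E, P.wt x ≤ ∑ x, P.wt x := by
  have : (T.card : ℤ) - P.wild.card + ∑ x ∈ G, P.wt x + ∑ x ∈ E, P.wt x =
      ∑ x, (ind T x - ind P.wild x + (if x ∈ G then P.wt x else 0) +
        (if x ∈ E then P.wt x else 0)) := by
    simp [Finset.sum_add_distrib, Finset.sum_sub_distrib, sum_ind]
  rw [this]
  refine Finset.sum_le_sum fun x _ => ?_
  by_cases x0 : x ∈ P.X 0
  · have k5 := wt_of_mem' x x0
    have hT : ind T x = 0 := ind_of_notMem fun hh => (hT x hh).1 x0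
    have hE : x ∉ E := fun hh => hE x hh x0
    rw [hT, if_neg hE]
    by_cases hg : x ∈ G
    · rw [ind_of_notMem fun hh => (hG x hg).2 (mem_wild.1 hh), if_pos hg]; omega
    · rw [if_neg hg]; omega
  · have hw : ind P.wild x = 0 := ind_of_notMem fun hh => x0 (mem_wild.1 hh).1
    have hG : x ∉ G := fun hh => x0 (hG x hh).1
    rw [hw, if_neg hG]
    by_cases hE' : x ∈ E
    · rw [if_pos hE', ind_of_notMem fun hh => (hT x hh).2.1 hE']; omega
    · have h2 := h x x0 hE'
      rw [if_neg hE']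
      by_cases hT' : x ∈ T
      · have := (hT x hT').2.2
        rw [ind_of_mem hT']; omega
      · rw [ind_of_notMem hT']; omega

/-- The palette of a colouring of `G - u` in which the adjacent vertices `x 0` and `x 1` have a
second colour `r` in common, besides the colour `g` of the edge between them. Here `Δ` is the
maximum degree and `Δ + e + deg (x 0)` is the number of colours; `cap` bounds the degree of `x 1`.
By `gc1` and `gc0`, a conflict of `g` with a colour at one end of the edge `x 0 - x 1` puts this
colour at the other end, because a path coloured with two colours has only two ends. -/
structure Linked (P : Palette K) (Δ e : ℕ) (g r : K) : Prop where
  stuck : P.Stuck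
  hA : (P.X 0)ᶜ.card = Δ + e + 1
  hX : ∀ t, t ≠ 0 → (P.X t).card + 1 ≤ Δ
  cap : (P.X 1).card ≤ 5 + min e 1
  hΔ : 5 ≤ Δ
  h0 : 4 ≤ (P.X 0).card + e
  gr : g ≠ r
  g0 : g ∈ P.X 0
  g1 : g ∈ P.X 1
  r0 : r ∈ P.X 0
  r1 : r ∈ P.X 1
  gc1 : ∀ t x, t ≠ 0 → t ≠ 1 → P.conf g t x 1 → x ∈ P.X 0
  gc0 : ∀ t x, t ≠ 0 → t ≠ 1 → P.conf g t x 0 → x ∈ P.X 1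

variable {Δ e : ℕ} {g r : K}

namespace Linked

theorem card_sdiff (H : P.Linked Δ e g r) (t : Fin 5) (ht : t ≠ 0) :
    e + 2 ≤ ((P.X 0)ᶜ \ P.X t).card := by
  have h1 := Finset.le_card_sdiff (P.X t) (P.X 0)ᶜ
  have := H.hX t ht
  have := H.hA
  omega

theorem card_inter (H : P.Linked Δ e g r) : ((P.X 0)ᶜ ∩ P.X 1).card + 2 ≤ (P.X 1).card := by
  have h1 : (P.X 0)ᶜ ∩ P.X 1 ⊆ P.X 1 \ {g, r} := by
    intro x hx
    simp only [Finset.mem_inter, Finset.mem_compl] at hx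
    simp only [Finset.mem_sdiff, Finset.mem_insert, Finset.mem_singleton]
    refine ⟨hx.2, ?_⟩
    rintro (rfl | rfl)
    · exact hx.1 H.g0
    · exact hx.1 H.r0
  have h2 := Finset.card_le_card h1
  have h3 : ({g, r} : Finset K) ⊆ P.X 1 := by
    intro x; simp; rintro (rfl | rfl); exacts [H.g1, H.r1]
  rw [Finset.card_sdiff_of_subset h3, Finset.card_pair H.gr] at h2
  have := Finset.card_le_card h3
  rw [Finset.card_pair H.gr] at this
  omega

/-- Many free colours are missing at `1`, since `X 1` is small and contains `g` and `r`. -/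
theorem card_sdiff_one (H : P.Linked Δ e g r) : Δ + e + 1 ≤
    ((P.X 0)ᶜ \ P.X 1).card + (Δ - 3) ∧ Δ + e + 1 ≤ ((P.X 0)ᶜ \ P.X 1).card + 3 + min e 1 := by
  have h1 := Finset.card_sdiff_add_card_inter (P.X 0)ᶜ (P.X 1)
  have h2 := H.card_inter
  have := H.hA
  have := H.cap
  have := H.hX 1 (by decide)
  omega

theorem exists_notMem (H : P.Linked Δ e g r) (t : Fin 5) (ht : t ≠ 0) (x : K) :
    ∃ y, y ∉ P.X 0 ∧ y ∉ P.X t ∧ y ≠ x := by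
  have h1 := H.card_sdiff t ht
  by_contra hn
  push Not at hn
  have h2 : (P.X 0)ᶜ \ P.X t ⊆ {x} := by
    intro y hy
    simp only [Finset.mem_sdiff, Finset.mem_compl] at hy
    simpa using hn y hy.1 hy.2
  have := Finset.card_le_card h2
  simp at this
  omega

theorem exists_notMem_one (H : P.Linked Δ e g r) (s : Finset K) (hs : s.card ≤ 3) :
    ∃ y, y ∉ P.X 0 ∧ y ∉ P.X 1 ∧ y ∉ s := by
  have h1 := H.card_sdiff_one
  have := H.hΔ
  by_contra hn
  push Not at hn
  have h2 : (P.X 0)ᶜ \ P.X 1 ⊆ s := by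
    intro y hy
    simp only [Finset.mem_sdiff, Finset.mem_compl] at hy
    exact hn y hy.1 hy.2
  have := Finset.card_le_card h2
  omega

theorem wild_le (H : P.Linked Δ e g r) : P.wild.card ≤ 2 :=
  card_wild_le H.stuck fun t ht x => H.exists_notMem t ht x

theorem not_wild_g (H : P.Linked Δ e g r) : ¬ P.Wild g := fun h => h.2 1 (by decide) H.g1
theorem not_wild_r (H : P.Linked Δ e g r) : ¬ P.Wild r := fun h => h.2 1 (by decide) H.r1

theorem wt_nonneg_g (H : P.Linked Δ e g r) : 0 ≤ P.wt g := by
  have := wt_of_mem' g H.g0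
  rwa [ind_of_notMem (by simpa [mem_wild] using H.not_wild_g), neg_zero] at this
theorem wt_nonneg_r (H : P.Linked Δ e g r) : 0 ≤ P.wt r := by
  have := wt_of_mem' r H.r0
  rwa [ind_of_notMem (by simpa [mem_wild] using H.not_wild_r), neg_zero] at this

/-- The form of `sum_bound` in which the colours `g` and `r` are counted separately. -/
theorem bound (H : P.Linked Δ e g r) (T E : Finset K)
    (hT : ∀ x ∈ T, x ∉ P.X 0 ∧ x ∉ E ∧ 1 ≤ P.wt x)
    (hE : ∀ x ∈ E, x ∉ P.X 0) (h : ∀ x, x ∉ P.X 0 → x ∉ E → 0 ≤ P.wt x) :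
    (T.card : ℤ) - P.wild.card + P.wt g + P.wt r + ∑ x ∈ E, P.wt x ≤ ∑ x, P.wt x := by
  have := sum_bound T E {g, r} hT hE h (by
    intro x hx
    simp only [Finset.mem_insert, Finset.mem_singleton] at hx
    rcases hx with rfl | rfl
    exacts [⟨H.g0, H.not_wild_g⟩, ⟨H.r0, H.not_wild_r⟩])
  rw [Finset.sum_pair H.gr] at this
  linarith

theorem notMem_of_wt (q : Quad 1 i j k) {x : K} (h0 : x ∈ P.X 0) (h1 : x ∈ P.X 1)
    (h : P.wt x ≤ 0) : x ∉ P.X i ∧ x ∉ P.X j ∧ x ∉ P.X k := by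
  rw [wt_eq q, ind_of_mem h0, ind_of_mem h1] at h
  have k1 := ind_nonneg (P.X i) x
  have k2 := ind_nonneg (P.X j) x
  have k3 := ind_nonneg (P.X k) x
  refine ⟨?_, ?_, ?_⟩ <;> intro hh <;> rw [ind_of_mem hh] at h <;> omega

/-- The bound when every fitting quadruple consists of used colours. -/
theorem sum_of_four (H : P.Linked Δ e g r) (h : P.Fits i j k l a b c d)
    (hmin : ∀ {i j k l a b c d}, P.Fits i j k l a b c d → a ∈ P.X 0) : 2 ≤ ∑ x, P.wt x := by
  have h1 := H.bound (P.X 0)ᶜ ∅ (by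
    intro x hx
    have := wt_of_four H.stuck h hmin (x := x) (by simpa using hx)
    simp at hx
    simp [hx, this]) (by simp) (by
    intro x hx _
    have := wt_of_four H.stuck h hmin (x := x) hx
    omega)
  have := H.wild_le
  have := H.hA
  have := H.hΔ
  have := H.wt_nonneg_g
  have := H.wt_nonneg_r
  simp only [Finset.sum_empty] at h1
  omega

section Three

variable (H : P.Linked Δ e g r)
  (hmin : ∀ {i j k l a b c d}, P.Fits i j k l a b c d → a ∈ P.X 0 ∨ b ∈ P.X 0)

include hmin in
theorem used_three (h : P.Fits i j k l a b c d) (hd : d ∉ P.X 0) :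
    a ∈ P.X 0 ∧ b ∈ P.X 0 ∧ c ∈ P.X 0 := by
  have h1 := hmin h.swap34.swap23
  have h2 := hmin h.swap34.swap23.swap12.swap23
  have h3 := hmin h.swap23.swap12.swap34.swap23
  tauto

include H hmin in
/-- The bound for three used colours when the free colour `d` cannot be exchanged: then no free
colour other than `d` can replace a colour of the quadruple. -/
theorem sum_of_three_rigid (h : P.Fits i j k l a b c d) (hd : d ∉ P.X 0)
    (hl : ∀ x, x ∉ P.X 0 → x ≠ d → ¬ P.Fits i j k l a b c x) : 2 ≤ ∑ x, P.wt x := by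
  have q := h.q
  obtain ⟨ha, hb, hc⟩ := used_three hmin h hd
  have hserve : ∀ x, x ∉ P.X 0 → x ≠ d →
      (x ∈ P.X i ∨ P.conf x i b j ∨ P.conf x i c k ∨ P.conf x i d l) ∧
      (x ∈ P.X j ∨ P.conf x j a i ∨ P.conf x j c k ∨ P.conf x j d l) ∧
      (x ∈ P.X k ∨ P.conf x k a i ∨ P.conf x k b j ∨ P.conf x k d l) ∧
      (x ∈ P.X l ∨ P.conf x l a i ∨ P.conf x l b j ∨ P.conf x l c k) ∧ 1 ≤ P.wt x := by
    intro x hx hxd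
    have na := (ne_of_mem_of_not_mem ha hx).symm
    have nb := (ne_of_mem_of_not_mem hb hx).symm
    have nc := (ne_of_mem_of_not_mem hc hx).symm
    have hh : ∀ {p q : Prop}, p ∨ q → ¬ p → ¬ q → False := fun h hp hq => h.elim hp hq
    have e4 := h.swap34.swap23.swap12.served na nb nc
      fun hh => hl x hx hxd hh.swap12.swap23.swap34
    obtain ⟨w0, w1, w2⟩ := wt_of_three H.stuck h hmin hd hx hxd
    exact ⟨h.served nb nc hxd fun f => hh (hmin f.swap34.swap23) hx hd,
      h.swap12.served na nc hxd fun f => hh (hmin f.swap34.swap23) hx hd,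
      h.swap23.swap12.served na nb hxd fun f => hh (hmin f.swap34.swap23) hx hd,
      e4, e4.elim w1 w2⟩
  -- At each index some free colour other than `d` is missing, hence conflicts there with one of
  -- `a, b, c, d`; so each of the four sets contains one of these colours.
  obtain ⟨y1, z1, z1', z1''⟩ := H.exists_notMem i q.i0 d
  obtain ⟨y2, z2, z2', z2''⟩ := H.exists_notMem j q.j0 d
  obtain ⟨y3, z3, z3', z3''⟩ := H.exists_notMem k q.k0 d
  obtain ⟨y4, z4, z4', z4''⟩ := H.exists_notMem l q.l0 d
  have s1 := (hserve y1 z1 z1'').1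
  have s2 := (hserve y2 z2 z2'').2.1
  have s3 := (hserve y3 z3 z3'').2.2.1
  have s4 := (hserve y4 z4 z4'').2.2.2.1
  have hm := fun a i b j => @conf_mem' K P i j a b
  have t1 : 1 ≤ ind (P.X i) b + ind (P.X i) c + ind (P.X i) d := by simp only [ind]; grind
  have t2 : 1 ≤ ind (P.X j) a + ind (P.X j) c + ind (P.X j) d := by simp only [ind]; grind
  have t3 : 1 ≤ ind (P.X k) a + ind (P.X k) b + ind (P.X k) d := by simp only [ind]; grind
  have t4 : 1 ≤ ind (P.X l) a + ind (P.X l) b + ind (P.X l) c := by simp only [ind]; grind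
  have hs : -1 ≤ P.wt a + P.wt b + P.wt c + P.wt d := by
    simp only [wt_eq q, ind_of_mem ha, ind_of_mem hb, ind_of_mem hc, ind_of_notMem hd]
    have := ind_nonneg (P.X i) a
    have := ind_nonneg (P.X j) b
    have := ind_nonneg (P.X k) c
    have := ind_nonneg (P.X l) d
    omega
  have h1 := sum_ge P.wt [(1, (P.X 0)ᶜ \ {d}), (-1, P.wild), (P.wt a, {a}), (P.wt b, {b}),
      (P.wt c, {c}), (P.wt d, {d})] (by
    intro x
    have := h.ab
    have := h.ac
    have := h.ad
    have := h.bc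
    have := h.bd
    have := h.cd
    have k0 := hserve x
    have k5 := wt_of_mem' (P := P) x
    have k7 := ind_nonneg P.wild x
    clear hserve hmin hl hm s1 s2 s3 s4 t1 t2 t3 t4
    by_cases hx : x ∈ P.X 0
    · have k5 := k5 hx
      have hxd : x ≠ d := ne_of_mem_of_not_mem hx hd
      simp only [List.map_cons, List.map_nil, List.sum_cons, List.sum_nil]
      generalize ind P.wild x = W at *
      by_cases x = a
      · simp_all [ind]
      by_cases x = b
      · simp_all [ind]
      by_cases x = c
      · simp_all [ind]
      simp_all [ind]
    · have : ind P.wild x = 0 := ind_of_notMem fun hh => hx (mem_wild.1 hh).1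
      have na := (ne_of_mem_of_not_mem ha hx).symm
      have nb := (ne_of_mem_of_not_mem hb hx).symm
      have nc := (ne_of_mem_of_not_mem hc hx).symm
      by_cases hxd : x = d
      · simp_all [ind]
      · have := (k0 hx hxd).2.2.2.2
        simp_all [ind])
  simp only [List.map_cons, List.map_nil, List.sum_cons, List.sum_nil, Finset.card_singleton] at h1
  have h2 := Finset.le_card_sdiff ({d} : Finset K) (P.X 0)ᶜ
  rw [Finset.card_singleton, H.hA] at h2
  have := H.wild_le
  have := H.hΔ
  omega
end Three

end Linked
end Palette

end

/-! ### Linked palettes: three used colours -/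

section

namespace Palette
variable {K : Type*} {P : Palette K} {i j k l : Fin 5} {a b c d : K}
variable [DecidableEq K] [Fintype K]

theorem Fits.set_wild (h : P.Fits i j k l a b c d) {x : K} (hx : P.Wild x) (xb : x ≠ b)
    (xc : x ≠ c) (xd : x ≠ d) : P.Fits i j k l x b c d :=
  ⟨h.q, hx.2 i h.q.i0, h.bj, h.ck, h.dl, xb, xc, xd, h.bc, h.bd, h.cd,
    fun hh => hx.2 _ h.q.j0 (P.conf_mem hh), fun hh => hx.2 _ h.q.k0 (P.conf_mem hh),
    fun hh => hx.2 _ h.q.l0 (P.conf_mem hh), h.hbc, h.hbd, h.hcd⟩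

variable {Δ e : ℕ} {g r : K}

namespace Linked

section Three

variable (H : P.Linked Δ e g r)
  (hmin : ∀ {i j k l a b c d}, P.Fits i j k l a b c d → a ∈ P.X 0 ∨ b ∈ P.X 0)

include H hmin in
/-- With three used colours, a free colour other than `d` conflicts at `0` with a used colour of the
quadruple, and cannot replace a used colour. -/
theorem served_three (h : P.Fits i j k l a b c d) (hd : d ∉ P.X 0) {x : K} (hx : x ∉ P.X 0)
    (hxd : x ≠ d) : 0 ≤ P.wt x ∧
      (P.conf x 0 a i ∨ P.conf x 0 b j ∨ P.conf x 0 c k) ∧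
      (x ∈ P.X i ∨ P.conf x i b j ∨ P.conf x i c k ∨ P.conf x i d l) ∧
      (x ∈ P.X j ∨ P.conf x j a i ∨ P.conf x j c k ∨ P.conf x j d l) ∧
      (x ∈ P.X k ∨ P.conf x k a i ∨ P.conf x k b j ∨ P.conf x k d l) := by
  obtain ⟨ha, hb, hc⟩ := used_three hmin h hd
  have na := (ne_of_mem_of_not_mem ha hx).symm
  have nb := (ne_of_mem_of_not_mem hb hx).symm
  have nc := (ne_of_mem_of_not_mem hc hx).symm
  have hh : ∀ {p q : Prop}, p ∨ q → ¬ p → ¬ q → False := fun h hp hq => h.elim hp hq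
  refine ⟨(wt_of_three H.stuck h hmin hd hx hxd).1, ?_,
    h.served nb nc hxd fun f => hh (hmin f.swap34.swap23) hx hd,
    h.swap12.served na nc hxd fun f => hh (hmin f.swap34.swap23) hx hd,
    h.swap23.swap12.served na nb hxd fun f => hh (hmin f.swap34.swap23) hx hd⟩
  rcases H.stuck.blocked h hx with h | h | h | h | h | h | h | h
  · exact (na h).elim
  · exact (nb h).elim
  · exact (nc h).elim
  · exact (hxd h).elim
  · exact Or.inl h
  · exact Or.inr (Or.inl h)
  · exact Or.inr (Or.inr h)
  · exact (hd (conf_mem' h)).elim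

include H hmin in
theorem wt_of_three_two_wild (h : P.Fits i j k l a b c d) (hd : d ∉ P.X 0) (ha : P.Wild a)
    (hb : P.Wild b) {x : K} (hx : x ∉ P.X 0) (hxd : x ≠ d) : 1 ≤ P.wt x := by
  have h0 := served_three H hmin h hd hx hxd
  obtain ⟨ua, ub, uc⟩ := used_three hmin h hd
  have q := h.q
  have f1 := fails (P := P) (i := i) (j := k) (k := j) (l := l) (a := x) (b := a) (c := b)
    (d := d) q.swap23 fun hh => (hmin hh.swap34.swap23).elim hx hd
  have f2 := fails (P := P) (i := j) (j := k) (k := i) (l := l) (a := x) (b := b) (c := a)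
    (d := d) q.swap12.swap23 fun hh => (hmin hh.swap34.swap23).elim hx hd
  obtain ⟨s, m, u⟩ := P.rules
  obtain ⟨-, ha⟩ := ha
  obtain ⟨-, hb⟩ := hb
  obtain ⟨q0, w1, w2, w3, w4, w5, w6, w7, w8, w9, w10, w11, w12, w13, w14, w15, w16⟩ := h
  rw [wt_eq q] at *
  obtain ⟨q1, q2, q3, q4, q5, q6, q7, q8, q9, q10⟩ := q
  clear hmin H
  simp only [ind] at *
  grind

include H hmin in
theorem wt_of_three_wild (h : P.Fits i j k l a b c d) (hd : d ∉ P.X 0) (ha : P.Wild a)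
    {x : K} (hx : x ∉ P.X 0) (hxi : x ∉ P.X i) (hxd : x ≠ d) : 1 ≤ P.wt x := by
  have h0 := served_three H hmin h hd hx hxd
  obtain ⟨ua, ub, uc⟩ := used_three hmin h hd
  have q := h.q
  have f1 := fails (P := P) (i := i) (j := k) (k := j) (l := l) (a := x) (b := a) (c := b)
    (d := d) q.swap23 fun hh => (hmin hh.swap34.swap23).elim hx hd
  have f2 := fails (P := P) (i := i) (j := j) (k := k) (l := l) (a := x) (b := a) (c := c)
    (d := d) q fun hh => (hmin hh.swap34.swap23).elim hx hd
  obtain ⟨s, m, u⟩ := P.rules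
  obtain ⟨-, ha⟩ := ha
  obtain ⟨q0, w1, w2, w3, w4, w5, w6, w7, w8, w9, w10, w11, w12, w13, w14, w15, w16⟩ := h
  rw [wt_eq q] at *
  obtain ⟨q1, q2, q3, q4, q5, q6, q7, q8, q9, q10⟩ := q
  clear hmin H
  simp only [ind] at *
  grind

include H hmin in
/-- If `g` is placed at an index other than `1` in a quadruple with three used colours whose free
colour is at `1`, all free colours but `d` have positive weight. -/
theorem wt_of_three_g (h : P.Fits i j k 1 g b c d) (hd : d ∉ P.X 0) (hgj : g ∉ P.X j)
    (hgk : g ∉ P.X k) {x : K} (hx : x ∉ P.X 0) (hxd : x ≠ d) : 1 ≤ P.wt x := by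
  have h0 := served_three H hmin h hd hx hxd
  obtain ⟨ua, ub, uc⟩ := used_three hmin h hd
  have q := h.q
  have f1 := fails (P := P) (i := i) (j := k) (k := j) (l := 1) (a := x) (b := g) (c := b)
    (d := d) q.swap23 fun hh => (hmin hh.swap34.swap23).elim hx hd
  have f2 := fails (P := P) (i := i) (j := j) (k := k) (l := 1) (a := x) (b := g) (c := c)
    (d := d) q fun hh => (hmin hh.swap34.swap23).elim hx hd
  have e1 := fun t => H.gc0 t x
  have e2 := fun t => H.gc1 t d
  obtain ⟨s, m, u⟩ := P.rules
  obtain ⟨q0, w1, w2, w3, w4, w5, w6, w7, w8, w9, w10, w11, w12, w13, w14, w15, w16⟩ := h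
  rw [wt_eq q] at *
  obtain ⟨q1, q2, q3, q4, q5, q6, q7, q8, q9, q10⟩ := q
  clear hmin H
  simp only [ind] at *
  grind

include H hmin in
/-- If `g` is placed at an index other than `1` in a quadruple with three used colours one of which
is at `1`, all free colours but `d` that are missing at `1` have positive weight. -/
theorem wt_of_three_g' (h : P.Fits 1 j k l a g c d) (hd : d ∉ P.X 0)
    {x : K} (hx : x ∉ P.X 0) (hx1 : x ∉ P.X 1) (hxd : x ≠ d) : 1 ≤ P.wt x := by
  have h0 := served_three H hmin h hd hx hxd
  obtain ⟨ua, ub, uc⟩ := used_three hmin h hd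
  have q := h.q
  have e1 := fun t => H.gc0 t x
  have e2 := fun t => H.gc1 t x
  obtain ⟨s, m, u⟩ := P.rules
  obtain ⟨q0, w1, w2, w3, w4, w5, w6, w7, w8, w9, w10, w11, w12, w13, w14, w15, w16⟩ := h
  rw [wt_eq q] at *
  obtain ⟨q1, q2, q3, q4, q5, q6, q7, q8, q9, q10⟩ := q
  clear hmin H
  simp only [ind] at *
  grind

include H hmin in
/-- For three used colours with the free colour at `1`, not all free colours other than `d` can have
nonpositive weight if `r` occurs in no set but `X 0` and `X 1` and is neither `b` nor `c`. -/
theorem three_tight (h : P.Fits i j k 1 a b c d) (hd : d ∉ P.X 0)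
    (hw : ∀ x, x ∉ P.X 0 → x ≠ d → P.wt x ≤ 0) (hr : ∀ t, t ≠ 0 → t ≠ 1 → r ∉ P.X t)
    (rb : r ≠ b) (rc : r ≠ c) : False := by
  have q := h.q
  obtain ⟨y, y0, yi, yd⟩ := H.exists_notMem i q.i0 d
  have key : ∀ {j k b c}, P.Fits i j k 1 a b c d → r ≠ b → r ≠ c → P.conf y 0 b j → False := by
    intro j k b c h rb rc hy
    have q := h.q
    obtain ⟨x, x0, xk, xd⟩ := H.exists_notMem k q.k0 d
    have h1 := served_three H hmin h hd y0 yd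
    have h2 := served_three H hmin h hd x0 xd
    have h3 := hw y y0 yd
    have h4 := hw x x0 xd
    obtain ⟨ua, ub, uc⟩ := used_three hmin h hd
    have f := fails (P := P) (i := i) (j := k) (k := j) (l := 1) (a := y) (b := r) (c := b)
      (d := x) q.swap23 fun hh => (hmin hh.swap34.swap23).elim y0 x0
    have r0 := H.r0
    obtain ⟨s, m, u⟩ := P.rules
    obtain ⟨q0, w1, w2, w3, w4, w5, w6, w7, w8, w9, w10, w11, w12, w13, w14, w15, w16⟩ := h
    rw [wt_eq q] at h1 h2 h3 h4
    obtain ⟨q1, q2, q3, q4, q5, q6, q7, q8, q9, q10⟩ := q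
    have := hr i q1 q7
    have := hr j q2 q9
    have := hr k q3 q10
    clear hmin H hw hr
    simp only [ind] at *
    grind
  have h1 := served_three H hmin h hd y0 yd
  rcases h1.2.1 with h2 | h2 | h2
  · exact yi (P.conf_mem h2)
  · exact key h rb rc h2
  · exact key h.swap23 rc rb h2

include H hmin in
/-- The analogue of `three_tight` for a used colour at `1` and `r` placed at another index. -/
theorem three_tight' (h : P.Fits 1 j k l a r c d) (hd : d ∉ P.X 0) (gc : g ≠ c) (ga : g ≠ a)
    (hw : ∀ x, x ∉ P.X 0 → x ≠ d → P.wt x ≤ 0) (hw0 : ∀ x, x ∈ P.X 0 → x ≠ g → P.wt x ≤ 0)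
    (hr : ∀ t, t ≠ 0 → t ≠ 1 → r ∉ P.X t) : False := by
  have q := h.q
  obtain ⟨y, y0, yk, yd⟩ := H.exists_notMem k q.k0 d
  obtain ⟨z, z0, zj, zd⟩ := H.exists_notMem j q.j0 d
  obtain ⟨x, x0, x1, xd⟩ := H.exists_notMem_one {d} (by simp)
  simp only [Finset.mem_singleton] at xd
  have h1 := served_three H hmin h hd y0 yd
  have h2 := served_three H hmin h hd z0 zd
  have h3 := served_three H hmin h hd x0 xd
  have h4 := hw y y0 yd
  have h5 := hw z z0 zd
  have h6 := hw x x0 xd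
  obtain ⟨ua, ub, uc⟩ := used_three hmin h hd
  have h7 := hw0 a ua ga.symm
  have h8 := hw0 c uc gc.symm
  have f := fails (P := P) (i := 1) (j := k) (k := j) (l := l) (a := x) (b := r) (c := a)
    (d := d) q.swap23 fun hh => (hmin hh.swap34.swap23).elim x0 hd
  have r0 := H.r0
  obtain ⟨s, m, u⟩ := P.rules
  obtain ⟨q0, w1, w2, w3, w4, w5, w6, w7, w8, w9, w10, w11, w12, w13, w14, w15, w16⟩ := h
  rw [wt_eq q] at h1 h2 h3 h4 h5 h6 h7 h8
  obtain ⟨q1, q2, q3, q4, q5, q6, q7, q8, q9, q10⟩ := q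
  have := hr j q2 q5.symm
  have := hr k q3 q6.symm
  have := hr l q4 q7.symm
  clear hmin H hw hr hw0
  simp only [ind] at *
  have k1 : a ∈ P.X k := by clear h2 h3 h5 h6 f; grind
  have k2 : a ∉ P.X j := by clear h1 h2 h3 h4 h5 h6 h8 f; grind
  have k3 : c ∈ P.X j := by clear h1 h3 h4 h6 h8 h7 f; grind
  have k4 : c ∉ P.X 1 := by clear h1 h2 h3 h4 h5 h6 h7 f; grind
  have k5 : P.conf x 1 r j := by clear h1 h2 h4 h5 h7 h8 f; grind
  have k6 : x ∉ P.X l := by clear h1 h2 h4 h5 h7 h8 f; grind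
  have k7 : a ∉ P.X l := by clear h1 h2 h3 h4 h5 h6 h8 f; grind
  clear h1 h2 h3 h4 h5 h6 h7 h8
  grind

end Three

end Linked
end Palette

end

section

namespace Palette
variable {K : Type*} {P : Palette K} {i j k l : Fin 5} {a b c d : K}
variable [DecidableEq K] [Fintype K]
variable {Δ e : ℕ} {g r : K}

namespace Linked

theorem bound_of_nonneg (H : P.Linked Δ e g r) (hw : ∀ x, x ∉ P.X 0 → 0 ≤ P.wt x) (T : Finset K)
    (hT : ∀ x ∈ T, x ∉ P.X 0 ∧ 1 ≤ P.wt x) :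
    (T.card : ℤ) - P.wild.card + P.wt g + P.wt r ≤ ∑ x, P.wt x := by
  have := H.bound T ∅ (fun x hx => ⟨(hT x hx).1, by simp, (hT x hx).2⟩) (by simp)
    fun x hx _ => hw x hx
  simpa using this

theorem card_erase (H : P.Linked Δ e g r) (d : K) : Δ + e ≤ ((P.X 0)ᶜ \ {d}).card := by
  have h2 := Finset.le_card_sdiff ({d} : Finset K) (P.X 0)ᶜ
  rw [Finset.card_singleton, H.hA] at h2
  omega

theorem card_sdiff_one_erase (H : P.Linked Δ e g r) (d : K) :
    3 + e ≤ (((P.X 0)ᶜ \ P.X 1) \ {d}).card := by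
  have h2 := Finset.le_card_sdiff ({d} : Finset K) ((P.X 0)ᶜ \ P.X 1)
  rw [Finset.card_singleton] at h2
  have := H.card_sdiff_one
  have := H.hΔ
  omega

section Three

variable (H : P.Linked Δ e g r)
  (hmin : ∀ {i j k l a b c d}, P.Fits i j k l a b c d → a ∈ P.X 0 ∨ b ∈ P.X 0)

include H hmin in
/-- The bound when every fitting quadruple has at least three used colours, and some has exactly
three. -/
theorem sum_of_three (h : P.Fits i j k l a b c d) (hd : d ∉ P.X 0) : 2 ≤ ∑ x, P.wt x := by
  by_cases hl : ∀ x, x ∉ P.X 0 → x ≠ d → ¬ P.Fits i j k l a b c x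
  · exact sum_of_three_rigid H hmin h hd hl
  push Not at hl
  obtain ⟨d', hd', hdd, h'⟩ := hl
  have hw : ∀ x, x ∉ P.X 0 → 0 ≤ P.wt x := by
    intro x hx
    by_cases hxd : x = d
    · exact (served_three H hmin h' hd' hx (by rw [hxd]; exact hdd.symm)).1
    · exact (served_three H hmin h hd hx hxd).1
  have hbd := H.bound_of_nonneg hw
  have hg0 := H.wt_nonneg_g
  have hr0 := H.wt_nonneg_r
  have hΔ := H.hΔ
  have hwl := H.wild_le
  obtain ⟨ua, ub, uc⟩ := used_three hmin h hd
  have all : (∀ x, x ∉ P.X 0 → x ≠ d → 1 ≤ P.wt x) → 2 ≤ ∑ x, P.wt x := by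
    intro hh
    have := hbd ((P.X 0)ᶜ \ {d}) fun x hx => by
      simp only [Finset.mem_sdiff, Finset.mem_compl, Finset.mem_singleton] at hx
      exact ⟨hx.1, hh x hx.1 hx.2⟩
    have := H.card_erase d
    omega
  have all1 : P.wild.card ≤ 1 → (∀ x, x ∉ P.X 0 → x ∉ P.X 1 → x ≠ d → 1 ≤ P.wt x) →
      2 ≤ ∑ x, P.wt x := by
    intro hwl hh
    have := hbd (((P.X 0)ᶜ \ P.X 1) \ {d}) fun x hx => by
      simp only [Finset.mem_sdiff, Finset.mem_compl, Finset.mem_singleton] at hx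
      exact ⟨hx.1.1, hh x hx.1.1 hx.1.2 hx.2⟩
    have := H.card_sdiff_one_erase d
    omega
  -- If there are two wild colours, every free colour other than `d` has positive weight.
  by_cases hw2 : 1 < P.wild.card
  · obtain ⟨θ, hθ, z, hz, hne⟩ := Finset.one_lt_card.1 hw2
    rw [mem_wild] at hθ hz
    have key : ∀ {i j k b c}, P.Fits i j k l θ b c d → 2 ≤ ∑ x, P.wt x := by
      intro i j k b c h
      by_cases zb : z = b
      · subst zb
        exact all fun x hx hxd => wt_of_three_two_wild H hmin h hd hθ hz hx hxd
      by_cases zc : z = c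
      · subst zc
        exact all fun x hx hxd => wt_of_three_two_wild H hmin h.swap23 hd hθ hz hx hxd
      · exact all fun x hx hxd => wt_of_three_two_wild H hmin
          (h.swap12.set_wild hz hne.symm zc (ne_of_mem_of_not_mem hz.1 hd)) hd hz hθ hx hxd
    by_cases h1 : θ = b
    · subst h1; exact key h.swap12
    by_cases h2 : θ = c
    · subst h2; exact key h.swap23.swap12
    exact key (h.set_wild hθ h1 h2 (ne_of_mem_of_not_mem hθ.1 hd))
  -- With a wild colour, the free colours missing at its index have positive weight.
  have one : ∀ θ, P.Wild θ → 1 ≤ P.wt g → 2 ≤ ∑ x, P.wt x := by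
    intro θ hθ hg
    have key : ∀ {i j k b c}, P.Fits i j k l θ b c d → P.Fits i j k l θ b c d' →
        2 ≤ ∑ x, P.wt x := by
      intro i j k b c h h'
      have := hbd ((P.X 0)ᶜ \ P.X i) fun x hx => by
        simp only [Finset.mem_sdiff, Finset.mem_compl] at hx
        refine ⟨hx.1, ?_⟩
        by_cases hxd : x = d
        · exact wt_of_three_wild H hmin h' hd' hθ hx.1 hx.2 (by rw [hxd]; exact hdd.symm)
        · exact wt_of_three_wild H hmin h hd hθ hx.1 hx.2 hxd
      have := H.card_sdiff i h.q.i0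
      omega
    have n1 := ne_of_mem_of_not_mem hθ.1 hd
    have n2 := ne_of_mem_of_not_mem hθ.1 hd'
    by_cases h1 : θ = b
    · subst h1; exact key h.swap12 h'.swap12
    by_cases h2 : θ = c
    · subst h2; exact key h.swap23.swap12 h'.swap23.swap12
    exact key (h.set_wild hθ h1 h2 n1) (h'.set_wild hθ h1 h2 n2)
  have hwt0 : P.wild.card = 0 → ∀ x, x ∈ P.X 0 → 0 ≤ P.wt x := by
    intro hc x hx
    have := wt_of_mem' x hx
    rw [Finset.card_eq_zero] at hc
    rwa [ind_of_notMem (by simp [hc]), neg_zero] at this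
  -- The case in which the free colour is placed at `1`.
  by_cases hl1 : l = 1
  · subst hl1
    by_cases hg : P.wt g ≤ 0
    · have hgn : ∀ {i j k}, Quad i j k 1 → g ∉ P.X i ∧ g ∉ P.X j ∧ g ∉ P.X k := fun q =>
        notMem_of_wt q.swap34.swap23.swap12 H.g0 H.g1 hg
      have key : ∀ {i j k b c}, P.Fits i j k 1 g b c d → 2 ≤ ∑ x, P.wt x := fun h =>
        all fun x hx hxd => wt_of_three_g H hmin h hd (hgn h.q).2.1 (hgn h.q).2.2 hx hxd
      by_cases h1 : g = b
      · subst h1; exact key h.swap12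
      by_cases h2 : g = c
      · subst h2; exact key h.swap23.swap12
      have hg := hgn h.q
      exact key ⟨h.q, hg.1, h.bj, h.ck, h.dl, h1, h2, ne_of_mem_of_not_mem H.g0 hd, h.bc, h.bd,
          h.cd,
        fun hh => hg.2.1 (P.conf_mem hh), fun hh => hg.2.2 (P.conf_mem hh),
        fun hh => hd (H.gc1 _ _ h.q.i0 h.q.il hh), h.hbc, h.hbd, h.hcd⟩
    by_cases hθ : ∃ θ, P.Wild θ
    · exact one _ hθ.choose_spec (by omega)
    have hw0 : P.wild.card = 0 := by
      rw [Finset.card_eq_zero, Finset.eq_empty_iff_forall_notMem]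
      exact fun x hx => hθ ⟨x, mem_wild.1 hx⟩
    -- If the bound fails, all free colours have weight zero.
    by_contra hS
    have hT : ∀ x, x ∉ P.X 0 → P.wt x ≤ 0 := by
      intro x hx
      by_contra hh
      have := hbd {x} (by simp; exact ⟨hx, by omega⟩)
      simp at this
      omega
    have hr : P.wt r ≤ 0 := by
      have := hbd ∅ (by simp)
      simp at this
      omega
    have hrn := notMem_of_wt h.q.swap34.swap23.swap12 H.r0 H.r1 hr
    have hr' : ∀ t, t ≠ 0 → t ≠ 1 → r ∉ P.X t := by
      intro t t0 t1
      rcases h.q.eq_or t with rfl | rfl | rfl | rfl | rfl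
      exacts [(t0 rfl).elim, hrn.1, hrn.2.1, hrn.2.2, (t1 rfl).elim]
    have key : ∀ {i j k a b c}, P.Fits i j k 1 a b c d → r ≠ b → r ≠ c → False :=
      fun h h1 h2 => three_tight H hmin h hd (fun x hx _ => hT x hx) hr' h1 h2
    by_cases h1 : r = b
    · subst h1; exact key h.swap12 h.ab.symm h.bc
    by_cases h2 : r = c
    · subst h2; exact key h.swap23.swap12 h.ac.symm h.bc.symm
    exact key h h1 h2
  -- The case in which a used colour is placed at `1`.
  have main : ∀ {j k a b c}, P.Fits 1 j k l a b c d → 2 ≤ ∑ x, P.wt x := by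
    intro j k a b c h
    have hga : g ≠ a := by rintro rfl; exact h.ai H.g1
    have hra : r ≠ a := by rintro rfl; exact h.ai H.r1
    have hwl : P.wild.card ≤ 1 := by omega
    have place : ∀ {j k a c}, P.Fits 1 j k l a g c d → 2 ≤ ∑ x, P.wt x := fun h =>
      all1 hwl fun x hx hx1 hxd => wt_of_three_g' H hmin h hd hx hx1 hxd
    by_cases h1 : g = b
    · subst h1; exact place h
    by_cases h2 : g = c
    · subst h2; exact place h.swap23
    have put : ∀ x, x ∈ P.X 0 → x ∈ P.X 1 → P.wt x ≤ 0 → x ≠ a → x ≠ b → x ≠ c →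
        P.Fits 1 j k l a x c d ∨ P.Fits 1 k j l a x b d := by
      intro x x0 x1 hx xa xb xc
      have hx := notMem_of_wt h.q x0 x1 hx
      have xd := ne_of_mem_of_not_mem x0 hd
      have e1 := h.swap12.replace_first xa xc xd
      have e2 := h.swap23.swap12.replace_first xa xb xd
      by_contra hn
      push Not at hn
      have e1 : P.conf x j a 1 := by
        rcases e1 with e | e | e | e | e
        exacts [(hx.1 e).elim, e, (hx.2.1 (P.conf_mem e)).elim, (hx.2.2 (P.conf_mem e)).elim,
          (hn.1 e.swap12).elim]
      have e2 : P.conf x k a 1 := by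
        rcases e2 with e | e | e | e | e
        exacts [(hx.2.1 e).elim, e, (hx.1 (P.conf_mem e)).elim, (hx.2.2 (P.conf_mem e)).elim,
          (hn.2 e.swap12).elim]
      exact h.q.jk (conf_unique' e1 e2)
    by_cases hg : P.wt g ≤ 0
    · rcases put g H.g0 H.g1 hg hga h1 h2 with h | h
      exacts [place h, place h]
    by_cases hθ : ∃ θ, P.Wild θ
    · exact one _ hθ.choose_spec (by omega)
    have hw0 : P.wild.card = 0 := by
      rw [Finset.card_eq_zero, Finset.eq_empty_iff_forall_notMem]
      exact fun x hx => hθ ⟨x, mem_wild.1 hx⟩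
    by_contra hS
    have hT : ∀ x, x ∉ P.X 0 → P.wt x ≤ 0 := by
      intro x hx
      by_contra hh
      have := hbd {x} (by simp; exact ⟨hx, by omega⟩)
      simp at this
      omega
    have hT0 : ∀ x, x ∈ P.X 0 → x ≠ g → P.wt x ≤ 0 := by
      intro x hx xg
      by_contra hh
      have := sum_bound (P := P) ∅ ∅ {g, x} (by simp) (by simp) (fun x hx _ => hw x hx) (by
        intro y hy
        simp only [Finset.mem_insert, Finset.mem_singleton] at hy
        refine ⟨?_, fun hh => hθ ⟨y, hh⟩⟩
        rcases hy with rfl | rfl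
        exacts [H.g0, hx])
      rw [Finset.sum_pair xg.symm, hw0] at this
      simp at this
      omega
    have hr : P.wt r ≤ 0 := hT0 r H.r0 H.gr.symm
    have hrn := notMem_of_wt h.q H.r0 H.r1 hr
    have hr' : ∀ t, t ≠ 0 → t ≠ 1 → r ∉ P.X t := by
      intro t t0 t1
      rcases h.q.eq_or t with rfl | rfl | rfl | rfl | rfl
      exacts [(t0 rfl).elim, (t1 rfl).elim, hrn.1, hrn.2.1, hrn.2.2]
    have key : ∀ {j k a c}, P.Fits 1 j k l a r c d → g ≠ c → g ≠ a → False :=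
      fun h gc ga => three_tight' H hmin h hd gc ga (fun x hx _ => hT x hx) hT0 hr'
    by_cases r1 : r = b
    · subst r1; exact key h h2 hga
    by_cases r2 : r = c
    · subst r2; exact key h.swap23 h1 hga
    rcases put r H.r0 H.r1 hr hra r1 r2 with h | h
    · exact key h h2 hga
    · exact key h h1 hga
  rcases h.q.eq_or 1 with h1 | h1 | h1 | h1 | h1
  · exact absurd h1 (by decide)
  · subst h1; exact main h
  · subst h1; exact main h.swap12
  · subst h1; exact main h.swap23.swap12
  · exact (hl1 h1.symm).elim

end Three

end Linked
end Palette

end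

/-! ### Linked palettes: one used colour -/

section

namespace Palette
variable {K : Type*} {P : Palette K} {i j k l : Fin 5} {a b c d : K}
variable [DecidableEq K] [Fintype K]
variable {Δ e : ℕ} {g r : K}

namespace Linked

section One

variable (H : P.Linked Δ e g r)

include H in
/-- If `X i` consists of all free colours but `c` and `d`, and all of these conflict at `0` with `a`
at `i`, then `c` or `d` can be moved to the index `0`; a colour outside the quadruple cannot be
placed at the index that becomes vacant. -/
theorem one_facts (h : P.Fits i j 1 l a b c d) (hb : b ∉ P.X 0)
    (hc : c ∉ P.X 0) (hd : d ∉ P.X 0) (hXi : ∀ x, x ∈ P.X i ↔ x ∉ P.X 0 ∧ x ≠ c ∧ x ≠ d)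
    (hconf : ∀ x, x ∈ P.X i → P.conf x 0 a i) {x : K} (xa : x ≠ a) (xb : x ≠ b) (xc : x ≠ c)
    (xd : x ≠ d) : (x ∈ P.X 1 ∨ P.conf x 1 b j ∨ P.conf x 1 d l) ∧
      (x ∈ P.X l ∨ P.conf x l b j ∨ P.conf x l c 1) := by
  have f1 := h.swap23.swap12.replace_first xa xb xd
  have f2 := h.swap34.swap23.swap12.replace_first xa xb xc
  have g1 : P.Fits 1 i j l x a b d → P.conf c 0 a i := fun f => by
    have := H.stuck.blocked f hc
    have := h.ck
    have := fun a i b k => @conf_mem' K P i k a b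
    have h1 := h.ac
    have h2 := h.bc
    have h3 := h.cd
    have := @P.conf_mem
    grind
  have g2 : P.Fits l i j 1 x a b c → P.conf d 0 a i := fun f => by
    have := H.stuck.blocked f hd
    have := h.dl
    have := fun a i b k => @conf_mem' K P i k a b
    have h1 := h.ad
    have h2 := h.bd
    have h3 := h.cd
    have := @P.conf_mem
    grind
  have q := h.q
  obtain ⟨s, m, u⟩ := P.rules
  have k1 := hXi c
  have k2 := hXi d
  have k3 := hconf x
  obtain ⟨q1, q2, q3, q4, q5, q6, q7, q8, q9, q10⟩ := q
  clear H hconf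
  grind

theorem one_sum (h : P.Fits i j k l a b c d) (g : K) (hga : g ≠ a) (hgb : g ≠ b) (hgc : g ≠ c)
    (hgd : g ≠ d) (hw : ∀ x, x ≠ a → x ≠ b → x ≠ c → x ≠ d → 0 ≤ P.wt x) (T : Finset K)
    (hT : ∀ x ∈ T, x ≠ a ∧ x ≠ b ∧ x ≠ c ∧ x ≠ d ∧ x ≠ g ∧ 1 ≤ P.wt x) :
    T.card + P.wt g + P.wt a + P.wt b + P.wt c + P.wt d ≤ ∑ x, P.wt x := by
  have h1 := sum_ge P.wt [(1, T), (P.wt g, {g}), (P.wt a, {a}), (P.wt b, {b}),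
      (P.wt c, {c}), (P.wt d, {d})] (by
    intro x
    have := h.ab
    have := h.ac
    have := h.ad
    have := h.bc
    have := h.bd
    have := h.cd
    have k0 := hw x
    have k1 := hT x
    clear hw hT h
    simp only [List.map_cons, List.map_nil, List.sum_cons, List.sum_nil, ind, Finset.mem_singleton]
    by_cases x = a
    · grind
    by_cases x = b
    · grind
    by_cases x = c
    · grind
    by_cases x = d
    · grind
    by_cases x = g
    · grind
    grind)
  simp only [List.map_cons, List.map_nil, List.sum_cons, List.sum_nil, Finset.card_singleton] at h1
  omega

set_option maxHeartbeats 3200000 in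
include H in
/-- The bound for one used colour `a` when the free colour `b` conflicts with `a` at `0`, the third
index being `1` and `g` at `i` conflicting with `b` at `j`. -/
theorem one_conf (h : P.Fits i j 1 l a b c d) (ha : a ∈ P.X 0) (hb : b ∉ P.X 0)
    (hc : c ∉ P.X 0) (hd : d ∉ P.X 0) (hga : g ≠ a) (he : e = 0)
    (hXi : ∀ x, x ∈ P.X i ↔ x ∉ P.X 0 ∧ x ≠ c ∧ x ≠ d)
    (hconf : ∀ x, x ∈ P.X i → P.conf x 0 a i) (hgj : P.conf g i b j) : 2 ≤ ∑ x, P.wt x := by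
  subst he
  have q := h.q
  obtain ⟨s, m, u⟩ := P.rules
  have hU := fun x => one_facts H h hb hc hd hXi hconf (x := x)
  have nb := ne_of_mem_of_not_mem H.g0 hb
  have nc := ne_of_mem_of_not_mem H.g0 hc
  have nd := ne_of_mem_of_not_mem H.g0 hd
  have g0 := H.g0
  have hl1 := q.kl.symm
  have hgj' : g ∈ P.X j := P.conf_mem hgj
  have hgl : g ∈ P.X l := by
    rcases (hU g hga nb nc nd).2 with hh | hh | hh
    · exact hh
    · exact (q.il (conf_unique' hgj hh)).elim
    · exact (hc (H.gc1 l c q.l0 hl1 hh)).elim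
  have bi : b ∈ P.X i := conf_mem' hgj
  have ci : c ∉ P.X i := fun hh => ((hXi c).1 hh).2.1 rfl
  have di : d ∉ P.X i := fun hh => ((hXi d).1 hh).2.2 rfl
  have gi : g ∉ P.X i := fun hh => ((hXi g).1 hh).1 g0
  obtain ⟨α, α0, α1, αb⟩ := H.exists_notMem_one {b, c, d} Finset.card_le_three
  simp only [Finset.mem_insert, Finset.mem_singleton, not_or] at αb
  -- No assignment has `α` at `0`, `g` at `i` and `x` at `j`.
  have five : ∀ α, α ∉ P.X 0 → α ∉ P.X 1 → α ≠ c → α ≠ d → ∀ x, x ∈ P.X 0 → x ≠ g →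
      x ∈ P.X j ∨ P.conf x j c 1 ∨ P.conf x j d l ∨ P.conf α 0 x j := by
    intro α α0 α1 αc αd x hx xg
    by_contra hn
    push Not at hn
    have f : P.Fits i j 1 l g x c d := by
      refine ⟨q, gi, hn.1, h.ck, h.dl, xg.symm, nc, nd, ne_of_mem_of_not_mem hx hc,
        ne_of_mem_of_not_mem hx hd, h.cd, ?_, fun hh => hc (H.gc1 i c q.i0 q.ik hh),
        fun hh => di (conf_mem' hh), hn.2.1, hn.2.2.1, h.hcd⟩
      intro hh
      exact ((hXi x).1 (conf_mem' hh)).1 hx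
    rcases H.stuck.blocked f α0 with hh | hh | hh | hh | hh | hh | hh | hh
    · exact α0 (hh ▸ g0)
    · exact α0 (hh ▸ hx)
    · exact αc hh
    · exact αd hh
    · exact α1 (H.gc0 i α q.i0 q.ik (P.conf_symm hh))
    · exact hn.2.2.2 hh
    · exact hc (conf_mem' hh)
    · exact hd (conf_mem' hh)
  have hainc : a ∈ P.X j ∨ a ∈ P.X 1 ∨ a ∈ P.X l := by
    rcases five α α0 α1 αb.2.1 αb.2.2 a ha hga.symm with hh | hh | hh | hh
    · exact Or.inl hh
    · exact Or.inr (Or.inl (P.conf_mem hh))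
    · exact Or.inr (Or.inr (P.conf_mem hh))
    · exact (q.ij (P.conf_unique (hconf α ((hXi α).2 ⟨α0, αb.2⟩)) hh)).elim
  have hwt : ∀ x, P.wt x = ind (P.X 0) x + ind (P.X i) x + ind (P.X j) x + ind (P.X 1) x +
      ind (P.X l) x - 2 := wt_eq q
  have hw : ∀ x, x ≠ a → x ≠ b → x ≠ c → x ≠ d → 0 ≤ P.wt x := by
    intro x xa xb xc xd
    have h1 := hU x xa xb xc xd
    have h2 := hXi x
    rw [hwt]
    clear hU hXi hconf five H
    obtain ⟨q1, q2, q3, q4, q5, q6, q7, q8, q9, q10⟩ := q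
    simp only [ind]
    grind
  have hwg : 2 ≤ P.wt g := by
    rw [hwt, ind_of_mem g0, ind_of_mem H.g1, ind_of_mem hgl, ind_of_mem hgj']
    have := ind_nonneg (P.X i) g
    omega
  have hb1 : b ∈ P.X 1 ∨ d ∈ P.X 1 := by
    have h1 := (hU α (ne_of_mem_of_not_mem ha α0).symm αb.1 αb.2.1 αb.2.2).1
    rcases h1 with hh | hh | hh
    exacts [(α1 hh).elim, Or.inl (conf_mem' hh), Or.inr (conf_mem' hh)]
  have hbl : b ∈ P.X l ∨ c ∈ P.X l := by
    by_contra hn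
    push Not at hn
    have h1 : ((P.X 0)ᶜ \ {b, c, d}) ∪ insert g ((P.X 0).erase a) ⊆ P.X l := by
      intro x hx
      simp only [Finset.mem_union, Finset.mem_sdiff, Finset.mem_compl, Finset.mem_insert,
        Finset.mem_singleton, Finset.mem_erase, not_or] at hx
      have : x ≠ a ∧ x ≠ b ∧ x ≠ c ∧ x ≠ d := by
        rcases hx with hx | rfl | hx
        · exact ⟨(ne_of_mem_of_not_mem ha hx.1).symm, hx.2⟩
        · exact ⟨hga, nb, nc, nd⟩
        · exact ⟨hx.1, ne_of_mem_of_not_mem hx.2 hb, ne_of_mem_of_not_mem hx.2 hc,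
            ne_of_mem_of_not_mem hx.2 hd⟩
      rcases (hU x this.1 this.2.1 this.2.2.1 this.2.2.2).2 with hh | hh | hh
      exacts [hh, (hn.1 (conf_mem' hh)).elim, (hn.2 (conf_mem' hh)).elim]
    have h2 := Finset.card_le_card h1
    rw [Finset.card_union_of_disjoint, Finset.insert_eq_of_mem (Finset.mem_erase.2 ⟨hga, g0⟩),
      Finset.card_erase_of_mem ha] at h2
    · have h3 := Finset.le_card_sdiff ({b, c, d} : Finset K) (P.X 0)ᶜ
      have h4 := Finset.card_le_three (a := b) (b := c) (c := d)
      have := H.hA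
      have := H.hX l q.l0
      have := H.h0
      omega
    · rw [Finset.disjoint_left]
      intro x hx
      simp only [Finset.mem_sdiff, Finset.mem_compl] at hx
      simp only [Finset.mem_insert, Finset.mem_erase, not_or]
      exact ⟨fun hh => hx.1 (hh ▸ g0), fun hh => hx.1 hh.2⟩
  have hWs : -3 ≤ P.wt a + P.wt b + P.wt c + P.wt d ∧
      (b ∈ P.X 1 ∧ d ∈ P.X 1 ∨ b ∈ P.X l ∧ c ∈ P.X l →
        -2 ≤ P.wt a + P.wt b + P.wt c + P.wt d) := by
    have e1 : 1 ≤ ind (P.X j) a + ind (P.X 1) a + ind (P.X l) a := by simp only [ind]; grind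
    have e2 : 1 ≤ ind (P.X 1) b + ind (P.X 1) d := by simp only [ind]; grind
    have e3 : 1 ≤ ind (P.X l) b + ind (P.X l) c := by simp only [ind]; grind
    have e4 := ind_nonneg (P.X i) a
    have e5 := ind_nonneg (P.X j) c
    have e6 := ind_nonneg (P.X j) d
    have e7 := ind_nonneg (P.X j) b
    have e8 := ind_nonneg (P.X 1) c
    have e9 := ind_nonneg (P.X l) d
    simp only [hwt, ind_of_mem ha, ind_of_notMem hb, ind_of_notMem hc, ind_of_notMem hd,
      ind_of_mem bi, ind_of_notMem ci, ind_of_notMem di]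
    refine ⟨by omega, ?_⟩
    rintro (⟨k1, k2⟩ | ⟨k1, k2⟩) <;> rw [ind_of_mem k1, ind_of_mem k2] at * <;> omega
  by_contra hS
  push Not at hS
  -- `T` collects the colours of positive weight outside the quadruple, apart from `g`.
  obtain ⟨T, hT⟩ : ∃ T : Finset K, ∀ x, x ∈ T ↔
      x ≠ a ∧ x ≠ b ∧ x ≠ c ∧ x ≠ d ∧ x ≠ g ∧ 1 ≤ P.wt x :=
    ⟨Finset.univ.filter fun x => x ≠ a ∧ x ≠ b ∧ x ≠ c ∧ x ≠ d ∧ x ≠ g ∧ 1 ≤ P.wt x, by simp⟩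
  have hTs := one_sum h g hga nb nc nd hw T fun x hx => (hT x).1 hx
  -- If `b` were in neither `X 1` nor `X l`, a free colour `α` of nonpositive weight could replace
  -- it.
  have swap : ∀ α, α ∉ P.X 0 → α ≠ b → α ≠ c → α ≠ d → P.wt α ≤ 0 → b ∉ P.X 1 → b ∈ P.X l := by
    intro α α0 αb αc αd hα hb1
    by_contra hbl
    have αa := (ne_of_mem_of_not_mem ha α0).symm
    have h1 := hU α αa αb αc αd
    have h2 := (hXi α).2 ⟨α0, αc, αd⟩
    have h3 := hconf α h2
    rw [hwt] at hα
    have f : P.Fits i j 1 l a α c d := by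
      by_contra hf
      have := fails q hf
      obtain ⟨q1, q2, q3, q4, q5, q6, q7, q8, q9, q10⟩ := q
      obtain ⟨q0, w1, w2, w3, w4, w5, w6, w7, w8, w9, w10, w11, w12, w13, w14, w15, w16⟩ := h
      clear hU hXi hconf five hwt hw hT H hf hWs
      simp only [ind] at hα
      grind
    rcases (one_facts H f α0 hc hd hXi hconf h.ab.symm (Ne.symm αb) h.bc h.bd).1 with hh | hh | hh
    · exact hb1 hh
    · exact h.bj (P.conf_mem hh)
    · exact hbl (P.conf_mem hh)
  have cX1 := H.card_sdiff_one
  have hA := H.hA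
  have hΔ := H.hΔ
  have h40 := H.h0
  have hQ : (P.X 0)ᶜ \ P.X 1 ⊆ ((P.X 0)ᶜ \ P.X 1) \ {b, c, d} ∪ ({b, c, d} \ P.X 1) := by
    intro x; simp; tauto
  have hQc := Finset.card_le_card hQ
  have hQu := Finset.card_union_le (((P.X 0)ᶜ \ P.X 1) \ {b, c, d}) ({b, c, d} \ P.X 1)
  -- Either some used colour other than `a` and `g` has nonpositive weight, so that `α ∈ T` for the
  -- free colours `α` missing at `1`, or all these used colours belong to `T`.
  by_cases hω : ∃ ω, ω ∈ P.X 0 ∧ ω ≠ a ∧ ω ≠ g ∧ P.wt ω ≤ 0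
  · obtain ⟨ω, ω0, ωa, ωg, hω⟩ := hω
    have hQT : ((P.X 0)ᶜ \ P.X 1) \ {b, c, d} ⊆ T := by
      intro x hx
      simp only [Finset.mem_sdiff, Finset.mem_compl, Finset.mem_insert, Finset.mem_singleton,
        not_or] at hx
      obtain ⟨⟨x0, x1⟩, xb, xc, xd⟩ := hx
      have xa := (ne_of_mem_of_not_mem ha x0).symm
      have h1 := five x x0 x1 xc xd ω ω0 ωg
      have h2 := hU ω ωa (ne_of_mem_of_not_mem ω0 hb) (ne_of_mem_of_not_mem ω0 hc)
        (ne_of_mem_of_not_mem ω0 hd)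
      have h3 := hU x xa xb xc xd
      have h4 := (hXi x).2 ⟨x0, xc, xd⟩
      have h5 : ω ∉ P.X i := fun hh => ((hXi ω).1 hh).1 ω0
      rw [hT]
      refine ⟨xa, xb, xc, xd, (ne_of_mem_of_not_mem g0 x0).symm, ?_⟩
      rw [hwt] at hω ⊢
      clear hU hXi hconf five hwt hw hT H hWs hQ hQc hQu swap
      obtain ⟨q1, q2, q3, q4, q5, q6, q7, q8, q9, q10⟩ := q
      simp only [ind] at *
      grind
    have hQTc := Finset.card_le_card hQT
    by_cases hbd : b ∈ P.X 1 ∧ d ∈ P.X 1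
    · have h1 := hWs.2 (Or.inl hbd)
      have h2 : ({b, c, d} \ P.X 1) ⊆ {c} := by
        intro x; simp; grind
      have := Finset.card_le_card h2
      rw [Finset.card_singleton] at this
      omega
    have h2 : ({b, c, d} \ P.X 1 : Finset K).card ≤ 2 := by
      rcases hb1 with hh | hh
      · have h2 : ({b, c, d} \ P.X 1) ⊆ {c, d} := by
          intro x; simp; grind
        exact (Finset.card_le_card h2).trans Finset.card_le_two
      · have h2 : ({b, c, d} \ P.X 1) ⊆ {b, c} := by
          intro x; simp; grind
        exact (Finset.card_le_card h2).trans Finset.card_le_two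
    have hQe : ((P.X 0)ᶜ \ P.X 1) \ {b, c, d} = T := Finset.eq_of_subset_of_card_le hQT (by omega)
    have hTe : ∀ x, x ∈ T → x ∉ P.X 0 ∧ x ∉ P.X 1 := by
      intro x hx
      rw [← hQe] at hx
      simp only [Finset.mem_sdiff, Finset.mem_compl] at hx
      exact hx.1
    have hin := Finset.card_sdiff_add_card_inter (P.X 0)ᶜ (P.X 1)
    have hX1c := H.hX 1 (by decide)
    by_cases hbX : b ∈ P.X 1
    · have hdX : d ∉ P.X 1 := fun hh => hbd ⟨hbX, hh⟩
      have hX1 : ∀ x, x ∈ P.X 0 → x ∈ P.X 1 → x = g ∨ x = r := by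
        intro x x0 x1
        by_contra hn
        push Not at hn
        have h1 : insert x (insert g (insert r ((P.X 0)ᶜ ∩ P.X 1))) ⊆ P.X 1 := by
          intro y; simp; rintro (rfl | rfl | rfl | hh)
          exacts [x1, H.g1, H.r1, hh.2]
        have h1 := Finset.card_le_card h1
        rw [Finset.card_insert_of_notMem (by simp [hn, x0]), Finset.card_insert_of_notMem
          (by simp [H.gr, g0]), Finset.card_insert_of_notMem (by simp [H.r0])] at h1
        omega
      obtain ⟨x, x0, hx⟩ : ∃ x ∈ P.X 0, x ∉ ({a, g, r} : Finset K) := by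
        by_contra hn
        push Not at hn
        have := Finset.card_le_card (show P.X 0 ⊆ {a, g, r} from hn)
        have := Finset.card_le_three (a := a) (b := g) (c := r)
        omega
      simp only [Finset.mem_insert, Finset.mem_singleton, not_or] at hx
      have xb := ne_of_mem_of_not_mem x0 hb
      have xc := ne_of_mem_of_not_mem x0 hc
      have xd := ne_of_mem_of_not_mem x0 hd
      have h1 := hU x hx.1 xb xc xd
      have x1 : x ∉ P.X 1 := fun hh => (hX1 x x0 hh).elim hx.2.1 hx.2.2
      refine (hTe x ((hT x).2 ⟨hx.1, xb, xc, xd, hx.2.1, ?_⟩)).1 x0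
      rw [hwt]
      clear hU hXi hconf five hwt hw hT H hWs hQ hQc hQu swap hX1 hTe
      obtain ⟨q1, q2, q3, q4, q5, q6, q7, q8, q9, q10⟩ := q
      simp only [ind] at *
      grind
    · have hdX : d ∈ P.X 1 := hb1.resolve_left hbX
      obtain ⟨α, hα, hαd⟩ : ∃ α ∈ (P.X 0)ᶜ ∩ P.X 1, α ≠ d := by
        by_contra hn
        push Not at hn
        have := Finset.card_le_card (show (P.X 0)ᶜ ∩ P.X 1 ⊆ {d} from fun x hx => by simp [hn x hx])
        rw [Finset.card_singleton] at this
        omega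
      simp only [Finset.mem_inter, Finset.mem_compl] at hα
      have αb : α ≠ b := fun hh => hbX (hh ▸ hα.2)
      have αc : α ≠ c := fun hh => h.ck (hh ▸ hα.2)
      have αa := (ne_of_mem_of_not_mem ha hα.1).symm
      have αg := (ne_of_mem_of_not_mem g0 hα.1).symm
      have hα0 : P.wt α ≤ 0 := by
        by_contra hn
        exact (hTe α ((hT α).2 ⟨αa, αb, αc, hαd, αg, by omega⟩)).2 hα.2
      have hbl' := swap α hα.1 αb αc hαd hα0 hbX
      have h1 := hU α αa αb αc hαd
      have h4 := (hXi α).2 ⟨hα.1, αc, hαd⟩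
      have hcl : c ∈ P.X l := by
        rw [hwt] at hα0
        clear hU hXi hconf five hwt hw hT H hWs hQ hQc hQu swap hTe
        obtain ⟨q1, q2, q3, q4, q5, q6, q7, q8, q9, q10⟩ := q
        simp only [ind] at *
        grind
      have := hWs.2 (Or.inr ⟨hbl', hcl⟩)
      omega
  · push Not at hω
    have hDT : ((P.X 0).erase a).erase g ⊆ T := by
      intro x hx
      simp only [Finset.mem_erase] at hx
      rw [hT]
      exact ⟨hx.2.1, ne_of_mem_of_not_mem hx.2.2 hb, ne_of_mem_of_not_mem hx.2.2 hc,
        ne_of_mem_of_not_mem hx.2.2 hd, hx.1, hω x hx.2.2 hx.2.1 hx.1⟩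
    have hDc := Finset.card_le_card hDT
    rw [Finset.card_erase_of_mem (Finset.mem_erase.2 ⟨hga, g0⟩), Finset.card_erase_of_mem ha] at hDc
    have hDe : ((P.X 0).erase a).erase g = T := Finset.eq_of_subset_of_card_le hDT (by
      rw [Finset.card_erase_of_mem (Finset.mem_erase.2 ⟨hga, g0⟩), Finset.card_erase_of_mem ha]
      omega)
    have hsing : ∀ x, x ∉ P.X 0 → x ≠ b → x ≠ c → x ≠ d → P.wt x ≤ 0 := by
      intro x x0 xb xc xd
      by_contra hn
      have : x ∈ T := (hT x).2 ⟨(ne_of_mem_of_not_mem ha x0).symm, xb, xc, xd,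
        (ne_of_mem_of_not_mem g0 x0).symm, by omega⟩
      rw [← hDe] at this
      simp only [Finset.mem_erase] at this
      exact x0 this.2.2
    have hα := hsing α α0 αb.1 αb.2.1 αb.2.2
    have hdX : d ∈ P.X 1 := by
      have h1 := hU α (ne_of_mem_of_not_mem ha α0).symm αb.1 αb.2.1 αb.2.2
      have h4 := (hXi α).2 ⟨α0, αb.2⟩
      rw [hwt] at hα
      clear hU hXi hconf five hwt hw hT H hWs hQ hQc hQu swap hsing hω
      obtain ⟨q1, q2, q3, q4, q5, q6, q7, q8, q9, q10⟩ := q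
      simp only [ind] at *
      grind
    have hbX : b ∉ P.X 1 := by
      intro hbX
      have := hWs.2 (Or.inl ⟨hbX, hdX⟩)
      omega
    have hbl' := swap α α0 αb.1 αb.2.1 αb.2.2 hα hbX
    have hcl : c ∉ P.X l := by
      intro hcl
      have := hWs.2 (Or.inr ⟨hbl', hcl⟩)
      omega
    have hsub : insert g (insert b ((P.X 0)ᶜ \ {b, c, d})) ⊆ P.X l := by
      intro x hx
      simp only [Finset.mem_sdiff, Finset.mem_compl, Finset.mem_insert,
        Finset.mem_singleton, not_or] at hx
      rcases hx with rfl | rfl | ⟨x0, xb, xc, xd⟩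
      · exact hgl
      · exact hbl'
      · have h1 := hU x (ne_of_mem_of_not_mem ha x0).symm xb xc xd
        have h4 := (hXi x).2 ⟨x0, xc, xd⟩
        have h5 := hsing x x0 xb xc xd
        rw [hwt] at h5
        clear hU hXi hconf five hwt hw hT H hWs hQ hQc hQu swap hsing hω
        obtain ⟨q1, q2, q3, q4, q5, q6, q7, q8, q9, q10⟩ := q
        simp only [ind] at *
        grind
    have h2 := Finset.card_le_card hsub
    rw [Finset.card_insert_of_notMem (by simp [nb, g0]),
        Finset.card_insert_of_notMem (by simp)] at h2
    have h3 := Finset.le_card_sdiff ({b, c, d} : Finset K) (P.X 0)ᶜ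
    have h4 := Finset.card_le_three (a := b) (b := c) (c := d)
    have := H.hX l q.l0
    omega
end One

end Linked
end Palette

end

section

namespace Palette
variable {K : Type*} {P : Palette K} {i j k l : Fin 5} {a b c d : K}
variable [DecidableEq K] [Fintype K]
variable {Δ e : ℕ} {g r : K}

namespace Linked

/-- The bound for one used colour `a` when the free colour `b` conflicts with `a` at `0`. The sizes
of the sets leave no slack in this case; `g` would be placeable at `i` unless it conflicts with `b`.
-/
theorem sum_of_one_conf (H : P.Linked Δ e g r) (h : P.Fits i j k l a b c d) (ha : a ∈ P.X 0)
    (hb : b ∉ P.X 0) (hc : c ∉ P.X 0) (hd : d ∉ P.X 0) (hba : P.conf b 0 a i) :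
    2 ≤ ∑ x, P.wt x := by
  have q := h.q
  have hA := H.hA
  have hΔ := H.hΔ
  have hconf' : ∀ x, x ∉ P.X 0 → x ≠ b → x ≠ c → x ≠ d → P.conf x 0 a i := by
    intro x hx xb xc xd
    rcases H.stuck.blocked h hx with hh | hh | hh | hh | hh | hh | hh | hh
    exacts [(hx (hh ▸ ha)).elim, (xb hh).elim, (xc hh).elim, (xd hh).elim, hh,
      (hb (conf_mem' hh)).elim, (hc (conf_mem' hh)).elim, (hd (conf_mem' hh)).elim]
  -- The free colours other than `c` and `d` fill `X i`, which leaves no room for further colours.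
  have hsub : (P.X 0)ᶜ \ {c, d} ⊆ P.X i := by
    intro x hx
    simp only [Finset.mem_sdiff, Finset.mem_compl, Finset.mem_insert, Finset.mem_singleton,
      not_or] at hx
    by_cases xb : x = b
    · exact xb ▸ P.conf_mem hba
    · exact P.conf_mem (hconf' x hx.1 xb hx.2.1 hx.2.2)
  have h2 := Finset.le_card_sdiff ({c, d} : Finset K) (P.X 0)ᶜ
  rw [Finset.card_pair h.cd] at h2
  have h3 := H.hX i q.i0
  have h4 := Finset.card_le_card hsub
  have he : e = 0 := by omega
  have hXe : (P.X 0)ᶜ \ {c, d} = P.X i := Finset.eq_of_subset_of_card_le hsub (by omega)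
  have hXi : ∀ x, x ∈ P.X i ↔ x ∉ P.X 0 ∧ x ≠ c ∧ x ≠ d := by
    intro x; rw [← hXe]; simp
  have hconf : ∀ x, x ∈ P.X i → P.conf x 0 a i := by
    intro x hx
    have := (hXi x).1 hx
    by_cases xb : x = b
    · exact xb ▸ hba
    · exact hconf' x this.1 xb this.2.1 this.2.2
  have hi1 : i ≠ 1 := by
    rintro rfl
    exact ((hXi g).1 H.g1).1 H.g0
  obtain ⟨α, α0, α1, αb⟩ := H.exists_notMem_one {b, c, d} Finset.card_le_three
  simp only [Finset.mem_insert, Finset.mem_singleton, not_or] at αb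
  have nog : ¬ P.conf α 0 g i := fun hh => α1 (H.gc0 i α q.i0 hi1 (P.conf_symm hh))
  have hga : g ≠ a := by
    rintro rfl
    exact nog (hconf' α α0 αb.1 αb.2.1 αb.2.2)
  have hgi : g ∉ P.X i := fun hh => ((hXi g).1 hh).1 H.g0
  have hci : c ∉ P.X i := fun hh => ((hXi c).1 hh).2.1 rfl
  have hdi : d ∉ P.X i := fun hh => ((hXi d).1 hh).2.2 rfl
  have hgj : P.conf g i b j := by
    by_contra hn
    have f : P.Fits i j k l g b c d := ⟨q, hgi, h.bj, h.ck, h.dl, ne_of_mem_of_not_mem H.g0 hb,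
      ne_of_mem_of_not_mem H.g0 hc, ne_of_mem_of_not_mem H.g0 hd, h.bc, h.bd, h.cd, hn,
      fun hh => hci (conf_mem' hh), fun hh => hdi (conf_mem' hh), h.hbc, h.hbd, h.hcd⟩
    rcases H.stuck.blocked f α0 with hh | hh | hh | hh | hh | hh | hh | hh
    exacts [α0 (hh ▸ H.g0), αb.1 hh, αb.2.1 hh, αb.2.2 hh, nog hh,
      hb (conf_mem' hh), hc (conf_mem' hh), hd (conf_mem' hh)]
  have hj1 : j ≠ 1 := by
    rintro rfl
    exact hb (H.gc1 i b q.i0 hi1 hgj)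
  rcases q.eq_or 1 with h1 | h1 | h1 | h1 | h1
  · exact absurd h1 (by decide)
  · exact (hi1 h1.symm).elim
  · exact (hj1 h1.symm).elim
  · subst h1
    exact one_conf H h ha hb hc hd hga he hXi hconf hgj
  · subst h1
    exact one_conf H h.swap34 ha hb hd hc hga he (by intro x; rw [hXi]; tauto) hconf hgj

theorem card_univ (H : P.Linked Δ e g r) : Fintype.card K = (P.X 0).card + (Δ + e + 1) := by
  rw [← H.hA, Finset.card_add_card_compl]

/-- The bound when some fitting quadruple has at most one used colour. -/
theorem sum_of_one (H : P.Linked Δ e g r) (h : P.Fits i j k l a b c d)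
    (hb : b ∉ P.X 0) (hc : c ∉ P.X 0) (hd : d ∉ P.X 0) : 2 ≤ ∑ x, P.wt x := by
  have hA := H.hA
  have hΔ := H.hΔ
  have := H.h0
  by_cases ha : a ∈ P.X 0
  · by_cases h1 : P.conf b 0 a i
    · exact sum_of_one_conf H h ha hb hc hd h1
    by_cases h2 : P.conf c 0 a i
    · exact sum_of_one_conf H h.swap23 ha hc hb hd h2
    by_cases h3 : P.conf d 0 a i
    · exact sum_of_one_conf H h.swap34.swap23 ha hd hb hc h3
    have := H.card_univ
    exact sum_ge_two_of_one_used_of_not_conf H.stuck H.hX h ha hb hc hd (by omega) (by omega) h1 h2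
        h3
  · exact (not_fits_zero H.stuck h (by omega) ha hb hc hd).elim

end Linked
end Palette

end

/-! ### Linked palettes: two used colours and `g` of weight zero -/

section

namespace Palette
variable {K : Type*} {P : Palette K} {i j k l : Fin 5} {a b c d : K}
variable [DecidableEq K] [Fintype K]
variable {Δ e : ℕ} {g r : K}

/-- For a colour `x` missing at `0`, either four colours do not fit, or `x` is one of them or
conflicts at `0` with one of them. -/
theorem Stuck.fails (hP : P.Stuck) (q : Quad i j k l) {x : K} (hx : x ∉ P.X 0) :
    (a ∈ P.X i ∨ b ∈ P.X j ∨ c ∈ P.X k ∨ d ∈ P.X l ∨ a = b ∨ a = c ∨ a = d ∨ b = c ∨ b = d ∨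
      c = d ∨ P.conf a i b j ∨ P.conf a i c k ∨ P.conf a i d l ∨ P.conf b j c k ∨ P.conf b j d l ∨
      P.conf c k d l) ∨
    x = a ∨ x = b ∨ x = c ∨ x = d ∨ P.conf x 0 a i ∨ P.conf x 0 b j ∨ P.conf x 0 c k ∨
      P.conf x 0 d l := by
  by_cases h : P.Fits i j k l a b c d
  · exact Or.inr (hP.blocked h hx)
  · exact Or.inl (Palette.fails q h)

namespace Linked

theorem wild_eq_zero (h : ∀ x, ¬ P.Wild x) : P.wild.card = 0 := by
  rw [Finset.card_eq_zero, Finset.eq_empty_iff_forall_notMem]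
  exact fun x hx => h x (mem_wild.1 hx)

section Two

variable (H : P.Linked Δ e g r)
  (hmin : ∀ {i j k l a b c d}, P.Fits i j k l a b c d → a ∈ P.X 0 ∨ b ∈ P.X 0 ∨ c ∈ P.X 0)

include hmin in
/-- Three free colours cannot be part of a fitting quadruple with two used colours at least. -/
theorem fails_three (q : Quad i j k l) (ha : a ∉ P.X 0) (hb : b ∉ P.X 0) (hc : c ∉ P.X 0) (d : K) :
    a ∈ P.X i ∨ b ∈ P.X j ∨ c ∈ P.X k ∨ d ∈ P.X l ∨ a = b ∨ a = c ∨ a = d ∨ b = c ∨ b = d ∨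
      c = d ∨ P.conf a i b j ∨ P.conf a i c k ∨ P.conf a i d l ∨ P.conf b j c k ∨ P.conf b j d l ∨
      P.conf c k d l :=
  Palette.fails q fun h => (hmin h).elim ha fun h => h.elim hb hc

include H hmin in
/-- With two used colours, a free colour other than `c, d` conflicts at `0` with a used colour of
the quadruple, and cannot replace a used colour. -/
theorem served_two (h : P.Fits i j k l a b c d) (hc : c ∉ P.X 0) (hd : d ∉ P.X 0) {x : K}
    (hx : x ∉ P.X 0) (hxc : x ≠ c) (hxd : x ≠ d) : 0 ≤ P.wt x ∧
      (P.conf x 0 a i ∨ P.conf x 0 b j) ∧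
      (x ∈ P.X i ∨ P.conf x i b j ∨ P.conf x i c k ∨ P.conf x i d l) ∧
      (x ∈ P.X j ∨ P.conf x j a i ∨ P.conf x j c k ∨ P.conf x j d l) := by
  obtain ⟨ha, hb⟩ := used_two h hmin hc hd
  have na := (ne_of_mem_of_not_mem ha hx).symm
  have nb := (ne_of_mem_of_not_mem hb hx).symm
  refine ⟨(wt_of_two H.stuck h hmin hc hd hx hxc hxd).1, ?_,
    h.served nb hxc hxd fun f => (hmin f.swap23.swap34).elim hx fun h => h.elim hc hd,
    h.swap12.served na hxc hxd fun f => (hmin f.swap23.swap34).elim hx fun h => h.elim hc hd⟩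
  rcases H.stuck.blocked h hx with h | h | h | h | h | h | h | h
  exacts [(na h).elim, (nb h).elim, (hxc h).elim, (hxd h).elim, Or.inl h, Or.inr h,
    (hc (conf_mem' h)).elim, (hd (conf_mem' h)).elim]

theorem card_sdiff_pair (t : Fin 5) (s : Finset K) :
    ((P.X 0)ᶜ \ P.X t).card ≤ (((P.X 0)ᶜ \ P.X t) \ s).card + s.card := by
  have := Finset.le_card_sdiff s ((P.X 0)ᶜ \ P.X t)
  omega

include H hmin in
/-- The bound for two used colours when `g` lies in `X 0` and `X 1` only, and a used colour is
placed at `1`. -/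
theorem two_g_used (h : P.Fits 1 j k l a b c d) (hc : c ∉ P.X 0) (hd : d ∉ P.X 0)
    (hg : ∀ t, t ≠ 0 → t ≠ 1 → g ∉ P.X t) : 2 ≤ ∑ x, P.wt x := by
  have q := h.q
  obtain ⟨ha, hb⟩ := used_two h hmin hc hd
  have hga : g ≠ a := fun hh => h.ai (hh ▸ H.g1)
  have ng : ∀ {x}, x ∉ P.X 0 → g ≠ x := fun h => ne_of_mem_of_not_mem H.g0 h
  have hgj := hg j q.j0 q.ij.symm
  have hgk := hg k q.k0 q.ik.symm
  have hgl := hg l q.l0 q.il.symm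
  obtain ⟨y, y0, y1, hy⟩ := H.exists_notMem_one {c, d} (Finset.card_le_two.trans (by simp))
  simp only [Finset.mem_insert, Finset.mem_singleton, not_or] at hy
  -- `g` cannot be placed at `j`: a free colour missing at `1` conflicts with no colour at `1`, nor
  -- with `g`.
  have noplace : ∀ x, ¬ P.Fits 1 j k l x g c d := by
    intro x f
    rcases (served_two H hmin f hc hd y0 hy.1 hy.2).2.1 with hh | hh
    · exact y1 (P.conf_mem hh)
    · exact y1 (H.gc0 j y q.j0 q.ij.symm (P.conf_symm hh))
  have hgb : g ≠ b := by rintro rfl; exact noplace _ h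
  have hgja : P.conf g j a 1 := by
    rcases h.swap12.replace_first hga (ng hc) (ng hd) with hh | hh | hh | hh | hh
    exacts [(hgj hh).elim, hh, (hgk (P.conf_mem hh)).elim, (hgl (P.conf_mem hh)).elim,
      (noplace _ hh.swap12).elim]
  have hwild : ∀ x, ¬ P.Wild x := by
    intro x hx
    refine noplace x ⟨q, hx.2 1 q.i0, hgj, h.ck, h.dl, ?_, ne_of_mem_of_not_mem hx.1 hc,
      ne_of_mem_of_not_mem hx.1 hd, ng hc, ng hd, h.cd, fun hh => hx.2 j q.j0 (P.conf_mem hh),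
      fun hh => hx.2 k q.k0 (P.conf_mem hh), fun hh => hx.2 l q.l0 (P.conf_mem hh),
      fun hh => hgk (P.conf_mem hh), fun hh => hgl (P.conf_mem hh), h.hcd⟩
    rintro rfl
    exact hx.2 1 q.i0 H.g1
  have hy' := served_two H hmin h hc hd y0 hy.1 hy.2
  have hB : ∀ x, x ∉ P.X 0 → x ∉ P.X j → x ≠ c → x ≠ d → 1 ≤ P.wt x ∧ c ∈ P.X j ∧ d ∈ P.X j := by
    intro x x0 xj xc xd
    have h1 := served_two H hmin h hc hd x0 xc xd
    have f1 := H.stuck.fails q (x := y) (a := a) (b := x) (c := g) (d := d) y0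
    have f2 := H.stuck.fails q (x := y) (a := a) (b := x) (c := c) (d := g) y0
    have e1 := fun t => H.gc0 t y
    obtain ⟨s, m, u⟩ := P.rules
    have n1 := ng x0
    have n2 := ng y0
    have n3 := ng hc
    have n4 := ng hd
    rw [wt_eq q] at *
    obtain ⟨q0, w1, w2, w3, w4, w5, w6, w7, w8, w9, w10, w11, w12, w13, w14, w15, w16⟩ := h
    obtain ⟨q1, q2, q3, q4, q5, q6, q7, q8, q9, q10⟩ := q
    clear hmin H noplace hwild hg
    simp only [ind] at *
    grind
  obtain ⟨x, x0, xj, hx⟩ : ∃ x, x ∉ P.X 0 ∧ x ∉ P.X j ∧ x ≠ c ∧ x ≠ d := by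
    have h1 : (P.X 0)ᶜ ∩ P.X j ⊆ (P.X j).erase a := by
      intro x hx
      simp only [Finset.mem_inter, Finset.mem_compl] at hx
      exact Finset.mem_erase.2 ⟨(ne_of_mem_of_not_mem ha hx.1).symm, hx.2⟩
    have h1 := Finset.card_le_card h1
    rw [Finset.card_erase_of_mem (conf_mem' hgja)] at h1
    have h2 := Finset.card_sdiff_add_card_inter (P.X 0)ᶜ (P.X j)
    have h3 := card_sdiff_pair (P := P) j {c, d}
    rw [Finset.card_pair h.cd] at h3
    have := H.hA
    have := H.hX j q.j0
    have := H.hΔ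
    obtain ⟨x, hx⟩ := Finset.card_pos.1 (show 0 < (((P.X 0)ᶜ \ P.X j) \ {c, d}).card by omega)
    simp only [Finset.mem_sdiff, Finset.mem_compl, Finset.mem_insert, Finset.mem_singleton,
      not_or] at hx
    exact ⟨x, hx.1.1, hx.1.2, hx.2⟩
  obtain ⟨-, cj, dj⟩ := hB x x0 xj hx.1 hx.2
  have hcd : -1 ≤ P.wt c + P.wt d := by
    have e1 : 1 ≤ ind (P.X 1) c + ind (P.X 1) d := by
      have hh : P.conf y 1 c k ∨ P.conf y 1 d l := by
        have h0 : P.conf y 0 b j := hy'.2.1.resolve_left fun hh => y1 (P.conf_mem hh)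
        rcases hy'.2.2.1 with hh | hh | hh | hh
        exacts [(y1 hh).elim, absurd (conf_unique' hh h0) (by decide), Or.inl hh, Or.inr hh]
      have e1 := ind_nonneg (P.X 1) c
      have e2 := ind_nonneg (P.X 1) d
      rcases hh with hh | hh <;> rw [ind_of_mem (conf_mem' hh)] <;> omega
    simp only [wt_eq q, ind_of_mem cj, ind_of_mem dj, ind_of_notMem hc, ind_of_notMem hd]
    have := ind_nonneg (P.X k) c
    have := ind_nonneg (P.X k) d
    have := ind_nonneg (P.X l) c
    have := ind_nonneg (P.X l) d
    omega
  have h1 := H.bound ((P.X 0)ᶜ \ P.X j) {c, d} (fun x hx => by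
    simp only [Finset.mem_sdiff, Finset.mem_compl] at hx
    have hxc : x ≠ c := fun hh => hx.2 (hh ▸ cj)
    have hxd : x ≠ d := fun hh => hx.2 (hh ▸ dj)
    exact ⟨hx.1, by simp [hxc, hxd], (hB x hx.1 hx.2 hxc hxd).1⟩) (by
      intro x; simp only [Finset.mem_insert, Finset.mem_singleton]
      rintro (rfl | rfl) <;> assumption) (fun x hx hxE => by
    simp only [Finset.mem_insert, Finset.mem_singleton, not_or] at hxE
    exact (served_two H hmin h hc hd hx hxE.1 hxE.2).1)
  rw [Finset.sum_pair h.cd, wild_eq_zero hwild] at h1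
  have h2 : e + 3 ≤ ((P.X 0)ᶜ \ P.X j).card := by
    have h1 : (P.X 0)ᶜ ∩ P.X j ⊆ (P.X j).erase a := by
      intro x hx
      simp only [Finset.mem_inter, Finset.mem_compl] at hx
      exact Finset.mem_erase.2 ⟨(ne_of_mem_of_not_mem ha hx.1).symm, hx.2⟩
    have h1 := Finset.card_le_card h1
    rw [Finset.card_erase_of_mem (conf_mem' hgja)] at h1
    have h2 := Finset.card_sdiff_add_card_inter (P.X 0)ᶜ (P.X j)
    have := H.hA
    have := H.hX j q.j0
    have := H.hΔ
    omega
  have := H.wt_nonneg_g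
  have := H.wt_nonneg_r
  push_cast at h1
  omega

/-- The bound on `X 1` excludes that every free colour missing at `i` lies in `X 1` and in `X j`
while every free colour missing at `j` lies in `X 1`. -/
theorem cap_contra (H : P.Linked Δ e g r) {i j : Fin 5} (hi : i ≠ 0) (hj : j ≠ 0)
    (h1 : ∀ x, x ∉ P.X 0 → x ∉ P.X i → x ∈ P.X 1 ∧ x ∈ P.X j)
    (h2 : ∀ x, x ∉ P.X 0 → x ∉ P.X j → x ∈ P.X 1) : False := by
  have hd : Disjoint ((P.X 0)ᶜ \ P.X i) ((P.X 0)ᶜ \ P.X j) := by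
    rw [Finset.disjoint_left]
    intro x hx hx'
    simp only [Finset.mem_sdiff, Finset.mem_compl] at hx hx'
    exact hx'.2 (h1 x hx.1 hx.2).2
  have hs : ((P.X 0)ᶜ \ P.X i) ∪ ((P.X 0)ᶜ \ P.X j) ⊆ (P.X 0)ᶜ ∩ P.X 1 := by
    intro x hx
    simp only [Finset.mem_union, Finset.mem_sdiff, Finset.mem_compl] at hx
    simp only [Finset.mem_inter, Finset.mem_compl]
    rcases hx with hx | hx
    exacts [⟨hx.1, (h1 x hx.1 hx.2).1⟩, ⟨hx.1, h2 x hx.1 hx.2⟩]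
  have h3 := Finset.card_le_card hs
  rw [Finset.card_union_of_disjoint hd] at h3
  have := H.card_sdiff i hi
  have := H.card_sdiff j hj
  have := H.card_inter
  have := H.cap
  omega

end Two

end Linked
end Palette

end

section

namespace Palette
variable {K : Type*} {P : Palette K} {i j k l n : Fin 5} {a b c d : K}
variable [DecidableEq K] [Fintype K]
variable {Δ e : ℕ} {g r : K}

namespace Linked

section Two

variable (H : P.Linked Δ e g r)
  (hmin : ∀ {i j k l a b c d}, P.Fits i j k l a b c d → a ∈ P.X 0 ∨ b ∈ P.X 0 ∨ c ∈ P.X 0)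
  (hg : ∀ t, t ≠ 0 → t ≠ 1 → g ∉ P.X t)

include H hmin hg in
/-- A free colour missing at `1` conflicts at `0` with the used colour `b`, because by the choice of
`g` it does not conflict with `g`. -/
theorem two_g_conf (h : P.Fits i j 1 n g b c d) (hc : c ∉ P.X 0) (hd : d ∉ P.X 0) {x : K}
    (hx : x ∉ P.X 0) (hxc : x ≠ c) (hxd : x ≠ d) (hx1 : x ∉ P.X 1) : P.conf x 0 b j := by
  rcases (served_two H hmin h hc hd hx hxc hxd).2.1 with hh | hh
  · exact absurd (H.gc0 i x h.q.i0 h.q.ik (P.conf_symm hh)) hx1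
  · exact hh

include H hmin hg in
/-- Where the free colours other than `c` and `d` occur, when one of them is missing at `j`. -/
theorem two_g_facts (h : P.Fits i j 1 n g b c d) (hc : c ∉ P.X 0) (hd : d ∉ P.X 0) {y : K}
    (hy : y ∉ P.X 0) (hyc : y ≠ c) (hyd : y ≠ d) (hyj : y ∉ P.X j) {x : K}
    (hx : x ∉ P.X 0) (hxc : x ≠ c) (hxd : x ≠ d) :
    (x ∉ P.X 1 → x ∈ P.X i ∧ x ∈ P.X j ∧ P.conf x 0 b j) ∧
    (x ∉ P.X i → x ∈ P.X 1 ∧ x ∈ P.X j ∧ P.conf x i c 1 ∧ P.conf x 0 b j) ∧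
    (x ∉ P.X j → x ∈ P.X 1 ∧ x ∈ P.X i ∧ (P.conf x j c 1 ∨ P.conf x j d n)) := by
  have ng : ∀ {x}, x ∉ P.X 0 → g ≠ x := fun h => ne_of_mem_of_not_mem H.g0 h
  have q := h.q
  obtain ⟨ha, hb⟩ := used_two h hmin hc hd
  have s1 := served_two H hmin h hc hd hx hxc hxd
  have s2 := served_two H hmin h hc hd hy hyc hyd
  have e1 := H.gc1 i
  have e2 := H.gc1 n
  have e3 := H.gc0 i
  have f1 := H.stuck.fails (q := q.swap34) (x := y) (a := x) (b := b) (c := g) (d := c) hy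
  have f2 := H.stuck.fails (q := q) (x := y) (a := x) (b := b) (c := c) (d := g) hy
  have n1 := hg i q.i0 q.ik
  have n2 := hg j q.j0 q.jk
  have n3 := hg n q.l0 q.kl.symm
  have m1 := ng hx
  have m2 := ng hy
  have m3 := ng hc
  have m4 := ng hd
  obtain ⟨s, m, u⟩ := P.rules
  obtain ⟨q0, w1, w2, w3, w4, w5, w6, w7, w8, w9, w10, w11, w12, w13, w14, w15, w16⟩ := h
  obtain ⟨q1, q2, q3, q4, q5, q6, q7, q8, q9, q10⟩ := q
  clear hmin H hg
  have p1 : x ∉ P.X 1 → P.conf x 0 b j := by grind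
  have p2 : P.conf y 0 g i := by grind
  have p3 : x ∉ P.X 1 → x ∈ P.X i := by grind
  have p4 : x ∉ P.X i → P.conf x i c 1 := by grind
  grind

include H hmin hg in
/-- There are no wild colours, as such a colour and `g` could be placed at `i` and `j` in either
order; likewise `b` cannot be moved to `i`. -/
theorem two_g_wild (h : P.Fits i j 1 n g b c d) (hc : c ∉ P.X 0) (hd : d ∉ P.X 0) :
    (∀ x, ¬ P.Wild x) ∧ (b ∈ P.X i ∨ P.conf b i c 1 ∨ P.conf b i d n) := by
  have ng : ∀ {x}, x ∉ P.X 0 → g ≠ x := fun h => ne_of_mem_of_not_mem H.g0 h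
  have q := h.q
  obtain ⟨ha, hb⟩ := used_two h hmin hc hd
  obtain ⟨y, y0, y1, hy⟩ := H.exists_notMem_one {c, d} (Finset.card_le_two.trans (by simp))
  simp only [Finset.mem_insert, Finset.mem_singleton, not_or] at hy
  have hyb := two_g_conf H hmin hg h hc hd y0 hy.1 hy.2 y1
  have n1 := hg i q.i0 q.ik
  have n2 := hg j q.j0 q.jk
  have n3 := hg n q.l0 q.kl.symm
  have e1 := H.gc1 i
  have e2 := H.gc1 j
  have e3 := H.gc0 i
  have e4 := H.gc0 j
  have g1 := H.g1
  have m2 := ng y0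
  have m3 := ng hc
  have m4 := ng hd
  constructor
  · rintro x ⟨x0, hx⟩
    have f1 := H.stuck.fails (q := q) (x := y) (a := x) (b := g) (c := c) (d := d) y0
    have f2 := H.stuck.fails (q := q) (x := y) (a := g) (b := x) (c := c) (d := d) y0
    have h1 := hx i q.i0
    have h2 := hx j q.j0
    have h3 := hx 1 q.k0
    have h4 := hx n q.l0
    obtain ⟨s, m, u⟩ := P.rules
    obtain ⟨q0, w1, w2, w3, w4, w5, w6, w7, w8, w9, w10, w11, w12, w13, w14, w15, w16⟩ := h
    obtain ⟨q1, q2, q3, q4, q5, q6, q7, q8, q9, q10⟩ := q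
    clear hmin H hg hx
    grind
  · have f1 := H.stuck.fails (q := q) (x := y) (a := b) (b := g) (c := c) (d := d) y0
    obtain ⟨s, m, u⟩ := P.rules
    obtain ⟨q0, w1, w2, w3, w4, w5, w6, w7, w8, w9, w10, w11, w12, w13, w14, w15, w16⟩ := h
    obtain ⟨q1, q2, q3, q4, q5, q6, q7, q8, q9, q10⟩ := q
    clear hmin H hg
    grind

theorem wt_ge_of_mem (q : Quad i j k l) {x : K} (h : x ∉ P.X 0) :
    P.wt x = ind (P.X i) x + ind (P.X j) x + ind (P.X k) x + ind (P.X l) x - 2 := by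
  rw [wt_eq q, ind_of_notMem h]; ring

include H hmin hg in
/-- The bound when `g` is placed at `i` and all free colours other than `c` and `d` lie in `X j`. -/
theorem two_g_full (h : P.Fits i j 1 n g b c d) (hc : c ∉ P.X 0) (hd : d ∉ P.X 0)
    (hj : ∀ x, x ∉ P.X 0 → x ≠ c → x ≠ d → x ∈ P.X j) : 2 ≤ ∑ x, P.wt x := by
  have ng : ∀ {x}, x ∉ P.X 0 → g ≠ x := fun h => ne_of_mem_of_not_mem H.g0 h
  have q := h.q
  obtain ⟨ha, hb⟩ := used_two h hmin hc hd
  have hXj : (P.X 0)ᶜ \ {c, d} = P.X j := by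
    refine Finset.eq_of_subset_of_card_le (fun x hx => ?_) ?_
    · simp only [Finset.mem_sdiff, Finset.mem_compl, Finset.mem_insert, Finset.mem_singleton,
        not_or] at hx
      exact hj x hx.1 hx.2.1 hx.2.2
    · have := Finset.le_card_sdiff {c, d} (P.X 0)ᶜ
      rw [Finset.card_pair h.cd] at this
      have := H.hX j q.j0
      have := H.hA
      omega
  have cj : c ∉ P.X j := by simp [← hXj]
  have dj : d ∉ P.X j := by simp [← hXj]
  have key : ∀ y, y ∉ P.X 0 → y ∉ P.X 1 → y ≠ c → y ≠ d →
      1 ≤ P.wt y ∧ d ∈ P.X 1 ∧ c ∈ P.X n ∧ c ∈ P.X i := by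
    intro y y0 y1 yc yd
    have c0 := H.stuck.fails (q := q) (x := c) (a := g) (b := b) (c := y) (d := d) hc
    have n1 := hg i q.i0 q.ik
    have n2 := hg j q.j0 q.jk
    have n3 := hg n q.l0 q.kl.symm
    have e1 := H.gc1 i
    have e2 := H.gc1 n
    have e3 := H.gc0 i
    have m2 := ng y0
    have m3 := ng hc
    have m4 := ng hd
    have yj := hj y y0 yc yd
    have s0 := two_g_conf H hmin hg h hc hd y0 yc yd y1
    have s1 := served_two H hmin h hc hd y0 yc yd
    have f1 := fails_three hmin (q := q.swap12.swap23.swap34) hd y0 hc g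
    have f2 := fails_three hmin (q := q.swap12.swap23) hd y0 hc g
    rw [wt_ge_of_mem q y0] at *
    obtain ⟨s, m, u⟩ := P.rules
    obtain ⟨q0, w1, w2, w3, w4, w5, w6, w7, w8, w9, w10, w11, w12, w13, w14, w15, w16⟩ := h
    obtain ⟨q1, q2, q3, q4, q5, q6, q7, q8, q9, q10⟩ := q
    clear hmin H hg hj hXj
    have p1 : P.conf y 1 d n := by grind
    have p2 : y ∈ P.X i := by grind
    have p3 : y ∈ P.X n := (m _ _ _ _ p1).2.1
    refine ⟨?_, (m _ _ _ _ p1).2.2.1, by grind, by grind⟩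
    rw [ind_of_mem p2, ind_of_mem p3, ind_of_mem yj, ind_of_notMem y1]
    omega
  obtain ⟨y, y0, y1, hy⟩ := H.exists_notMem_one {c, d} (Finset.card_le_two.trans (by simp))
  simp only [Finset.mem_insert, Finset.mem_singleton, not_or] at hy
  obtain ⟨-, d1, cn, ci⟩ := key y y0 y1 hy.1 hy.2
  have hwc : 0 ≤ P.wt c := by
    rw [wt_ge_of_mem q hc, ind_of_mem ci, ind_of_mem cn]
    have := ind_nonneg (P.X j) c
    have := ind_nonneg (P.X 1) c
    omega
  have hwd : -1 ≤ P.wt d := by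
    rw [wt_ge_of_mem q hd, ind_of_mem d1]
    have := ind_nonneg (P.X i) d
    have := ind_nonneg (P.X j) d
    have := ind_nonneg (P.X n) d
    omega
  have h1 := H.bound (((P.X 0)ᶜ \ P.X 1) \ {c}) {c, d} (fun x hx => by
    simp only [Finset.mem_sdiff, Finset.mem_compl, Finset.mem_singleton] at hx
    have hxd : x ≠ d := fun hh => hx.1.2 (hh ▸ d1)
    exact ⟨hx.1.1, by simp [hx.2, hxd], (key x hx.1.1 hx.1.2 hx.2 hxd).1⟩) (by
      intro x; simp only [Finset.mem_insert, Finset.mem_singleton]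
      rintro (rfl | rfl) <;> assumption) (fun x hx hxE => by
    simp only [Finset.mem_insert, Finset.mem_singleton, not_or] at hxE
    exact (served_two H hmin h hc hd hx hxE.1 hxE.2).1)
  rw [Finset.sum_pair h.cd, wild_eq_zero (two_g_wild H hmin hg h hc hd).1] at h1
  have := H.card_sdiff_one_erase c
  have := H.wt_nonneg_g
  have := H.wt_nonneg_r
  push_cast at h1
  omega

set_option maxHeartbeats 1000000 in
include H hmin hg in
/-- The bound when `g` is placed at `i` and a free colour other than `c` and `d` is missing at `j`.
-/
theorem two_g_not_full (h : P.Fits i j 1 n g b c d) (hc : c ∉ P.X 0) (hd : d ∉ P.X 0) {z : K}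
    (hz : z ∉ P.X 0) (hzc : z ≠ c) (hzd : z ≠ d) (hzj : z ∉ P.X j) : 2 ≤ ∑ x, P.wt x := by
  have q := h.q
  obtain ⟨ha, hb⟩ := used_two h hmin hc hd
  obtain ⟨hwild, hst⟩ := two_g_wild H hmin hg h hc hd
  have hF := fun x (hx : x ∉ P.X 0) (hxc : x ≠ c) (hxd : x ≠ d) =>
    two_g_facts H hmin hg h hc hd hz hzc hzd hzj hx hxc hxd
  -- Some free colour other than `c` and `d` is missing at `i`.
  obtain ⟨w, w0, wi, wc, wd⟩ : ∃ w, w ∉ P.X 0 ∧ w ∉ P.X i ∧ w ≠ c ∧ w ≠ d := by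
    by_contra! hn
    obtain ⟨v, hv, hv'⟩ : ∃ v ∈ P.X i, v ∉ (P.X 0)ᶜ \ {c, d} := by
      rcases hst with hh | hh | hh
      · exact ⟨b, hh, by simp [hb]⟩
      · exact ⟨c, conf_mem' hh, by simp⟩
      · exact ⟨d, conf_mem' hh, by simp⟩
    have h1 : insert v ((P.X 0)ᶜ \ {c, d}) ⊆ P.X i := by
      intro x hx
      rcases Finset.mem_insert.1 hx with rfl | hx
      · exact hv
      simp only [Finset.mem_sdiff, Finset.mem_compl, Finset.mem_insert, Finset.mem_singleton,
        not_or] at hx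
      by_contra hh
      exact hx.2.2 (hn x hx.1 hh hx.2.1)
    have h1 := Finset.card_le_card h1
    rw [Finset.card_insert_of_notMem hv'] at h1
    have := Finset.le_card_sdiff {c, d} (P.X 0)ᶜ
    rw [Finset.card_pair h.cd] at this
    have := H.hX i q.i0
    have := H.hA
    omega
  obtain ⟨w1, wj, wic, -⟩ := (hF w w0 wc wd).2.1 wi
  have ci := conf_mem' wic
  obtain ⟨z1, zi, hzs⟩ := (hF z hz hzc hzd).2.2 hzj
  have c1 := h.ck
  have hpos : ∀ x, x ∉ P.X 0 → x ≠ c → x ≠ d → 0 ≤ P.wt x := fun x hx hxc hxd =>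
    (served_two H hmin h hc hd hx hxc hxd).1
  have hgr := H.wt_nonneg_g
  have hgr' := H.wt_nonneg_r
  -- Either `d` conflicts with all free colours missing at `1`, or one of these can replace `c`.
  by_cases hI : ∀ y, y ∉ P.X 0 → y ∉ P.X 1 → y ≠ c → y ≠ d → P.conf y 1 d n
  · obtain ⟨y, y0, y1, hy⟩ := H.exists_notMem_one {c, d} (Finset.card_le_two.trans (by simp))
    simp only [Finset.mem_insert, Finset.mem_singleton, not_or] at hy
    have d1 := conf_mem' (hI y y0 y1 hy.1 hy.2)
    have h1 := H.bound (((P.X 0)ᶜ \ P.X 1) \ {c}) {c, d} (fun x hx => by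
      simp only [Finset.mem_sdiff, Finset.mem_compl, Finset.mem_singleton] at hx
      have hxd : x ≠ d := fun hh => hx.1.2 (hh ▸ d1)
      refine ⟨hx.1.1, by simp [hx.2, hxd], ?_⟩
      obtain ⟨p1, p2, -⟩ := (hF x hx.1.1 hx.2 hxd).1 hx.1.2
      rw [wt_ge_of_mem q hx.1.1, ind_of_mem p1, ind_of_mem p2,
        ind_of_mem (P.conf_mem (hI x hx.1.1 hx.1.2 hx.2 hxd)), ind_of_notMem hx.1.2]
      omega) (by
        intro x; simp only [Finset.mem_insert, Finset.mem_singleton]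
        rintro (rfl | rfl) <;> assumption) (fun x hx hxE => by
      simp only [Finset.mem_insert, Finset.mem_singleton, not_or] at hxE
      exact hpos x hx hxE.1 hxE.2)
    have hcd : -1 ≤ P.wt c + P.wt d := by
      have e1 : 1 ≤ ind (P.X j) c + ind (P.X j) d := by
        have e1 := ind_nonneg (P.X j) c
        have e2 := ind_nonneg (P.X j) d
        rcases hzs with hh | hh <;> rw [ind_of_mem (conf_mem' hh)] <;> omega
      rw [wt_ge_of_mem q hc, wt_ge_of_mem q hd, ind_of_mem ci, ind_of_mem d1]
      have := ind_nonneg (P.X 1) c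
      have := ind_nonneg (P.X n) c
      have := ind_nonneg (P.X i) d
      have := ind_nonneg (P.X n) d
      omega
    rw [Finset.sum_pair h.cd, wild_eq_zero hwild] at h1
    have := H.card_sdiff_one_erase c
    push_cast at h1
    omega
  · push Not at hI
    obtain ⟨y, y0, y1, yc, yd, hy⟩ := hI
    obtain ⟨yi, yj, yb⟩ := (hF y y0 yc yd).1 y1
    have h' : P.Fits i j 1 n g b y d := by
      have n1 := hg i q.i0 q.ik
      have e1 := H.gc1 i y q.i0 q.ik
      have m2 := ne_of_mem_of_not_mem H.g0 y0
      have m3 := ne_of_mem_of_not_mem hb y0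
      exact ⟨q, h.ai, h.bj, y1, h.dl, h.ab, m2, h.ad, m3, h.bd, yd, h.hab, fun hh => y0 (e1 hh),
        h.had, fun hh => absurd (conf_unique' (P.conf_symm hh) yb) q.k0,
        h.hbd, hy⟩
    have hzy : z ≠ y := fun hh => hzj (hh ▸ yj)
    have hF' := fun x (hx : x ∉ P.X 0) (hxc : x ≠ y) (hxd : x ≠ d) =>
      two_g_facts H hmin hg h' y0 hd hz hzy hzd hzj hx hxc hxd
    have hFc := hF' c hc yc.symm h.cd
    have hpc : 0 ≤ P.wt c := (served_two H hmin h' y0 hd hc yc.symm h.cd).1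
    have swap : ∀ x, x ∉ P.X 0 → x ∉ P.X n → x ≠ c → x ≠ d → ¬ P.conf x n b j → ¬ P.conf x n c 1 →
        P.Fits i j 1 n g b c x := by
      intro x x0 xn xc xd h1 h2
      have n1 := hg n q.l0 q.kl.symm
      exact ⟨q, h.ai, h.bj, h.ck, xn, h.ab, h.ac, ne_of_mem_of_not_mem H.g0 x0, h.bc,
        ne_of_mem_of_not_mem hb x0, xc.symm, h.hab, h.hac, fun hh => n1 (P.conf_mem hh), h.hbc,
        fun hh => h1 (P.conf_symm hh), fun hh => h2 (P.conf_symm hh)⟩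
    -- If some `x` missing at `n` can replace `d` as well, then the description of the missing
    -- colours also holds for `c` and `d`, which contradicts the bound on `X 1`.
    by_cases hs : ∃ x, x ∉ P.X 0 ∧ x ≠ c ∧ x ≠ d ∧ (x ∉ P.X 1 ∨ x ∉ P.X i) ∧ x ∉ P.X n
    · obtain ⟨x, x0, xc, xd, x1, xn⟩ := hs
      have hxF := hF x x0 xc xd
      have hxb : P.conf x 0 b j := by
        rcases x1 with hh | hh
        exacts [(hxF.1 hh).2.2, (hxF.2.1 hh).2.2.2]
      have h'' := swap x x0 xn xc xd (fun hh => q.l0 (conf_unique' hh hxb)) (fun hh => by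
        rcases x1 with h1 | h1
        exacts [h1 (P.conf_mem hh), q.il (conf_unique' (hxF.2.1 h1).2.2.1 hh)])
      have hxj : x ∈ P.X j := P.conf_mem hxb
      have hFd := two_g_facts H hmin hg h'' hc x0 hz hzc (fun hh => hzj (hh ▸ hxj)) hzj hd
        h.cd.symm xd.symm
      refine (H.cap_contra q.i0 q.j0 (fun v v0 vi => ?_) (fun v v0 vj => ?_)).elim
      · by_cases vc : v = c
        · subst vc; exact ⟨(hFc.2.1 vi).1, (hFc.2.1 vi).2.1⟩
        by_cases vd : v = d
        · subst vd; exact ⟨(hFd.2.1 vi).1, (hFd.2.1 vi).2.1⟩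
        exact ⟨((hF v v0 vc vd).2.1 vi).1, ((hF v v0 vc vd).2.1 vi).2.1⟩
      · by_cases vc : v = c
        · subst vc; exact (hFc.2.2 vj).1
        by_cases vd : v = d
        · subst vd; exact (hFd.2.2 vj).1
        exact ((hF v v0 vc vd).2.2 vj).1
    · push Not at hs
      have hd2 := neg_two_le_wt P d
      set T := (((P.X 0)ᶜ \ P.X 1) \ {c, d}) ∪ (((P.X 0)ᶜ \ P.X i) \ {c, d}) with hT
      have hTw : ∀ x ∈ T, x ∉ P.X 0 ∧ x ∉ ({d} : Finset K) ∧ 1 ≤ P.wt x := by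
        intro x hx
        simp only [hT, Finset.mem_union, Finset.mem_sdiff, Finset.mem_compl, Finset.mem_insert,
          Finset.mem_singleton, not_or] at hx
        rcases hx with hx | hx
        · refine ⟨hx.1.1, by simp [hx.2.2], ?_⟩
          obtain ⟨p1, p2, -⟩ := (hF x hx.1.1 hx.2.1 hx.2.2).1 hx.1.2
          rw [wt_ge_of_mem q hx.1.1, ind_of_mem p1, ind_of_mem p2, ind_of_notMem hx.1.2,
            ind_of_mem (hs x hx.1.1 hx.2.1 hx.2.2 (Or.inl hx.1.2))]
          omega
        · refine ⟨hx.1.1, by simp [hx.2.2], ?_⟩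
          obtain ⟨p1, p2, -⟩ := (hF x hx.1.1 hx.2.1 hx.2.2).2.1 hx.1.2
          rw [wt_ge_of_mem q hx.1.1, ind_of_mem p1, ind_of_mem p2, ind_of_notMem hx.1.2,
            ind_of_mem (hs x hx.1.1 hx.2.1 hx.2.2 (Or.inr hx.1.2))]
          omega
      have hpos' : ∀ x, x ∉ P.X 0 → x ∉ ({d} : Finset K) → 0 ≤ P.wt x := fun x hx hxE => by
        by_cases hxc : x = c
        · exact hxc ▸ hpc
        · exact hpos x hx hxc (by simpa using hxE)
      have hE : ∀ x ∈ ({d} : Finset K), x ∉ P.X 0 := by simpa using hd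
      have hdis : Disjoint (((P.X 0)ᶜ \ P.X 1) \ {c, d}) (((P.X 0)ᶜ \ P.X i) \ {c, d}) := by
        rw [Finset.disjoint_left]
        intro x hx hx'
        simp only [Finset.mem_sdiff, Finset.mem_compl, Finset.mem_insert, Finset.mem_singleton,
          not_or] at hx hx'
        exact hx.1.2 ((hF x hx.1.1 hx.2.1 hx.2.2).2.1 hx'.1.2).1
      have hcard : T.card = _ := Finset.card_union_of_disjoint hdis
      have c2 := H.card_sdiff_one_erase c
      have c3 : (((P.X 0)ᶜ \ P.X 1) \ {c}).card ≤ (((P.X 0)ᶜ \ P.X 1) \ {c, d}).card + 1 := by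
        refine (Finset.card_le_card fun x hx => ?_).trans (Finset.card_insert_le d _)
        simp only [Finset.mem_sdiff, Finset.mem_singleton, Finset.mem_insert] at hx ⊢
        tauto
      have c4 : 1 ≤ (((P.X 0)ᶜ \ P.X i) \ {c, d}).card := Finset.card_pos.2 ⟨w, by
        simp [w0, wi, wc, wd]⟩
      have h1 := H.bound T {d} hTw hE hpos'
      rw [Finset.sum_singleton, wild_eq_zero hwild] at h1
      push_cast at h1
      by_cases hd1 : -1 ≤ P.wt d
      · omega
      have hdz : ∀ t, t ≠ 0 → d ∉ P.X t := by
        intro t _ ht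
        refine hd1 ?_
        have := Finset.single_le_sum (f := fun t => ind (P.X t) d) (fun t _ => ind_nonneg _ _)
          (Finset.mem_univ t)
        simp only [ind_of_mem ht] at this
        unfold wt
        omega
      have hzn : P.conf z j c 1 := hzs.resolve_right fun hh => hdz j q.j0 (conf_mem' hh)
      by_cases zn : z ∈ P.X n
      · have h1 := H.bound (insert z T) {d} (by
          intro x hx
          rcases Finset.mem_insert.1 hx with rfl | hx
          · refine ⟨hz, by simp [hzd], ?_⟩
            rw [wt_ge_of_mem q hz, ind_of_mem z1, ind_of_mem zi, ind_of_mem zn, ind_of_notMem hzj]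
            omega
          · exact hTw x hx) hE hpos'
        rw [Finset.sum_singleton, wild_eq_zero hwild, Finset.card_insert_of_notMem (by
          simp [hT, z1, zi])] at h1
        push_cast at h1
        omega
      · have h'' := swap z hz zn hzc hzd (fun hh => hzj (P.conf_mem hh))
          (fun hh => q.jl (conf_unique' hzn hh))
        have := (served_two H hmin h'' hc hz hd h.cd.symm hzd.symm).1
        omega

include H hmin hg in
/-- The bound for two used colours when `g` lies in `X 0` and `X 1` only. -/
theorem two_of_g (h : P.Fits i j k l a b c d) (hc : c ∉ P.X 0) (hd : d ∉ P.X 0) :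
    2 ≤ ∑ x, P.wt x := by
  have main : ∀ {i j n b c d}, P.Fits i j 1 n g b c d → c ∉ P.X 0 → d ∉ P.X 0 →
      2 ≤ ∑ x, P.wt x := by
    intro i j n b c d h hc hd
    by_cases hj : ∀ x, x ∉ P.X 0 → x ≠ c → x ≠ d → x ∈ P.X j
    · exact two_g_full H hmin hg h hc hd hj
    · push Not at hj
      obtain ⟨z, hz, hzc, hzd, hzj⟩ := hj
      exact two_g_not_full H hmin hg h hc hd hz hzc hzd hzj
  have main' : ∀ {i j n a b c d}, P.Fits i j 1 n a b c d → c ∉ P.X 0 → d ∉ P.X 0 →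
      2 ≤ ∑ x, P.wt x := by
    intro i j n a b c d h hc hd
    have gc := ne_of_mem_of_not_mem H.g0 hc
    have gd := ne_of_mem_of_not_mem H.g0 hd
    by_cases hgb : g = b
    · subst hgb; exact main h.swap12 hc hd
    rcases h.replace_first hgb gc gd with hh | hh | hh | hh | hh
    · exact (hg i h.q.i0 h.q.ik hh).elim
    · exact (hg j h.q.j0 h.q.jk (P.conf_mem hh)).elim
    · exact (hc (H.gc1 i c h.q.i0 h.q.ik hh)).elim
    · exact (hg n h.q.l0 h.q.kl.symm (P.conf_mem hh)).elim
    · exact main hh hc hd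
  rcases h.q.eq_or 1 with hh | rfl | rfl | rfl | rfl
  · exact absurd hh (by decide)
  · exact two_g_used H hmin h hc hd hg
  · exact two_g_used H hmin h.swap12 hc hd hg
  · exact main' h hc hd
  · exact main' h.swap34 hd hc

end Two
end Linked
end Palette

end

/-! ### Linked palettes: two used colours and a wild colour -/

section

namespace Palette
variable {K : Type*} {P : Palette K} {i j k l n : Fin 5} {a b c d : K}
variable [DecidableEq K] [Fintype K]
variable {Δ e : ℕ} {g r : K}

theorem ind_le_wt {t : Fin 5} {x : K} : ind (P.X t) x - 2 ≤ P.wt x := by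
  have := Finset.single_le_sum (f := fun t => ind (P.X t) x) (fun t _ => ind_nonneg _ _)
    (Finset.mem_univ t)
  unfold wt
  omega

theorem neg_one_le_wt {t : Fin 5} {x : K} (h : x ∈ P.X t) : -1 ≤ P.wt x := by
  have := ind_le_wt (P := P) (t := t) (x := x)
  rw [ind_of_mem h] at this
  omega

theorem wt_nonneg_of_mem_pair (q : Quad i j k l) {x : K} (hi : x ∈ P.X i) (hj : x ∈ P.X j) :
    0 ≤ P.wt x := by
  rw [wt_eq q, ind_of_mem hi, ind_of_mem hj]
  have := ind_nonneg (P.X 0) x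
  have := ind_nonneg (P.X k) x
  have := ind_nonneg (P.X l) x
  omega

theorem one_le_wt_of_mem (q : Quad i j k l) {x : K} (hi : x ∈ P.X i) (hj : x ∈ P.X j)
    (hk : x ∈ P.X k) : 1 ≤ P.wt x := by
  rw [wt_eq q, ind_of_mem hi, ind_of_mem hj, ind_of_mem hk]
  have := ind_nonneg (P.X 0) x
  have := ind_nonneg (P.X l) x
  omega

namespace Linked

/-- If all free colours other than `c` and `d` lie in `X j`, they make up all of `X j`, and `e = 0`.
-/
theorem eq_of_full (H : P.Linked Δ e g r) (hcd : c ≠ d) (hc : c ∉ P.X 0) (hd : d ∉ P.X 0) (hj0 : j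
    ≠ 0)
    (hj : ∀ x, x ∉ P.X 0 → x ≠ c → x ≠ d → x ∈ P.X j) :
    e = 0 ∧ ∀ x, x ∈ P.X j → x ∉ P.X 0 ∧ x ≠ c ∧ x ≠ d := by
  have h1 : (P.X 0)ᶜ \ {c, d} ⊆ P.X j := fun x hx => by
    simp only [Finset.mem_sdiff, Finset.mem_compl, Finset.mem_insert, Finset.mem_singleton,
      not_or] at hx
    exact hj x hx.1 hx.2.1 hx.2.2
  have h2 : ((P.X 0)ᶜ \ {c, d}).card + 2 = Δ + e + 1 := by
    rw [← H.hA, ← Finset.card_pair hcd]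
    exact Finset.card_sdiff_add_card_eq_card (by
      intro x; simp only [Finset.mem_insert, Finset.mem_singleton, Finset.mem_compl]
      rintro (rfl | rfl) <;> assumption)
  have h3 := H.hX j hj0
  have h4 := Finset.card_le_card h1
  have h5 := Finset.eq_of_subset_of_card_le h1 (by omega)
  exact ⟨by omega, fun x hx => by rw [← h5] at hx; simpa using hx⟩

section Two

variable (H : P.Linked Δ e g r)
  (hmin : ∀ {i j k l a b c d}, P.Fits i j k l a b c d → a ∈ P.X 0 ∨ b ∈ P.X 0 ∨ c ∈ P.X 0)

include H hmin in
/-- The free colours of a quadruple do not both have weight `-2`: otherwise they could be placed at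
any two indices. -/
theorem neg_three_le (h : P.Fits i j k l a b c d) (hc : c ∉ P.X 0) (hd : d ∉ P.X 0) :
    -3 ≤ P.wt c + P.wt d := by
  by_contra hn
  have h1 := neg_two_le_wt P c
  have h2 := neg_two_le_wt P d
  have hcz : ∀ t, c ∉ P.X t := fun t ht => by have := neg_one_le_wt ht; omega
  have hdz : ∀ t, d ∉ P.X t := fun t ht => by have := neg_one_le_wt ht; omega
  obtain ⟨ha, hb⟩ := used_two h hmin hc hd
  have main : ∀ {i j k l a b c d}, P.Fits i j k l a b c d → c ∉ P.X 0 → d ∉ P.X 0 →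
      (∀ t, c ∉ P.X t) → (∀ t, d ∉ P.X t) → a ∈ P.X 0 → b ∈ P.X 0 → ∀ x, x ∉ P.X 0 → x ≠ c →
      x ≠ d → x ∈ P.X l ∧ x ∈ P.X i := by
    intro i j k l a b c d h hc hd hcz hdz ha hb x hx xc xd
    have s1 := served_two H hmin h hc hd hx xc xd
    have q := h.q
    have f1 := fails_three hmin (q := q.swap23.swap34) hc hd hx b
    have f2 := fails_three hmin (q := q.swap12.swap23.swap34) hc hd hx a
    obtain ⟨s, m, u⟩ := P.rules
    have c1 := hcz i
    have c2 := hcz j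
    have c3 := hcz k
    have c4 := hcz l
    have d1 := hdz i
    have d2 := hdz j
    have d3 := hdz k
    have d4 := hdz l
    obtain ⟨q0, w1, w2, w3, w4, w5, w6, w7, w8, w9, w10, w11, w12, w13, w14, w15, w16⟩ := h
    obtain ⟨q1, q2, q3, q4, q5, q6, q7, q8, q9, q10⟩ := q
    clear hmin H hcz hdz hn h1 h2
    grind
  obtain ⟨y, y0, y1, hy⟩ := H.exists_notMem_one {c, d} (Finset.card_le_two.trans (by simp))
  simp only [Finset.mem_insert, Finset.mem_singleton, not_or] at hy
  have p1 := main h hc hd hcz hdz ha hb y y0 hy.1 hy.2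
  have p2 := main h.swap12.swap34 hd hc hdz hcz hb ha y y0 hy.2 hy.1
  rcases h.q.eq_or 1 with hh | rfl | rfl | rfl | rfl
  · exact absurd hh (by decide)
  · exact y1 p1.2
  · exact y1 p2.2
  · exact y1 p2.1
  · exact y1 p1.1

include H hmin in
/-- The bound for two used colours when neither `c` nor `d` can be exchanged for another free
colour. -/
theorem two_of_rigid (h : P.Fits i j k l a b c d) (hc : c ∉ P.X 0) (hd : d ∉ P.X 0)
    (hw : ∀ x, ¬ P.Wild x) (hg : 1 ≤ P.wt g)
    (hk : ∀ x, x ∉ P.X 0 → x ≠ c → x ≠ d → ¬ P.Fits i j k l a b x d)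
    (hl : ∀ x, x ∉ P.X 0 → x ≠ c → x ≠ d → ¬ P.Fits i j k l a b c x) : 2 ≤ ∑ x, P.wt x := by
  obtain ⟨ha, hb⟩ := used_two h hmin hc hd
  have h1 := H.bound ((P.X 0)ᶜ \ {c, d}) {c, d} (fun x hx => by
    simp only [Finset.mem_sdiff, Finset.mem_compl, Finset.mem_insert, Finset.mem_singleton,
      not_or] at hx ⊢
    obtain ⟨x0, xc, xd⟩ := hx
    refine ⟨x0, ⟨xc, xd⟩, ?_⟩
    have na := (ne_of_mem_of_not_mem ha x0).symm
    have nb := (ne_of_mem_of_not_mem hb x0).symm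
    have e2 := h.swap23.swap12.replace_first na nb xd
    have e3 := fun hh : P.Fits l i j k x a b c => hl x x0 xc xd hh.swap12.swap23.swap34
    have e4 := fun hh : P.Fits k i j l x a b d => hk x x0 xc xd hh.swap12.swap23
    have e5 := wt_of_two H.stuck h hmin hc hd x0 xc xd
    refine (e5.2 ?_).2.2 ?_
    · have e1 := h.swap34.swap23.swap12.replace_first na nb xc
      grind
    · grind) (by
      intro x; simp only [Finset.mem_insert, Finset.mem_singleton]
      rintro (rfl | rfl) <;> assumption) (fun x hx hxE => by
    simp only [Finset.mem_insert, Finset.mem_singleton, not_or] at hxE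
    exact (served_two H hmin h hc hd hx hxE.1 hxE.2).1)
  rw [Finset.sum_pair h.cd, wild_eq_zero hw] at h1
  have := neg_three_le H hmin h hc hd
  have := H.wt_nonneg_r
  have := H.hA
  have := H.hΔ
  have := Finset.le_card_sdiff {c, d} (P.X 0)ᶜ
  rw [Finset.card_pair h.cd] at this
  push_cast at h1
  omega

include H hmin in
/-- If the wild colour `a` is placed at `i`, a free colour missing at `i` conflicts there with both
`c` and `d`, since `a` can be moved to their indices, and at `0` with `b`. -/
theorem two_wild_conf (h : P.Fits i j k l a b c d) (hc : c ∉ P.X 0) (hd : d ∉ P.X 0)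
    (hw : P.Wild a) {x : K} (hx : x ∉ P.X 0) (xc : x ≠ c) (xd : x ≠ d) (xi : x ∉ P.X i) :
    P.conf x i c k ∧ P.conf x i d l ∧ P.conf x 0 b j := by
  have main : ∀ {k l c d}, P.Fits i j k l a b c d → c ∉ P.X 0 → d ∉ P.X 0 → x ≠ c → x ≠ d →
      P.conf x i d l ∧ P.conf x 0 b j := by
    intro k l c d h hc hd xc xd
    have q := h.q
    obtain ⟨y, y0, yj, yd⟩ := H.exists_notMem j q.j0 d
    obtain ⟨ha, hb⟩ := used_two h hmin hc hd
    have s1 := served_two H hmin h hc hd hx xc xd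
    have s2 := H.stuck.blocked h y0
    have w1 := hw.2 i q.i0
    have w2 := hw.2 j q.j0
    have w3 := hw.2 k q.k0
    have w4 := hw.2 l q.l0
    have f1 := H.stuck.fails (q := q) (a := x) (b := b) (c := a) (d := d) y0
    obtain ⟨s, m, u⟩ := P.rules
    obtain ⟨q0, w1, w2, w3, w4, w5, w6, w7, w8, w9, w10, w11, w12, w13, w14, w15, w16⟩ := h
    obtain ⟨q1, q2, q3, q4, q5, q6, q7, q8, q9, q10⟩ := q
    clear hmin H hw
    grind
  exact ⟨(main h.swap34 hd hc xd xc).1, main h hc hd xc xd⟩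

include H hmin in
/-- The bound for two used colours, one of them a wild colour placed at `i`, when a free colour
other than `c` and `d` is missing at `i`. -/
theorem two_of_wild_of_missing (h : P.Fits i j k l a b c d) (hc : c ∉ P.X 0) (hd : d ∉ P.X 0)
    (hw : P.Wild a) (hg : 1 ≤ P.wt g) {v : K} (v0 : v ∉ P.X 0) (vc : v ≠ c) (vd : v ≠ d)
    (vi : v ∉ P.X i) : 2 ≤ ∑ x, P.wt x := by
  have q := h.q
  have hr := H.wt_nonneg_r
  obtain ⟨hv1, hv2, hv3⟩ := two_wild_conf H hmin h hc hd hw v0 vc vd vi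
  have ci := conf_mem' hv1
  have di := conf_mem' hv2
  have hT : ∀ x, x ∉ P.X 0 → x ∉ P.X i → x ∈ P.X j ∧ 1 ≤ P.wt x := by
    intro x x0 xi
    have p := two_wild_conf H hmin h hc hd hw x0 (fun hh => xi (hh ▸ ci)) (fun hh => xi (hh ▸ di))
      xi
    have xj := P.conf_mem p.2.2
    exact ⟨xj, one_le_wt_of_mem q.swap12.swap23.swap34 xj (P.conf_mem p.1) (P.conf_mem p.2.1)⟩
  have hpos : ∀ x, x ∉ P.X 0 → x ≠ c → x ≠ d → 0 ≤ P.wt x := fun x hx hxc hxd =>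
    (served_two H hmin h hc hd hx hxc hxd).1
  have hcard := H.card_sdiff i q.i0
  have hwc := neg_one_le_wt ci
  have hwd := neg_one_le_wt di
  -- Either `X j` consists of all free colours other than `c` and `d`, or one of them is missing.
  by_cases hj : ∀ x, x ∉ P.X 0 → x ≠ c → x ≠ d → x ∈ P.X j
  · obtain ⟨rfl, hXj⟩ := H.eq_of_full h.cd hc hd q.j0 hj
    have cj : c ∉ P.X j := fun hh => (hXj c hh).2.1 rfl
    have dj : d ∉ P.X j := fun hh => (hXj d hh).2.2 rfl
    have gj : g ∉ P.X j := fun hh => (hXj g hh).1 H.g0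
    have hj1 : j ≠ 1 := fun hh => gj (hh ▸ H.g1)
    have hone : P.wild.card ≤ 1 := by
      rw [Finset.card_le_one]
      have : ∀ x ∈ P.wild, x = a := by
        intro x hx
        rw [mem_wild] at hx
        by_contra hxa
        have x0 := hx.2
        have h' := (h.swap12.set_wild hx hxa (ne_of_mem_of_not_mem hx.1 hc)
          (ne_of_mem_of_not_mem hx.1 hd)).swap12
        have h1 := (two_wild_conf H hmin h' hc hd hw v0 vc vd vi).2.2
        have f1 := H.stuck.fails (q := q.swap23) (x := v) (a := a) (b := x) (c := c) (d := d) v0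
        have w1 := hx.2 k q.k0
        have w2 := hx.2 j q.j0
        have w3 := hx.2 l q.l0
        have w4 := hw.2 j q.j0
        have w5 := hw.2 k q.k0
        have w6 := hw.2 l q.l0
        have xc := ne_of_mem_of_not_mem hx.1 hc
        have xd := ne_of_mem_of_not_mem hx.1 hd
        obtain ⟨s, m, u⟩ := P.rules
        obtain ⟨q0, w1, w2, w3, w4, w5, w6, w7, w8, w9, w10, w11, w12, w13, w14, w15, w16⟩ := h
        obtain ⟨q1, q2, q3, q4, q5, q6, q7, q8, q9, q10⟩ := q
        clear hmin H hw hx x0 hpos hT hj hXj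
        grind
      exact fun x hx y hy => (this x hx).trans (this y hy).symm
    have hga : g ≠ a := fun hh => hw.2 1 (by decide) (hh ▸ H.g1)
    have h' : P.Fits i j k l a g c d := by
      refine (h.swap12.replace_first hga (ne_of_mem_of_not_mem H.g0 hc)
        (ne_of_mem_of_not_mem H.g0 hd)).elim (fun hh => (gj hh).elim) fun hh => ?_
      rcases hh with hh | hh | hh | hh
      exacts [(hw.2 j q.j0 (conf_mem' hh)).elim, (cj (conf_mem' hh)).elim,
        (dj (conf_mem' hh)).elim, hh.swap12]
    have hT1 : ∀ x, x ∉ P.X 0 → x ∉ P.X i → x ∈ P.X 1 := fun x x0 xi =>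
      H.gc0 j x q.j0 hj1 (P.conf_symm (two_wild_conf H hmin h' hc hd hw x0
        (fun hh => xi (hh ▸ ci)) (fun hh => xi (hh ▸ di)) xi).2.2)
    have key : ∀ x, x ∉ P.X 0 → x ≠ c → x ≠ d → 1 ≤ P.wt x := by
      intro x x0 xc xd
      by_cases xi : x ∉ P.X i
      · exact (hT x x0 xi).2
      rw [not_not] at xi
      have xj := hj x x0 xc xd
      have two : ∀ {l c d}, P.Fits i j 1 l a b c d → c ∉ P.X 0 → d ∉ P.X 0 → c ∉ P.X j →
          d ∉ P.X j → x ≠ c → x ≠ d → 1 ≤ P.wt x := by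
        intro l c d h hc hd cj dj xc xd
        have q := h.q
        by_cases x1 : x ∈ P.X 1
        · exact one_le_wt_of_mem q xi xj x1
        · refine one_le_wt_of_mem q.swap34 xi xj ?_
          have f1 := fails_three hmin (q := q.swap12.swap23.swap34) hc x0 hd a
          have w4 := hw.2 j q.j0
          have w5 := hw.2 1 q.k0
          have w6 := hw.2 l q.l0
          obtain ⟨s, m, u⟩ := P.rules
          obtain ⟨q0, w1, w2, w3, w4, w5, w6, w7, w8, w9, w10, w11, w12, w13, w14, w15, w16⟩ := h
          obtain ⟨q1, q2, q3, q4, q5, q6, q7, q8, q9, q10⟩ := q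
          have := hw.1
          clear hmin H hw hpos hT hj hXj
          grind
      rcases q.eq_or 1 with hh | rfl | rfl | rfl | rfl
      · exact absurd hh (by decide)
      · exact absurd (hT1 v v0 vi) vi
      · exact absurd rfl hj1
      · exact two h hc hd cj dj xc xd
      · exact two h.swap34 hd hc dj cj xd xc
    have h1 := H.bound ((P.X 0)ᶜ \ {c, d}) {c, d} (fun x hx => by
      simp only [Finset.mem_sdiff, Finset.mem_compl, Finset.mem_insert, Finset.mem_singleton,
        not_or] at hx ⊢
      exact ⟨hx.1, hx.2, key x hx.1 hx.2.1 hx.2.2⟩) (by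
        intro x; simp only [Finset.mem_insert, Finset.mem_singleton]
        rintro (rfl | rfl) <;> assumption) (fun x hx hxE => by
      simp only [Finset.mem_insert, Finset.mem_singleton, not_or] at hxE
      exact hpos x hx hxE.1 hxE.2)
    rw [Finset.sum_pair h.cd] at h1
    have := H.hA
    have := H.hΔ
    have := Finset.le_card_sdiff {c, d} (P.X 0)ᶜ
    rw [Finset.card_pair h.cd] at this
    omega
  · push Not at hj
    obtain ⟨z, z0, zc, zd, zj⟩ := hj
    have hzi : z ∈ P.X i := by
      by_contra hh
      exact zj (hT z z0 hh).1
    have hE : ∀ x ∈ ({c, d} : Finset K), x ∉ P.X 0 := by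
      intro x; simp only [Finset.mem_insert, Finset.mem_singleton]
      rintro (rfl | rfl) <;> assumption
    have hpos' : ∀ x, x ∉ P.X 0 → x ∉ ({c, d} : Finset K) → 0 ≤ P.wt x := fun x hx hxE => by
      simp only [Finset.mem_insert, Finset.mem_singleton, not_or] at hxE
      exact hpos x hx hxE.1 hxE.2
    have hT' : ∀ x ∈ (P.X 0)ᶜ \ P.X i, x ∉ P.X 0 ∧ x ∉ ({c, d} : Finset K) ∧ 1 ≤ P.wt x := by
      intro x hx
      simp only [Finset.mem_sdiff, Finset.mem_compl] at hx
      have hxc : x ≠ c := fun hh => hx.2 (hh ▸ ci)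
      have hxd : x ≠ d := fun hh => hx.2 (hh ▸ di)
      exact ⟨hx.1, by simp [hxc, hxd], (hT x hx.1 hx.2).2⟩
    -- A second wild colour can be moved to `j`, where the same argument applies.
    by_cases h2 : ∃ x, P.Wild x ∧ x ≠ a
    · obtain ⟨x, hx, hxa⟩ := h2
      have h' := (h.swap12.set_wild hx hxa (ne_of_mem_of_not_mem hx.1 hc)
          (ne_of_mem_of_not_mem hx.1 hd))
      obtain ⟨hz1, hz2, hz3⟩ := two_wild_conf H hmin h' hc hd hx z0 zc zd zj
      have cj := conf_mem' hz1
      have dj := conf_mem' hz2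
      have wc := wt_nonneg_of_mem_pair q ci cj
      have wd := wt_nonneg_of_mem_pair q di dj
      have h1 := H.bound (((P.X 0)ᶜ \ P.X i) ∪ ((P.X 0)ᶜ \ P.X j)) {c, d} (by
        intro x hx
        rcases Finset.mem_union.1 hx with hx | hx
        · exact hT' x hx
        simp only [Finset.mem_sdiff, Finset.mem_compl] at hx
        have hxc : x ≠ c := fun hh => hx.2 (hh ▸ cj)
        have hxd : x ≠ d := fun hh => hx.2 (hh ▸ dj)
        have p := two_wild_conf H hmin h' hc hd (by assumption) hx.1 hxc hxd hx.2
        exact ⟨hx.1, by simp [hxc, hxd], one_le_wt_of_mem q.swap23.swap34 (P.conf_mem p.2.2)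
          (P.conf_mem p.1) (P.conf_mem p.2.1)⟩) hE hpos'
      rw [Finset.card_union_of_disjoint, Finset.sum_pair h.cd] at h1
      · have := H.card_sdiff j q.j0
        have := H.wild_le
        push_cast at h1
        omega
      · rw [Finset.disjoint_left]
        intro x hx hx'
        simp only [Finset.mem_sdiff, Finset.mem_compl] at hx hx'
        exact hx'.2 (hT x hx.1 hx.2).1
    · push Not at h2
      have hone : P.wild.card ≤ 1 := by
        rw [Finset.card_le_one]
        exact fun x hx y hy => (h2 x (mem_wild.1 hx)).trans (h2 y (mem_wild.1 hy)).symm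
      by_cases hcd : 0 ≤ P.wt c + P.wt d
      · have h1 := H.bound ((P.X 0)ᶜ \ P.X i) {c, d} hT' hE hpos'
        rw [Finset.sum_pair h.cd] at h1
        omega
      · have three : ∀ {k l c d}, P.Fits i j k l a b c d → c ∉ P.X 0 → d ∉ P.X 0 → z ≠ c → z ≠ d →
            c ∈ P.X i → P.wt c ≤ -1 →
            d ∈ P.X i → 1 ≤ P.wt z ∧ 0 ≤ P.wt d := by
          intro k l c d h hc hd zc zd ci wc di
          have q := h.q
          have ct : c ∉ P.X j ∧ c ∉ P.X k ∧ c ∉ P.X l := by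
            rw [wt_eq q, ind_of_mem ci] at wc
            simp only [ind] at wc
            clear hT' hE hpos' hT hpos hmin H
            grind
          have s1 := (served_two H hmin h hc hd z0 zc zd).2.2.2
          have p1 : P.conf z j d l := by
            rcases s1 with hh | hh | hh | hh
            exacts [(zj hh).elim, (hw.2 j q.j0 (conf_mem' hh)).elim, (ct.1 (conf_mem' hh)).elim, hh]
          refine ⟨one_le_wt_of_mem q.swap23.swap34 hzi ?_ (P.conf_mem p1),
            wt_nonneg_of_mem_pair q di (conf_mem' p1)⟩
          have f1 := fails_three hmin (q := q.swap12.swap23.swap34) hc z0 hd a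
          have w4 := hw.2 j q.j0
          have w5 := hw.2 k q.k0
          have w6 := hw.2 l q.l0
          have w7 := hw.2 i q.i0
          have := hw.1
          obtain ⟨s, m, u⟩ := P.rules
          obtain ⟨q0, w1, w2, w3, w4, w5, w6, w7, w8, w9, w10, w11, w12, w13, w14, w15, w16⟩ := h
          obtain ⟨q1, q2, q3, q4, q5, q6, q7, q8, q9, q10⟩ := q
          clear hmin H hw hpos hT hT' hE hpos' h2
          grind
        have hz1 : 1 ≤ P.wt z ∧ (0 ≤ P.wt c ∨ 0 ≤ P.wt d) := by
          by_cases wc : P.wt c ≤ -1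
          · exact (three h hc hd zc zd ci wc di).imp_right Or.inr
          · exact (three h.swap34 hd hc zd zc di (by omega) ci).imp_right Or.inl
        have h1 := H.bound (insert z ((P.X 0)ᶜ \ P.X i)) {c, d} (by
          intro x hx
          rcases Finset.mem_insert.1 hx with rfl | hx
          · exact ⟨z0, by simp [zc, zd], hz1.1⟩
          · exact hT' x hx) hE hpos'
        rw [Finset.sum_pair h.cd, Finset.card_insert_of_notMem (by simp [hzi])] at h1
        push_cast at h1
        omega

include H hmin in
/-- The bound for two used colours when there is a wild colour and `g` has positive weight. -/
theorem two_of_wild (h : P.Fits i j k l a b c d) (hc : c ∉ P.X 0) (hd : d ∉ P.X 0)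
    (hw : ∃ x, P.Wild x) (hg : 1 ≤ P.wt g) : 2 ≤ ∑ x, P.wt x := by
  obtain ⟨w, hw⟩ := hw
  have wc := ne_of_mem_of_not_mem hw.1 hc
  have wd := ne_of_mem_of_not_mem hw.1 hd
  have main : ∀ {i j b}, P.Fits i j k l w b c d → 2 ≤ ∑ x, P.wt x := by
    intro i j b h
    have q := h.q
    obtain ⟨ha, hb⟩ := used_two h hmin hc hd
    by_cases hi : ∀ x, x ∉ P.X 0 → x ≠ c → x ≠ d → x ∈ P.X i
    · obtain ⟨-, hXi⟩ := H.eq_of_full h.cd hc hd q.i0 hi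
      have ci : c ∉ P.X i := fun hh => (hXi c hh).2.1 rfl
      have di : d ∉ P.X i := fun hh => (hXi d hh).2.2 rfl
      have bi : b ∉ P.X i := fun hh => (hXi b hh).1 hb
      by_cases hj : ∀ x, x ∉ P.X 0 → x ≠ c → x ≠ d → x ∈ P.X j
      · obtain ⟨-, hXj⟩ := H.eq_of_full h.cd hc hd q.j0 hj
        have cj : c ∉ P.X j := fun hh => (hXj c hh).2.1 rfl
        have dj : d ∉ P.X j := fun hh => (hXj d hh).2.2 rfl
        have two : ∀ {k l c d}, P.Fits i j k l w b c d → c ∉ P.X 0 → d ∉ P.X 0 → c ∉ P.X i →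
            d ∉ P.X i → c ∉ P.X j → d ∉ P.X j → ∀ x, x ∉ P.X 0 → x ≠ c → x ≠ d → x ∈ P.X k := by
          intro k l c d h hc hd ci di cj dj x x0 xc xd
          have q := h.q
          have f1 := fails_three hmin (q := q) hc hd x0 w
          have f2 := fails_three hmin (q := q) hd hc x0 w
          have w4 := hw.2 j q.j0
          have w5 := hw.2 k q.k0
          have w6 := hw.2 l q.l0
          have w7 := hw.2 i q.i0
          have := hw.1
          obtain ⟨s, m, u⟩ := P.rules
          obtain ⟨q0, w1, w2, w3, w4, w5, w6, w7, w8, w9, w10, w11, w12, w13, w14, w15, w16⟩ := h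
          obtain ⟨q1, q2, q3, q4, q5, q6, q7, q8, q9, q10⟩ := q
          clear hmin H hw hi hXi hj hXj
          grind
        obtain ⟨y, y0, y1, hy⟩ := H.exists_notMem_one {c, d} (Finset.card_le_two.trans (by simp))
        simp only [Finset.mem_insert, Finset.mem_singleton, not_or] at hy
        rcases q.eq_or 1 with hh | rfl | rfl | rfl | rfl
        · exact absurd hh (by decide)
        · exact (y1 (hi y y0 hy.1 hy.2)).elim
        · exact (y1 (hj y y0 hy.1 hy.2)).elim
        · exact (y1 (two h hc hd ci di cj dj y y0 hy.1 hy.2)).elim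
        · exact (y1 (two h.swap34 hd hc di ci dj cj y y0 hy.2 hy.1)).elim
      · push Not at hj
        obtain ⟨v, v0, vc, vd, vj⟩ := hj
        have h' : P.Fits i j k l b w c d := by
          have w1 := hw.2 j q.j0
          exact ⟨q, bi, w1, h.ck, h.dl, h.ab.symm, h.bc, h.bd, wc, wd, h.cd,
            fun hh => hw.2 i q.i0 (conf_mem' hh), fun hh => ci (conf_mem' hh),
                fun hh => di (conf_mem' hh),
            fun hh => hw.2 k q.k0 (P.conf_mem hh), fun hh => hw.2 l q.l0 (P.conf_mem hh), h.hcd⟩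
        exact two_of_wild_of_missing H hmin h'.swap12 hc hd hw hg v0 vc vd vj
    · push Not at hi
      obtain ⟨v, v0, vc, vd, vi⟩ := hi
      exact two_of_wild_of_missing H hmin h hc hd hw hg v0 vc vd vi
  by_cases wa : w = a
  · subst wa; exact main h
  by_cases wb : w = b
  · subst wb; exact main h.swap12
  · exact main (h.set_wild hw wb wc wd)

end Two
end Linked
end Palette

end

/-! ### Linked palettes: two used colours, one free colour fixed -/

section

namespace Palette
variable {K : Type*} {P : Palette K} {i j k l n : Fin 5} {a b c d : K}
variable [DecidableEq K] [Fintype K]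
variable {Δ e : ℕ} {g r : K}

theorem card_add_card_le {s t X : Finset K} (hs : s ⊆ X) (ht : t ⊆ X) (hd : ∀ x ∈ t, x ∉ s) :
    s.card + t.card ≤ X.card := by
  rw [← Finset.card_union_of_disjoint (Finset.disjoint_right.2 hd)]
  exact Finset.card_le_card (Finset.union_subset hs ht)

theorem card_four (hab : a ≠ b) (hac : a ≠ c) (had : a ≠ d) (hbc : b ≠ c) (hbd : b ≠ d)
    (hcd : c ≠ d) : ({a, b, c, d} : Finset K).card = 4 := by
  rw [Finset.card_insert_of_notMem (by simp [*]), Finset.card_insert_of_notMem (by simp [*]),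
    Finset.card_pair hcd]

namespace Linked

section Two

variable (H : P.Linked Δ e g r)
  (hmin : ∀ {i j k l a b c d}, P.Fits i j k l a b c d → a ∈ P.X 0 ∨ b ∈ P.X 0 ∨ c ∈ P.X 0)

include H hmin in
/-- If `c` can be exchanged, the free colours other than `d` have nonnegative weight. -/
theorem rigid_nonneg (h : P.Fits i j k l a b c d) (hc : c ∉ P.X 0) (hd : d ∉ P.X 0)
    (hk : ∃ x, x ∉ P.X 0 ∧ x ≠ c ∧ x ≠ d ∧ P.Fits i j k l a b x d) {x : K} (hx : x ∉ P.X 0)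
    (xd : x ≠ d) : 0 ≤ P.wt x := by
  obtain ⟨c', c0', cc, cd', h'⟩ := hk
  by_cases xc : x = c
  · exact (served_two H hmin h' c0' hd hx (xc ▸ cc.symm) xd).1
  · exact (served_two H hmin h hc hd hx xc xd).1

include H hmin in
/-- If `c` can be exchanged for other free colours but `d` cannot, a free colour of weight zero
other than `d` is missing at `k` and can take the place of `c`; its position is determined by the
sets in which it occurs. -/
theorem rigid_facts (h : P.Fits i j k l a b c d) (hc : c ∉ P.X 0) (hd : d ∉ P.X 0)
    (hk : ∃ x, x ∉ P.X 0 ∧ x ≠ c ∧ x ≠ d ∧ P.Fits i j k l a b x d)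
    (hl : ∀ x y, x ∉ P.X 0 → y ∉ P.X 0 → x ≠ d → y ≠ d → ¬ P.Fits i j k l a b x y) {x : K}
    (hx : x ∉ P.X 0) (xd : x ≠ d) (hw : P.wt x ≤ 0) :
    x ∉ P.X k ∧ P.Fits i j k l a b x d ∧
      (x ∉ P.X i → d ∈ P.X i ∧ P.conf x i d l ∧ P.conf x 0 b j ∧ x ∈ P.X j ∧ x ∈ P.X l) ∧
      (x ∉ P.X j → d ∈ P.X j ∧ P.conf x j d l ∧ P.conf x 0 a i ∧ x ∈ P.X i ∧ x ∈ P.X l) ∧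
      (x ∈ P.X i → x ∈ P.X j → x ∉ P.X l) := by
  obtain ⟨c', hc', cx, cd', h'⟩ : ∃ c', c' ∉ P.X 0 ∧ c' ≠ x ∧ c' ≠ d ∧ P.Fits i j k l a b c' d := by
    obtain ⟨c', c0', cc, cd', h'⟩ := hk
    by_cases xc : x = c
    · exact ⟨c', c0', xc ▸ cc, cd', h'⟩
    · exact ⟨c, hc, Ne.symm xc, h.cd, h⟩
  clear h hc hk
  have h := h'
  obtain ⟨ha, hb⟩ := used_two h hmin hc' hd
  have na := (ne_of_mem_of_not_mem ha hx).symm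
  have nb := (ne_of_mem_of_not_mem hb hx).symm
  have s1 := served_two H hmin h hc' hd hx cx.symm xd
  have e4 := fun hh : P.Fits l i j k x a b c' =>
    hl c' x hc' hx cd' xd hh.swap12.swap23.swap34
  have e1 := h.swap34.swap23.swap12.replace_first (x := x) na nb cx.symm
  have w1 := wt_of_two H.stuck h hmin hc' hd hx cx.symm xd
  have w2 := wt_of_two H.stuck h.swap12 (fun hh => hmin hh) hc' hd hx cx.symm xd
  have q := h.q
  have el : x ∈ P.X l ∨ P.conf x l a i ∨ P.conf x l b j ∨ P.conf x l c' k := by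
    rcases e1 with hh | hh | hh | hh | hh
    exacts [Or.inl hh, Or.inr (Or.inl hh), Or.inr (Or.inr (Or.inl hh)),
      Or.inr (Or.inr (Or.inr hh)), (e4 hh).elim]
  have wl := w1.2 el
  have wl' := w2.2 (el.imp_right fun hh => hh.elim (fun hh => Or.inr (Or.inl hh)) fun hh =>
    hh.elim Or.inl fun hh => Or.inr (Or.inr hh))
  have xk : x ∉ P.X k := fun hh => by have := wl.1 hh; omega
  have hf : P.Fits i j k l a b x d := by
    by_contra hn
    have := wl.2.2 (by
      rcases h.swap23.swap12.replace_first (x := x) na nb xd with hh | hh | hh | hh | hh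
      exacts [Or.inl hh, Or.inr (Or.inl hh), Or.inr (Or.inr (Or.inl hh)),
        Or.inr (Or.inr (Or.inr hh)), (hn hh.swap12.swap23).elim])
    omega
  refine ⟨xk, hf, fun xi => ?_, fun xj => ?_, fun xi xj xl => ?_⟩
  · have di : d ∈ P.X i := by
      by_contra hn
      have := wl.2.1 xi hn
      omega
    have p1 := s1.2.1.resolve_left fun hh => xi (P.conf_mem hh)
    have p2 : P.conf x i d l := by
      rcases s1.2.2.1 with hh | hh | hh | hh
      exacts [(xi hh).elim, absurd (conf_unique' hh p1) q.i0, (xk (P.conf_mem hh)).elim, hh]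
    exact ⟨di, p2, p1, P.conf_mem p1, P.conf_mem p2⟩
  · have dj : d ∈ P.X j := by
      by_contra hn
      have := wl'.2.1 xj hn
      omega
    have p1 := s1.2.1.resolve_right fun hh => xj (P.conf_mem hh)
    have p2 : P.conf x j d l := by
      rcases s1.2.2.2 with hh | hh | hh | hh
      exacts [(xj hh).elim, absurd (conf_unique' hh p1) q.j0, (xk (P.conf_mem hh)).elim, hh]
    exact ⟨dj, p2, p1, P.conf_mem p1, P.conf_mem p2⟩
  · have := one_le_wt_of_mem q.swap34 xi xj xl
    omega

include H hmin in
/-- If `c` can be exchanged but `d` cannot, and `d` lies in no set, then at most one free colour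
other than `d` has nonpositive weight. -/
theorem rigid_zero (h : P.Fits i j k l a b c d) (hc : c ∉ P.X 0) (hd : d ∉ P.X 0)
    (hk : ∃ x, x ∉ P.X 0 ∧ x ≠ c ∧ x ≠ d ∧ P.Fits i j k l a b x d)
    (hl : ∀ x y, x ∉ P.X 0 → y ∉ P.X 0 → x ≠ d → y ≠ d → ¬ P.Fits i j k l a b x y)
    (hdz : ∀ t, d ∉ P.X t) {x y : K}
    (hx : x ∉ P.X 0) (xd : x ≠ d) (hxw : P.wt x ≤ 0) (hy : y ∉ P.X 0) (yd : y ≠ d)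
    (hyw : P.wt y ≤ 0) (hxy : x ≠ y) : False := by
  have fx := rigid_facts H hmin h hc hd hk hl hx xd hxw
  have fy := rigid_facts H hmin h hc hd hk hl hy yd hyw
  obtain ⟨ha, hb⟩ := used_two h hmin hc hd
  have s1 := served_two H hmin fx.2.1 hx hd hy hxy.symm yd
  have q := h.q
  have f1 := fails_three hmin (q := q.swap23.swap34) hd hx hy b
  have f2 := fails_three hmin (q := q.swap12.swap23.swap34) hd hx hy a
  obtain ⟨s, m, u⟩ := P.rules
  have c1 := hdz i
  have c2 := hdz j
  have c3 := hdz k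
  have c4 := hdz l
  have u' : ∀ {a i b j k}, P.conf a i b j → P.conf a k b j → i = k := conf_unique'
  have gx := fx.2.1
  have gy := fy.2.1
  replace fx := fx.2.2
  replace fy := fy.2.2
  obtain ⟨q0, w1, w2, w3, w4, w5, w6, w7, w8, w9, w10, w11, w12, w13, w14, w15, w16⟩ := gx
  obtain ⟨_, v1, v2, v3, v4, v5, v6, v7, v8, v9, v10, v11, v12, v13, v14, v15, v16⟩ := gy
  obtain ⟨q1, q2, q3, q4, q5, q6, q7, q8, q9, q10⟩ := q
  clear hmin H hdz hk hl h hxw hyw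
  have p1 : x ∈ P.X i ∧ x ∈ P.X j := ⟨by_contra fun hh => c1 (fx.1 hh).1,
    by_contra fun hh => c2 (fx.2.1 hh).1⟩
  have p2 : y ∈ P.X i ∧ y ∈ P.X j := ⟨by_contra fun hh => c1 (fy.1 hh).1,
    by_contra fun hh => c2 (fy.2.1 hh).1⟩
  have p3 := fx.2.2 p1.1 p1.2
  have p4 := fy.2.2 p2.1 p2.2
  clear fx fy
  have g1 : ¬ P.conf y l a i ∨ ¬ P.conf y l b j := by
    rcases s1.2.1 with hh | hh
    · exact Or.inl fun h' => q4 (u' h' hh)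
    · exact Or.inr fun h' => q4 (u' h' hh)
  grind

include H hmin in
/-- If `c` can be exchanged but `d` cannot, it is impossible that `d` lies in `X j` alone while the
free colours other than `d` have nonpositive weight with one exception `z`. -/
theorem rigid_one (h : P.Fits i j k l a b c d) (hc : c ∉ P.X 0) (hd : d ∉ P.X 0)
    (hk : ∃ x, x ∉ P.X 0 ∧ x ≠ c ∧ x ≠ d ∧ P.Fits i j k l a b x d)
    (hl : ∀ x y, x ∉ P.X 0 → y ∉ P.X 0 → x ≠ d → y ≠ d → ¬ P.Fits i j k l a b x y)
    (hg : P.wt g = 1) (hr : P.wt r = 0) {z : K} (z0 : z ∉ P.X 0) (zd : z ≠ d)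
    (hz : ∀ x, x ∉ P.X 0 → x ≠ d → x ≠ z → P.wt x ≤ 0)
    (di : d ∉ P.X i) (dj : d ∈ P.X j) (dk : d ∉ P.X k) (he : e = 0)
    (zi : z ∉ P.X i) (zj : z ∈ P.X j) (zl : z ∈ P.X l)
    (hXi : ∀ x, x ∈ P.X i ↔ x ∉ P.X 0 ∧ x ≠ d ∧ x ≠ z) : False := by
  subst he
  have q := h.q
  obtain ⟨ha, hb⟩ := used_two h hmin hc hd
  have ng : ∀ {x}, x ∉ P.X 0 → g ≠ x := fun h => ne_of_mem_of_not_mem H.g0 h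
  have nr : ∀ {x}, x ∉ P.X 0 → r ≠ x := fun h => ne_of_mem_of_not_mem H.r0 h
  have hF : ∀ x, x ∈ P.X i → x ∉ P.X 0 ∧ x ∉ P.X k ∧ P.Fits i j k l a b x d ∧
      (x ∉ P.X j → d ∈ P.X j ∧ P.conf x j d l ∧ P.conf x 0 a i ∧ x ∈ P.X i ∧ x ∈ P.X l) ∧
      (x ∈ P.X j → x ∉ P.X l) := by
    intro x hx
    obtain ⟨x0, xd, xz⟩ := (hXi x).1 hx
    obtain ⟨p1, p2, -, p3, p4⟩ := rigid_facts H hmin h hc hd hk hl x0 xd (hz x x0 xd xz)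
    exact ⟨x0, p1, p2, p3, p4 hx⟩
  have hX0 : ∀ {x}, x ∈ P.X 0 → x ∉ P.X i := fun hx hh => ((hXi _).1 hh).1 hx
  have dl := h.dl
  have hcard : (P.X i).card + 2 = Δ + 1 := by
    have : insert d (insert z (P.X i)) = (P.X 0)ᶜ := by
      ext x
      simp only [Finset.mem_insert, Finset.mem_compl, hXi]
      by_cases h1 : x = d
      · simp [h1, hd]
      by_cases h2 : x = z
      · simp [h2, z0]
      simp [h1, h2]
    have h1 := congrArg Finset.card this
    rw [Finset.card_insert_of_notMem (by simp [di, zd.symm]), Finset.card_insert_of_notMem zi,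
      H.hA] at h1
    omega
  have hΔ := H.hΔ
  have other : ∀ x, ∃ y ∈ P.X i, y ≠ x := fun x =>
    Finset.exists_mem_ne (by omega) x
  -- The colours in `X i` are of two types, according to whether they lie in `X j`.
  have hT1 : ∀ x, x ∈ P.X i → x ∈ P.X j → x ∉ P.X l ∧ P.conf x l b j ∧ P.conf x 0 a i := by
    intro x hx xj
    obtain ⟨x0, xk, p2, -, p3⟩ := hF x hx
    have xl := p3 xj
    obtain ⟨y, hy, hyx⟩ := other x
    obtain ⟨y0, yk, p4, -⟩ := hF y hy
    have bi := hX0 hb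
    obtain ⟨_, xd, _⟩ := (hXi x).1 hx
    have s1 := served_two H hmin p4 y0 hd x0 hyx.symm xd
    have f1 := fails_three hmin (q := q.swap23.swap34) hd y0 x0 b
    have nx := ne_of_mem_of_not_mem hb x0
    have ny := ne_of_mem_of_not_mem hb y0
    have xb : P.conf x l b j := by
      have := p4.hbc
      have := p4.bj
      have := p4.cd
      obtain ⟨s, m, u⟩ := P.rules
      obtain ⟨q1, q2, q3, q4, q5, q6, q7, q8, q9, q10⟩ := q
      clear hmin H hk hl h hz hXi hF hX0 other p2 p3 p4 s1
      grind
    exact ⟨xl, xb, s1.2.1.resolve_right fun hh => q.l0 (conf_unique' xb hh)⟩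
  have hT2 : ∀ x, x ∈ P.X i → x ∉ P.X j → x ∈ P.X l ∧ P.conf x j d l ∧ P.conf x 0 a i := by
    intro x hx xj
    have := (hF x hx).2.2.2.1 xj
    exact ⟨this.2.2.2.2, this.2.1, this.2.2.1⟩
  have c0 : (P.X i ∩ P.X j).card + (P.X i \ P.X j).card = (P.X i).card :=
    Finset.card_inter_add_card_sdiff _ _
  have c1 : (P.X i ∩ P.X j).card + 2 ≤ (P.X j).card := by
    have := card_add_card_le (s := P.X i ∩ P.X j) (t := {d, z}) (X := P.X j)
      Finset.inter_subset_right (by simp [Finset.insert_subset_iff, dj, zj]) (by simp [di, zi])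
    rwa [Finset.card_pair zd.symm] at this
  have c2 := H.hX j q.j0
  have c3 := H.hX l q.l0
  have hsub : P.X i \ P.X j ⊆ P.X l := fun x hx => by
    rw [Finset.mem_sdiff] at hx
    exact (hT2 x hx.1 hx.2).1
  have c4 : (P.X i \ P.X j).card + 1 ≤ (P.X l).card := by
    have := card_add_card_le (t := {z}) hsub (by simp [zl]) (by simp [zi])
    simpa using this
  obtain ⟨v, hv⟩ := Finset.card_pos.1 (show 0 < (P.X i ∩ P.X j).card by omega)
  rw [Finset.mem_inter] at hv
  have bl : b ∈ P.X l := conf_mem' (hT1 v hv.1 hv.2).2.1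
  have bz : b ≠ z := ne_of_mem_of_not_mem hb z0
  have c5 : (P.X i \ P.X j).card + 2 ≤ (P.X l).card := by
    have := card_add_card_le (t := {b, z}) hsub (by simp [Finset.insert_subset_iff, zl, bl])
      (by simp [zi, hX0 hb])
    rwa [Finset.card_pair bz] at this
  -- Counting shows that there are at least two colours of each type.
  have t1 : 2 ≤ (P.X i ∩ P.X j).card := by omega
  have t2 : 2 ≤ (P.X i \ P.X j).card := by omega
  have gi := hX0 H.g0
  have ri := hX0 H.r0
  have i1 : i ≠ 1 := fun hh => gi (hh ▸ H.g1)
  -- `g` cannot be placed at `i`.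
  have gno : ∀ x, x ∈ P.X i → ¬ P.Fits i j k l g b x d := by
    intro x hx f
    obtain ⟨x0, -⟩ := hF x hx
    obtain ⟨y, hy, yx⟩ := Finset.exists_mem_ne (show 1 < (P.X i ∩ P.X j).card by omega) x
    obtain ⟨y', hy', yx'⟩ := Finset.exists_mem_ne (show 1 < (P.X i \ P.X j).card by omega) x
    rw [Finset.mem_inter] at hy
    rw [Finset.mem_sdiff] at hy'
    have fy := hF y hy.1
    have fy' := hF y' hy'.1
    have b1 := (served_two H hmin f x0 hd fy.1 yx ((hXi y).1 hy.1).2.1).2.1.resolve_right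
      fun hh => q.l0 (conf_unique' (hT1 y hy.1 hy.2).2.1 hh)
    have b2 := (served_two H hmin f x0 hd fy'.1 yx' ((hXi y').1 hy'.1).2.1).2.1.resolve_right
      fun hh => hy'.2 (P.conf_mem hh)
    have y1 := H.gc0 i y q.i0 i1 (P.conf_symm b1)
    have y1' := H.gc0 i y' q.i0 i1 (P.conf_symm b2)
    have fy2 := fy.2.2.2.2 hy.2
    rcases q.eq_or 1 with hh | hh | hh | hh | hh
    · exact absurd hh (by decide)
    · exact i1 hh.symm
    · exact hy'.2 (hh ▸ y1')
    · exact fy.2.1 (hh ▸ y1)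
    · exact fy2 (hh ▸ y1)
  have gconf : g ≠ b → ∀ x, x ∈ P.X i → P.conf g i x k := by
    intro hgb x hx
    obtain ⟨x0, -, p, -⟩ := hF x hx
    rcases p.replace_first hgb (ng x0) (ng hd) with hh | hh | hh | hh | hh
    exacts [(gi hh).elim, (hX0 hb (conf_mem' hh)).elim, hh, (di (conf_mem' hh)).elim,
      (gno x hx hh).elim]
  have gset : ∀ {i j k}, Quad 1 i j k → g ∈ P.X i → g ∉ P.X j ∧ g ∉ P.X k := by
    intro i j k q hi
    rw [wt_eq q, ind_of_mem H.g0, ind_of_mem H.g1, ind_of_mem hi] at hg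
    constructor <;> intro hh <;> rw [ind_of_mem hh] at hg
    · have := ind_nonneg (P.X k) g; omega
    · have := ind_nonneg (P.X j) g; omega
  have rset : ∀ {i j k}, Quad 1 i j k → r ∉ P.X i ∧ r ∉ P.X j ∧ r ∉ P.X k := fun q =>
    notMem_of_wt q H.r0 H.r1 hr.le
  have hcap := H.cap
  obtain ⟨u, hu, v', hv', huv⟩ := Finset.one_lt_card.1 (show 1 < (P.X i ∩ P.X j).card by omega)
  obtain ⟨w, hw, w', hw', hww⟩ := Finset.one_lt_card.1 (show 1 < (P.X i \ P.X j).card by omega)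
  rw [Finset.mem_inter] at hu hv'
  rw [Finset.mem_sdiff] at hw hw'
  have gr := H.gr
  -- Either `g` is the colour at `j`, or `g` at `i` conflicts with every colour of `X i` at `k`.
  by_cases hgb : g = b
  · subst hgb
    have j1 : j ≠ 1 := fun hh => h.bj (hh ▸ H.g1)
    have l1 : l ≠ 1 := by
      rintro rfl
      exact (hF v hv.1).1 (H.gc1 j v q.j0 j1 (P.conf_symm (hT1 v hv.1 hv.2).2.1))
    have k1 : k = 1 := by
      rcases q.eq_or 1 with hh | hh | hh | hh | hh
      · exact absurd hh (by decide)
      exacts [(i1 hh.symm).elim, (j1 hh.symm).elim, hh.symm, (l1 hh.symm).elim]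
    subst k1
    have rj := rset q.swap23.swap12
    have pw := hF w hw.1
    have pw' := hF w' hw'.1
    have q' := hT2 w hw.1 hw.2
    have f1 := H.stuck.fails (q := q) (x := w') (a := g) (b := r) (c := w) (d := d) pw'.1
    have e1 := H.gc1 i w q.i0 i1
    have e2 := H.gc0 i w' q.i0 i1
    have n1 := ng pw.1
    have n2 := nr pw.1
    have n3 := ng hd
    have n4 := nr hd
    have n5 := ng pw'.1
    have n6 := nr pw'.1
    have wd := ((hXi w).1 hw.1).2.1
    have wd' := ((hXi w').1 hw'.1).2.1
    have pw1 := pw.2.1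
    have pw2 := pw'.2.1
    have pw3 := pw.1
    have pw4 := pw'.1
    have hw2 := hw.2
    have hw2' := hw'.2
    have r0 := H.r0
    have g0 := H.g0
    obtain ⟨s, m, u⟩ := P.rules
    obtain ⟨q1, q2, q3, q4, q5, q6, q7, q8, q9, q10⟩ := q
    clear hmin H hk hl h hz hXi hF hX0 other hT1 hT2 gno gconf gset rset pw pw' c0 c1 c2 c3 c4 c5
    clear hsub bl hcap hw hw' hu hv hv' t1 t2 hcard hΔ ng nr hg hr
    grind
  · have gk : g ∈ P.X k := P.conf_mem (gconf hgb v hv.1)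
    have k1 : k ≠ 1 := fun hh => (hF v hv.1).1 (H.gc1 i v q.i0 i1 (hh ▸ gconf hgb v hv.1))
    rcases q.eq_or 1 with hh | hh | rfl | hh | rfl
    · exact absurd hh (by decide)
    · exact i1 hh.symm
    · have := card_add_card_le (s := P.X i ∩ P.X 1) (t := {d, z, g, r}) (X := P.X 1)
        Finset.inter_subset_right (by simp [Finset.insert_subset_iff, dj, zj, H.g1, H.r1])
        (by simp [di, zi, gi, ri])
      rw [card_four zd.symm (ng hd).symm (nr hd).symm (ng z0).symm (nr z0).symm gr] at this
      omega
    · exact k1 hh.symm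
    · have hbr : b = r := by
        by_contra hbr
        have := card_add_card_le (t := {b, z, g, r}) hsub
          (by simp [Finset.insert_subset_iff, bl, zl, H.g1, H.r1])
          (by simp [hX0 hb, zi, gi, ri])
        rw [card_four bz (Ne.symm hgb) hbr (ng z0).symm (nr z0).symm gr] at this
        omega
      subst hbr
      have Q := q.swap34.swap23.swap12
      obtain ⟨ri, rj, rk⟩ := rset Q
      obtain ⟨-, gj⟩ := gset Q.swap34.swap23 gk
      have fu := hF u hu.1
      have fv := hF v' hv'.1
      have f : P.Fits i j k 1 b g v' u := by
        refine ⟨q, ri, gj, fv.2.1, (hT1 u hu.1 hu.2).1, gr.symm, nr fv.1, nr fu.1, ng fv.1, ng fu.1,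
          huv.symm, fun hh => gi (conf_mem' hh), fun hh => rk (P.conf_mem hh), fun hh => ?_,
          fun hh => ?_, fun hh => fu.1 (H.gc1 j u q.j0 q.jl hh), fun hh => fu.2.1 (conf_mem' hh)⟩
        · exact q.ij (P.conf_unique (P.conf_symm hh) (hT1 u hu.1 hu.2).2.1)
        · exact q.ij (P.conf_unique (P.conf_symm (gconf hgb v' hv'.1)) (P.conf_symm hh))
      have := (served_two H hmin f fv.1 fu.1 hd (fun hh => ((hXi v').1 hv'.1).2.1 hh.symm)
        (fun hh => ((hXi u).1 hu.1).2.1 hh.symm)).1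
      rw [wt_ge_of_mem q hd, ind_of_mem dj, ind_of_notMem di, ind_of_notMem dk, ind_of_notMem dl]
        at this
      omega

include H hmin in
/-- If `c` can be exchanged but `d` cannot, it is impossible that `d` lies in `X i` and `X j` alone
while the free colours other than `d` have nonpositive weight. -/
theorem rigid_two (h : P.Fits i j k l a b c d) (hc : c ∉ P.X 0) (hd : d ∉ P.X 0)
    (hk : ∃ x, x ∉ P.X 0 ∧ x ≠ c ∧ x ≠ d ∧ P.Fits i j k l a b x d)
    (hl : ∀ x y, x ∉ P.X 0 → y ∉ P.X 0 → x ≠ d → y ≠ d → ¬ P.Fits i j k l a b x y)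
    (hg : P.wt g = 1) (hr : P.wt r = 0)
    (hz : ∀ x, x ∉ P.X 0 → x ≠ d → P.wt x ≤ 0)
    (di : d ∈ P.X i) (dj : d ∈ P.X j) (dk : d ∉ P.X k) : False := by
  have q := h.q
  have dl := h.dl
  obtain ⟨ha, hb⟩ := used_two h hmin hc hd
  have ng : ∀ {x}, x ∉ P.X 0 → g ≠ x := fun h => ne_of_mem_of_not_mem H.g0 h
  have nr : ∀ {x}, x ∉ P.X 0 → r ≠ x := fun h => ne_of_mem_of_not_mem H.r0 h
  have hF := fun x (x0 : x ∉ P.X 0) (xd : x ≠ d) =>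
    rigid_facts H hmin h hc hd hk hl x0 xd (hz x x0 xd)
  have gr := H.gr
  set A := (P.X 0)ᶜ \ {d} with hA
  have mA : ∀ x, x ∈ A ↔ x ∉ P.X 0 ∧ x ≠ d := fun x => by simp [hA]
  have cA : A.card = Δ + e := by
    have := Finset.card_sdiff_add_card_eq_card (s := {d}) (t := (P.X 0)ᶜ) (by simpa using hd)
    rw [← hA, H.hA, Finset.card_singleton] at this
    omega
  clear_value A
  set T2 := A \ P.X j with hT2
  set T3 := A \ P.X i with hT3
  have m2 : ∀ x, x ∈ T2 ↔ x ∈ A ∧ x ∉ P.X j := fun x => by simp [hT2]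
  have m3 : ∀ x, x ∈ T3 ↔ x ∈ A ∧ x ∉ P.X i := fun x => by simp [hT3]
  have c2 : (A ∩ P.X j).card + T2.card = A.card := Finset.card_inter_add_card_sdiff _ _
  have c3 : (A ∩ P.X i).card + T3.card = A.card := Finset.card_inter_add_card_sdiff _ _
  have hsub : T2 ∪ T3 ⊆ P.X l := by
    intro x hx
    rcases Finset.mem_union.1 hx with hx | hx
    · rw [m2, mA] at hx
      exact ((hF x hx.1.1 hx.1.2).2.2.2.1 hx.2).2.2.2.2
    · rw [m3, mA] at hx
      exact ((hF x hx.1.1 hx.1.2).2.2.1 hx.2).2.2.2.2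
  have cu : (T2 ∪ T3).card = T2.card + T3.card := by
    refine Finset.card_union_of_disjoint (Finset.disjoint_left.2 fun x hx hx' => ?_)
    rw [m2, mA] at hx
    rw [m3] at hx'
    exact hx'.2 ((hF x hx.1.1 hx.1.2).2.2.2.1 hx.2).2.2.2.1
  have bi : (A ∩ P.X i).card + 1 ≤ (P.X i).card := by
    have := card_add_card_le (s := A ∩ P.X i) (t := {d}) (X := P.X i)
      Finset.inter_subset_right (by simp [di]) (by simp [mA])
    simpa using this
  have bj : (A ∩ P.X j).card + 1 ≤ (P.X j).card := by
    have := card_add_card_le (s := A ∩ P.X j) (t := {d}) (X := P.X j)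
      Finset.inter_subset_right (by simp [dj]) (by simp [mA])
    simpa using this
  have bl := Finset.card_le_card hsub
  have xi := H.hX i q.i0
  have xj := H.hX j q.j0
  have xl := H.hX l q.l0
  have hΔ := H.hΔ
  have hcap := H.cap
  have gA : g ∉ A := fun hh => ((mA g).1 hh).1 H.g0
  have rA : r ∉ A := fun hh => ((mA r).1 hh).1 H.r0
  -- The set `X 1` contains `g` and `r`, which leaves too little room unless `k = 1`.
  have k1 : k = 1 := by
    rcases q.eq_or 1 with hh | rfl | rfl | hh | rfl
    · exact absurd hh (by decide)
    · have := card_add_card_le (s := A ∩ P.X 1) (t := {d, g, r}) (X := P.X 1)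
        Finset.inter_subset_right (by simp [Finset.insert_subset_iff, di, H.g1, H.r1])
        (by simp [mA, H.g0, H.r0])
      rw [Finset.card_insert_of_notMem (by simp [(ng hd).symm, (nr hd).symm]),
        Finset.card_pair gr] at this
      omega
    · have := card_add_card_le (s := A ∩ P.X 1) (t := {d, g, r}) (X := P.X 1)
        Finset.inter_subset_right (by simp [Finset.insert_subset_iff, dj, H.g1, H.r1])
        (by simp [mA, H.g0, H.r0])
      rw [Finset.card_insert_of_notMem (by simp [(ng hd).symm, (nr hd).symm]),
        Finset.card_pair gr] at this
      omega
    · exact hh.symm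
    · have := card_add_card_le (t := {g, r}) hsub
        (by simp [Finset.insert_subset_iff, H.g1, H.r1])
        (by simp [m2, m3, gA, rA])
      rw [Finset.card_pair gr] at this
      omega
  subst k1
  obtain ⟨u, hu, u', hu', huv⟩ := Finset.one_lt_card.1 (show 1 < T2.card by omega)
  obtain ⟨w, hw, w', hw', hww⟩ := Finset.one_lt_card.1 (show 1 < T3.card by omega)
  rw [m2, mA] at hu hu'
  rw [m3, mA] at hw hw'
  -- `g` cannot be placed at `i`, nor at `j`.
  have gni : ¬ P.Fits i j 1 l g b c d := by
    intro f
    have main : ∀ x, x ∉ P.X 0 → x ≠ d → x ∉ P.X j → x ≠ c → False := by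
      intro x x0 xd xj xc
      have b1 := (served_two H hmin f hc hd x0 xc xd).2.1.resolve_right
        fun hh => xj (P.conf_mem hh)
      exact (hF x x0 xd).1 (H.gc0 i x q.i0 q.ik (P.conf_symm b1))
    by_cases hh : u = c
    · exact main u' hu'.1.1 hu'.1.2 hu'.2 (hh ▸ huv.symm)
    · exact main u hu.1.1 hu.1.2 hu.2 hh
  have gnj : ¬ P.Fits i j 1 l a g c d := by
    intro f
    have main : ∀ x, x ∉ P.X 0 → x ≠ d → x ∉ P.X i → x ≠ c → False := by
      intro x x0 xd xj xc
      have b1 := (served_two H hmin f hc hd x0 xc xd).2.1.resolve_left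
        fun hh => xj (P.conf_mem hh)
      exact (hF x x0 xd).1 (H.gc0 j x q.j0 q.jk (P.conf_symm b1))
    by_cases hh : w = c
    · exact main w' hw'.1.1 hw'.1.2 hw'.2 (hh ▸ hww.symm)
    · exact main w hw.1.1 hw.1.2 hw.2 hh
  obtain ⟨ri, rj, rl⟩ := notMem_of_wt q.swap23.swap12 H.r0 H.r1 hr.le
  -- The quadruple `r, g, w, d` cannot be blocked for the free colour `w'`.
  have last : ∀ {i j a b w w'}, P.Fits i j 1 l a b c d → g ∉ P.X j → g ∉ P.X l → r ∉ P.X i →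
      r ∉ P.X j → w ∉ P.X 0 → w ≠ d → w ∉ P.X i → w ∉ P.X 1 →
      w' ∉ P.X 0 → w' ≠ d → w' ∉ P.X i → w' ∉ P.X 1 → w ≠ w' → False := by
    intro i j a b w w' h gj gl ri rj w0 wd wi w1 w0' wd' wi' w1' hne
    have q := h.q
    have f1 := H.stuck.fails (q := q) (x := w') (a := r) (b := g) (c := w) (d := d) w0'
    have e1 := H.gc1 j w q.j0 q.jk
    have e2 := H.gc0 j w' q.j0 q.jk
    have n1 := ng w0
    have n2 := nr w0
    have n3 := ng hd
    have n4 := nr hd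
    have n5 := ng w0'
    have n6 := nr w0'
    obtain ⟨s, m, u⟩ := P.rules
    obtain ⟨q1, q2, q3, q4, q5, q6, q7, q8, q9, q10⟩ := q
    clear hmin H hk hl h hz hF hsub gni gnj
    grind
  have gset : ∀ {i j k}, Quad 1 i j k → g ∈ P.X i → g ∉ P.X j ∧ g ∉ P.X k := by
    intro i j k q hi
    rw [wt_eq q, ind_of_mem H.g0, ind_of_mem H.g1, ind_of_mem hi] at hg
    constructor <;> intro hh <;> rw [ind_of_mem hh] at hg
    · have := ind_nonneg (P.X k) g; omega
    · have := ind_nonneg (P.X j) g; omega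
  by_cases gi : g ∈ P.X i
  · obtain ⟨gj, gl⟩ := gset q.swap23.swap12 gi
    exact last h gj gl ri rj hw.1.1 hw.1.2 hw.2 (hF w hw.1.1 hw.1.2).1 hw'.1.1 hw'.1.2
      hw'.2 (hF w' hw'.1.1 hw'.1.2).1 hww
  by_cases gj : g ∈ P.X j
  · obtain ⟨-, gl⟩ := gset q.swap23.swap12.swap23 gj
    exact last h.swap12 gi gl rj ri hu.1.1 hu.1.2 hu.2 (hF u hu.1.1 hu.1.2).1 hu'.1.1
      hu'.1.2 hu'.2 (hF u' hu'.1.1 hu'.1.2).1 huv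
  have p1 : g = b ∨ P.conf g i d l := by
    by_contra hn
    push Not at hn
    rcases h.replace_first hn.1 (ng hc) (ng hd) with hh | hh | hh | hh | hh
    exacts [gi hh, gj (P.conf_mem hh), hc (H.gc1 i c q.i0 q.ik hh), hn.2 hh, gni hh]
  have p2 : g = a ∨ P.conf g j d l := by
    by_contra hn
    push Not at hn
    rcases h.swap12.replace_first hn.1 (ng hc) (ng hd) with hh | hh | hh | hh | hh
    exacts [gj hh, gi (P.conf_mem hh), hc (H.gc1 j c q.j0 q.jk hh), hn.2 hh, gnj hh.swap12]
  rcases p1 with rfl | p1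
  · rcases p2 with rfl | p2
    exacts [h.ab rfl, h.hbd p2]
  · rcases p2 with rfl | p2
    exacts [h.had p1, q.ij (P.conf_unique (P.conf_symm p1) (P.conf_symm p2))]

include H hmin in
/-- The bound for two used colours when `c` can be exchanged for another free colour but `d` cannot.
-/
theorem two_of_semirigid (h : P.Fits i j k l a b c d) (hc : c ∉ P.X 0) (hd : d ∉ P.X 0)
    (hk : ∃ x, x ∉ P.X 0 ∧ x ≠ c ∧ x ≠ d ∧ P.Fits i j k l a b x d)
    (hl : ∀ x y, x ∉ P.X 0 → y ∉ P.X 0 → x ≠ d → y ≠ d → ¬ P.Fits i j k l a b x y)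
    (hw : ∀ x, ¬ P.Wild x) (hg : 1 ≤ P.wt g) : 2 ≤ ∑ x, P.wt x := by
  by_contra hS
  have hr := H.wt_nonneg_r
  have hΔ := H.hΔ
  -- `T` consists of the free colours of positive weight, and `A` of those of weight zero, always
  -- apart from `d`.
  set T := ((P.X 0)ᶜ \ {d}).filter fun x => 1 ≤ P.wt x with hT
  have mT : ∀ x, x ∈ T ↔ (x ∉ P.X 0 ∧ x ≠ d) ∧ 1 ≤ P.wt x := fun x => by simp [hT]
  have hB := H.bound T {d} (fun x hx => by
    have := (mT x).1 hx
    exact ⟨this.1.1, by simp [this.1.2], this.2⟩) (by simpa using hd) (fun x hx hxE =>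
      rigid_nonneg H hmin h hc hd hk hx (by simpa using hxE))
  rw [Finset.sum_singleton, wild_eq_zero hw] at hB
  set A := (((P.X 0)ᶜ \ {d}).filter fun x => ¬ 1 ≤ P.wt x) with hA
  have mA : ∀ x, x ∈ A ↔ (x ∉ P.X 0 ∧ x ≠ d) ∧ ¬ 1 ≤ P.wt x := fun x => by simp [hA]
  have cA : T.card + A.card = Δ + e := by
    rw [hT, hA, Finset.card_filter_add_card_filter_not]
    have := Finset.card_sdiff_add_card_eq_card (s := {d}) (t := (P.X 0)ᶜ) (by simpa using hd)
    rw [H.hA, Finset.card_singleton] at this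
    omega
  clear_value A T
  -- If `d` is missing at `i`, the colours in `A` are all in `X i`.
  have sub : ∀ {i j a b}, P.Fits i j k l a b c d → (∃ x, x ∉ P.X 0 ∧ x ≠ c ∧ x ≠ d ∧
      P.Fits i j k l a b x d) → (∀ x y, x ∉ P.X 0 → y ∉ P.X 0 → x ≠ d → y ≠ d →
      ¬ P.Fits i j k l a b x y) → d ∉ P.X i → A ⊆ P.X i := by
    intro i j a b h hk hl di x hx
    obtain ⟨⟨x0, xd⟩, xw⟩ := (mA x).1 hx
    by_contra hh
    exact di ((rigid_facts H hmin h hc hd hk hl x0 xd (by omega)).2.2.1 hh).1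
  have one : ∀ {i j a b}, P.Fits i j k l a b c d → (∃ x, x ∉ P.X 0 ∧ x ≠ c ∧ x ≠ d ∧
      P.Fits i j k l a b x d) → (∀ x y, x ∉ P.X 0 → y ∉ P.X 0 → x ≠ d → y ≠ d →
      ¬ P.Fits i j k l a b x y) → d ∉ P.X i → T.card ≤ 1 → T.card = 1 ∧ e = 0 ∧ P.X i = A := by
    intro i j a b h hk hl di hT1
    have h1 := sub h hk hl di
    have h2 := Finset.card_le_card h1
    have h3 := H.hX i h.q.i0
    exact ⟨by omega, by omega, (Finset.eq_of_subset_of_card_le h1 (by omega)).symm⟩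
  have h' := h.swap12
  have hk' : ∃ x, x ∉ P.X 0 ∧ x ≠ c ∧ x ≠ d ∧ P.Fits j i k l b a x d := by
    obtain ⟨x, p1, p2, p3, p4⟩ := hk
    exact ⟨x, p1, p2, p3, p4.swap12⟩
  have hl' : ∀ x y, x ∉ P.X 0 → y ∉ P.X 0 → x ≠ d → y ≠ d → ¬ P.Fits j i k l b a x y :=
    fun x y p1 p2 p3 p4 p5 => hl x y p1 p2 p3 p4 p5.swap12
  have single : ∀ {i j a b}, P.Fits i j k l a b c d → (∃ x, x ∉ P.X 0 ∧ x ≠ c ∧ x ≠ d ∧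
      P.Fits i j k l a b x d) → (∀ x y, x ∉ P.X 0 → y ∉ P.X 0 → x ≠ d → y ≠ d →
      ¬ P.Fits i j k l a b x y) → d ∉ P.X i → d ∈ P.X j → d ∉ P.X k → False := by
    intro i j a b h hk hl di dj dk
    have wd := neg_one_le_wt dj
    obtain ⟨hT1, he, hXi⟩ := one h hk hl di (by omega)
    obtain ⟨z, hz⟩ := Finset.card_eq_one.1 hT1
    obtain ⟨⟨z0, zd⟩, zw⟩ := (mT z).1 (by simp [hz])
    have zA : z ∉ A := fun hh => ((mA z).1 hh).2 zw
    have nT : ∀ x, x ∉ P.X 0 → x ≠ d → x ≠ z → P.wt x ≤ 0 := by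
      intro x x0 xd xz
      by_contra hh
      have := (mT x).2 ⟨⟨x0, xd⟩, by omega⟩
      rw [hz, Finset.mem_singleton] at this
      exact xz this
    have zi : z ∉ P.X i := hXi ▸ zA
    have zz : z ∈ P.X j ∧ z ∈ P.X l := by
      rw [wt_ge_of_mem h.q z0, ind_of_notMem zi] at zw
      simp only [ind] at zw
      clear hl hk h sub one hmin H h' hk' hl' hXi
      grind
    refine rigid_one H hmin h hc hd hk hl (by omega) (by omega) z0 zd nT di dj dk he zi zz.1 zz.2
      fun x => ⟨fun hx => ?_, fun hx => ?_⟩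
    · rw [hXi] at hx
      have := (mA x).1 hx
      exact ⟨this.1.1, this.1.2, fun hh => zA (hh ▸ hx)⟩
    · rw [hXi, mA]
      have := nT x hx.1 hx.2.1 hx.2.2
      exact ⟨⟨hx.1, hx.2.1⟩, by omega⟩
  have q := h.q
  -- The cases are which of `X i`, `X j`, `X k` contain `d`.
  by_cases di : d ∈ P.X i <;> by_cases dj : d ∈ P.X j <;> by_cases dk : d ∈ P.X k
  · have := one_le_wt_of_mem q di dj dk
    omega
  · have wd := wt_nonneg_of_mem_pair q di dj
    refine rigid_two H hmin h hc hd hk hl (by omega) (by omega) (fun x x0 xd => ?_) di dj dk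
    by_contra hh
    have := Finset.card_pos.2 ⟨x, (mT x).2 ⟨⟨x0, xd⟩, by omega⟩⟩
    omega
  · have wd := wt_nonneg_of_mem_pair q.swap23 di dk
    have := one h' hk' hl' dj (by omega)
    omega
  · exact single h' hk' hl' dj di dk
  · have wd := wt_nonneg_of_mem_pair q.swap12.swap23 dj dk
    have := one h hk hl di (by omega)
    omega
  · exact single h hk hl di dj dk
  · have wd := neg_one_le_wt dk
    obtain ⟨hT1, -, hXi⟩ := one h hk hl di (by omega)
    obtain ⟨-, -, hXj⟩ := one h' hk' hl' dj (by omega)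
    obtain ⟨z, hz⟩ := Finset.card_eq_one.1 hT1
    obtain ⟨⟨z0, zd⟩, zw⟩ := (mT z).1 (by simp [hz])
    have zA : z ∉ A := fun hh => ((mA z).1 hh).2 zw
    rw [wt_ge_of_mem q z0, hXi, hXj, ind_of_notMem zA] at zw
    have := ind_le_one (P.X k) z
    have := ind_le_one (P.X l) z
    omega
  · have wd := neg_two_le_wt P d
    obtain ⟨x, hx, y, hy, hxy⟩ := Finset.one_lt_card.1 (show 1 < A.card by omega)
    rw [mA] at hx hy
    refine rigid_zero H hmin h hc hd hk hl (fun t ht => ?_) hx.1.1 hx.1.2 (by omega) hy.1.1 hy.1.2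
      (by omega) hxy
    rcases q.eq_or t with rfl | rfl | rfl | rfl | rfl
    exacts [hd ht, di ht, dj ht, dk ht, h.dl ht]

end Two
end Linked
end Palette

end

/-! ### Linked palettes: two used colours and vanishing weights -/

section

namespace Palette
variable {K : Type*} {P : Palette K} {i j k l n : Fin 5} {a b c d : K}
variable [DecidableEq K] [Fintype K]
variable {Δ e : ℕ} {g r : K}

/-- A free colour of weight zero lies in exactly two of the four sets at nonzero indices. -/
theorem mem_of_wt_eq_zero (q : Quad i j k l) {x : K} (hx : x ∉ P.X 0) (hw : P.wt x = 0) :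
    (x ∈ P.X i → x ∈ P.X j → x ∉ P.X k ∧ x ∉ P.X l) ∧
    (x ∈ P.X i → x ∈ P.X k → x ∉ P.X j ∧ x ∉ P.X l) ∧
    (x ∈ P.X i → x ∈ P.X l → x ∉ P.X j ∧ x ∉ P.X k) ∧
    (x ∈ P.X j → x ∈ P.X k → x ∉ P.X i ∧ x ∉ P.X l) ∧
    (x ∈ P.X j → x ∈ P.X l → x ∉ P.X i ∧ x ∉ P.X k) ∧
    (x ∈ P.X k → x ∈ P.X l → x ∉ P.X i ∧ x ∉ P.X j) ∧
    (x ∉ P.X i → x ∉ P.X j → x ∈ P.X k ∧ x ∈ P.X l) ∧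
    (x ∉ P.X i → x ∉ P.X k → x ∈ P.X j ∧ x ∈ P.X l) ∧
    (x ∉ P.X i → x ∉ P.X l → x ∈ P.X j ∧ x ∈ P.X k) ∧
    (x ∉ P.X j → x ∉ P.X k → x ∈ P.X i ∧ x ∈ P.X l) ∧
    (x ∉ P.X j → x ∉ P.X l → x ∈ P.X i ∧ x ∈ P.X k) ∧
    (x ∉ P.X k → x ∉ P.X l → x ∈ P.X i ∧ x ∈ P.X j) := by
  rw [Linked.wt_ge_of_mem q hx] at hw
  simp only [ind] at hw
  by_cases h1 : x ∈ P.X i <;> by_cases h2 : x ∈ P.X j <;> by_cases h3 : x ∈ P.X k <;>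
    by_cases h4 : x ∈ P.X l <;> simp_all

namespace Linked

section Tight

variable (H : P.Linked Δ e g r)
  (hmin : ∀ {i j k l a b c d}, P.Fits i j k l a b c d → a ∈ P.X 0 ∨ b ∈ P.X 0 ∨ c ∈ P.X 0)
  (hg : P.wt g = 1) (ht : ∀ x, x ≠ g → P.wt x = 0)

include H ht in
/-- If all weights but that of `g` vanish, `r` lies in `X 0` and `X 1` only. -/
theorem tight_r (q : Quad 1 i j k) : r ∉ P.X i ∧ r ∉ P.X j ∧ r ∉ P.X k :=
  notMem_of_wt q H.r0 H.r1 (ht r H.gr.symm).le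

include H hg in
/-- If `g` has weight one, it lies in exactly one set besides `X 0` and `X 1`. -/
theorem tight_g (q : Quad 1 i j k) : (g ∈ P.X i → g ∉ P.X j ∧ g ∉ P.X k) ∧
    (g ∈ P.X j → g ∉ P.X i ∧ g ∉ P.X k) ∧ (g ∈ P.X k → g ∉ P.X i ∧ g ∉ P.X j) ∧
    (g ∈ P.X i ∨ g ∈ P.X j ∨ g ∈ P.X k) := by
  rw [wt_eq q, ind_of_mem H.g0, ind_of_mem H.g1] at hg
  simp only [ind] at hg
  by_cases h1 : g ∈ P.X i <;> by_cases h2 : g ∈ P.X j <;> by_cases h3 : g ∈ P.X k <;> simp_all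

include H ht in
theorem tight_zero {x : K} (hx : x ∉ P.X 0) : P.wt x = 0 :=
  ht x (ne_of_mem_of_not_mem H.g0 hx).symm

include H hmin hg ht in
/-- With `r` placed at `i` and a free colour at `1`, some free colour other than `c, d` is missing
at `j`. -/
theorem tight_exists_snd (h : P.Fits i j 1 n r b c d) (hc : c ∉ P.X 0) (hd : d ∉ P.X 0) :
    ∃ x, x ∉ P.X 0 ∧ x ≠ c ∧ x ≠ d ∧ x ∉ P.X j := by
  by_contra! hj
  have q := h.q
  obtain ⟨-, hXj⟩ := H.eq_of_full h.cd hc hd q.j0 hj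
  have cj : c ∉ P.X j := fun hh => (hXj c hh).2.1 rfl
  have dj : d ∉ P.X j := fun hh => (hXj d hh).2.2 rfl
  have gj : g ∉ P.X j := fun hh => (hXj g hh).1 H.g0
  obtain ⟨y, y0, y1, hy⟩ := H.exists_notMem_one {c, d} (Finset.card_le_two.trans (by simp))
  simp only [Finset.mem_insert, Finset.mem_singleton, not_or] at hy
  obtain ⟨ri, rj, rn⟩ := H.tight_r ht q.swap23.swap12.swap34.swap34
  have tx := mem_of_wt_eq_zero q y0 (H.tight_zero ht y0)
  have gc := ne_of_mem_of_not_mem H.g0 hc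
  have gd := ne_of_mem_of_not_mem H.g0 hd
  have gr := H.gr
  have f := h.swap12.replace_first gr gc gd
  have s1 := fun hh : P.Fits j i 1 n g r c d =>
    (served_two H hmin hh.swap12 hc hd y0 hy.1 hy.2).2.1
  have f1 := fails_three hmin (q := q.swap12.swap23.swap34) hc y0 hd r
  have e1 := H.gc0 j y q.j0 q.jk
  have e2 := H.gc1 j c q.j0 q.jk
  have yj := hj y y0 hy.1 hy.2
  have r0 := H.r0
  obtain ⟨s, m, u⟩ := P.rules
  obtain ⟨q0, w1, w2, w3, w4, w5, w6, w7, w8, w9, w10, w11, w12, w13, w14, w15, w16⟩ := h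
  obtain ⟨q1, q2, q3, q4, q5, q6, q7, q8, q9, q10⟩ := q
  clear hmin H hj hXj hg ht
  grind

include H hmin hg ht in
/-- With `r` placed at `i` and a free colour at `1`, some free colour other than `c, d` is missing
at `i`. -/
theorem tight_exists_fst (h : P.Fits i j 1 n r b c d) (hc : c ∉ P.X 0) (hd : d ∉ P.X 0) :
    ∃ x, x ∉ P.X 0 ∧ x ≠ c ∧ x ≠ d ∧ x ∉ P.X i := by
  by_contra! hi
  have q := h.q
  obtain ⟨-, b0⟩ := used_two h hmin hc hd
  obtain ⟨-, hXi⟩ := H.eq_of_full h.cd hc hd q.i0 hi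
  have ci : c ∉ P.X i := fun hh => (hXi c hh).2.1 rfl
  have di : d ∉ P.X i := fun hh => (hXi d hh).2.2 rfl
  have gi : g ∉ P.X i := fun hh => (hXi g hh).1 H.g0
  have bi : b ∉ P.X i := fun hh => (hXi b hh).1 b0
  obtain ⟨y, y0, y1, hy⟩ := H.exists_notMem_one {c, d} (Finset.card_le_two.trans (by simp))
  simp only [Finset.mem_insert, Finset.mem_singleton, not_or] at hy
  obtain ⟨ri, rj, rn⟩ := H.tight_r ht q.swap23.swap12.swap34.swap34
  have tx := mem_of_wt_eq_zero q y0 (H.tight_zero ht y0)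
  have gc := ne_of_mem_of_not_mem H.g0 hc
  have gd := ne_of_mem_of_not_mem H.g0 hd
  have f := fun hh => h.replace_first (x := g) hh gc gd
  have s1 := fun hh : P.Fits i j 1 n g b c d =>
    (served_two H hmin hh hc hd y0 hy.1 hy.2).2.1
  have s2 := (served_two H hmin h hc hd y0 hy.1 hy.2)
  have f1 := fails_three hmin (q := q.swap23.swap34) hc y0 hd b
  have e1 := H.gc0 i y q.i0 q.ik
  have e2 := H.gc1 i c q.i0 q.ik
  have e3 := H.gc1 j y q.j0 q.jk
  have yi := hi y y0 hy.1 hy.2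
  have nb := ne_of_mem_of_not_mem b0 y0
  obtain ⟨s, m, u⟩ := P.rules
  obtain ⟨q0, w1, w2, w3, w4, w5, w6, w7, w8, w9, w10, w11, w12, w13, w14, w15, w16⟩ := h
  obtain ⟨q1, q2, q3, q4, q5, q6, q7, q8, q9, q10⟩ := q
  clear hmin H hi hXi hg ht
  have p : P.conf y 1 d n ∨ P.conf y 1 b j := by grind
  have p' : P.conf y 1 b j := by
    rcases p with p | p
    · grind
    · exact p
  grind

include H hmin ht in
/-- With `r` at `i` and `g` at `j`, a free colour missing at `i` conflicts there with `c` at `1`,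
and at `0` with `g`. -/
theorem tight_fst_aux (h : P.Fits i j 1 n r g c d) (hc : c ∉ P.X 0) (hd : d ∉ P.X 0)
    {x : K} (x0 : x ∉ P.X 0) (xc : x ≠ c) (xd : x ≠ d) (xi : x ∉ P.X i) :
    x ∈ P.X 1 ∧ x ∈ P.X j ∧ x ∉ P.X n ∧ P.conf x i c 1 ∧ P.conf x 0 g j := by
  have q := h.q
  have tx := mem_of_wt_eq_zero q x0 (H.tight_zero ht x0)
  have s2 := (served_two H hmin h hc hd x0 xc xd)
  have e1 := H.gc0 j x q.j0 q.jk
  have p1 := s2.2.1.resolve_left fun hh => xi (P.conf_mem hh)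
  have x1 := e1 (P.conf_symm p1)
  have xj := P.conf_mem p1
  have xn : x ∉ P.X n := (tx.2.2.2.1 xj x1).2
  refine ⟨x1, xj, xn, ?_, p1⟩
  rcases s2.2.2.1 with hh | hh | hh | hh
  exacts [(xi hh).elim, absurd (conf_unique' hh p1) q.i0, hh, (xn (P.conf_mem hh)).elim]

include H hmin hg ht in
/-- With `r` placed at `i` and a free colour at `1`, the set `X i` does not contain `g`. -/
theorem tight_fst (h : P.Fits i j 1 n r b c d) (hc : c ∉ P.X 0) (hd : d ∉ P.X 0)
    (gi : g ∈ P.X i) : False := by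
  have q := h.q
  obtain ⟨w, w0, wc, wd, wi⟩ := tight_exists_fst H hmin hg ht h hc hd
  have Q := q.swap23.swap12
  obtain ⟨gj, gn⟩ := (H.tight_g hg Q).1 gi
  obtain ⟨ri, rj, rn⟩ := H.tight_r ht Q
  have gr := H.gr
  have h2 : P.Fits i j 1 n r g c d := by
    rcases h.swap12.replace_first (x := g) gr (ne_of_mem_of_not_mem H.g0 hc)
      (ne_of_mem_of_not_mem H.g0 hd) with hh | hh | hh | hh | hh
    exacts [(gj hh).elim, (rj (conf_mem' hh)).elim, (hc (H.gc1 j c q.j0 q.jk hh)).elim,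
      (gn (P.conf_mem hh)).elim, hh.swap12]
  clear h
  have F := fun x (x0 : x ∉ P.X 0) (xc : x ≠ c) (xd : x ≠ d) (xi : x ∉ P.X i) =>
    tight_fst_aux H hmin ht h2 hc hd x0 xc xd xi
  obtain ⟨w1, wj, wn, wic, w0g⟩ := F w w0 wc wd wi
  have h3 : P.Fits i j 1 n r g c w := by
    refine ⟨q, ri, gj, h2.ck, wn, h2.ab, h2.ac, ne_of_mem_of_not_mem H.r0 w0, h2.bc,
      ne_of_mem_of_not_mem H.g0 w0, wc.symm, h2.hab, h2.hac, fun hh => rn (P.conf_mem hh), h2.hbc,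
      fun hh => q.l0 (conf_unique' (P.conf_symm hh) w0g),
      fun hh => q.il (conf_unique' wic (P.conf_symm hh))⟩
  refine H.cap_contra q.i0 q.j0 (fun x x0 xi => ?_) (fun z z0 zj => ?_)
  · have xc : x ≠ c := fun hh => xi (hh ▸ conf_mem' wic)
    by_cases xd : x = d
    · subst xd
      have := tight_fst_aux H hmin ht h3 hc w0 x0 xc (Ne.symm wd) xi
      exact ⟨this.1, this.2.1⟩
    · exact ⟨(F x x0 xc xd xi).1, (F x x0 xc xd xi).2.1⟩
  · obtain ⟨y, y0, y1, hy⟩ := H.exists_notMem_one {c, d, z} Finset.card_le_three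
    simp only [Finset.mem_insert, Finset.mem_singleton, not_or] at hy
    have f1 := H.stuck.fails (q := q.swap34.swap23.swap34) (x := w) (a := r) (b := g) (c := y) (d
        := z) w0
    have s1 := served_two H hmin h2 hc hd y0 hy.1 hy.2.1
    have e1 := H.gc0 j y q.j0 q.jk
    have e2 := H.gc1 n y q.l0 q.kl.symm
    have hyz := hy.2.2
    have m1 := ne_of_mem_of_not_mem H.g0 z0
    have m2 := ne_of_mem_of_not_mem H.r0 z0
    have m3 := ne_of_mem_of_not_mem H.g0 y0
    have m4 := ne_of_mem_of_not_mem H.r0 y0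
    have m5 := ne_of_mem_of_not_mem H.g0 w0
    have m6 := ne_of_mem_of_not_mem H.r0 w0
    obtain ⟨s, m, u⟩ := P.rules
    obtain ⟨q1, q2, q3, q4, q5, q6, q7, q8, q9, q10⟩ := q
    clear hmin H hg ht F h2 h3 Q hy
    grind

end Tight
end Linked
end Palette

end

section

namespace Palette
variable {K : Type*} {P : Palette K} {i j k l n : Fin 5} {a b c d : K}
variable [DecidableEq K] [Fintype K]
variable {Δ e : ℕ} {g r : K}

namespace Linked

section Tight

variable (H : P.Linked Δ e g r)
  (hmin : ∀ {i j k l a b c d}, P.Fits i j k l a b c d → a ∈ P.X 0 ∨ b ∈ P.X 0 ∨ c ∈ P.X 0)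
  (hg : P.wt g = 1) (ht : ∀ x, x ≠ g → P.wt x = 0)

include H hmin hg ht in
/-- If `g` lies in `X n`, then `r` and `g` cannot be placed at `i` and `j` together with free
colours at `1` and `n`. A free colour `w` missing at `i` may take the place of `d`, and
interchanging `r` and `g` then yields a contradiction to the bound on `X 1`. -/
theorem tight_lst_aux (h : P.Fits i j 1 n r g c d) (hc : c ∉ P.X 0) (hd : d ∉ P.X 0)
    (gn : g ∈ P.X n) {w : K} (w0 : w ∉ P.X 0) (wc : w ≠ c) (wd : w ≠ d) (wi : w ∉ P.X i) :
    False := by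
  have q := h.q
  have Q := q.swap23.swap12
  obtain ⟨gi, gj⟩ := (H.tight_g hg Q).2.2.1 gn
  obtain ⟨ri, rj, rn⟩ := H.tight_r ht Q
  have F := fun x (x0 : x ∉ P.X 0) (xc : x ≠ c) (xd : x ≠ d) (xi : x ∉ P.X i) =>
    tight_fst_aux H hmin ht h hc hd x0 xc xd xi
  obtain ⟨w1, wj, wn, wic, w0g⟩ := F w w0 wc wd wi
  have ng : ∀ {x}, x ∉ P.X 0 → g ≠ x := fun h => ne_of_mem_of_not_mem H.g0 h
  have nr : ∀ {x}, x ∉ P.X 0 → r ≠ x := fun h => ne_of_mem_of_not_mem H.r0 h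
  have h3 : P.Fits i j 1 n r g c w := by
    refine ⟨q, ri, gj, h.ck, wn, h.ab, h.ac, nr w0, h.bc,
      ng w0, wc.symm, h.hab, h.hac, fun hh => rn (P.conf_mem hh), h.hbc,
      fun hh => q.l0 (conf_unique' (P.conf_symm hh) w0g),
      fun hh => q.il (conf_unique' wic (P.conf_symm hh))⟩
  -- The quadruple with `g` at `i`, `r` at `j`, a free colour at `1` and `w` at `n` is impossible.
  have key : ∀ x, x ∉ P.X 0 → x ∉ P.X 1 → x ≠ w → ¬ P.conf x 1 w n → x ∈ P.X j := by
    intro x x0 x1 xw hx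
    obtain ⟨y, y0, y1, hy⟩ := H.exists_notMem_one {c, d, x} Finset.card_le_three
    simp only [Finset.mem_insert, Finset.mem_singleton, not_or] at hy
    have f1 := H.stuck.fails (q := q) (x := y) (a := g) (b := r) (c := x) (d := w) y0
    have s1 := (served_two H hmin h hc hd y0 hy.1 hy.2.1).2.1
    have e1 := H.gc0 j y q.j0 q.jk
    have e2 := H.gc0 i y q.i0 q.ik
    have e3 := H.gc1 i x q.i0 q.ik
    have m1 := ng x0
    have m2 := nr x0
    have m3 := ng y0
    have m4 := nr y0
    have m5 := ng w0
    have m6 := nr w0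
    have gr := H.gr
    obtain ⟨s, m, u⟩ := P.rules
    obtain ⟨q1, q2, q3, q4, q5, q6, q7, q8, q9, q10⟩ := q
    clear hmin H hg ht F h h3 Q
    grind
  have cj : c ∈ P.X j := key c hc h.ck wc.symm h3.hcd
  have yj : ∀ y, y ∉ P.X 0 → y ≠ c → y ∉ P.X 1 → y ∈ P.X j := by
    intro y y0 yc y1
    have yw : y ≠ w := fun hh => y1 (hh ▸ w1)
    by_contra yj
    refine yj (key y y0 y1 yw fun hh => ?_)
    rcases (served_two H hmin h3 hc w0 y0 yc yw).2.2.2 with p | p | p | p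
    exacts [yj p, rj (conf_mem' p), y1 (P.conf_mem p), q.jk (conf_unique' p hh)]
  refine H.cap_contra q.i0 q.j0 (fun x x0 xi => ?_) (fun z z0 zj => ?_)
  · have xc : x ≠ c := fun hh => xi (hh ▸ conf_mem' wic)
    by_cases xd : x = d
    · subst xd
      have := tight_fst_aux H hmin ht h3 hc w0 x0 xc (Ne.symm wd) xi
      exact ⟨this.1, this.2.1⟩
    · exact ⟨(F x x0 xc xd xi).1, (F x x0 xc xd xi).2.1⟩
  · by_contra z1
    by_cases zc : z = c
    · exact zj (zc ▸ cj)
    · exact zj (yj z z0 zc z1)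

include H hmin hg ht in
/-- With `r` placed at `i` and free colours at `1` and `n`, the set `X n` does not contain `g`. -/
theorem tight_lst (h : P.Fits i j 1 n r b c d) (hc : c ∉ P.X 0) (hd : d ∉ P.X 0)
    (gn : g ∈ P.X n) : False := by
  have q := h.q
  have Q := q.swap23.swap12
  obtain ⟨gi, gj⟩ := (H.tight_g hg Q).2.2.1 gn
  obtain ⟨ri, rj, rn⟩ := H.tight_r ht Q
  have ng : ∀ {x}, x ∉ P.X 0 → g ≠ x := fun h => ne_of_mem_of_not_mem H.g0 h
  have nr : ∀ {x}, x ∉ P.X 0 → r ≠ x := fun h => ne_of_mem_of_not_mem H.r0 h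
  obtain ⟨w, w0, wc, wd, wi⟩ := tight_exists_fst H hmin hg ht h hc hd
  rcases h.swap12.replace_first H.gr (ng hc) (ng hd) with hh | hh | hh | hh | hh
  · exact gj hh
  · exact rj (conf_mem' hh)
  · exact hc (H.gc1 j c q.j0 q.jk hh)
  · obtain ⟨x, x0, xc, xd, xj⟩ := tight_exists_snd H hmin hg ht h hc hd
    have gb : g ≠ b := fun hb => h.hbd (hb ▸ hh)
    have h2 : P.Fits i j 1 n g b c d := by
      rcases h.replace_first gb (ng hc) (ng hd) with p | p | p | p | p
      exacts [(gi p).elim, (gj (P.conf_mem p)).elim, (hc (H.gc1 i c q.i0 q.ik p)).elim,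
        (q.ij (P.conf_unique (P.conf_symm p) (P.conf_symm hh))).elim, p]
    have yj : ∀ y, y ∉ P.X 0 → y ≠ c → y ≠ d → y ∉ P.X 1 → y ∈ P.X j := by
      intro y y0 yc yd y1
      rcases (served_two H hmin h2 hc hd y0 yc yd).2.1 with p | p
      · exact (y1 (H.gc0 i y q.i0 q.ik (P.conf_symm p))).elim
      · exact P.conf_mem p
    have x1 : x ∈ P.X 1 := by_contra fun p => xj (yj x x0 xc xd p)
    obtain ⟨-, s1, -, s2⟩ := served_two H hmin h hc hd x0 xc xd
    have xri := s1.resolve_right fun p => xj (P.conf_mem p)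
    have xi := P.conf_mem xri
    have xn : x ∉ P.X n := ((mem_of_wt_eq_zero q x0 (H.tight_zero ht x0)).2.1 xi x1).2
    have xjc : P.conf x j c 1 := by
      rcases s2 with p | p | p | p
      exacts [(xj p).elim, (rj (conf_mem' p)).elim, p, (xn (P.conf_mem p)).elim]
    refine tight_lst_aux H hmin hg ht (i := i) (j := j) (n := n) (c := c) (d := x) (w := w)
      ⟨q, ri, gj, h.ck, xn, H.gr.symm, nr hc, nr x0, ng hc, ng x0, xc.symm,
        fun p => gi (conf_mem' p), h.hac, fun p => rn (P.conf_mem p),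
        fun p => hc (H.gc1 j c q.j0 q.jk p), fun p => xj (conf_mem' p),
        fun p => q.jl (conf_unique' xjc (P.conf_symm p))⟩ hc x0 gn w0 wc (fun p => wi (p ▸ xi)) wi
  · exact tight_lst_aux H hmin hg ht hh.swap12 hc hd gn w0 wc wd wi

include H hmin hg ht in
/-- If `g` lies in `X j`, where `r` is placed at `i` and free colours at `1` and `n`, this
determines the conflicts of the free colours missing at `1` and at `j`. -/
theorem tight_snd_aux (h : P.Fits i j 1 n r b c d) (hc : c ∉ P.X 0) (hd : d ∉ P.X 0)
    (gj : g ∈ P.X j) :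
    (∀ x, x ∉ P.X 0 → x ≠ d → x ∉ P.X 1 → P.conf x 1 r j ∧ x ∈ P.X j) ∧
    (∀ x, x ∉ P.X 0 → x ≠ c → x ≠ d → x ∉ P.X j → x ∈ P.X 1 ∧ P.conf x 0 r i ∧ P.conf x j c 1) ∧
    (∀ x, x ∉ P.X 0 → x ≠ c → x ≠ d → x ∉ P.X 1 → x ∉ P.X i →
      P.conf x i d n ∧ P.conf x 0 b j) := by
  have q := h.q
  have Q := q.swap23.swap12
  obtain ⟨gi, gn⟩ := (H.tight_g hg Q).2.1 gj
  obtain ⟨ri, rj, rn⟩ := H.tight_r ht Q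
  have ng : ∀ {x}, x ∉ P.X 0 → g ≠ x := fun h => ne_of_mem_of_not_mem H.g0 h
  have nr : ∀ {x}, x ∉ P.X 0 → r ≠ x := fun h => ne_of_mem_of_not_mem H.r0 h
  have nf : ∀ x, x ∉ P.X 0 → ¬ P.Fits i j 1 n g r x d := fun x x0 f =>
    tight_fst H hmin hg ht f.swap12 x0 hd gj
  have k1 : ∀ x, x ∉ P.X 0 → x ≠ d → x ∉ P.X 1 → P.conf x 1 r j ∨ P.conf x 1 d n := by
    intro x x0 xd x1
    have f := Palette.fails q (nf x x0)
    have e3 := H.gc1 i x q.i0 q.ik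
    have m1 := ng x0
    have m2 := nr x0
    have m3 := ng hd
    have m4 := nr hd
    have m5 := H.gr
    have dn := h.dl
    obtain ⟨s, m, u⟩ := P.rules
    obtain ⟨q1, q2, q3, q4, q5, q6, q7, q8, q9, q10⟩ := q
    clear hmin H hg ht h Q nf
    grind
  have k2 : ∀ x, x ∉ P.X 0 → x ≠ c → x ≠ d → x ∉ P.X 1 → x ∉ P.X i →
      P.conf x i d n ∧ P.conf x 0 b j := by
    intro x x0 xc xd x1 xi
    obtain ⟨-, s1, s2, -⟩ := served_two H hmin h hc hd x0 xc xd
    have p := s1.resolve_left fun hh => xi (P.conf_mem hh)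
    refine ⟨?_, p⟩
    rcases s2 with hh | hh | hh | hh
    exacts [(xi hh).elim, (q.i0 (conf_unique' hh p)).elim, (x1 (P.conf_mem hh)).elim, hh]
  have k3 : ∀ x, x ∉ P.X 0 → x ≠ d → x ∉ P.X 1 → P.conf x 1 r j := by
    intro x x0 xd x1
    refine (k1 x x0 xd x1).resolve_right fun p => ?_
    by_cases xc : x = c
    · subst xc; exact h.hcd p
    by_cases xi : x ∈ P.X i
    · have xj : x ∉ P.X j := ((mem_of_wt_eq_zero q x0 (H.tight_zero ht x0)).2.2.1 xi
        (P.conf_mem p)).1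
      rcases (served_two H hmin h hc hd x0 xc xd).2.2.2 with hh | hh | hh | hh
      exacts [xj hh, rj (conf_mem' hh), x1 (P.conf_mem hh), q.jk (conf_unique' hh p)]
    · exact q.ik (conf_unique' (k2 x x0 xc xd x1 xi).1 p)
  have k4 : ∀ x, x ∉ P.X 0 → x ≠ d → x ∉ P.X 1 → P.conf x 1 r j ∧ x ∈ P.X j :=
    fun x x0 xd x1 => ⟨k3 x x0 xd x1, P.conf_mem (k3 x x0 xd x1)⟩
  refine ⟨k4, fun x x0 xc xd xj => ?_, k2⟩
  have x1 : x ∈ P.X 1 := by_contra fun hh => xj (k4 x x0 xd hh).2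
  obtain ⟨-, s1, -, s2⟩ := served_two H hmin h hc hd x0 xc xd
  have p := s1.resolve_right fun hh => xj (P.conf_mem hh)
  refine ⟨x1, p, ?_⟩
  have xn : x ∉ P.X n := ((mem_of_wt_eq_zero q x0 (H.tight_zero ht x0)).2.1 (P.conf_mem p) x1).2
  rcases s2 with hh | hh | hh | hh
  exacts [(xj hh).elim, (rj (conf_mem' hh)).elim, hh, (xn (P.conf_mem hh)).elim]

include H hmin hg ht in
/-- With `r` placed at `i` and free colours at `1` and `n`, the set `X j` does not contain `g`. -/
theorem tight_snd (h : P.Fits i j 1 n r b c d) (hc : c ∉ P.X 0) (hd : d ∉ P.X 0)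
    (gj : g ∈ P.X j) : False := by
  have q := h.q
  have Q := q.swap23.swap12
  obtain ⟨gi, gn⟩ := (H.tight_g hg Q).2.1 gj
  obtain ⟨ri, rj, rn⟩ := H.tight_r ht Q
  obtain ⟨-, b0⟩ := used_two h hmin hc hd
  have ng : ∀ {x}, x ∉ P.X 0 → g ≠ x := fun h => ne_of_mem_of_not_mem H.g0 h
  have nr : ∀ {x}, x ∉ P.X 0 → r ≠ x := fun h => ne_of_mem_of_not_mem H.r0 h
  have nb : ∀ {x}, x ∉ P.X 0 → b ≠ x := fun h => ne_of_mem_of_not_mem b0 h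
  obtain ⟨w, w0, wc, wd, wi⟩ := tight_exists_fst H hmin hg ht h hc hd
  obtain ⟨z, z0, zc, zd, zj⟩ := tight_exists_snd H hmin hg ht h hc hd
  obtain ⟨k1, k2, k3⟩ := tight_snd_aux H hmin hg ht h hc hd gj
  obtain ⟨z1, z0r, zjc⟩ := k2 z z0 zc zd zj
  have zi := P.conf_mem z0r
  have zn : z ∉ P.X n := ((mem_of_wt_eq_zero q z0 (H.tight_zero ht z0)).2.1 zi z1).2
  have cj := conf_mem' zjc
  -- No free colour missing at `1` is missing at `i`.
  have A : ∀ x, x ∉ P.X 0 → x ≠ c → x ≠ d → x ∉ P.X 1 → x ∈ P.X i := by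
    intro x x0 xc xd x1
    by_contra xi
    obtain ⟨p1, p2⟩ := k3 x x0 xc xd x1 xi
    obtain ⟨p3, xj⟩ := k1 x x0 xd x1
    have gb : g ≠ b := fun hh => h.bj (hh ▸ gj)
    have f1 := fails_three hmin (q := Q.swap23.swap34) x0 z0 hd r
    have f2 := H.stuck.fails (q := q) (x := z) (a := x) (b := b) (c := c) (d := g) z0
    have e1 := H.gc1 n c q.l0 q.kl.symm
    have e2 := H.gc1 i c q.i0 q.ik
    have c1 := h.ck
    have dn := h.dl
    have bj := h.bj
    have hbc := h.hbc
    have n1 := nr hd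
    have n2 := nr z0
    have n3 := nr x0
    have n4 := ng z0
    have n5 := ng x0
    have n6 := nb z0
    have n7 := nb x0
    have n8 := nb hc
    have n9 := ng hc
    have n10 := H.g1
    have q1 : P.conf x 1 z j := by
      obtain ⟨s, m, u⟩ := P.rules
      obtain ⟨q1, q2, q3, q4, q5, q6, q7, q8, q9, q10⟩ := q
      clear hmin H hg ht h Q k1 k2 k3 f2
      grind
    have q2 : P.conf b j g n := by
      obtain ⟨s, m, u⟩ := P.rules
      obtain ⟨q1, q2, q3, q4, q5, q6, q7, q8, q9, q10⟩ := q
      clear hmin H hg ht h Q k1 k2 k3 f1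
      grind
    have bn := P.conf_mem q2
    have bw := ht b gb.symm
    rw [wt_eq q, ind_of_mem b0, ind_of_mem bn] at bw
    have b1 : b ∉ P.X 1 := fun hh => by
      rw [ind_of_mem hh] at bw
      have := ind_nonneg (P.X i) b
      have := ind_nonneg (P.X j) b
      omega
    have bi : b ∉ P.X i := fun hh => by
      rw [ind_of_mem hh] at bw
      have := ind_nonneg (P.X 1) b
      have := ind_nonneg (P.X j) b
      omega
    have h2 : P.Fits i j 1 n g b c d := by
      rcases h.replace_first gb (ng hc) (ng hd) with p | p | p | p | p
      exacts [(gi p).elim, (bi (conf_mem' p)).elim, (hc (e2 p)).elim, (gn (P.conf_mem p)).elim, p]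
    obtain ⟨y, y0, y1, hy⟩ := H.exists_notMem_one {c, d, x} Finset.card_le_three
    simp only [Finset.mem_insert, Finset.mem_singleton, not_or] at hy
    have yb : P.conf y 0 b j := by
      rcases (served_two H hmin h2 hc hd y0 hy.1 hy.2.1).2.1 with p | p
      · exact (y1 (H.gc0 i y q.i0 q.ik (P.conf_symm p))).elim
      · exact p
    have f3 := H.stuck.fails (q := Q.swap23.swap34.swap23) (x := y) (a := b) (b := g) (c := z)
      (d := x) y0
    have e3 := H.gc0 n y q.l0 q.kl.symm
    have yx := hy.2.2
    obtain ⟨s, m, u⟩ := P.rules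
    obtain ⟨q1, q2, q3, q4, q5, q6, q7, q8, q9, q10⟩ := q
    clear hmin H hg ht h Q k1 k2 k3 f1 f2 bw h2 hy
    grind
  have w1 : w ∈ P.X 1 := by_contra fun hh => wi (A w w0 wc wd hh)
  have wj : w ∈ P.X j := P.conf_mem ((served_two H hmin h hc hd w0 wc wd).2.1.resolve_left
    fun p => wi (P.conf_mem p))
  have h3 : P.Fits i j 1 n r b c z :=
    ⟨q, ri, h.bj, h.ck, zn, h.ab, h.ac, nr z0, h.bc, nb z0, zc.symm, h.hab, h.hac,
      fun p => rn (P.conf_mem p), h.hbc, fun p => zj (conf_mem' p),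
      fun p => q.jl (conf_unique' zjc (P.conf_symm p))⟩
  -- Every free colour missing at `j` lies in `X 1`, so `X 1` is too large.
  have B : ∀ x, x ∉ P.X 0 → x ∉ P.X j → x ∈ P.X 1 := by
    intro x x0 xj
    have xc : x ≠ c := fun hh => xj (hh ▸ cj)
    by_cases xd : x = d
    · subst xd
      exact ((tight_snd_aux H hmin hg ht h3 hc z0 gj).2.1 x x0 xc zd.symm xj).1
    · exact (k2 x x0 xc xd xj).1
  have h1 : (P.X 0)ᶜ \ P.X j ⊆ (P.X 0)ᶜ ∩ P.X 1 := fun x hx => by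
    simp only [Finset.mem_sdiff, Finset.mem_compl, Finset.mem_inter] at hx ⊢
    exact ⟨hx.1, B x hx.1 hx.2⟩
  have h2 := card_add_card_le (t := {w}) h1 (by simp [w0, w1]) (by simp [wj])
  have h4 : ((P.X 0)ᶜ ∩ P.X j).card + 1 ≤ (P.X j).card := by
    have := card_add_card_le (s := (P.X 0)ᶜ ∩ P.X j) (t := {g}) (X := P.X j)
      Finset.inter_subset_right (by simp [gj]) (by simp [H.g0])
    simpa using this
  have h5 := Finset.card_sdiff_add_card_inter (P.X 0)ᶜ (P.X j)
  have := H.hA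
  have := H.hX j q.j0
  have := H.hΔ
  have := H.card_inter
  have := H.cap
  rw [Finset.card_singleton] at h2
  omega

include H hmin hg ht in
/-- If all weights but that of `g` vanish, no fitting quadruple with two used colours has a free
colour at `1`. -/
theorem tight_one_unused (h : P.Fits i j 1 n a b c d) (hc : c ∉ P.X 0) (hd : d ∉ P.X 0) :
    False := by
  have q := h.q
  have Q := q.swap23.swap12
  obtain ⟨ri, rj, rn⟩ := H.tight_r ht Q
  have ng : ∀ {x}, x ∉ P.X 0 → g ≠ x := fun h => ne_of_mem_of_not_mem H.g0 h
  have nr : ∀ {x}, x ∉ P.X 0 → r ≠ x := fun h => ne_of_mem_of_not_mem H.r0 h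
  have main : ∀ {i j b}, P.Fits i j 1 n r b c d → False := by
    intro i j b h
    rcases (H.tight_g hg h.q.swap23.swap12).2.2.2 with hh | hh | hh
    exacts [tight_fst H hmin hg ht h hc hd hh, tight_snd H hmin hg ht h hc hd hh,
      tight_lst H hmin hg ht h hc hd hh]
  have place : ∀ {i j a b}, P.Fits i j 1 n a b c d → r ∉ P.X i → r ∉ P.X j → r = b ∨
      P.conf r i c 1 := by
    intro i j a b h ri rj
    by_contra hn
    push Not at hn
    rcases h.replace_first hn.1 (nr hc) (nr hd) with p | p | p | p | p
    exacts [ri p, rj (P.conf_mem p), hn.2 p, rn (P.conf_mem p), main p]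
  rcases place h ri rj with rfl | p
  · exact main h.swap12
  · rcases place h.swap12 rj ri with rfl | p'
    · exact main h
    · exact q.ij (P.conf_unique (P.conf_symm p) (P.conf_symm p'))

end Tight
end Linked
end Palette

end

section

namespace Palette
variable {K : Type*} {P : Palette K} {i j k l n : Fin 5} {a b c d : K}
variable [DecidableEq K] [Fintype K]
variable {Δ e : ℕ} {g r : K}

namespace Linked

section Tight

variable (H : P.Linked Δ e g r)
  (hmin : ∀ {i j k l a b c d}, P.Fits i j k l a b c d → a ∈ P.X 0 ∨ b ∈ P.X 0 ∨ c ∈ P.X 0)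
  (hg : P.wt g = 1) (ht : ∀ x, x ≠ g → P.wt x = 0)

include H hmin hg ht in
/-- The reasons why two free colours, one of them at `1`, are not part of a fitting quadruple. -/
theorem tight_fails (q : Quad 1 i j k) {x y : K} (hx : x ∉ P.X 0) (hy : y ∉ P.X 0) (a b : K) :
    x ∈ P.X 1 ∨ y ∈ P.X i ∨ a ∈ P.X j ∨ b ∈ P.X k ∨ x = y ∨ x = a ∨ x = b ∨ y = a ∨ y = b ∨
      a = b ∨ P.conf x 1 y i ∨ P.conf x 1 a j ∨ P.conf x 1 b k ∨ P.conf y i a j ∨ P.conf y i b k ∨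
      P.conf a j b k :=
  Palette.fails q fun h =>
    tight_one_unused H hmin hg ht h.swap23.swap12.swap34.swap23 hx hy

include H hmin ht in
/-- With used colours at `1` and `j`, a free colour missing at `1` conflicts at `0` with `b`, and at
`1` with exactly one of `c` and `d`. -/
theorem tight_used_aux (h : P.Fits 1 j k l a b c d) (hc : c ∉ P.X 0) (hd : d ∉ P.X 0) {y : K}
    (y0 : y ∉ P.X 0) (yc : y ≠ c) (yd : y ≠ d) (y1 : y ∉ P.X 1) :
    P.conf y 0 b j ∧ y ∈ P.X j ∧ (P.conf y 1 c k ∧ y ∈ P.X k ∧ y ∉ P.X l ∨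
      P.conf y 1 d l ∧ y ∈ P.X l ∧ y ∉ P.X k) := by
  obtain ⟨-, s1, s2, -⟩ := served_two H hmin h hc hd y0 yc yd
  have q := h.q
  have p := s1.resolve_left fun hh => y1 (P.conf_mem hh)
  have yj := P.conf_mem p
  have tx := mem_of_wt_eq_zero q y0 (H.tight_zero ht y0)
  refine ⟨p, yj, ?_⟩
  rcases s2 with hh | hh | hh | hh
  · exact (y1 hh).elim
  · exact absurd (conf_unique' hh p) (by decide)
  · have yk := P.conf_mem hh
    exact Or.inl ⟨hh, yk, (tx.2.2.2.1 yj yk).2⟩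
  · have yl := P.conf_mem hh
    exact Or.inr ⟨hh, yl, (tx.2.2.2.2.1 yj yl).2⟩

include H hmin ht in
/-- If one free colour missing at `1` conflicts there with `c`, all free colours missing at `1` do,
and they can take the place of `d`. -/
theorem tight_used_facts (h : P.Fits 1 j k l a b c d) (hc : c ∉ P.X 0) (hd : d ∉ P.X 0) {v : K}
    (v0 : v ∉ P.X 0) (vc : v ≠ c) (vd : v ≠ d) (v1 : v ∉ P.X 1) (hv : P.conf v 1 c k) {y : K}
    (y0 : y ∉ P.X 0) (yc : y ≠ c) (y1 : y ∉ P.X 1) :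
    P.conf y 0 b j ∧ P.conf y 1 c k ∧ y ∈ P.X j ∧ y ∈ P.X k ∧ y ∉ P.X l ∧
      P.Fits 1 j k l a b c y := by
  have q := h.q
  obtain ⟨ha, hb⟩ := used_two h hmin hc hd
  have fits : ∀ {y}, y ∉ P.X 0 → y ≠ c → y ∉ P.X 1 → P.conf y 0 b j → P.conf y 1 c k → y ∉ P.X l →
      P.Fits 1 j k l a b c y := by
    intro y y0 yc y1 p1 p2 yl
    exact ⟨q, h.ai, h.bj, h.ck, yl, h.ab, h.ac, ne_of_mem_of_not_mem ha y0, h.bc,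
      ne_of_mem_of_not_mem hb y0, yc.symm, h.hab, h.hac, fun hh => y1 (conf_mem' hh), h.hbc,
      fun hh => q.l0 (conf_unique' (P.conf_symm hh) p1),
      fun hh => q.il (conf_unique' p2 (P.conf_symm hh))⟩
  have ev := tight_used_aux H hmin ht h hc hd v0 vc vd v1
  have vl : v ∉ P.X l := by
    rcases ev.2.2 with hh | hh
    · exact hh.2.2
    · exact (hh.2.2 (P.conf_mem hv)).elim
  have fv := fits v0 vc v1 ev.1 hv vl
  by_cases yv : y = v
  · subst yv
    exact ⟨ev.1, hv, ev.2.1, P.conf_mem hv, vl, fv⟩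
  · have ey := tight_used_aux H hmin ht fv hc v0 y0 yc yv y1
    rcases ey.2.2 with hh | hh
    · exact ⟨ey.1, hh.1, ey.2.1, hh.2.1, hh.2.2, fits y0 yc y1 ey.1 hh.1 hh.2.2⟩
    · exact (v1 (conf_mem' hh.1)).elim

include H hmin ht in
/-- In the situation of `tight_used_facts`, some free colour lies in `X 1` and `X l` and in neither
`X j` nor `X k`. -/
theorem tight_used_exists (h : P.Fits 1 j k l a b c d) (hc : c ∉ P.X 0) (hd : d ∉ P.X 0) {v : K}
    (v0 : v ∉ P.X 0) (vc : v ≠ c) (vd : v ≠ d) (v1 : v ∉ P.X 1) (hv : P.conf v 1 c k) :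
    ∃ z, z ∉ P.X 0 ∧ z ≠ c ∧ z ≠ d ∧ z ∈ P.X 1 ∧ z ∈ P.X l ∧ z ∉ P.X j ∧ z ∉ P.X k := by
  -- Otherwise each free colour other than `c` lies in `X j ∪ X k`, and in `X j ∩ X k` when missing
  -- at `1`; the sizes of `X 1`, `X j` and `X k` do not allow this.
  by_contra hn
  have q := h.q
  have F := fun y (y0 : y ∉ P.X 0) (yc : y ≠ c) (y1 : y ∉ P.X 1) =>
    tight_used_facts H hmin ht h hc hd v0 vc vd v1 hv y0 yc y1
  have c1 := conf_mem' hv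
  have hx : ∀ x, x ∉ P.X 0 → x ≠ c → x ∈ P.X j ∨ x ∈ P.X k := by
    intro x x0 xc
    by_contra! hh
    have tx := mem_of_wt_eq_zero q x0 (H.tight_zero ht x0)
    have t2 := tx.2.2.2.2.2.2.2.2.2.1 hh.1 hh.2
    exact hn ⟨x, x0, xc, fun hd => h.dl (hd ▸ t2.2), t2.1, t2.2, hh.1, hh.2⟩
  have hΔ := H.hΔ
  have cj : c ∈ P.X j := by
    by_contra cj
    have main : ∀ {d}, P.Fits 1 j k l a b c d → d ∉ P.X 0 → ∀ x, x ∉ P.X 0 → x ≠ c → x ≠ d →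
        x ∈ P.X j := by
      intro d h hd x x0 xc xd
      by_contra xj
      have tx := mem_of_wt_eq_zero q x0 (H.tight_zero ht x0)
      have xk := (hx x x0 xc).resolve_left xj
      have x1 : x ∈ P.X 1 := by_contra fun hh => xj (F x x0 xc hh).2.2.1
      have xl := (tx.2.1 x1 xk).2
      obtain ⟨-, s1, -, s2⟩ := served_two H hmin h hc hd x0 xc xd
      have p := s1.resolve_right fun hh => xj (P.conf_mem hh)
      rcases s2 with hh | hh | hh | hh
      exacts [xj hh, q.j0 (conf_unique' hh p), cj (conf_mem' hh), xl (P.conf_mem hh)]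
    have hsub : (P.X 0)ᶜ \ {c} ⊆ P.X j := by
      intro x hx
      simp only [Finset.mem_sdiff, Finset.mem_compl, Finset.mem_singleton] at hx
      by_cases xd : x = d
      · exact main (F v v0 vc v1).2.2.2.2.2 v0 x hx.1 hx.2 (xd ▸ vd.symm)
      · exact main h hd x hx.1 hx.2 xd
    have := Finset.card_le_card hsub
    have := H.hX j q.j0
    have := H.card_erase c
    omega
  set A := (P.X 0)ᶜ \ {c} with hA
  have mA : ∀ x, x ∈ A ↔ x ∉ P.X 0 ∧ x ≠ c := fun x => by simp [hA]
  have cA := H.card_erase c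
  rw [← hA] at cA
  clear_value A
  have h1 : (A ∩ P.X j).card + 1 ≤ (P.X j).card := by
    have := card_add_card_le (s := A ∩ P.X j) (t := {c}) (X := P.X j)
      Finset.inter_subset_right (by simp [cj]) (by simp [mA])
    simpa using this
  have h2 : (A ∩ P.X k).card ≤ (P.X k).card := Finset.card_le_card Finset.inter_subset_right
  have h3 : A ⊆ (A ∩ P.X j) ∪ (A ∩ P.X k) := by
    intro x hxA
    have := (mA x).1 hxA
    have := hx x this.1 this.2
    simp only [Finset.mem_union, Finset.mem_inter]
    tauto
  have h4 : A \ P.X 1 ⊆ (A ∩ P.X j) ∩ (A ∩ P.X k) := by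
    intro x hxA
    rw [Finset.mem_sdiff] at hxA
    have := (mA x).1 hxA.1
    have := F x this.1 this.2 hxA.2
    simp only [Finset.mem_inter]
    exact ⟨⟨hxA.1, this.2.2.1⟩, hxA.1, this.2.2.2.1⟩
  have h5 := Finset.card_union_add_card_inter (A ∩ P.X j) (A ∩ P.X k)
  have h6 : (A ∩ P.X 1).card + 1 ≤ ((P.X 0)ᶜ ∩ P.X 1).card := by
    have := card_add_card_le (s := A ∩ P.X 1) (t := {c}) (X := (P.X 0)ᶜ ∩ P.X 1)
      (fun x hx => by
        rw [Finset.mem_inter] at hx ⊢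
        exact ⟨Finset.mem_compl.2 ((mA x).1 hx.1).1, hx.2⟩) (by simp [c1, hc]) (by simp [mA])
    simpa using this
  have h7 := Finset.card_sdiff_add_card_inter A (P.X 1)
  have h8 := Finset.card_le_card h3
  have h9 := Finset.card_le_card h4
  have := H.card_inter
  have := H.cap
  have := H.hX j q.j0
  have := H.hX k q.k0
  omega

include H hmin hg ht in
/-- In the situation of `tight_used_facts`, the used colour `a` placed at `1` occurs in `X k`, and
in neither `X j` nor `X l`. -/
theorem tight_used_fst (h : P.Fits 1 j k l a b c d) (hc : c ∉ P.X 0) (hd : d ∉ P.X 0) {v : K}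
    (v0 : v ∉ P.X 0) (vc : v ≠ c) (vd : v ≠ d) (v1 : v ∉ P.X 1) (hv : P.conf v 1 c k) :
    a ∈ P.X k ∧ a ∉ P.X j ∧ a ∉ P.X l ∧ ∃ z, z ∉ P.X 0 ∧ z ≠ c ∧ z ≠ d ∧ z ∈ P.X 1 ∧ z ∈ P.X l ∧
      z ∉ P.X j ∧ z ∉ P.X k ∧ P.conf z 0 a 1 := by
  have q := h.q
  obtain ⟨a0, b0⟩ := used_two h hmin hc hd
  obtain ⟨z, z0, zc, zd, z1, zl, zj, zk⟩ := tight_used_exists H hmin ht h hc hd v0 vc vd v1 hv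
  obtain ⟨ri, rj, rl⟩ := H.tight_r ht q
  have F := tight_used_facts H hmin ht h hc hd v0 vc vd v1 hv v0 vc v1
  obtain ⟨-, s1, -, s2⟩ := served_two H hmin h hc hd z0 zc zd
  have za := s1.resolve_right fun hh => zj (P.conf_mem hh)
  have ak : a ∈ P.X k := by
    have f1 := tight_fails H hmin hg ht (q := q.swap23) v0 z0 b d
    have f2 := tight_fails H hmin hg ht (q := q) v0 z0 a r
    have n1 := (ne_of_mem_of_not_mem b0 z0)
    have n2 := (ne_of_mem_of_not_mem b0 v0)
    have n3 := (ne_of_mem_of_not_mem a0 z0)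
    have n4 := (ne_of_mem_of_not_mem a0 v0)
    have n5 := (ne_of_mem_of_not_mem H.r0 z0)
    have n6 := (ne_of_mem_of_not_mem H.r0 v0)
    have n7 := H.r1
    obtain ⟨s, m, u⟩ := P.rules
    obtain ⟨q0, w1, w2, w3, w4, w5, w6, w7, w8, w9, w10, w11, w12, w13, w14, w15, w16⟩ := h
    obtain ⟨F1, F2, F3, F4, F5, -⟩ := F
    obtain ⟨q1, q2, q3, q4, q5, q6, q7, q8, q9, q10⟩ := q
    clear hmin H hg ht
    have p1 : P.conf z j d l := by grind
    have p2 : P.conf v 1 z k := by grind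
    grind
  have ag : a ≠ g := fun hh => h.ai (hh ▸ H.g1)
  have aw := ht a ag
  rw [wt_eq q, ind_of_mem a0, ind_of_mem ak] at aw
  refine ⟨ak, fun hh => ?_, fun hh => ?_, z, z0, zc, zd, z1, zl, zj, zk, za⟩
  · rw [ind_of_mem hh] at aw
    have := ind_nonneg (P.X 1) a
    have := ind_nonneg (P.X l) a
    omega
  · rw [ind_of_mem hh] at aw
    have := ind_nonneg (P.X 1) a
    have := ind_nonneg (P.X j) a
    omega

include H hmin hg ht in
/-- In the situation of `tight_used_facts`, the used colour at `j` is not `r`. -/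
theorem tight_used_snd (h : P.Fits 1 j k l a r c d) (hc : c ∉ P.X 0) (hd : d ∉ P.X 0) {v : K}
    (v0 : v ∉ P.X 0) (vc : v ≠ c) (vd : v ≠ d) (v1 : v ∉ P.X 1) (hv : P.conf v 1 c k) : False := by
  have q := h.q
  obtain ⟨a0, r0⟩ := used_two h hmin hc hd
  obtain ⟨ak, aj, al, z, z0, zc, zd, z1, zl, zj, zk, za⟩ :=
    tight_used_fst H hmin hg ht h hc hd v0 vc vd v1 hv
  obtain ⟨ri, rj, rl⟩ := H.tight_r ht q
  have F := fun y (y0 : y ∉ P.X 0) (yc : y ≠ c) (y1 : y ∉ P.X 1) =>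
    tight_used_facts H hmin ht h hc hd v0 vc vd v1 hv y0 yc y1
  have ng : ∀ {x}, x ∉ P.X 0 → g ≠ x := fun h => ne_of_mem_of_not_mem H.g0 h
  have nr : ∀ {x}, x ∉ P.X 0 → r ≠ x := fun h => ne_of_mem_of_not_mem H.r0 h
  have na : ∀ {x}, x ∉ P.X 0 → a ≠ x := fun h => ne_of_mem_of_not_mem a0 h
  have ga : g ≠ a := fun hh => h.ai (hh ▸ H.g1)
  -- `g` cannot be placed at `j`.
  have nf : ∀ d, d ∉ P.X 0 → ¬ P.Fits 1 j k l a g c d := by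
    intro d hd f
    obtain ⟨y, y0, y1, hy⟩ := H.exists_notMem_one {c, d} (Finset.card_le_two.trans (by simp))
    simp only [Finset.mem_insert, Finset.mem_singleton, not_or] at hy
    rcases (served_two H hmin f hc hd y0 hy.1 hy.2).2.1 with hh | hh
    · exact y1 (P.conf_mem hh)
    · exact y1 (H.gc0 j y q.j0 q.ij.symm (P.conf_symm hh))
  obtain ⟨y, y0, y1, hy⟩ := H.exists_notMem_one {c, d, v} Finset.card_le_three
  simp only [Finset.mem_insert, Finset.mem_singleton, not_or] at hy
  obtain ⟨hg1, hg2, hg3, hg4⟩ := H.tight_g hg q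
  -- `g` lies in exactly one of `X j`, `X k` and `X l`.
  rcases hg4 with gj | gk | gl
  · obtain ⟨gk, gl⟩ := hg1 gj
    have f1 := tight_fails H hmin hg ht (q := q.swap34.swap23) v0 y0 r g
    have f2 := H.gc1 k v q.k0 q.ik.symm
    have n1 := nr v0
    have n2 := nr y0
    have n3 := ng v0
    have n4 := ng y0
    have n5 := H.gr
    have n6 := hy.2.2
    obtain ⟨F1, F2, F3, F4, F5, -⟩ := F v v0 vc v1
    obtain ⟨G1, G2, G3, G4, G5, -⟩ := F y y0 hy.1 y1
    obtain ⟨s, m, u⟩ := P.rules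
    obtain ⟨q1, q2, q3, q4, q5, q6, q7, q8, q9, q10⟩ := q
    clear hmin H hg ht F h nf hy
    grind
  · obtain ⟨gj, gl⟩ := hg2 gk
    have p : P.conf g j c k := by
      have f := Palette.fails q (nf d hd)
      obtain ⟨q0, w1, w2, w3, w4, w5, w6, w7, w8, w9, w10, w11, w12, w13, w14, w15, w16⟩ := h
      have n1 := ng hc
      have n2 := ng hd
      obtain ⟨s, m, u⟩ := P.rules
      obtain ⟨q1, q2, q3, q4, q5, q6, q7, q8, q9, q10⟩ := q
      clear hmin H hg ht F nf hy
      grind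
    have f3 := H.stuck.fails (q := q.swap12.swap23.swap34.swap23.swap34) (x := y) (a := z) (b := g)
        (c := a)
      (d := c) y0
    have f4 := H.gc0 l y q.l0 q.il.symm
    have n1 := na z0
    have n2 := na y0
    have n3 := ng z0
    have n4 := ng y0
    have n5 := ng hc
    obtain ⟨G1, G2, G3, G4, G5, -⟩ := F y y0 hy.1 y1
    obtain ⟨q0, w1, w2, w3, w4, w5, w6, w7, w8, w9, w10, w11, w12, w13, w14, w15, w16⟩ := h
    obtain ⟨s, m, u⟩ := P.rules
    obtain ⟨q1, q2, q3, q4, q5, q6, q7, q8, q9, q10⟩ := q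
    clear hmin H hg ht F nf
    grind
  · obtain ⟨gj, gk⟩ := hg3 gl
    have f1 := tight_fails H hmin hg ht (q := q.swap34.swap23) v0 y0 r g
    have f := Palette.fails q (nf y y0)
    have f2 := H.gc1 k v q.k0 q.ik.symm
    have n1 := nr v0
    have n2 := nr y0
    have n3 := ng v0
    have n4 := ng y0
    have n5 := H.gr
    have n6 := hy.2.2
    have n7 := ng hc
    have n8 := na y0
    obtain ⟨F1, F2, F3, F4, F5, -⟩ := F v v0 vc v1
    obtain ⟨G1, G2, G3, G4, G5, -⟩ := F y y0 hy.1 y1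
    obtain ⟨s, m, u⟩ := P.rules
    obtain ⟨q0, w1, w2, w3, w4, w5, w6, w7, w8, w9, w10, w11, w12, w13, w14, w15, w16⟩ := h
    obtain ⟨q1, q2, q3, q4, q5, q6, q7, q8, q9, q10⟩ := q
    clear hmin H hg ht F nf
    have p : P.conf g k y l := by grind
    grind

include H hmin hg ht in
/-- If all weights but that of `g` vanish, no fitting quadruple with two used colours has a used
colour at `1`. -/
theorem tight_one_used (h : P.Fits 1 j k l a b c d) (hc : c ∉ P.X 0) (hd : d ∉ P.X 0) : False := by
  have main : ∀ {k l c d v}, P.Fits 1 j k l a b c d → c ∉ P.X 0 → d ∉ P.X 0 → v ∉ P.X 0 → v ≠ c →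
      v ≠ d → v ∉ P.X 1 → P.conf v 1 c k → False := by
    intro k l c d v h hc hd v0 vc vd v1 hv
    have q := h.q
    obtain ⟨ak, aj, al, -⟩ := tight_used_fst H hmin hg ht h hc hd v0 vc vd v1 hv
    obtain ⟨rj, rk, rl⟩ := H.tight_r ht q
    have ra : r ≠ a := fun hh => h.ai (hh ▸ H.r1)
    rcases h.swap12.replace_first ra (ne_of_mem_of_not_mem H.r0 hc) (ne_of_mem_of_not_mem H.r0 hd)
        with
      p | p | p | p | p
    exacts [rj p, aj (conf_mem' p), rk (P.conf_mem p), rl (P.conf_mem p),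
      tight_used_snd H hmin hg ht p.swap12 hc hd v0 vc vd v1 hv]
  obtain ⟨y, y0, y1, hy⟩ := H.exists_notMem_one {c, d} (Finset.card_le_two.trans (by simp))
  simp only [Finset.mem_insert, Finset.mem_singleton, not_or] at hy
  rcases (tight_used_aux H hmin ht h hc hd y0 hy.1 hy.2 y1).2.2 with p | p
  · exact main h hc hd y0 hy.1 hy.2 y1 p.1
  · exact main h.swap34 hd hc y0 hy.2 hy.1 y1 p.1

end Tight

section Two

variable (H : P.Linked Δ e g r)
  (hmin : ∀ {i j k l a b c d}, P.Fits i j k l a b c d → a ∈ P.X 0 ∨ b ∈ P.X 0 ∨ c ∈ P.X 0)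

include H hmin in
/-- The bound for two used colours when all free colours have nonnegative weight. If it fails, `g`
has weight one and all other weights vanish. -/
theorem two_of_swappable (h : P.Fits i j k l a b c d) (hc : c ∉ P.X 0) (hd : d ∉ P.X 0)
    (hw : ∀ x, ¬ P.Wild x) (hg : 1 ≤ P.wt g) (hpos : ∀ x, x ∉ P.X 0 → 0 ≤ P.wt x) :
    2 ≤ ∑ x, P.wt x := by
  by_contra hn
  have hpos' : ∀ x, 0 ≤ P.wt x := by
    intro x
    by_cases hx : x ∈ P.X 0
    · have := wt_of_mem' x hx
      rwa [ind_of_notMem (by simp [mem_wild, hw]), neg_zero] at this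
    · exact hpos x hx
  have hsplit := Finset.add_sum_erase Finset.univ P.wt (Finset.mem_univ g)
  have h0 := Finset.sum_nonneg (s := Finset.univ.erase g) fun x _ => hpos' x
  have hg1 : P.wt g = 1 := by omega
  have ht : ∀ x, x ≠ g → P.wt x = 0 := by
    intro x hx
    have := Finset.single_le_sum (f := P.wt) (s := Finset.univ.erase g) (fun x _ => hpos' x)
      (Finset.mem_erase.2 ⟨hx, Finset.mem_univ x⟩)
    have := hpos' x
    omega
  rcases h.q.eq_or 1 with hh | rfl | rfl | rfl | rfl
  · exact absurd hh (by decide)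
  · exact tight_one_used H hmin hg1 ht h hc hd
  · exact tight_one_used H hmin hg1 ht h.swap12 hc hd
  · exact tight_one_unused H hmin hg1 ht h hc hd
  · exact tight_one_unused H hmin hg1 ht h.swap34 hd hc

include H hmin in
/-- The bound when every fitting quadruple has at least two used colours, and some has exactly two.
-/
theorem sum_of_two (h : P.Fits i j k l a b c d) (hc : c ∉ P.X 0) (hd : d ∉ P.X 0) :
    2 ≤ ∑ x, P.wt x := by
  by_cases hg0 : ∀ t, t ≠ 0 → t ≠ 1 → g ∉ P.X t
  · exact two_of_g H hmin hg0 h hc hd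
  have hg : 1 ≤ P.wt g := by
    push Not at hg0
    obtain ⟨t, t0, t1, ht⟩ := hg0
    have := Finset.add_sum_erase Finset.univ (fun t => ind (P.X t) g) (Finset.mem_univ t)
    have h2 := Finset.add_sum_erase (Finset.univ.erase t) (fun t => ind (P.X t) g) (a := 0)
      (by simp [t0.symm])
    have h3 := Finset.add_sum_erase ((Finset.univ.erase t).erase 0) (fun t => ind (P.X t) g)
      (a := 1) (by simp [t1.symm])
    have h4 := Finset.sum_nonneg (s := ((Finset.univ.erase t).erase 0).erase 1)
      (f := fun t => ind (P.X t) g) fun x _ => ind_nonneg _ _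
    simp only [ind_of_mem ht, ind_of_mem H.g0, ind_of_mem H.g1] at *
    unfold wt
    omega
  by_cases hw : ∃ x, P.Wild x
  · exact two_of_wild H hmin h hc hd hw hg
  push Not at hw
  have main : ∀ {k l c d}, P.Fits i j k l a b c d → c ∉ P.X 0 → d ∉ P.X 0 →
      (∃ x, x ∉ P.X 0 ∧ x ≠ c ∧ x ≠ d ∧ P.Fits i j k l a b x d) → 2 ≤ ∑ x, P.wt x := by
    intro k l c d h hc hd hk
    by_cases hl : ∀ x y, x ∉ P.X 0 → y ∉ P.X 0 → x ≠ d → y ≠ d → ¬ P.Fits i j k l a b x y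
    · exact two_of_semirigid H hmin h hc hd hk hl hw hg
    · push Not at hl
      obtain ⟨x, y, x0, y0, xd, yd, f⟩ := hl
      refine two_of_swappable H hmin h hc hd hw hg fun v v0 => ?_
      by_cases hv : v = d
      · subst hv
        exact (served_two H hmin f x0 y0 v0 xd.symm yd.symm).1
      · exact rigid_nonneg H hmin h hc hd hk v0 hv
  by_cases hk : ∃ x, x ∉ P.X 0 ∧ x ≠ c ∧ x ≠ d ∧ P.Fits i j k l a b x d
  · exact main h hc hd hk
  by_cases hl : ∃ x, x ∉ P.X 0 ∧ x ≠ d ∧ x ≠ c ∧ P.Fits i j l k a b x c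
  · exact main h.swap34 hd hc hl
  · push Not at hk hl
    exact two_of_rigid H hmin h hc hd hw hg hk fun x x0 xc xd f => hl x x0 xd xc f.swap34

end Two

/-- The sum of the weights of a linked palette is at least two. As in `Stuck.sum_nonneg`, the proof
considers a fitting quadruple with as few used colours as possible. -/
theorem sum_ge_two (H : P.Linked Δ e g r) (h : P.Fits i j k l a b c d) : 2 ≤ ∑ x, P.wt x := by
  by_cases h1 : ∃ i j k l a b c d, P.Fits i j k l a b c d ∧ b ∉ P.X 0 ∧ c ∉ P.X 0 ∧ d ∉ P.X 0
  · obtain ⟨i, j, k, l, a, b, c, d, h, hb, hc, hd⟩ := h1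
    exact sum_of_one H h hb hc hd
  by_cases h2 : ∃ i j k l a b c d, P.Fits i j k l a b c d ∧ c ∉ P.X 0 ∧ d ∉ P.X 0
  · obtain ⟨i, j, k, l, a, b, c, d, h, hc, hd⟩ := h2
    refine sum_of_two H (fun {i j k l a b c d} h => ?_) h hc hd
    by_contra hn
    push Not at hn
    exact h1 ⟨_, _, _, _, _, _, _, _, h.swap34.swap23.swap12, hn⟩
  by_cases h3 : ∃ i j k l a b c d, P.Fits i j k l a b c d ∧ d ∉ P.X 0
  · obtain ⟨i, j, k, l, a, b, c, d, h, hd⟩ := h3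
    refine sum_of_three H (fun {i j k l a b c d} h => ?_) h hd
    by_contra hn
    push Not at hn
    exact h2 ⟨_, _, _, _, _, _, _, _, h.swap23.swap34.swap12.swap23, hn⟩
  refine sum_of_four H h fun {i j k l a b c d} h => ?_
  by_contra hn
  exact h3 ⟨_, _, _, _, _, _, _, _, h.swap12.swap23.swap34, hn⟩

end Linked
end Palette

end

/-! ### Acyclic edge colourings as functions on pairs -/

section

variable {V : Type*} {K : Type*}

/-- The subgraph of `H` formed by the edges coloured `a` or `b`. -/
def bichromatic (H : SimpleGraph V) (f : Sym2 V → K) (a b : K) : SimpleGraph V where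
  Adj x y := H.Adj x y ∧ (f s(x, y) = a ∨ f s(x, y) = b)
  symm := ⟨fun x y h => by rwa [H.adj_comm, Sym2.eq_swap]⟩
  loopless := ⟨fun x h => H.loopless.irrefl x h.1⟩

/-- The colouring `f` is proper and acyclic on the edges of `H`. It is defined on all pairs, so that
colourings of different graphs can be compared; values outside the edges of `H` do not matter.
Acyclicity is stated as the absence of cycles coloured with two colours. -/
structure IsGoodColoring (H : SimpleGraph V) (f : Sym2 V → K) : Prop where
  proper : ∀ {v x y}, H.Adj v x → H.Adj v y → f s(v, x) = f s(v, y) → x = y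
  acyclic : ∀ a b, (H.bichromatic f a b).IsAcyclic

theorem bichromatic_comm (H : SimpleGraph V) (f : Sym2 V → K) (a b : K) :
    H.bichromatic f a b = H.bichromatic f b a := by
  ext x y
  simp [bichromatic, or_comm]

/-- A set that is closed under adjacency contains the components of its elements. -/
theorem Reachable.mem_of_closed {B : SimpleGraph V} {x y : V} (h : B.Reachable x y) {S : Set V}
    (hS : ∀ ⦃v w⦄, v ∈ S → B.Adj v w → w ∈ S) (hx : x ∈ S) : y ∈ S := by
  obtain ⟨p⟩ := h
  induction p with
  | nil => exact hx
  | cons h p ih => exact ih (hS hx h)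

/-- Two paths from `v` that avoid its neighbour `u` and end in vertices of degree one run along each
other, if all degrees are at most two. -/
theorem eq_of_walk {B : SimpleGraph V} (h2 : ∀ v a b c, B.Adj v a → B.Adj v b → B.Adj v c →
      a = b ∨ a = c ∨ b = c) {v y z : V} (p : B.Walk v y) : ∀ (q : B.Walk v z) {u : V}
      (_ : B.Adj u v), (∀ a b, B.Adj y a → B.Adj y b → a = b) →
      (∀ a b, B.Adj z a → B.Adj z b → a = b) → p.IsPath → q.IsPath → u ∉ p.support →
      u ∉ q.support → y = z := by
  induction p with
  | nil =>
    intro q u hu hy hz hp hq hup huq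
    cases q with
    | nil => rfl
    | cons h q =>
      have := hy _ _ hu.symm h
      subst this
      simp at huq
  | cons h p ih =>
    intro q u hu hy hz hp hq hup huq
    cases q with
    | nil =>
      have := hz _ _ hu.symm h
      subst this
      simp at hup
    | cons h' q =>
      have := h2 _ _ _ _ hu.symm h h'
      rw [Walk.cons_isPath_iff] at hp hq
      rw [Walk.support_cons, List.mem_cons, not_or] at hup huq
      rcases this with rfl | rfl | rfl
      · simp at hup
      · simp at huq
      · exact ih q h hy hz hp.1 hq.1 hp.2 hq.2

/-- In a graph with maximum degree at most two, a component has at most two vertices of degree at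
most one. -/
theorem Reachable.eq_of_endpoints {B : SimpleGraph V} (h2 : ∀ v a b c, B.Adj v a → B.Adj v b →
      B.Adj v c → a = b ∨ a = c ∨ b = c) {x y z : V} (hx : ∀ a b, B.Adj x a → B.Adj x b → a = b)
    (hy : ∀ a b, B.Adj y a → B.Adj y b → a = b) (hz : ∀ a b, B.Adj z a → B.Adj z b → a = b)
    (xy : x ≠ y) (xz : x ≠ z) (h : B.Reachable x y) (h' : B.Reachable x z) : y = z := by
  obtain ⟨p, hp⟩ := h.exists_isPath
  obtain ⟨q, hq⟩ := h'.exists_isPath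
  cases p with
  | nil => exact absurd rfl xy
  | cons h p =>
    cases q with
    | nil => exact absurd rfl xz
    | cons h' q =>
      rw [Walk.cons_isPath_iff] at hp hq
      have := hx _ _ h h'
      subst this
      exact eq_of_walk h2 p q h hy hz hp.1 hq.1 hp.2 hq.2

namespace IsGoodColoring

variable {H : SimpleGraph V} {f : Sym2 V → K} {a b c : K}

theorem of_le {H' : SimpleGraph V} (h : H.IsGoodColoring f) (hle : H' ≤ H) :
    H'.IsGoodColoring f :=
  ⟨fun h1 h2 => h.proper (hle h1) (hle h2), fun a b =>
    (h.acyclic a b).anti (show H'.bichromatic f a b ≤ H.bichromatic f a b from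
      fun _ _ h => ⟨hle h.1, h.2⟩)⟩

theorem eq_or_eq (h : H.IsGoodColoring f) {v x y z : V} (hx : (H.bichromatic f a b).Adj v x)
    (hy : (H.bichromatic f a b).Adj v y) (hz : (H.bichromatic f a b).Adj v z) :
    x = y ∨ x = z ∨ y = z := by
  have h1 := fun e => h.proper hx.1 hy.1 e
  have h2 := fun e => h.proper hx.1 hz.1 e
  have h3 := fun e => h.proper hy.1 hz.1 e
  rcases hx.2 with e1 | e1 <;> rcases hy.2 with e2 | e2 <;> rcases hz.2 with e3 | e3 <;>
    simp_all

/-- A vertex with no edge coloured `a` has at most one neighbour along edges coloured `a` or `b`. -/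
theorem eq_of_missing (h : H.IsGoodColoring f) {v : V} (hv : ∀ x, H.Adj v x → f s(v, x) ≠ a)
    {x y : V} (hx : (H.bichromatic f a b).Adj v x) (hy : (H.bichromatic f a b).Adj v y) :
    x = y :=
  h.proper hx.1 hy.1 ((hx.2.resolve_left (hv x hx.1)).trans (hy.2.resolve_left (hv y hy.1)).symm)

theorem eq_of_missing' (h : H.IsGoodColoring f) {v : V} (hv : ∀ x, H.Adj v x → f s(v, x) ≠ b)
    {x y : V} (hx : (H.bichromatic f a b).Adj v x) (hy : (H.bichromatic f a b).Adj v y) :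
    x = y := by
  rw [bichromatic_comm] at hx hy
  exact h.eq_of_missing hv hx hy

end IsGoodColoring

section Bridge

theorem exists_pair_of_encard_lt_three [Nonempty K] {s : Set K} (hs : s.encard < 3) :
    ∃ a b, s ⊆ {a, b} := by
  have h2 : s.encard ≤ 2 := by
    have : s.encard < 2 + 1 := by norm_num; exact hs
    exact ENat.lt_add_one_iff (by simp) |>.1 this
  have hfin := Set.finite_of_encard_le_coe (k := 2) h2
  rcases s.eq_empty_or_nonempty with rfl | ⟨a, ha⟩
  · exact ⟨Classical.arbitrary K, Classical.arbitrary K, by simp⟩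
  by_cases h : ∃ b ∈ s, b ≠ a
  · obtain ⟨b, hb, hba⟩ := h
    refine ⟨a, b, fun c hc => ?_⟩
    by_contra hn
    have : ({a, b, c} : Set K).encard = 3 := by
      rw [Set.encard_eq_three]
      exact ⟨a, b, c, hba.symm, fun h => hn (by simp [h]), fun h => hn (by simp [h]), rfl⟩
    have h5 := Set.encard_le_encard (show ({a, b, c} : Set K) ⊆ s by
      rintro x (rfl | rfl | rfl) <;> assumption)
    rw [this] at h5
    exact absurd (h5.trans_lt hs) (lt_irrefl _)
  · push Not at h
    exact ⟨a, a, fun c hc => by simp [h c hc]⟩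

theorem exists_isGoodColoring_of_iso {V' : Type*} {G' : SimpleGraph V'} {H : SimpleGraph V}
    (φ : H ≃g G') [Nonempty K] (C : G'.lineGraph.Coloring K) (hC : IsAcyclicEdgeColoring C) :
    ∃ f : Sym2 V → K, H.IsGoodColoring f := by
  classical
  let f : Sym2 V → K := fun e => if h : e.map φ ∈ G'.edgeSet then C ⟨e.map φ, h⟩ else
    Classical.arbitrary K
  have hf : ∀ e (h : e.map φ ∈ G'.edgeSet), f e = C ⟨e.map φ, h⟩ := fun e h => dif_pos h
  have hm : ∀ {x y}, H.Adj x y → s(x, y).map φ ∈ G'.edgeSet := fun h => φ.map_adj_iff.2 h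
  refine ⟨f, ⟨fun {v x y} hx hy he => ?_, fun a b => ?_⟩⟩
  · rw [hf _ (hm hx), hf _ (hm hy)] at he
    by_contra hxy
    refine C.valid ?_ he
    rw [lineGraph_adj_iff_exists]
    refine ⟨fun hh => hxy ?_, φ v, by simp, by simp⟩
    have := congrArg Subtype.val hh
    have hvx := hx.ne'
    have hvy := hy.ne
    simp only [Sym2.map_mk, Sym2.eq_iff, φ.injective.eq_iff] at this
    tauto
  · intro v p hp
    have hle : H.bichromatic f a b ≤ H := fun _ _ h => h.1
    have h3 := hC _ _ ((hp.mapLe hle).map (f := φ.toHom) φ.injective)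
    have hsub : C '' {e | (e : Sym2 V') ∈ ((p.mapLe hle).map φ.toHom).edges} ⊆ {a, b} := by
      rintro _ ⟨⟨e', he'⟩, h, rfl⟩
      simp only [Walk.edges_map, List.mem_map, Set.mem_ofPred_eq] at h
      obtain ⟨e, he, rfl⟩ := h
      obtain ⟨e, he, rfl⟩ := he
      have := p.edges_subset_edgeSet he
      induction e with
      | h x y => exact (hf _ he').symm ▸ this.2
    have h4 := (Set.encard_le_encard hsub).trans (Set.encard_insert_le _ _)
    rw [Set.encard_singleton] at h4
    exact absurd (h3.trans h4) (by norm_num)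

theorem IsGoodColoring.acyclicallyEdgeColorable {G : SimpleGraph V} {n : ℕ} {f : Sym2 V → Fin n}
    (hf : G.IsGoodColoring f) : G.AcyclicallyEdgeColorable n := by
  refine ⟨Coloring.mk (fun e => f e) ?_, fun v p hp => ?_⟩
  · rintro ⟨e, he⟩ ⟨e', he'⟩ h hh
    rw [lineGraph_adj_iff_exists] at h
    obtain ⟨hne, v, hv, hv'⟩ := h
    simp only at hv hv' hh
    obtain ⟨x, rfl⟩ := hv
    obtain ⟨y, rfl⟩ := hv'
    exact hne (Subtype.ext (congrArg (fun z => s(v, z)) (hf.proper he he' hh)))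
  · by_contra hn
    have : Nonempty (Fin n) := ⟨f s(v, v)⟩
    obtain ⟨a, b, hab⟩ := exists_pair_of_encard_lt_three (not_le.1 hn)
    have hmem : ∀ e ∈ p.edges, e ∈ (G.bichromatic f a b).edgeSet := by
      intro e he
      have h1 := p.edges_subset_edgeSet he
      have := hab ⟨⟨e, h1⟩, he, rfl⟩
      induction e with
      | h x y => exact ⟨h1, this⟩
    exact hf.acyclic a b _ (hp.transfer hmem)

end Bridge

end

/-! ### The palette of an edge colouring -/

section

variable {V : Type*} {K : Type*} {u : V} {f : Sym2 V → K} {x : Fin 5 → V} {c : Fin 5 → K}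

section Palette

variable [DecidableEq K] [Fintype V] {H : SimpleGraph V}

open Classical in
/-- The palette of a good colouring of `H` at five of its vertices. A conflict between `a` at `x i`
and `b` at `x k` is expressed by `x i` and `x k` belonging to the same component of the subgraph of
edges coloured `a` or `b`, of which they are then the two ends. -/
noncomputable def IsGoodColoring.palette (hf : H.IsGoodColoring f) (hx : Function.Injective x) :
    Palette K where
  X i := (H.neighborFinset (x i)).image fun y => f s(x i, y)
  conf a i b k := (∀ y, H.Adj (x i) y → f s(x i, y) ≠ a) ∧ (∀ y, H.Adj (x k) y → f s(x k, y) ≠ b) ∧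
    (∃ y, H.Adj (x k) y ∧ f s(x k, y) = a) ∧ (∃ y, H.Adj (x i) y ∧ f s(x i, y) = b) ∧
    (H.bichromatic f a b).Reachable (x i) (x k)
  conf_symm := fun ⟨h1, h2, h3, h4, h5⟩ => ⟨h2, h1, h4, h3, H.bichromatic_comm f _ _ ▸ h5.symm⟩
  conf_notMem := fun ⟨h, _⟩ => by simpa using h
  conf_mem := fun ⟨_, _, h, _⟩ => by simpa using h
  conf_unique := by
    intro a i b k l ⟨h1, h2, h3, h4, h5⟩ ⟨_, h2', h3', _, h5'⟩
    by_contra hkl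
    refine hkl (hx (Reachable.eq_of_endpoints (fun v _ _ _ => hf.eq_or_eq) (fun _ _ =>
      hf.eq_of_missing h1) (fun _ _ => hf.eq_of_missing' h2)
      (fun _ _ => hf.eq_of_missing' h2') ?_ ?_ h5 h5'))
    · rintro h
      rw [h] at h1
      obtain ⟨y, hy, hy'⟩ := h3
      exact h1 y hy hy'
    · rintro h
      rw [h] at h1
      obtain ⟨y, hy, hy'⟩ := h3'
      exact h1 y hy hy'

variable (hf : H.IsGoodColoring f) (hx : Function.Injective x)

theorem mem_palette_X {i : Fin 5} {a : K} :
    a ∈ (hf.palette hx).X i ↔ ∃ y, H.Adj (x i) y ∧ f s(x i, y) = a := by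
  simp [IsGoodColoring.palette]

theorem notMem_palette_X {i : Fin 5} {a : K} :
    a ∉ (hf.palette hx).X i ↔ ∀ y, H.Adj (x i) y → f s(x i, y) ≠ a := by
  simp [IsGoodColoring.palette]

theorem card_palette_X (i : Fin 5) [Fintype (H.neighborSet (x i))] :
    ((hf.palette hx).X i).card = H.degree (x i) := by
  rw [IsGoodColoring.palette, Finset.card_image_of_injOn, card_neighborFinset_eq_degree]
  · convert rfl
  intro y hy z hz h
  exact hf.proper (by simpa using hy) (by simpa using hz) h

/-- For colours missing at their vertices, a conflict is the same as a path between the vertices in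
these two colours. -/
theorem palette_conf_iff {a b : K} {i k : Fin 5} (hik : i ≠ k) (ha : a ∉ (hf.palette hx).X i)
    (hb : b ∉ (hf.palette hx).X k) :
    (hf.palette hx).conf a i b k ↔ (H.bichromatic f a b).Reachable (x i) (x k) := by
  refine ⟨fun h => h.2.2.2.2, fun h => ?_⟩
  rw [notMem_palette_X] at ha hb
  have key : ∀ {y z : V} {B : SimpleGraph V}, y ≠ z → B.Reachable y z → ∃ v, B.Adj y v := by
    rintro y z B hyz ⟨p⟩
    cases p with
    | nil => exact (hyz rfl).elim
    | cons h _ => exact ⟨_, h⟩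
  obtain ⟨y, hy⟩ := key (hx.ne hik) h
  obtain ⟨z, hz⟩ := key (hx.ne hik.symm) h.symm
  exact ⟨ha, hb, ⟨z, hz.1, hz.2.resolve_right (hb z hz.1)⟩,
    ⟨y, hy.1, hy.2.resolve_left (ha y hy.1)⟩, h⟩

end Palette

section Star

variable [DecidableEq K] [Fintype V] {J : SimpleGraph V}
  (hf : (J.deleteIncidenceSet u).IsGoodColoring f) (hx : Function.Injective x)

/-- Joining an isolated vertex `u` to two vertices of different components creates no cycle. -/
theorem IsAcyclic.sup_edge_sup_edge {B : SimpleGraph V} (hB : B.IsAcyclic) (hu : ∀ v, ¬ B.Adj u v)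
    {y z : V} (hy : y ≠ u) (hz : z ≠ u) (hyz : y = z ∨ ¬ B.Reachable y z) :
    (B ⊔ edge u y ⊔ edge u z).IsAcyclic := by
  have h1 : (B ⊔ edge u y).IsAcyclic := by
    refine hB.sup_edge_of_not_reachable fun h => hy ?_
    exact h.mem_of_closed (S := {u}) (by rintro v w rfl h; exact (hu _ h).elim) rfl
  rcases hyz with rfl | hyz
  · rwa [sup_assoc, sup_idem]
  refine h1.sup_edge_of_not_reachable fun h => ?_
  have : z ∈ {v | v = u ∨ B.Reachable y v} := by
    refine h.mem_of_closed ?_ (Or.inl rfl)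
    rintro v w hv h
    rw [sup_adj, edge_adj] at h
    rcases h with h | ⟨⟨rfl, rfl⟩ | ⟨rfl, rfl⟩, _⟩
    · rcases hv with rfl | hv
      · exact (hu _ ‹_›).elim
      · exact Or.inr (hv.trans h.reachable)
    · exact Or.inr .rfl
    · exact Or.inl rfl
  exact hyz (this.resolve_left hz)

/-- An assignment for the palette extends the colouring of `J - u` to `J`. -/
theorem IsGoodColoring.exists_of_isAssignment (hux : ∀ v, J.Adj u v → ∃ i, v = x i)
    (hxu : ∀ i, x i ≠ u) (hc : (hf.palette hx).IsAssignment c) :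
    ∃ f' : Sym2 V → K, J.IsGoodColoring f' ∧ (∀ i, f' s(u, x i) = c i) ∧
      ∀ v w, v ≠ u → w ≠ u → f' s(v, w) = f s(v, w) := by
  classical
  let f' : Sym2 V → K := fun e => if h : ∃ i, e = s(u, x i) then c h.choose else f e
  have hf'c : ∀ i, f' s(u, x i) = c i := by
    intro i
    have h : ∃ k, s(u, x i) = s(u, x k) := ⟨i, rfl⟩
    have h1 := h.choose_spec
    rw [Sym2.congr_right] at h1
    simp only [f', dif_pos h]
    rw [hx h1.symm]
  have hf'f : ∀ v w, v ≠ u → w ≠ u → f' s(v, w) = f s(v, w) := by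
    intro v w hv hw
    refine dif_neg ?_
    rintro ⟨i, h⟩
    rw [Sym2.eq_iff] at h
    tauto
  clear_value f'
  have hJ : ∀ v w, v ≠ u → w ≠ u → J.Adj v w → (J.deleteIncidenceSet u).Adj v w :=
    fun v w hv hw h => deleteIncidenceSet_adj.2 ⟨h, hv, hw⟩
  obtain ⟨c1, c2, c3⟩ := hc
  have c2' := fun i => (notMem_palette_X hf hx).1 (c2 i)
  refine ⟨f', ⟨fun {v y z} hy hz he => ?_, fun a b => ?_⟩, hf'c, hf'f⟩
  · have key : ∀ {v z}, v ≠ u → J.Adj v u → J.Adj v z → f' s(v, u) = f' s(v, z) → u = z := by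
      intro v z hv hy hz he
      by_contra hzu
      obtain ⟨i, rfl⟩ := hux v hy.symm
      rw [Sym2.eq_swap, hf'c, hf'f _ _ hv (Ne.symm hzu)] at he
      exact c2' i z (hJ _ _ hv (Ne.symm hzu) hz) he.symm
    by_cases hv : v = u
    · subst hv
      obtain ⟨i, rfl⟩ := hux _ hy
      obtain ⟨k, rfl⟩ := hux _ hz
      rw [hf'c, hf'c] at he
      rw [c1 he]
    by_cases hyu : y = u
    · subst hyu
      exact key hv hy hz he
    by_cases hzu : z = u
    · subst hzu
      exact (key hv hz hy he.symm).symm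
    rw [hf'f _ _ hv hyu, hf'f _ _ hv hzu] at he
    exact hf.proper (hJ _ _ hv hyu hy) (hJ _ _ hv hzu hz) he
  · have hu : ∀ v, ¬ ((J.deleteIncidenceSet u).bichromatic f a b).Adj u v :=
      fun v h => (deleteIncidenceSet_adj.1 h.1).2.1 rfl
    obtain ⟨i, k, hik, hi, hk⟩ : ∃ i k, (i = k ∨ i ≠ k ∧ c i = a ∧ c k = b) ∧
        (∀ t, c t = a → t = i ∨ t = k) ∧ ∀ t, c t = b → t = i ∨ t = k := by
      by_cases h1 : ∃ i, c i = a <;> by_cases h2 : ∃ k, c k = b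
      · obtain ⟨i, rfl⟩ := h1
        obtain ⟨k, rfl⟩ := h2
        exact ⟨i, k, by tauto, fun t h => .inl (c1 h), fun t h => .inr (c1 h)⟩
      · obtain ⟨i, rfl⟩ := h1
        exact ⟨i, i, .inl rfl, fun t h => .inl (c1 h), fun t h => (h2 ⟨t, h⟩).elim⟩
      · obtain ⟨i, rfl⟩ := h2
        exact ⟨i, i, .inl rfl, fun t h => (h1 ⟨t, h⟩).elim, fun t h => .inl (c1 h)⟩
      · exact ⟨0, 0, .inl rfl, fun t h => (h1 ⟨t, h⟩).elim, fun t h => (h2 ⟨t, h⟩).elim⟩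
    refine ((hf.acyclic a b).sup_edge_sup_edge hu (hxu i) (hxu k) ?_).anti
      (show J.bichromatic f' a b ≤ _ from ?_)
    · rcases hik with rfl | ⟨hik, rfl, rfl⟩
      · exact .inl rfl
      · exact .inr fun h => c3 i k ((palette_conf_iff hf hx hik (c2 i) (c2 k)).2 h)
    · have key : ∀ {v}, (J.bichromatic f' a b).Adj u v → v = x i ∨ v = x k := by
        intro v h
        obtain ⟨t, rfl⟩ := hux _ h.1
        have h2 := h.2
        rw [hf'c] at h2
        rcases h2 with h2 | h2
        · rcases hi t h2 with rfl | rfl <;> simp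
        · rcases hk t h2 with rfl | rfl <;> simp
      intro v w h
      rw [sup_adj, sup_adj, edge_adj, edge_adj]
      by_cases hv : v = u
      · subst hv
        rcases key h with rfl | rfl
        · exact .inl (.inr ⟨.inl ⟨rfl, rfl⟩, h.ne⟩)
        · exact .inr ⟨.inl ⟨rfl, rfl⟩, h.ne⟩
      by_cases hw : w = u
      · subst hw
        rcases key h.symm with rfl | rfl
        · exact .inl (.inr ⟨.inr ⟨rfl, rfl⟩, h.ne⟩)
        · exact .inr ⟨.inr ⟨rfl, rfl⟩, h.ne⟩
      exact .inl (.inl ⟨hJ _ _ hv hw h.1, hf'f _ _ hv hw ▸ h.2⟩)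

/-- If `f` is a good colouring of a graph that contains `J - u` and four of the edges at `u`, then
the colours of these edges fit: a conflict would close a cycle through `u` in two colours. -/
theorem IsGoodColoring.fits {G' : SimpleGraph V} (hG' : G'.IsGoodColoring f)
    (hle : J.deleteIncidenceSet u ≤ G') (h : ∀ i, i ≠ 0 → G'.Adj u (x i)) :
    (hf.palette hx).Fits 1 2 3 4 (f s(u, x 1)) (f s(u, x 2)) (f s(u, x 3)) (f s(u, x 4)) := by
  have hn : ∀ i, i ≠ 0 → f s(u, x i) ∉ (hf.palette hx).X i := by
    intro i hi
    rw [notMem_palette_X]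
    intro y hy he
    exact (deleteIncidenceSet_adj.1 hy).2.2
      (hG'.proper (hle hy) (h i hi).symm (he.trans (congrArg f Sym2.eq_swap)))
  have hne : ∀ i k, i ≠ 0 → k ≠ 0 → i ≠ k → f s(u, x i) ≠ f s(u, x k) :=
    fun i k hi hk hik he => hik (hx (hG'.proper (h i hi) (h k hk) he))
  have hc : ∀ i k, i ≠ 0 → k ≠ 0 → i ≠ k →
      ¬ (hf.palette hx).conf (f s(u, x i)) i (f s(u, x k)) k := by
    intro i k hi hk hik hc
    rw [palette_conf_iff hf hx hik (hn i hi) (hn k hk)] at hc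
    obtain ⟨a, ha⟩ : ∃ a, a = f s(u, x i) := ⟨_, rfl⟩
    obtain ⟨b, hb⟩ : ∃ b, b = f s(u, x k) := ⟨_, rfl⟩
    rw [← ha, ← hb] at hc
    have h1 : (G'.bichromatic f a b).Adj u (x i) := ⟨h i hi, .inl ha.symm⟩
    have h2 : (G'.bichromatic f a b).Adj u (x k) := ⟨h k hk, .inr hb.symm⟩
    have h3 := isAcyclic_iff_forall_adj_isBridge.1 (hG'.acyclic a b) h1
    rw [isBridge_iff] at h3
    refine h3 (Reachable.trans (v := x k) (Adj.reachable ?_) (hc.symm.mono ?_))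
    · rw [deleteEdges_adj]
      refine ⟨h2, ?_⟩
      rw [Set.mem_singleton_iff, Sym2.congr_right]
      exact fun h => hik (hx h).symm
    · intro v w hvw
      rw [deleteEdges_adj]
      have h4 := deleteIncidenceSet_adj.1 hvw.1
      refine ⟨⟨hle hvw.1, hvw.2⟩, ?_⟩
      rw [Set.mem_singleton_iff, Sym2.eq_iff]
      tauto
  constructor <;> first | exact Palette.quad1234 | (apply hn; decide) |
    (apply hne <;> decide) | (apply hc <;> decide)

end Star

end

/-! ### Colouring one further edge -/

section

variable {V : Type*} {K : Type*} {u : V} {f : Sym2 V → K} {x : Fin 5 → V} {c : Fin 5 → K}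

/-- The edge `w - w₁` can be given the colour `g` if `g` is missing at both ends and no path between
them is coloured with `g` and one other colour. -/
theorem IsGoodColoring.exists_of_not_reachable {J G : SimpleGraph V} (hf : J.IsGoodColoring f)
    {w w₁ : V} (hJ : ¬ J.Adj w w₁) (hle : G ≤ J ⊔ edge w w₁) {g : K}
    (hw : ∀ y, J.Adj w y → f s(w, y) ≠ g) (hw₁ : ∀ y, J.Adj w₁ y → f s(w₁, y) ≠ g)
    (hr : ∀ b, ¬ (J.bichromatic f g b).Reachable w w₁) :
    ∃ f' : Sym2 V → K, G.IsGoodColoring f' := by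
  classical
  let f' : Sym2 V → K := Function.update f s(w, w₁) g
  have hf'g : f' s(w, w₁) = g := Function.update_self ..
  have hf'f : ∀ {y z}, J.Adj y z → f' s(y, z) = f s(y, z) := by
    intro y z h
    refine Function.update_of_ne ?_ _ _
    intro he
    rw [Sym2.eq_iff] at he
    rcases he with ⟨rfl, rfl⟩ | ⟨rfl, rfl⟩
    · exact hJ h
    · exact hJ h.symm
  clear_value f'
  have hf'g' : f' s(w₁, w) = g := by rw [Sym2.eq_swap, hf'g]
  have hadj : ∀ {y z}, G.Adj y z → J.Adj y z ∨ y = w ∧ z = w₁ ∨ y = w₁ ∧ z = w := by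
    intro y z h
    have := hle h
    rw [sup_adj, edge_adj] at this
    tauto
  refine ⟨f', fun {v y z} hy hz he => ?_, fun a b => ?_⟩
  · rcases hadj hy with h1 | ⟨rfl, rfl⟩ | ⟨rfl, rfl⟩ <;>
      rcases hadj hz with h2 | ⟨h3, h4⟩ | ⟨h3, h4⟩
    · rw [hf'f h1, hf'f h2] at he
      exact hf.proper h1 h2 he
    · subst h3 h4
      rw [hf'f h1, hf'g] at he
      exact (hw _ h1 he).elim
    · subst h3 h4
      rw [hf'f h1, hf'g'] at he
      exact (hw₁ _ h1 he).elim
    · rw [hf'g, hf'f h2] at he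
      exact (hw _ h2 he.symm).elim
    · exact h4.symm
    · exact (h4.trans h3).symm
    · rw [hf'g', hf'f h2] at he
      exact (hw₁ _ h2 he.symm).elim
    · exact (h4.trans h3).symm
    · exact h4.symm
  · by_cases hg : g = a ∨ g = b
    · have key : (J.bichromatic f a b ⊔ edge w w₁).IsAcyclic := by
        refine (hf.acyclic a b).sup_edge_of_not_reachable ?_
        rcases hg with rfl | rfl
        · exact hr b
        · rw [bichromatic_comm]
          exact hr a
      refine key.anti (show G.bichromatic f' a b ≤ _ from fun y z h => ?_)
      rw [sup_adj, edge_adj]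
      rcases hadj h.1 with h1 | h1
      · exact .inl ⟨h1, hf'f h1 ▸ h.2⟩
      · exact .inr ⟨h1, h.ne⟩
    · refine (hf.acyclic a b).anti (show G.bichromatic f' a b ≤ _ from fun y z h => ?_)
      have h2 := h.2
      rcases hadj h.1 with h1 | ⟨rfl, rfl⟩ | ⟨rfl, rfl⟩
      · exact ⟨h1, hf'f h1 ▸ h.2⟩
      · rw [hf'g] at h2
        exact (hg h2).elim
      · rw [hf'g'] at h2
        exact (hg h2).elim

variable [DecidableEq K] [Fintype V] {J : SimpleGraph V}
  (hf : (J.deleteIncidenceSet u).IsGoodColoring f) (hx : Function.Injective x)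

/-- A path from `x s` to `x t` that uses only `g` and the colour of the edge from `u` to `x s`,
where `g` is missing at both ends, begins with `x s, u, x k` for some further index `k`, and
continues with an edge in the colour of the edge from `u` to `x s`. -/
theorem IsGoodColoring.exists_of_reachable (hux : ∀ v, J.Adj u v → ∃ i, v = x i)
    (hxu : ∀ i, x i ≠ u) (hJx : ∀ i, J.Adj u (x i)) {f' : Sym2 V → K} (hf' : J.IsGoodColoring f')
    (hf'c : ∀ i, f' s(u, x i) = c i) (hf'f : ∀ v w, v ≠ u → w ≠ u → f' s(v, w) = f s(v, w))
    {s t : Fin 5} (hst : s ≠ t) {g : K} (hs : ∀ y, J.Adj (x s) y → f' s(x s, y) ≠ g)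
    (ht : ∀ y, J.Adj (x t) y → f' s(x t, y) ≠ g)
    (h : (J.bichromatic f' g (c s)).Reachable (x s) (x t)) :
    ∃ k, k ≠ s ∧ k ≠ t ∧ g = c k ∧ c s ∈ (hf.palette hx).X k := by
  obtain ⟨b, hb⟩ : ∃ b, b = c s := ⟨_, rfl⟩
  rw [← hb] at h ⊢
  have hus : J.Adj (x s) u := (hJx s).symm
  have hus' : f' s(x s, u) = b := by rw [Sym2.eq_swap, hf'c, hb]
  have h1 : ∀ v, (J.bichromatic f' g b).Adj (x s) v → v = u := by
    intro v hv
    exact hf'.proper hv.1 hus (by rw [hus', hv.2.resolve_left (hs _ hv.1)])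
  by_contra hn
  push Not at hn
  by_cases hk : ∃ k, c k = g
  · obtain ⟨k, rfl⟩ := hk
    have hks : k ≠ s := by
      rintro rfl
      exact hs u hus (by rw [Sym2.eq_swap, hf'c])
    have hkt : k ≠ t := by
      rintro rfl
      exact ht u (hJx _).symm (by rw [Sym2.eq_swap, hf'c])
    have h2 := hn k hks hkt rfl
    rw [notMem_palette_X] at h2
    have : x t ∈ ({x s, u, x k} : Set V) := by
      refine h.mem_of_closed ?_ (Or.inl rfl)
      rintro v w (rfl | rfl | rfl) hvw
      · exact .inr (.inl (h1 _ hvw))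
      · obtain ⟨i, rfl⟩ := hux _ hvw.1
        rcases hvw.2 with h3 | h3
        · exact .inr (.inr (hf'.proper hvw.1 (hJx k) (by rw [h3, hf'c])))
        · exact .inl (hf'.proper hvw.1 (hJx s) (by rw [h3, hf'c, hb]))
      · by_cases hwu : w = u
        · exact .inr (.inl hwu)
        rcases hvw.2 with h3 | h3
        · exact .inr (.inl (hf'.proper hvw.1 (hJx k).symm (by
            rw [h3, Sym2.eq_swap, hf'c])))
        · exact (h2 w (deleteIncidenceSet_adj.2 ⟨hvw.1, hxu k, hwu⟩)
            (hf'f _ _ (hxu k) hwu ▸ h3)).elim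
    rcases this with h | h | h
    · exact hst (hx h).symm
    · exact hxu t h
    · exact hkt (hx h).symm
  · push Not at hk
    have : x t ∈ ({x s, u} : Set V) := by
      refine h.mem_of_closed ?_ (Or.inl rfl)
      rintro v w (rfl | rfl) hvw
      · exact .inr (h1 _ hvw)
      · obtain ⟨i, rfl⟩ := hux _ hvw.1
        rcases hvw.2 with h3 | h3
        · exact (hk i (by rw [← hf'c, h3])).elim
        · exact .inl (hf'.proper hvw.1 (hJx s) (by rw [h3, hf'c, hb]))
    rcases this with h | h
    · exact hst (hx h).symm
    · exact hxu t h

/-- An assignment extends the colouring to all edges but `x 0 - x 1`. If it cannot be completed by a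
colour `g` missing at both ends of this edge, a path in two colours between the ends is in the way;
when the ends have no colour in common, it passes through `u`. -/
theorem IsGoodColoring.exists_of_final (hux : ∀ v, J.Adj u v → ∃ i, v = x i)
    (hxu : ∀ i, x i ≠ u) (hJx : ∀ i, J.Adj u (x i)) {G : SimpleGraph V}
    (hJ : ¬ J.Adj (x 0) (x 1)) (hle : G ≤ J ⊔ edge (x 0) (x 1))
    (hG : ∀ f' : Sym2 V → K, ¬ G.IsGoodColoring f')
    (hdis : ∀ a, a ∈ (hf.palette hx).X 0 → a ∉ (hf.palette hx).X 1)
    (hc : (hf.palette hx).IsAssignment c) {g : K} (hg0 : g ∉ (hf.palette hx).X 0)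
    (hg1 : g ∉ (hf.palette hx).X 1) (hgc0 : g ≠ c 0) (hgc1 : g ≠ c 1) :
    ∃ k, k ≠ 0 ∧ k ≠ 1 ∧ g = c k ∧
      (c 0 ∈ (hf.palette hx).X 1 ∧ c 0 ∈ (hf.palette hx).X k ∨
        c 1 ∈ (hf.palette hx).X 0 ∧ c 1 ∈ (hf.palette hx).X k) := by
  obtain ⟨f', hf', hf'c, hf'f⟩ := hf.exists_of_isAssignment hx hux hxu hc
  have hmem : ∀ {i y}, J.Adj (x i) y → f' s(x i, y) = c i ∨
      f' s(x i, y) ∈ (hf.palette hx).X i := by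
    intro i y h
    by_cases hy : y = u
    · left
      rw [hy, Sym2.eq_swap, hf'c]
    · right
      rw [mem_palette_X]
      exact ⟨y, deleteIncidenceSet_adj.2 ⟨h, hxu i, hy⟩, (hf'f _ _ (hxu i) hy).symm⟩
  have hmiss : ∀ {i}, g ∉ (hf.palette hx).X i → g ≠ c i →
      ∀ y, J.Adj (x i) y → f' s(x i, y) ≠ g := by
    rintro i h h' y hy rfl
    exact (hmem hy).elim h' h
  have h0 := hmiss hg0 hgc0
  have h1 := hmiss hg1 hgc1
  have hr : ∃ b, (J.bichromatic f' g b).Reachable (x 0) (x 1) := by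
    by_contra hn
    push Not at hn
    obtain ⟨f'', hf''⟩ := hf'.exists_of_not_reachable hJ hle h0 h1 hn
    exact hG f'' hf''
  obtain ⟨b, hb⟩ := hr
  have hend : ∀ {i k}, i ≠ k → (∀ y, J.Adj (x i) y → f' s(x i, y) ≠ g) →
      (J.bichromatic f' g b).Reachable (x i) (x k) → b = c i ∨ b ∈ (hf.palette hx).X i := by
    rintro i k hik hi ⟨p⟩
    obtain ⟨z, hz⟩ : ∃ z, z = x k := ⟨_, rfl⟩
    rw [← hz] at p
    cases p with
    | nil => exact (hik (hx hz)).elim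
    | cons h _ => exact h.2.resolve_left (hi _ h.1) ▸ hmem h.1
  have e0 := hend (by decide) h0 hb
  have e1 := hend (by decide) h1 hb.symm
  by_cases hb0 : b = c 0
  · subst hb0
    obtain ⟨k, k0, k1, hk, hk'⟩ :=
      IsGoodColoring.exists_of_reachable hf hx hux hxu hJx hf' hf'c hf'f (by decide) h0 h1 hb
    exact ⟨k, k0, k1, hk, .inl ⟨e1.resolve_left (hc.1.ne (by decide)), hk'⟩⟩
  · have e0 := e0.resolve_left hb0
    have e1 := e1.resolve_right (hdis _ e0)
    subst e1
    obtain ⟨k, k1, k0, hk, hk'⟩ :=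
      IsGoodColoring.exists_of_reachable hf hx hux hxu hJx hf' hf'c hf'f (by decide) h1 h0 hb.symm
    exact ⟨k, k0, k1, hk, .inr ⟨e0, hk'⟩⟩

end

/-! ### Deletion-minimal graphs -/

section

variable {V : Type*}

theorem AcyclicallyEdgeColorable.of_chromaticIndex_le {G : SimpleGraph V} {κ : ℕ}
    (h : G.acyclicChromaticIndex ≤ κ) : ∃ n ≤ κ, G.AcyclicallyEdgeColorable n := by
  by_contra hn
  push Not at hn
  have : ((κ + 1 : ℕ) : ℕ∞) ≤ G.acyclicChromaticIndex := by
    refine le_iInf₂ fun n hn' => ?_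
    by_contra hlt
    refine hn n ?_ hn'
    have := Nat.cast_lt.1 (not_le.1 hlt)
    omega
  have := Nat.cast_le.1 (this.trans h)
  omega

theorem IsGoodColoring.comp {K L : Type*} {H : SimpleGraph V} {f : Sym2 V → K}
    (hf : H.IsGoodColoring f) {φ : K → L} (hφ : Function.Injective φ) :
    H.IsGoodColoring (φ ∘ f) := by
  refine ⟨fun h1 h2 he => hf.proper h1 h2 (hφ he), fun a b => ?_⟩
  by_cases ha : ∃ a', φ a' = a
  · obtain ⟨a', rfl⟩ := ha
    by_cases hb : ∃ b', φ b' = b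
    · obtain ⟨b', rfl⟩ := hb
      refine (hf.acyclic a' b').anti (show H.bichromatic (φ ∘ f) (φ a') (φ b') ≤ _ from ?_)
      exact fun y z h => ⟨h.1, h.2.imp (@hφ _ _) (@hφ _ _)⟩
    · refine (hf.acyclic a' a').anti (show H.bichromatic (φ ∘ f) (φ a') b ≤ _ from ?_)
      exact fun y z h => ⟨h.1, .inl (h.2.elim (@hφ _ _) fun h => (hb ⟨_, h⟩).elim)⟩
  · by_cases hb : ∃ b', φ b' = b
    · obtain ⟨b', rfl⟩ := hb
      refine (hf.acyclic b' b').anti (show H.bichromatic (φ ∘ f) a (φ b') ≤ _ from ?_)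
      exact fun y z h => ⟨h.1, .inl (h.2.elim (fun h => (ha ⟨_, h⟩).elim) (@hφ _ _))⟩
    · have : H.bichromatic (φ ∘ f) a b = ⊥ := by
        ext y z
        simp only [bot_adj, iff_false]
        exact fun h => h.2.elim (fun h => ha ⟨_, h⟩) fun h => hb ⟨_, h⟩
      rw [this]
      exact isAcyclic_bot

theorem IsDeletionMinimal.not_isGoodColoring [Fintype V] {G : SimpleGraph V} [DecidableRel G.Adj]
    {κ : ℕ} (hG : G.IsDeletionMinimal κ) (f : Sym2 V → Fin κ) : ¬ G.IsGoodColoring f := by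
  intro hf
  have : G.acyclicChromaticIndex ≤ κ := iInf₂_le κ hf.acyclicallyEdgeColorable
  exact absurd (hG.2.1.trans_le this) (lt_irrefl _)

theorem IsDeletionMinimal.exists_isGoodColoring [Fintype V] {G : SimpleGraph V}
    [DecidableRel G.Adj] {κ : ℕ} (hG : G.IsDeletionMinimal κ) (hκ : 0 < κ) {u w : V}
    (huw : G.Adj u w) : ∃ f : Sym2 V → Fin κ, (G.deleteEdges {s(u, w)}).IsGoodColoring f := by
  let H : G.Subgraph := (⊤ : G.Subgraph).deleteEdges {s(u, w)}
  have hH : H < ⊤ := by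
    refine lt_of_le_of_ne le_top fun h => ?_
    have : H.Adj u w := by rw [h]; exact huw
    simp [H] at this
  obtain ⟨n, hn, C, hC⟩ := AcyclicallyEdgeColorable.of_chromaticIndex_le (hG.2.2 H hH)
  have hs : H.IsSpanning := fun v => Set.mem_univ v
  have he : H.spanningCoe = G.deleteEdges {s(u, w)} := by
    ext y z
    simp [H]
  have hne : Nonempty (Fin κ) := ⟨⟨0, hκ⟩⟩
  rcases Nat.eq_zero_or_pos n with rfl | hn0
  · refine ⟨fun _ => Classical.arbitrary _, ?_⟩
    have hemp : ∀ y z, ¬ (G.deleteEdges {s(u, w)}).Adj y z := by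
      intro y z h
      rw [← he] at h
      have h : H.coe.Adj ⟨y, hs y⟩ ⟨z, hs z⟩ := h
      exact (C ⟨s(_, _), h⟩).elim0
    refine ⟨fun h => (hemp _ _ h).elim, fun a b => ?_⟩
    refine isAcyclic_bot.anti (show bichromatic _ _ _ _ ≤ _ from fun y z h => ?_)
    exact (hemp _ _ h.1).elim
  · have : Nonempty (Fin n) := ⟨⟨0, hn0⟩⟩
    obtain ⟨f, hf⟩ := exists_isGoodColoring_of_iso
      (Subgraph.spanningCoeEquivCoeOfSpanning H hs) C hC
    rw [he] at hf
    exact ⟨_, hf.comp (Fin.castLE_injective hn)⟩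

/-- An enumeration of the neighbours of `u` that starts with `w` and `w₁`. -/
theorem exists_enumeration [Fintype V] {G : SimpleGraph V} [DecidableRel G.Adj] {u w w₁ : V}
    (hu : G.degree u = 5) (huw : G.Adj u w) (huw₁ : G.Adj u w₁) (hww₁ : G.Adj w w₁) :
    ∃ x : Fin 5 → V, Function.Injective x ∧ x 0 = w ∧ x 1 = w₁ ∧ (∀ i, G.Adj u (x i)) ∧
      ∀ v, G.Adj u v → ∃ i, v = x i := by
  classical
  have h3 : (((G.neighborFinset u).erase w).erase w₁).card = 3 := by
    rw [Finset.card_erase_of_mem (by simp [huw₁, hww₁.ne']), Finset.card_erase_of_mem (by simpa),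
      card_neighborFinset_eq_degree, hu]
  obtain ⟨a, b, c, hab, hac, hbc, h⟩ := Finset.card_eq_three.1 h3
  have key : ∀ v, (v = a ∨ v = b ∨ v = c) ↔ v ≠ w₁ ∧ v ≠ w ∧ G.Adj u v := by
    intro v
    have := congrArg (v ∈ ·) h
    simpa [eq_comm] using this.symm
  have ha := (key a).1 (by simp)
  have hb := (key b).1 (by simp)
  have hc := (key c).1 (by simp)
  have hw := hww₁.ne
  refine ⟨![w, w₁, a, b, c], ?_, rfl, rfl, ?_, ?_⟩
  · intro i k hik
    fin_cases i <;> fin_cases k <;> simp_all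
  · intro i
    fin_cases i <;> simp_all
  · intro v hv
    by_cases h1 : v = w
    · exact ⟨0, h1⟩
    by_cases h2 : v = w₁
    · exact ⟨1, h2⟩
    rcases (key v).2 ⟨h2, h1, hv⟩ with rfl | rfl | rfl
    exacts [⟨2, rfl⟩, ⟨3, rfl⟩, ⟨4, rfl⟩]

theorem sum_neighborFinset_eq [Fintype V] {G : SimpleGraph V} [DecidableRel G.Adj] {u : V}
    {x : Fin 5 → V} (hx : Function.Injective x) (h1 : ∀ i, G.Adj u (x i))
    (h2 : ∀ v, G.Adj u v → ∃ i, v = x i) (g : V → ℕ) :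
    ∑ v ∈ G.neighborFinset u, g v = ∑ i, g (x i) := by
  classical
  have : G.neighborFinset u = Finset.univ.map ⟨x, hx⟩ := by
    ext v
    simp only [mem_neighborFinset, Finset.mem_map, Finset.mem_univ, true_and]
    exact ⟨fun h => (h2 v h).imp fun i hi => hi.symm, fun ⟨i, hi⟩ => hi ▸ h1 i⟩
  rw [this, Finset.sum_map]
  rfl

theorem deleteIncidenceSet_deleteEdges_le (G : SimpleGraph V) (s : Set (Sym2 V)) (u : V) :
    (G.deleteEdges s).deleteIncidenceSet u ≤ G.deleteIncidenceSet u := by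
  intro y z h
  rw [deleteIncidenceSet_adj] at h ⊢
  exact ⟨deleteEdges_le _ h.1, h.2⟩

theorem degree_deleteIncidenceSet_add_one {G : SimpleGraph V} {u v : V}
    [Fintype (G.neighborSet v)] [Fintype ((G.deleteIncidenceSet u).neighborSet v)]
    (h : G.Adj u v) : (G.deleteIncidenceSet u).degree v + 1 = G.degree v := by
  classical
  have : (G.deleteIncidenceSet u).neighborFinset v = (G.neighborFinset v).erase u := by
    ext y
    simp only [mem_neighborFinset, Finset.mem_erase, deleteIncidenceSet_adj]
    have := h.ne'
    tauto
  rw [← card_neighborFinset_eq_degree, this, Finset.card_erase_add_one (by simpa using h.symm),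
    card_neighborFinset_eq_degree]

theorem degree_deleteEdges_singleton_add_one {G : SimpleGraph V} {v w : V}
    [Fintype (G.neighborSet v)] [Fintype ((G.deleteEdges {s(v, w)}).neighborSet v)]
    (h : G.Adj v w) : (G.deleteEdges {s(v, w)}).degree v + 1 = G.degree v := by
  classical
  have : (G.deleteEdges {s(v, w)}).neighborFinset v = (G.neighborFinset v).erase w := by
    ext y
    simp only [mem_neighborFinset, Finset.mem_erase, deleteEdges_adj, Set.mem_singleton_iff,
      Sym2.congr_right]
    tauto
  rw [← card_neighborFinset_eq_degree, this, Finset.card_erase_add_one (by simpa using h),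
    card_neighborFinset_eq_degree]

theorem degree_deleteEdges_singleton_of_ne {G : SimpleGraph V} {v w y : V}
    [Fintype (G.neighborSet y)] [Fintype ((G.deleteEdges {s(v, w)}).neighborSet y)]
    (hv : y ≠ v) (hw : y ≠ w) : (G.deleteEdges {s(v, w)}).degree y = G.degree y := by
  classical
  have : (G.deleteEdges {s(v, w)}).neighborFinset y = G.neighborFinset y := by
    ext z
    simp only [mem_neighborFinset, deleteEdges_adj, Set.mem_singleton_iff, Sym2.eq_iff]
    tauto
  rw [← card_neighborFinset_eq_degree, this, card_neighborFinset_eq_degree]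

end

/-! ### The degree sum around a vertex of degree five -/

section

variable {V : Type*} [Fintype V]

/-- The bound when no edge at `x 0` has the same colour as an edge at `x 1`, apart from the edges at
`u` and the edge `x 0 - x 1` itself. -/
theorem two_mul_add_seven_le_of_disjoint {G : SimpleGraph V} [DecidableRel G.Adj] {κ Δ e : ℕ} (hκ :
    Δ + 5 ≤ κ)
    (hΔ : 5 ≤ Δ) (hdeg : ∀ v, G.degree v ≤ Δ) (hno : ∀ f : Sym2 V → Fin κ, ¬ G.IsGoodColoring f)
    {u : V} {x : Fin 5 → V} (hx : Function.Injective x) (hGx : ∀ i, G.Adj u (x i))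
    (hux : ∀ v, G.Adj u v → ∃ i, v = x i) (h01 : G.Adj (x 0) (x 1))
    (he : G.degree (x 0) + e + Δ = κ) {f : Sym2 V → Fin κ}
    (hf : ((G.deleteEdges {s(x 0, x 1)}).deleteIncidenceSet u).IsGoodColoring f)
    {G' : SimpleGraph V} (hG' : G'.IsGoodColoring f) (hle : G.deleteIncidenceSet u ≤ G')
    (hG'x : ∀ i, i ≠ 0 → G'.Adj u (x i))
    (hdis : ∀ a, a ∈ (hf.palette hx).X 0 → a ∉ (hf.palette hx).X 1) :
    2 * κ + 7 ≤ ∑ i, G.degree (x i) := by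
  classical
  have hxu : ∀ i, x i ≠ u := fun i => (hGx i).ne'
  have hJx : ∀ i, (G.deleteEdges {s(x 0, x 1)}).Adj u (x i) := by
    intro i
    rw [deleteEdges_adj, Set.mem_singleton_iff, Sym2.eq_iff]
    refine ⟨hGx i, ?_⟩
    have h0 := hxu 0
    have h1 := hxu 1
    tauto
  have hcard : ∀ i, ((hf.palette hx).X i).card + 1 = (G.deleteEdges {s(x 0, x 1)}).degree (x i) :=
    fun i => by rw [card_palette_X, degree_deleteIncidenceSet_add_one (hJx i)]
  have c0 := degree_deleteEdges_singleton_add_one h01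
  rw [← hcard] at c0
  have c1 := degree_deleteEdges_singleton_add_one h01.symm
  rw [Sym2.eq_swap, ← hcard] at c1
  have c2 : ∀ i, i ≠ 0 → i ≠ 1 → ((hf.palette hx).X i).card + 1 = G.degree (x i) := by
    intro i h0 h1
    rw [hcard, degree_deleteEdges_singleton_of_ne (hx.ne h0) (hx.ne h1)]
  have hdis' : Disjoint ((hf.palette hx).X 0) ((hf.palette hx).X 1) :=
    Finset.disjoint_left.2 hdis
  have hU : ((hf.palette hx).X 0 ∪ (hf.palette hx).X 1)ᶜ.card + ((hf.palette hx).X 0).card +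
      ((hf.palette hx).X 1).card = κ := by
    rw [add_assoc, ← Finset.card_union_of_disjoint hdis', add_comm, Finset.card_add_card_compl,
      Fintype.card_fin]
  have hC : ((hf.palette hx).X 0).card + ((hf.palette hx).X 0)ᶜ.card = κ := by
    rw [Finset.card_add_card_compl, Fintype.card_fin]
  have hXle : ∀ t, t ≠ 0 → ((hf.palette hx).X t).card + 1 ≤ Δ := by
    intro t ht
    by_cases h1 : t = 1
    · subst h1
      have := hdeg (x 1)
      omega
    · rw [c2 t ht h1]
      exact hdeg _
  have hfits := hf.fits hx hG' ((deleteIncidenceSet_deleteEdges_le _ _ _).trans hle) hG'x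
  have hpos : 0 ≤ ∑ a, (hf.palette hx).wt a := by
    have h0 := hdeg (x 0)
    have h1 := hdeg (x 1)
    by_cases hst : (hf.palette hx).Stuck
    · exact Palette.Stuck.sum_nonneg (Δ := Δ) (e := e) (by omega) hXle hst hfits (by omega)
        (by simpa using hκ) hΔ
    · obtain ⟨c, hc⟩ : ∃ c, (hf.palette hx).IsAssignment c := by
        simpa [Palette.Stuck] using hst
      refine Palette.sum_nonneg_of_final (e := e) (Δ := Δ) hdis (fun c hc g h0 h1 hg0 hg1 => ?_) hc
        (by omega) (by omega) (by omega) hΔ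
      refine hf.exists_of_final hx (fun v hv => hux v (deleteEdges_le _ hv)) hxu hJx ?_ ?_ hno hdis
        hc h0 h1 hg0 hg1
      · simp
      · intro y z h
        rw [sup_adj, deleteEdges_adj, edge_adj, Set.mem_singleton_iff, Sym2.eq_iff]
        have := h.ne
        tauto
  rw [Palette.sum_wt, Fintype.card_fin, Fin.sum_univ_five] at hpos
  rw [Fin.sum_univ_five]
  have c22 := c2 2 (by decide) (by decide)
  have c23 := c2 3 (by decide) (by decide)
  have c24 := c2 4 (by decide) (by decide)
  omega

/-- The bound when some colour `r` occurs both at `x 0` and at `x 1`, on edges other than those at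
`u` and the edge `x 0 - x 1`. Then the edge `x 0 - x 1` keeps its colour. -/
theorem two_mul_add_seven_le_of_common {G : SimpleGraph V} [DecidableRel G.Adj] {κ Δ e : ℕ} (hκ : Δ
    + 5 ≤ κ)
    (hΔ : 5 ≤ Δ) (hdeg : ∀ v, G.degree v ≤ Δ) (hno : ∀ f : Sym2 V → Fin κ, ¬ G.IsGoodColoring f)
    {u : V} {x : Fin 5 → V} (hx : Function.Injective x) (hGx : ∀ i, G.Adj u (x i))
    (hux : ∀ v, G.Adj u v → ∃ i, v = x i) (h01 : G.Adj (x 0) (x 1))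
    (he : G.degree (x 0) + e + Δ = κ) (hcap : G.degree (x 1) ≤ 6 + min e 1)
    {f : Sym2 V → Fin κ}
    (hf : ((G.deleteEdges {s(x 0, x 1)}).deleteIncidenceSet u).IsGoodColoring f)
    {G' : SimpleGraph V} (hG' : G'.IsGoodColoring f) (hle : G.deleteIncidenceSet u ≤ G')
    (hG'x : ∀ i, i ≠ 0 → G'.Adj u (x i)) {r : Fin κ} (hr0 : r ∈ (hf.palette hx).X 0)
    (hr1 : r ∈ (hf.palette hx).X 1) :
    2 * κ + 7 ≤ ∑ i, G.degree (x i) := by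
  classical
  have hxu : ∀ i, x i ≠ u := fun i => (hGx i).ne'
  have hH : (G.deleteIncidenceSet u).IsGoodColoring f := hG'.of_le hle
  have hadj : (G.deleteIncidenceSet u).Adj (x 0) (x 1) :=
    deleteIncidenceSet_adj.2 ⟨h01, hxu 0, hxu 1⟩
  have hcard : ∀ i, ((hH.palette hx).X i).card + 1 = G.degree (x i) :=
    fun i => by rw [card_palette_X, degree_deleteIncidenceSet_add_one (hGx i)]
  have hC : ((hH.palette hx).X 0).card + ((hH.palette hx).X 0)ᶜ.card = κ := by
    rw [Finset.card_add_card_compl, Fintype.card_fin]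
  have hmono : ∀ {i}, r ∈ (hf.palette hx).X i → r ∈ (hH.palette hx).X i := by
    intro i h
    rw [mem_palette_X] at h ⊢
    obtain ⟨y, hy, hy'⟩ := h
    exact ⟨y, deleteIncidenceSet_deleteEdges_le _ _ _ hy, hy'⟩
  -- A component of two colours that contains the edge `x 0 - x 1` has at most two endpoints.
  have hend : ∀ {s t t' a}, s ≠ t → s ≠ t' → (hH.palette hx).conf (f s(x 0, x 1)) t a s →
      (G.deleteIncidenceSet u).Adj (x s) (x t') → f s(x s, x t') = f s(x 0, x 1) → t ≠ t' →
      a ∈ (hH.palette hx).X t' := by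
    intro s t t' a hst hst' hconf hs hs' htt'
    by_contra hn
    obtain ⟨h1, h2, h3, h4, h5⟩ := hconf
    rw [notMem_palette_X] at hn
    refine htt' (hx (Reachable.eq_of_endpoints (fun v _ _ _ => hH.eq_or_eq) (fun _ _ =>
      hH.eq_of_missing' h2) (fun _ _ => hH.eq_of_missing h1) (fun _ _ => hH.eq_of_missing' hn)
      (hx.ne hst) (hx.ne hst') h5.symm (Adj.reachable ⟨hs, .inl hs'⟩)))
  have hL : (hH.palette hx).Linked Δ e (f s(x 0, x 1)) r := by
    have hc0 := hcard 0
    have hc1 := hcard 1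
    refine ⟨fun c hc => ?_, by omega, fun t _ => ?_, by omega, hΔ, by omega, ?_, ?_, ?_,
      hmono hr0, hmono hr1, fun t a h0 h1 hc => ?_, fun t a h0 h1 hc => ?_⟩
    · obtain ⟨f', hf', -⟩ := hH.exists_of_isAssignment hx hux hxu hc
      exact hno f' hf'
    · rw [hcard]
      exact hdeg _
    · rintro rfl
      rw [mem_palette_X] at hr0
      obtain ⟨y, hy, hy'⟩ := hr0
      have h2 := hH.proper (deleteIncidenceSet_deleteEdges_le _ _ _ hy) hadj hy'
      have h3 := (deleteIncidenceSet_adj.1 hy).1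
      simp [h2] at h3
    · exact (mem_palette_X hH hx).2 ⟨_, hadj, rfl⟩
    · exact (mem_palette_X hH hx).2 ⟨_, hadj.symm, by rw [Sym2.eq_swap]⟩
    · exact hend (s := 1) h1.symm (by decide) hc hadj.symm (by rw [Sym2.eq_swap]) h0
    · exact hend (s := 0) h0.symm (by decide) hc hadj rfl h1
  have hpos := hL.sum_ge_two (hH.fits hx hG' hle hG'x)
  rw [Palette.sum_wt, Fintype.card_fin, Fin.sum_univ_five] at hpos
  rw [Fin.sum_univ_five]
  have := hcard 0
  have := hcard 1
  have := hcard 2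
  have := hcard 3
  have := hcard 4
  omega

theorem IsDeletionMinimal.two_mul_add_seven_le {G : SimpleGraph V} [DecidableRel G.Adj] {κ e : ℕ}
    (hG : G.IsDeletionMinimal κ) (hκ : G.maxDegree + 5 ≤ κ) {u w w₁ : V} (hu : G.degree u = 5)
    (huw : G.Adj u w) (huw₁ : G.Adj u w₁) (hww₁ : G.Adj w w₁)
    (he : G.degree w + e + G.maxDegree = κ) (hcap : G.degree w₁ ≤ 6 + min e 1) :
    2 * κ + 7 ≤ ∑ x ∈ G.neighborFinset u, G.degree x := by
  obtain ⟨f, hf⟩ := hG.exists_isGoodColoring (by omega) huw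
  obtain ⟨x, hx, rfl, rfl, hGx, hux⟩ := exists_enumeration hu huw huw₁ hww₁
  rw [sum_neighborFinset_eq hx hGx hux]
  have hxu : ∀ i, x i ≠ u := fun i => (hGx i).ne'
  have hle : G.deleteIncidenceSet u ≤ G.deleteEdges {s(u, x 0)} := by
    intro y z h
    rw [deleteIncidenceSet_adj] at h
    rw [deleteEdges_adj, Set.mem_singleton_iff, Sym2.eq_iff]
    tauto
  have hG'x : ∀ i, i ≠ 0 → (G.deleteEdges {s(u, x 0)}).Adj u (x i) := by
    intro i hi
    rw [deleteEdges_adj, Set.mem_singleton_iff, Sym2.congr_right]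
    exact ⟨hGx i, hx.ne hi⟩
  have hH := hf.of_le ((deleteIncidenceSet_deleteEdges_le G {s(x 0, x 1)} u).trans hle)
  have hΔ : 5 ≤ G.maxDegree := hu ▸ G.degree_le_maxDegree u
  have hdeg := G.degree_le_maxDegree
  have hno := hG.not_isGoodColoring
  by_cases hdis : ∀ a, a ∈ (hH.palette hx).X 0 → a ∉ (hH.palette hx).X 1
  · exact two_mul_add_seven_le_of_disjoint hκ hΔ hdeg hno hx hGx hux hww₁ he hH hf hle hG'x hdis
  · push Not at hdis
    obtain ⟨r, hr0, hr1⟩ := hdis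
    exact two_mul_add_seven_le_of_common hκ hΔ hdeg hno hx hGx hux hww₁ he hcap hH hf hle hG'x
      hr0 hr1

end

end SimpleGraph

theorem mainTheorem3 {V : Type*} [Fintype V] (G : SimpleGraph V) [DecidableRel G.Adj]
    (κ : ℕ) (hG : G.IsDeletionMinimal κ) (hκ : G.maxDegree + 5 ≤ κ)
    (u w w₁ : V) (hu : G.degree u = 5)
    (huw : G.Adj u w) (huw₁ : G.Adj u w₁) (hww₁ : G.Adj w w₁) :
    (G.degree w ≤ κ - G.maxDegree → G.degree w₁ ≤ 6 →
      2 * κ + 7 ≤ ∑ x ∈ G.neighborFinset u, G.degree x) ∧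
    (G.degree w ≤ κ - G.maxDegree - 1 → G.degree w₁ ≤ 7 →
      2 * κ + 7 ≤ ∑ x ∈ G.neighborFinset u, G.degree x) := by
  refine ⟨fun h h' => ?_, fun h h' => ?_⟩ <;>
    exact hG.two_mul_add_seven_le (e := κ - G.maxDegree - G.degree w) hκ hu huw huw₁ hww₁
      (by omega) (by omega)
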